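/- **Conventions.** Algorithms are randomized word-RAM programs with unit-cost instructions (arithmetic, bitwise operations, shifts and comparisons on words, indirect memory access, conditional jumps, and fair coin flips). SETH is the hypothesis that for every $\epsilon>0$ there is a $K$ such that no randomized algorithm with $O(N)$-bit words solves $K$-SAT on $N$ variables (formulas with pairwise distinct clauses) in time $2^{(1-\epsilon)N}\,\mathrm{poly}(N)$, where solving means: on every instance, with probability at least $2/3$, the algorithm halts within the time bound with the correct answer. In a directed graph, $d(u,v)\in\mathbb N\cup\{\infty\}$ is the length of a shortest directed path from $u$ to $v$, and the eccentricity of $v$ is $\max_u d(v,u)$. A value $e\in\mathbb N\cup\{\infty\}$ is an $\alpha$-approximation of $D$ if $e\le D\le \alpha e$ (or, in the other usual convention, if $D\le e\le\alpha D$; the theorem holds for both, the convention being fixed for the algorithm). A dynamic algorithm consists of programs for preprocessing, edge insertion, edge deletion and query, sharing one memory with $O(\log n)$-bit words, $n$ being the fixed number of vertices. A query gives estimates of the eccentricities of all vertices. The algorithm has preprocessing time $p(n)$ and amortized (resp. worst-case) update time $u(n)$ and query time $q(n)$ if, for every initial graph and every operation sequence fixed in advance that ends with a query, with probability at least $2/3$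 all of the following hold: preprocessing takes at most $p(n)$ steps; the operations take in total at most $u(n)$ times the number of updates plus $q(n)$ times the number of queries (resp. each update takes at most $u(n)$ and each query at most $q(n)$ steps); and all estimates given by the last query are $\alpha$-approximations. In the fully dynamic setting edges are inserted and deleted, in the incremental (decremental) setting they are only inserted (only deleted). **Theorem.** (1) Let $t,\epsilon,\epsilon'>0$ be real numbers and let $k\ge 1$ be an integer. Assume SETH. Then there is no fully dynamic algorithm for $(2-\epsilon)$-approximate all Eccentricities on loopless directed unweighted graphs with $n$ vertices and, at all times, at most $n\lfloor\log_2 n\rfloor^k$ edges, which has preprocessing time $p(n)=O(n^t)$, amortized update time $u(n)=O(n^{2-\epsilon'})$ and amortized query time $q(n)=O(n^{2-\epsilon'})$. Likewise there is no incremental algorithm, and no decremental algorithm, with preprocessing time $O(n^t)$ and worst-case update and query times $O(n^{2-\epsilon'})$. (2) Let $a\ge 1$ and $d$ be natural numbers, let $U,V$ be finite families of vectors in $\{0,1\}^d$ such that no vector is zero and every coordinate is nonzero in some vector of $U$ and in some vector of $V$, and let $w\in\{0,1\}^d$. Let $G$ be the directed graph consisting of: a directed path $u^0\to u^1\to\dots\to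 u^a$ for each $u\in U$ and a directed path $v^0\to\dots\to v^a$ for each $v\in V$; vertices $c_U,c_V$ for each coordinate $c$; edges $u^a\to c_U$ whenever $u[c]=1$ and $c_V\to v^0$ whenever $v[c]=1$; vertices $x,y$ with edges $u^a\to x$ and $x\to u^0$ for each $u\in U$, an edge $c_U\to y$ and a directed path of length $a$ from $y$ to $c_V$ (with its own inner vertices) for each coordinate $c$; and edges $c_U\to c_V$ whenever $w[c]=1$. Then for each $u\in U$ the eccentricity of $u^a$ in $G$ is $2a+3$ if there is $v\in V$ with $\sum_{c} u[c]\,v[c]\,w[c]=0$, and it is $a+3$ otherwise. -/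

import Mathlib

open MeasureTheory Filter
open scoped ENNReal

/-! ## The randomized word RAM -/

namespace WordRAM

/-- Binary operations of the machine, all of unit cost. -/
inductive BinOp
  | add | sub | mul | div | mod | and | or | xor | shl | shr | lt | eq

/-- The value of an operation on `w`-bit words; the result is again reduced to a `w`-bit word. -/
def BinOp.eval (w : ℕ) : BinOp → ℕ → ℕ → ℕ
  | .add, a, b => (a + b) % 2 ^ w
  | .sub, a, b => (a + (2 ^ w - b % 2 ^ w)) % 2 ^ w
  | .mul, a, b => (a * b) % 2 ^ w
  | .div, a, b => (a / b) % 2 ^ w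
  | .mod, a, b => (a % b) % 2 ^ w
  | .and, a, b => (a &&& b) % 2 ^ w
  | .or, a, b => (a ||| b) % 2 ^ w
  | .xor, a, b => (a ^^^ b) % 2 ^ w
  | .shl, a, b => (a <<< b) % 2 ^ w
  | .shr, a, b => (a >>> b) % 2 ^ w
  | .lt, a, b => (if a < b then 1 else 0) % 2 ^ w
  | .eq, a, b => (if a = b then 1 else 0) % 2 ^ w

/-- Instructions. `r, a, b` are names of registers and `l` is a position in the program. -/
inductive Instr
  /-- put the constant `x` into register `r` -/
  | const (r x : ℕ)
  /-- apply an operation to registers `a`, `b` and put the result into register `r` -/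
  | bin (o : BinOp) (r a b : ℕ)
  /-- put into register `r` the memory cell whose address is in register `a` -/
  | load (r a : ℕ)
  /-- put register `r` into the memory cell whose address is in register `a` -/
  | store (a r : ℕ)
  /-- jump to position `l` if register `r` is zero -/
  | jz (r l : ℕ)
  /-- put a fresh fair random bit into register `r` -/
  | coin (r : ℕ)

/-- A program; a program mentions only finitely many registers. -/
abbrev Program := List Instr

/-- A machine state: program position, number of steps made so far, registers, memory. -/
structure State where
  pc : ℕ
  time : ℕ
  reg : ℕ → ℕ
  mem : ℕ → ℕ

/-- The effect of one instruction with word size `w`, when the random bit of this step is `b`.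
Each instruction takes one unit of time. -/
def Instr.exec (w : ℕ) (b : Bool) (s : State) : Instr → State
  | .const r x => ⟨s.pc + 1, s.time + 1, Function.update s.reg r (x % 2 ^ w), s.mem⟩
  | .bin o r x y =>
      ⟨s.pc + 1, s.time + 1, Function.update s.reg r (o.eval w (s.reg x) (s.reg y)), s.mem⟩
  | .load r a => ⟨s.pc + 1, s.time + 1, Function.update s.reg r (s.mem (s.reg a)), s.mem⟩
  | .store a r => ⟨s.pc + 1, s.time + 1, s.reg, Function.update s.mem (s.reg a) (s.reg r)⟩
  | .jz r l => ⟨if s.reg r = 0 then l else s.pc + 1, s.time + 1, s.reg, s.mem⟩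
  | .coin r => ⟨s.pc + 1, s.time + 1, Function.update s.reg r (b.toNat % 2 ^ w), s.mem⟩

/-- The machine has halted when its position has left the program. -/
def Halted (P : Program) (s : State) : Prop := P.length ≤ s.pc

/-- One step, with tape `ω` of random bits (the step made at time `τ` may use the bit `ω τ`, so
that no bit is used twice); a halted machine does not change. -/
def step (P : Program) (w : ℕ) (ω : ℕ → Bool) (s : State) : State :=
  match P[s.pc]? with
  | none => s
  | some i => i.exec w (ω s.time) s

/-- Started in `s`, the program halts after exactly `T` steps, in the state `s'`. -/
def HaltsIn (P : Program) (w : ℕ) (ω : ℕ → Bool) (s : State) (T : ℕ) (s' : State) : Prop :=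
  (∃ j, (step P w ω)^[j] s = s') ∧ Halted P s' ∧ s'.time = s.time + T

/-- The law of an infinite sequence of independent fair random bits. -/
noncomputable def coins : Measure (ℕ → Bool) :=
  Measure.infinitePi fun _ : ℕ => (PMF.uniformOfFintype Bool).toMeasure

/-- The initial state: registers `0` and `1` hold `a` and `b`, the memory starts with the list
`input`, and everything else is zero. -/
def initState (a b : ℕ) (input : List ℕ) : State where
  pc := 0
  time := 0
  reg := Function.update (Function.update (fun _ => 0) 0 a) 1 b
  mem := fun i => input.getD i 0

/-- Restart a program on the current contents of registers and memory, with arguments `a`, `b`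
in registers `0` and `1`. -/
def State.call (s : State) (a b : ℕ) : State where
  pc := 0
  time := s.time
  reg := Function.update (Function.update s.reg 0 a) 1 b
  mem := s.mem

end WordRAM

/-! ## CNF satisfiability and the Strong Exponential Time Hypothesis -/

/-- A CNF formula in `N` variables: a list of clauses, each a list of literals; `(x, true)` is the
literal `x` and `(x, false)` is its negation. -/
abbrev CNF (N : ℕ) := List (List (Fin N × Bool))

namespace CNF

/-- At most `K` literals in each clause, and no clause is listed twice (so that there are at most
polynomially many clauses). -/
def IsK {N : ℕ} (K : ℕ) (φ : CNF N) : Prop := φ.Nodup ∧ ∀ C ∈ φ, C.length ≤ K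

def Satisfiable {N : ℕ} (φ : CNF N) : Prop :=
  ∃ a : Fin N → Bool, ∀ C ∈ φ, ∃ l ∈ C, a l.1 = l.2

/-- Literals are coded by positive numbers, and each clause is followed by a zero. -/
def encode {N : ℕ} (φ : CNF N) : List ℕ :=
  φ.flatMap fun C => C.map (fun l => 2 * (l.1 : ℕ) + 1 + l.2.toNat) ++ [0]

end CNF

open WordRAM in
/-- The Strong Exponential Time Hypothesis, for randomized algorithms: for every `ε > 0` there is
a `K` such that no randomized word RAM program, with words of `O(N)` bits, solves `K`-SAT on `N`
variables in time `2 ^ ((1 - ε) N) poly(N)`. To solve it means that on every instance, with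
probability at least `2/3`, the program halts within the time bound with the correct answer in
register `0`. -/
def SETH : Prop :=
  ∀ ε : ℝ, 0 < ε → ∃ K : ℕ, ¬ ∃ (P : Program) (c C : ℕ), ∀ (N : ℕ) (φ : CNF N), φ.IsK K →
    2 / 3 ≤ coins {ω | ∃ T s, HaltsIn P (c * (N + 1)) ω (initState N φ.length φ.encode) T s ∧
      (T : ℝ) ≤ C * (2 : ℝ) ^ ((1 - ε) * (N : ℝ)) * ((N : ℝ) + 1) ^ C ∧
      (s.reg 0 = 1 ↔ φ.Satisfiable)}

/-! ## Eccentricities in directed graphs -/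

/-- There is a directed walk with `k` edges from `u` to `v`. -/
def HasWalk {V : Type*} (G : Digraph V) : ℕ → V → V → Prop
  | 0, u, v => u = v
  | k + 1, u, v => ∃ x, G.Adj u x ∧ HasWalk G k x v

/-- The directed distance, infinite if `v` is not reachable from `u`. -/
noncomputable def ddist {V : Type*} (G : Digraph V) (u v : V) : ℕ∞ :=
  ⨅ (k : ℕ) (_ : HasWalk G k u v), (k : ℕ∞)

/-- The eccentricity of `v`: the largest distance from `v` to a vertex. -/
noncomputable def ecc {V : Type*} (G : Digraph V) (v : V) : ℕ∞ := ⨆ u, ddist G v u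

/-- The two usual conventions for approximate values. -/
inductive Convention
  | under
  | over

/-- `e` is an `α`-approximation of `D`: it satisfies `D / α ≤ e ≤ D` or `D ≤ e ≤ α D`, depending
on the convention. In both cases `e` is infinite if and only if `D` is (for `α > 0`). -/
def IsApprox (α : ℝ) : Convention → (D e : ℕ∞) → Prop
  | .under, D, e => e ≤ D ∧ (D : ℝ≥0∞) ≤ ENNReal.ofReal α * (e : ℝ≥0∞)
  | .over, D, e => D ≤ e ∧ (e : ℝ≥0∞) ≤ ENNReal.ofReal α * (D : ℝ≥0∞)

/-! ## Dynamic graphs -/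

/-- Operations on a dynamic directed graph with vertex set `Fin n`. -/
inductive DynOp (n : ℕ)
  | insert (u v : Fin n)
  | delete (u v : Fin n)
  | query

/-- The edge set of a directed graph on `Fin n`. -/
abbrev EdgeSet (n : ℕ) := Finset (Fin n × Fin n)

def EdgeSet.toDigraph {n : ℕ} (E : EdgeSet n) : Digraph (Fin n) := ⟨fun u v => (u, v) ∈ E⟩

/-- A loopless directed graph with `n` vertices and at most `n (log n) ^ k` edges. -/
def EdgeSet.Sparse {n : ℕ} (k : ℕ) (E : EdgeSet n) : Prop :=
  (∀ e ∈ E, e.1 ≠ e.2) ∧ E.card ≤ n * Nat.log 2 n ^ k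

namespace DynOp

variable {n : ℕ}

/-- The edge set after an operation. -/
def apply (E : EdgeSet n) : DynOp n → EdgeSet n
  | .insert u v => Insert.insert (u, v) E
  | .delete u v => E.erase (u, v)
  | .query => E

/-- Only absent edges are inserted, only present edges are deleted. -/
def Proper (E : EdgeSet n) : DynOp n → Prop
  | .insert u v => (u, v) ∉ E
  | .delete u v => (u, v) ∈ E
  | .query => True

/-- A sequence of proper operations, starting from `E`, that keeps the graph sparse. -/
def Legal (k : ℕ) : EdgeSet n → List (DynOp n) → Prop
  | E, [] => E.Sparse k
  | E, o :: os => E.Sparse k ∧ o.Proper E ∧ Legal k (o.apply E) os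

/-- `u` for an update and `q` for a query. -/
def cost (u q : ℝ) : DynOp n → ℝ
  | .insert _ _ => u
  | .delete _ _ => u
  | .query => q

end DynOp

/-- Which updates may occur. -/
inductive Setting
  | fullyDynamic
  | incremental
  | decremental

def Setting.Allows {n : ℕ} : Setting → DynOp n → Prop
  | .incremental, .delete _ _ => False
  | .decremental, .insert _ _ => False
  | _, _ => True

/-- How the running times of operations are bounded. -/
inductive TimeMode
  | amortized
  | worstCase

/-- The operations `ops` took the times `ts`, and these respect the bound `u` for updates and `q`
for queries, in total or each by itself. -/
def TimeMode.Within {n : ℕ} (u q : ℝ) (ops : List (DynOp n)) (ts : List ℕ) : TimeMode → Prop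
  | .amortized => (ts.sum : ℝ) ≤ (ops.map (DynOp.cost u q)).sum
  | .worstCase => List.Forall₂ (fun o t => ((t : ℕ) : ℝ) ≤ DynOp.cost u q o) ops ts

open WordRAM

/-- A dynamic algorithm: word RAM programs for preprocessing, for the two kinds of updates and for
queries, working on a common memory with words of `c (⌊log₂ n⌋ + 1)` bits on graphs with `n`
vertices. -/
structure DynAlg where
  prep : Program
  ins : Program
  del : Program
  qry : Program
  c : ℕ

namespace DynAlg

variable {n : ℕ}

def wordSize (A : DynAlg) (n : ℕ) : ℕ := A.c * (Nat.log 2 n + 1)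

/-- A single operation, begun in state `s`, takes `T` steps and ends in state `s'`. The endpoints
of the edge of an update are passed in registers `0` and `1`. -/
def OpRun (A : DynAlg) (ω : ℕ → Bool) (s : State) : DynOp n → ℕ → State → Prop
  | .insert u v, T, s' => HaltsIn A.ins (A.wordSize n) ω (s.call u v) T s'
  | .delete u v, T, s' => HaltsIn A.del (A.wordSize n) ω (s.call u v) T s'
  | .query, T, s' => HaltsIn A.qry (A.wordSize n) ω (s.call 0 0) T s'

/-- A sequence of operations, begun in state `s`, takes the times `ts` and ends in `s'`. -/
inductive Run (A : DynAlg) (ω : ℕ → Bool) : State → List (DynOp n) → List ℕ → State → Prop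
  | nil (s : State) : Run A ω s [] [] s
  | cons {s s₁ s' : State} {o : DynOp n} {os : List (DynOp n)} {T : ℕ} {ts : List ℕ} :
      A.OpRun ω s o T s₁ → Run A ω s₁ os ts s' → Run A ω s (o :: os) (T :: ts) s'

/-- The input of the preprocessing: `n` and `m` in registers `0` and `1`, and the endpoints of the
`i`-th edge in memory cells `2 i` and `2 i + 1`. -/
def start (L : List (Fin n × Fin n)) : State :=
  initState n L.length (L.flatMap fun e => [(e.1 : ℕ), (e.2 : ℕ)])

/-- The estimates of all eccentricities given by a query: the estimate for `v` is in the memory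
cell number `v` of an array whose address is left in register `0`; the word `0` stands for
infinity and the word `d + 1` for `d`. -/
def answer (s : State) (v : Fin n) : ℕ∞ :=
  match s.mem (s.reg 0 + v) with
  | 0 => ⊤
  | d + 1 => (d : ℕ∞)

/-- `A` is a (randomized) dynamic `α`-approximation algorithm for all eccentricities on directed
graphs with `n` vertices and at most `n (log n) ^ k` edges, in the given setting, with
preprocessing time `p`, update time `u` and query time `q`: for every initial graph, given by any
list of its edges, and every legal sequence of operations fixed in advance that ends with a query,
with probability at least `2/3` all time bounds hold and the estimates given by this last query
are correct. -/
def Solves (A : DynAlg) (S : Setting) (mode : TimeMode) (conv : Convention) (α : ℝ) (k : ℕ)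
    (p u q : ℕ → ℝ) : Prop :=
  ∀ (n : ℕ) (L : List (Fin n × Fin n)) (ops : List (DynOp n)), L.Nodup →
    DynOp.Legal k L.toFinset ops → (∀ o ∈ ops, S.Allows o) →
    2 / 3 ≤ coins {ω | ∃ T₀ s₀ ts s,
      HaltsIn A.prep (A.wordSize n) ω (start L) T₀ s₀ ∧ (T₀ : ℝ) ≤ p n ∧
      A.Run ω s₀ (ops ++ [DynOp.query]) ts s ∧ mode.Within (u n) (q n) (ops ++ [DynOp.query]) ts ∧
      ∀ v : Fin n, IsApprox α conv
        (ecc (EdgeSet.toDigraph (ops.foldl DynOp.apply L.toFinset)) v) (answer s v)}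

/-- There is such an algorithm with preprocessing time `O(n ^ t)` and update and query times
`O(n ^ r)`. -/
def ExistsWithBounds (S : Setting) (mode : TimeMode) (conv : Convention) (α : ℝ) (k : ℕ)
    (t r : ℝ) : Prop :=
  ∃ (A : DynAlg) (p u q : ℕ → ℝ),
    p =O[atTop] (fun n : ℕ => (n : ℝ) ^ t) ∧
    u =O[atTop] (fun n : ℕ => (n : ℝ) ^ r) ∧
    q =O[atTop] (fun n : ℕ => (n : ℝ) ^ r) ∧
    A.Solves S mode conv α k p u q

end DynAlg

/-! ## The directed gadget for three orthogonal vectors -/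

/-- The vertices `u^i`, `v^i` (`0 ≤ i ≤ a`), `c_U`, `c_V`, `x`, `y`, and, for each coordinate, the
`a - 1` inner vertices of the path from `y` to `c_V`. -/
inductive GadgetVertex (p q d a : ℕ)
  | uNode (u : Fin p) (i : Fin (a + 1))
  | vNode (v : Fin q) (i : Fin (a + 1))
  | cU (c : Fin d)
  | cV (c : Fin d)
  | x
  | y
  | inner (c : Fin d) (i : Fin (a - 1))

/-- The directed gadget of path length `a` for vectors `U`, `V` in the stage of the vector `w`. -/
inductive GadgetAdj {p q d : ℕ} (a : ℕ) (U : Fin p → Fin d → Bool) (V : Fin q → Fin d → Bool)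
    (w : Fin d → Bool) : GadgetVertex p q d a → GadgetVertex p q d a → Prop
  | uPath (u : Fin p) (i j : Fin (a + 1)) : (j : ℕ) = i + 1 → GadgetAdj a U V w (.uNode u i) (.uNode u j)
  | vPath (v : Fin q) (i j : Fin (a + 1)) : (j : ℕ) = i + 1 → GadgetAdj a U V w (.vNode v i) (.vNode v j)
  | uCoord (u : Fin p) (c : Fin d) : U u c = true → GadgetAdj a U V w (.uNode u (Fin.last a)) (.cU c)
  | vCoord (v : Fin q) (c : Fin d) : V v c = true → GadgetAdj a U V w (.cV c) (.vNode v 0)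
  | toX (u : Fin p) : GadgetAdj a U V w (.uNode u (Fin.last a)) .x
  | fromX (u : Fin p) : GadgetAdj a U V w .x (.uNode u 0)
  | toY (c : Fin d) : GadgetAdj a U V w (.cU c) .y
  | yDirect (c : Fin d) : a = 1 → GadgetAdj a U V w .y (.cV c)
  | yFirst (c : Fin d) (i : Fin (a - 1)) : (i : ℕ) = 0 → GadgetAdj a U V w .y (.inner c i)
  | yPath (c : Fin d) (i j : Fin (a - 1)) : (j : ℕ) = i + 1 →
      GadgetAdj a U V w (.inner c i) (.inner c j)
  | yLast (c : Fin d) (i : Fin (a - 1)) : (i : ℕ) + 1 = a - 1 → GadgetAdj a U V w (.inner c i) (.cV c)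
  | stage (c : Fin d) : w c = true → GadgetAdj a U V w (.cU c) (.cV c)

def gadget {p q d : ℕ} (a : ℕ) (U : Fin p → Fin d → Bool) (V : Fin q → Fin d → Bool)
    (w : Fin d → Bool) : Digraph (GadgetVertex p q d a) := ⟨GadgetAdj a U V w⟩

/-- The generalized inner product of the three vectors is zero. -/
def OrthogonalTriple {d : ℕ} (u v w : Fin d → Bool) : Prop :=
  ∀ c, ¬ (u c = true ∧ v c = true ∧ w c = true)

/-- No vector is zero, and every coordinate is nonzero in some vector. -/
def NonDegenerate {p d : ℕ} (U : Fin p → Fin d → Bool) : Prop :=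
  (∀ i, ∃ c, U i c = true) ∧ ∀ c, ∃ i, U i c = true

/-! Distances in the gadget. From `u^a` the vertex `x` leads to all paths of `U` and from there to
all `c_U`, and `y` leads to all `c_V`, everything within `a + 3` steps. Only the paths of `V` can be
farther away. The start `v^0` is reached after `a + 3` steps through `y`, but after three steps
through a stage edge if `u`, `v`, `w` have a common one. Lower bounds come from potentials, that is,
functions on the vertices that vanish at the start and grow by at most one along each edge
(`ecc_gadget_of_orthogonal`, `ecc_gadget_of_not_orthogonal`).

The lower bound under SETH. Split the `N` variables of a `K`-SAT formula into blocks of `b`, `b` and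
`N - 2b` variables, and assign to each partial assignment the vector of the clauses that it leaves
unsatisfied. The formula is satisfiable iff some three vectors, one for each block, have no common
one. The gadget for the first two blocks has `n = 2^b poly(N)` vertices, since there are only
polynomially many clauses. For each of the `2^(N-2b)` assignments of the third block, a stage adapts
the edges `c_U → c_V` by at most one update for each clause and then queries. As `(2a+3)/(a+3) > 2 -
ε` for `εa ≥ 3`, the estimates tell the two cases apart. Paths at least as long as the number of
coordinates keep the graph sparse.

Let `E > 1/ε'`, `T = ⌈t⌉`, `ν = ⌊N/((T+2)E+1)⌋` and `b = Eν`. Up to polynomial factors an operation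
costs at most `n^(2-1/E) = 2^((2E-1)ν)`, so all stages together cost `2^(N-2Eν) 2^((2E-1)ν) =
2^(N-ν)`. The preprocessing costs `2^(Tb) ≤ 2^(N-ν)`. This contradicts SETH (`Parameters.poly_time`,
`SETH.not_solves`).

Three points need care. (1) Each stage has to start from the state after the preprocessing, although
nothing can be undone in the incremental and decremental settings. Hence the simulated memory is
versioned: a cell has a basic value, a current value and a stamp, and a new stage number invalidates
all current values at once (`Ready.holds`). Every stage is thus a run with few updates and one
query. (2) The runs share the coins of the preprocessing and each one may fail with probability
`1/3`. No union bound is needed: a stage only picks a `u` with a large estimate and checks it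
against all `2^b` vectors `v`, so an unsatisfiable formula is never accepted. For a satisfiable
formula one stage has to succeed, and the preprocessing together with this stage alone is
distributed like a genuine run (`Cmd.le_expect_main`, `DynAlg.Solves.le_prob_reveals`). (3) All of
this has to be one word RAM program. It is written in a structured language whose outcomes are
finite trees of coin flips. `expect_exec_le_reach` transfers expectations over such trees to the
compiled program, and `coins_runActs` relates them to the measure on infinite sequences of bits. The
dynamic algorithm is simulated with its own shorter words for fixed numbers of steps
(`le_expect_simCall`); surplus steps do not matter, because a halted machine does not change. -/

set_option linter.unusedSimpArgs false

/-! ## Distances in the gadget -/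

theorem HasWalk.trans {V : Type*} {G : Digraph V} {k l : ℕ} {u v w : V}
    (h : HasWalk G k u v) (h' : HasWalk G l v w) : HasWalk G (k + l) u w := by
  induction k generalizing u with
  | zero => cases h; simpa using h'
  | succ k ih =>
    obtain ⟨x, hx, hw⟩ := h
    rw [Nat.add_right_comm]
    exact ⟨x, hx, ih hw⟩

theorem HasWalk.snoc {V : Type*} {G : Digraph V} {k : ℕ} {u v w : V}
    (h : HasWalk G k u v) (h' : G.Adj v w) : HasWalk G (k + 1) u w :=
  h.trans (l := 1) ⟨w, h', rfl⟩

theorem ddist_le_of_hasWalk {V : Type*} {G : Digraph V} {k : ℕ} {u v : V}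
    (h : HasWalk G k u v) : ddist G u v ≤ k :=
  iInf₂_le k h

/-- Along a walk the potential gains at most one per edge, while it may drop arbitrarily. Hence its
value at the end bounds the length from below. -/
theorem le_ddist_of_potential {V : Type*} {G : Digraph V} (h : V → ℕ)
    (hG : ∀ x y, G.Adj x y → h y ≤ h x + 1) {u : V} (hu : h u = 0) (v : V) :
    (h v : ℕ∞) ≤ ddist G u v := by
  refine le_iInf₂ fun k hk => ?_
  suffices ∀ k u, HasWalk G k u v → h v ≤ h u + k by
    exact_mod_cast (hu ▸ this k u hk).trans_eq (zero_add k)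
  intro k
  induction k with
  | zero => rintro u rfl; simp
  | succ k ih =>
    rintro u ⟨x, hx, hw⟩
    have := ih x hw
    have := hG u x hx
    omega

section Gadget

variable {p q d a : ℕ} {U : Fin p → Fin d → Bool} {V : Fin q → Fin d → Bool} {w : Fin d → Bool}

theorem hasWalk_uNode {k : ℕ} {z : GadgetVertex p q d a} {u : Fin p}
    (h : HasWalk (gadget a U V w) k z (.uNode u 0)) (i : Fin (a + 1)) :
    HasWalk (gadget a U V w) (k + i) z (.uNode u i) := by
  obtain ⟨i, hi⟩ := i
  induction i with
  | zero => exact h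
  | succ i ih => exact (ih (by omega)).snoc (.uPath u _ _ rfl)

theorem hasWalk_vNode {k : ℕ} {z : GadgetVertex p q d a} {v : Fin q}
    (h : HasWalk (gadget a U V w) k z (.vNode v 0)) (i : Fin (a + 1)) :
    HasWalk (gadget a U V w) (k + i) z (.vNode v i) := by
  obtain ⟨i, hi⟩ := i
  induction i with
  | zero => exact h
  | succ i ih => exact (ih (by omega)).snoc (.vPath v _ _ rfl)

theorem hasWalk_inner {k : ℕ} {z : GadgetVertex p q d a}
    (h : HasWalk (gadget a U V w) k z .y) (c : Fin d) (i : Fin (a - 1)) :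
    HasWalk (gadget a U V w) (k + 1 + i) z (.inner c i) := by
  obtain ⟨i, hi⟩ := i
  induction i with
  | zero => exact h.snoc (.yFirst c _ rfl)
  | succ i ih => exact (ih (by omega)).snoc (.yPath c _ _ rfl)

theorem hasWalk_cV (ha : 1 ≤ a) {k : ℕ} {z : GadgetVertex p q d a}
    (h : HasWalk (gadget a U V w) k z .y) (c : Fin d) :
    HasWalk (gadget a U V w) (k + a) z (.cV c) := by
  -- For `a = 1` there are no inner vertices and `y` is joined to `c_V` directly; otherwise the last
  -- inner vertex has index `a - 2`.
  rcases ha.eq_or_lt with rfl | ha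
  · exact h.snoc (.yDirect c rfl)
  · have hl : (gadget a U V w).Adj (.inner c ⟨a - 2, by omega⟩) (.cV c) :=
      GadgetAdj.yLast c _ (show a - 2 + 1 = a - 1 by omega)
    have h' := (hasWalk_inner h c ⟨a - 2, by omega⟩).snoc hl
    rwa [show k + 1 + (a - 2) + 1 = k + a by omega] at h'

/-- These walks avoid the stage edges, so `w` plays no role. A vertex `c_U` is the farthest of the
first kind: one step to `x`, one to a path that meets `c`, then `a` steps and one more. Since `u` is
nonzero, `y` is at distance at most 2 and each `c_V` at distance at most `a + 2`. -/
theorem hasWalk_gadget (ha : 1 ≤ a) (hU : NonDegenerate U) (hV : NonDegenerate V) (u : Fin p)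
    (z : GadgetVertex p q d a) :
    (∃ k ≤ a + 3, HasWalk (gadget a U V w) k (.uNode u (Fin.last a)) z) ∨
      ∃ v i, z = .vNode v i ∧ HasWalk (gadget a U V w) (a + 3 + i) (.uNode u (Fin.last a)) z := by
  have hx : HasWalk (gadget a U V w) 1 (.uNode u (Fin.last a)) .x := ⟨_, .toX u, rfl⟩
  have hu (u' : Fin p) (i : Fin (a + 1)) :=
    hasWalk_uNode (hx.snoc (.fromX u')) i
  have hy : HasWalk (gadget a U V w) 2 (.uNode u (Fin.last a)) .y :=
    let ⟨c, hc⟩ := hU.1 u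
    ⟨_, .uCoord u c hc, _, .toY c, rfl⟩
  cases z with
  | uNode u' i => exact .inl ⟨_, by have := i.isLt; omega, hu u' i⟩
  | cU c =>
    obtain ⟨u', hc⟩ := hU.2 c
    exact .inl ⟨_, by simp; omega, (hu u' (Fin.last a)).snoc (.uCoord u' c hc)⟩
  | cV c => exact .inl ⟨_, by omega, hasWalk_cV ha hy c⟩
  | x => exact .inl ⟨_, by omega, hx⟩
  | y => exact .inl ⟨_, by omega, hy⟩
  | inner c i => exact .inl ⟨_, by have := i.isLt; omega, hasWalk_inner hy c i⟩
  | vNode v i =>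
    obtain ⟨c, hc⟩ := hV.1 v
    refine .inr ⟨v, i, rfl, ?_⟩
    convert hasWalk_vNode ((hasWalk_cV ha hy c).snoc (.vCoord v c hc)) i using 1
    omega

/-- A potential that grows by at most one along the edges, for a vector `u` for which no
orthogonal triple is needed. -/
def gadgetPotential : GadgetVertex p q d a → ℕ
  | .uNode _ _ => 0
  | .vNode _ i => 3 + i
  | .cU _ => 1
  | .cV _ => 2
  | .x => 0
  | .y => 1
  | .inner _ _ => 1

/-- A potential that grows by at most one along the edges, if `u`, `v`, `w` are orthogonal. -/
def gadgetPotentialOrthogonal (U : Fin p → Fin d → Bool) (w : Fin d → Bool) (u : Fin p)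
    (v : Fin q) : GadgetVertex p q d a → ℕ
  | .uNode u' i => if u' = u ∧ i = Fin.last a then 0 else 2 + i
  | .vNode v' i => if v' = v then a + 3 + i else 0
  | .cU c => if U u c then 1 else a + 3
  | .cV c => if U u c ∧ w c then 2 else a + 2
  | .x => 1
  | .y => 2
  | .inner _ i => 3 + i

theorem ecc_gadget_of_orthogonal (ha : 1 ≤ a) (hU : NonDegenerate U) (hV : NonDegenerate V)
    (u : Fin p) (h : ∃ v, OrthogonalTriple (U u) (V v) w) :
    ecc (gadget a U V w) (.uNode u (Fin.last a)) = 2 * a + 3 := by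
  obtain ⟨v, hv⟩ := h
  apply le_antisymm
  · refine iSup_le fun z => ?_
    rcases hasWalk_gadget (w := w) ha hU hV u z with ⟨k, hk, h⟩ | ⟨v', i, -, h⟩
    · refine (ddist_le_of_hasWalk h).trans ?_
      exact_mod_cast (by omega : k ≤ 2 * a + 3)
    · refine (ddist_le_of_hasWalk h).trans ?_
      have := i.isLt
      exact_mod_cast (by omega : a + 3 + (i : ℕ) ≤ 2 * a + 3)
  -- The last vertex of the path of `v` has potential `2a + 3`.
  · have key := le_ddist_of_potential (G := gadget a U V w) (gadgetPotentialOrthogonal U w u v)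
      ?_ (u := .uNode u (Fin.last a)) (by simp [gadgetPotentialOrthogonal]) (.vNode v (Fin.last a))
    · refine le_trans ?_ (le_iSup _ (GadgetVertex.vNode v (Fin.last a)))
      refine le_trans ?_ key
      simp only [gadgetPotentialOrthogonal, if_true, Fin.val_last]
      exact_mod_cast (by omega : 2 * a + 3 ≤ a + 3 + a)
    · rintro _ _ (⟨u', i, j, hij⟩ | ⟨v', i, j, hij⟩ | ⟨u', c, hc⟩ | ⟨v', c, hc⟩ | u' | u' | c | ⟨c, h1⟩ |
        ⟨c, i, hi⟩ | ⟨c, i, j, hij⟩ | ⟨c, i, hi⟩ | ⟨c, hc⟩)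
      -- The vertex `u^a`, the only one of its path with potential zero, has no successor on the
      -- path.
      · have : i ≠ Fin.last a := by rintro rfl; have := j.isLt; simp at hij; omega
        simp only [gadgetPotentialOrthogonal, this, and_false, if_false]
        split_ifs <;> omega
      · simp only [gadgetPotentialOrthogonal]
        split_ifs <;> omega
      · simp only [gadgetPotentialOrthogonal, and_true, Fin.val_last]
        by_cases hu : u' = u
        · subst hu; simp [hc]
        · simp only [hu, if_false]; split_ifs <;> omega
      · simp only [gadgetPotentialOrthogonal]
        by_cases hvv : v' = v
        · subst hvv
          -- The path of `v` is entered only from some `c_V` with `v[c] = 1`. Orthogonality excludes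
          -- the low potential 2 there, so the step goes from `a + 2` to `a + 3`.
          have : ¬ (U u c = true ∧ w c = true) := fun h => hv c ⟨h.1, hc, h.2⟩
          simp [this]
        · simp [hvv]
      all_goals simp only [gadgetPotentialOrthogonal]
      all_goals first | omega | skip
      · split_ifs <;> simp
      · split_ifs <;> simp
      · split_ifs <;> omega
      · split_ifs <;> omega
      · by_cases h : U u c = true <;> simp [h, hc]

theorem ecc_gadget_of_not_orthogonal (ha : 1 ≤ a) (hU : NonDegenerate U) (hV : NonDegenerate V)
    (u : Fin p) (h : ¬ ∃ v, OrthogonalTriple (U u) (V v) w) :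
    ecc (gadget a U V w) (.uNode u (Fin.last a)) = a + 3 := by
  apply le_antisymm
  · refine iSup_le fun z => ?_
    have hle : ∃ k ≤ a + 3, HasWalk (gadget a U V w) k (.uNode u (Fin.last a)) z := by
      rcases hasWalk_gadget (w := w) ha hU hV u z with h' | ⟨v, i, rfl, -⟩
      · exact h'
      · have hv : ¬ OrthogonalTriple (U u) (V v) w := fun h' => h ⟨v, h'⟩
        simp only [OrthogonalTriple, not_forall, not_not] at hv
        obtain ⟨c, h1, h2, h3⟩ := hv
        -- The shortcut `u^a → c_U → c_V → v^0` at a common one of the three vectors.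
        have h0 : HasWalk (gadget a U V w) 3 (.uNode u (Fin.last a)) (.vNode v 0) :=
          ⟨_, .uCoord u c h1, _, .stage c h3, _, .vCoord v c h2, rfl⟩
        exact ⟨_, by have := i.isLt; omega, hasWalk_vNode h0 i⟩
    obtain ⟨k, hk, h'⟩ := hle
    exact (ddist_le_of_hasWalk h').trans (by exact_mod_cast hk)
  -- Some vector of `V` exists: `u` provides a coordinate and this coordinate a vector. The end of
  -- its path is at distance at least `a + 3` in any case.
  · obtain ⟨c, -⟩ := hU.1 u
    obtain ⟨v, -⟩ := hV.2 c
    have key := le_ddist_of_potential (G := gadget a U V w) gadgetPotential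
      ?_ (u := .uNode u (Fin.last a)) rfl (.vNode v (Fin.last a))
    · refine le_trans ?_ (le_iSup _ (GadgetVertex.vNode v (Fin.last a)))
      refine le_trans ?_ key
      simp only [gadgetPotential, Fin.val_last]
      exact_mod_cast (by omega : a + 3 ≤ 3 + a)
    · rintro _ _ (_ | ⟨v', i, j, hij⟩ | _ | _ | _ | _ | _ | _ | _ | _ | _ | _) <;>
        simp only [gadgetPotential] <;> first | omega | simp

end Gadget

/-! ## Machines driven by fresh random bits -/

namespace WordRAM

/-- A product measure is mapped coordinate by coordinate, and negation preserves the fair measure on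
one bit. -/
theorem coins_map_flip (τ : ℕ) :
    coins.map (fun ω i => if i = τ then !(ω i) else ω i) = coins := by
  have h := Measure.infinitePi_map_pi
    (μ := fun _ : ℕ => (PMF.uniformOfFintype Bool).toMeasure)
    (f := fun i b => if i = τ then !b else b) (fun i => measurable_of_finite _)
  refine h.trans ?_
  unfold coins
  congr 1
  funext i
  rw [PMF.toMeasure_map _ _ (measurable_of_finite _)]
  congr 1
  ext b
  rw [PMF.map_apply]
  by_cases hi : i = τ <;> cases b <;> simp [hi, tsum_fintype]

/-- The flip of the bit number `τ`. -/
def flipAt (τ : ℕ) (ω : ℕ → Bool) : ℕ → Bool := fun i => if i = τ then !(ω i) else ω i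

theorem flipAt_flipAt (τ : ℕ) (ω : ℕ → Bool) : flipAt τ (flipAt τ ω) = ω := by
  funext i
  by_cases h : i = τ <;> simp [flipAt, h]

theorem measurable_flipAt (τ : ℕ) : Measurable (flipAt τ) := by
  refine measurable_pi_lambda _ fun i => ?_
  by_cases h : i = τ
  · simp only [flipAt, h, if_true]
    exact (measurable_of_finite Bool.not).comp (measurable_pi_apply τ)
  · simpa only [flipAt, h, if_false] using measurable_pi_apply i

/-- The flip of one bit as an equivalence. -/
def flipEquiv (τ : ℕ) : (ℕ → Bool) ≃ᵐ (ℕ → Bool) where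
  toFun := flipAt τ
  invFun := flipAt τ
  left_inv := flipAt_flipAt τ
  right_inv := flipAt_flipAt τ
  measurable_toFun := measurable_flipAt τ
  measurable_invFun := measurable_flipAt τ

/-- The set is arbitrary, because the flip is a measurable equivalence. The events about programs
are therefore never shown to be measurable. -/
theorem coins_preimage_flipAt (τ : ℕ) (A : Set (ℕ → Bool)) :
    coins (flipAt τ ⁻¹' A) = coins A := by
  conv_rhs => rw [← coins_map_flip τ]
  exact ((flipEquiv τ).map_apply A).symm

theorem measurableSet_bit (τ : ℕ) (b : Bool) : MeasurableSet {ω : ℕ → Bool | ω τ = b} :=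
  measurableSet_eq_fun (measurable_pi_apply τ) measurable_const

/-- The flip exchanges the two parts into which bit `τ` cuts the invariant set, so they have the
same measure. -/
theorem coins_bit_inter (τ : ℕ) (b : Bool) {A : Set (ℕ → Bool)}
    (hA : ∀ ω, flipAt τ ω ∈ A ↔ ω ∈ A) : coins ({ω | ω τ = b} ∩ A) = coins A / 2 := by
  have hm := measurableSet_bit τ b
  have h1 := measure_inter_add_sdiff (μ := coins) A hm
  have h2 : coins (A \ {ω | ω τ = b}) = coins (A ∩ {ω | ω τ = b}) := by
    rw [← coins_preimage_flipAt τ]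
    congr 1
    ext ω
    have := hA ω
    simp only [Set.mem_preimage, Set.mem_sdiff, Set.mem_ofPred_eq, Set.mem_inter_iff, this]
    simp [flipAt]
  rw [h2, ← two_mul] at h1
  rw [Set.inter_comm, ← h1, mul_comm, ENNReal.mul_div_cancel_right (by simp) (by simp)]

instance : IsProbabilityMeasure coins := by
  unfold coins
  infer_instance

/-- An action of a machine that reads one random bit. -/
abbrev Act := Bool → State → State

/-- The action either advances the time or does not depend on the random bit. -/
def Act.Fresh (f : Act) : Prop :=
  ∀ s, (∀ b, s.time < (f b s).time) ∨ ∀ b, f b s = f false s ∧ s.time ≤ (f b s).time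

theorem Act.Fresh.time_le {f : Act} (hf : f.Fresh) (b : Bool) (s : State) :
    s.time ≤ (f b s).time := by
  rcases hf s with h | h
  · exact (h b).le
  · exact (h b).2

/-- Perform actions one after the other, each with the bit of its time. -/
def runActs (ω : ℕ → Bool) : List Act → State → State
  | [], s => s
  | f :: l, s => runActs ω l (f (ω s.time) s)

/-- The probability to arrive at `G` by some actions, each with a fresh bit. -/
noncomputable def prob (G : State → Prop) : List Act → State → ℝ≥0∞
  | [], s => open Classical in if G s then 1 else 0
  | f :: l, s => (prob G l (f false s) + prob G l (f true s)) / 2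

theorem runActs_append (ω : ℕ → Bool) (l l' : List Act) (s : State) :
    runActs ω (l ++ l') s = runActs ω l' (runActs ω l s) := by
  induction l generalizing s with
  | nil => rfl
  | cons f l ih => exact ih _

/-- Time never decreases, hence bits of earlier times are not read any more. -/
theorem runActs_congr {l : List Act} (hl : ∀ f ∈ l, Act.Fresh f) {ω ω' : ℕ → Bool} {s : State}
    (h : ∀ i, s.time ≤ i → ω i = ω' i) : runActs ω l s = runActs ω' l s := by
  induction l generalizing s with
  | nil => rfl
  | cons f l ih =>
    have hf := hl f (by simp)
    simp only [runActs]
    rw [h s.time le_rfl]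
    exact ih (fun g hg => hl g (by simp [hg])) fun i hi => h i ((hf.time_le _ s).trans hi)

/-- If the first action advances the time, then the remaining ones do not read its bit and
`coins_bit_inter` splits the event into two halves. If it does not depend on its bit, both terms of
the average coincide. -/
theorem coins_runActs (G : State → Prop) {l : List Act} (hl : ∀ f ∈ l, Act.Fresh f) (s : State) :
    coins {ω | G (runActs ω l s)} = prob G l s := by
  induction l generalizing s with
  | nil => by_cases h : G s <;> simp [runActs, prob, h]
  | cons f l ih =>
    have hl' : ∀ g ∈ l, Act.Fresh g := fun g hg => hl g (by simp [hg])
    simp only [prob, ← ih hl']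
    rcases hl f (by simp) s with h | h
    · have key (b : Bool) : coins ({ω | ω s.time = b} ∩ {ω | G (runActs ω (f :: l) s)}) =
          coins {ω | G (runActs ω l (f b s))} / 2 := by
        rw [← coins_bit_inter s.time b (A := {ω | G (runActs ω l (f b s))})]
        · congr 1
          ext ω
          simp only [runActs, Set.mem_inter_iff, Set.mem_ofPred_eq, and_congr_right_iff]
          rintro rfl
          rfl
        · intro ω
          simp only [Set.mem_ofPred_eq]
          rw [runActs_congr hl' (ω' := ω)]
          intro i hi
          have := h b
          simp only [flipAt]
          rw [if_neg (by omega)]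
      have hm := measurableSet_bit s.time false
      rw [← measure_inter_add_sdiff _ hm, Set.inter_comm, key false, ENNReal.add_div, ← key true]
      congr 2
      ext ω
      simp [and_comm]
    · simp only [runActs, (h _).1]
      rw [ENNReal.add_div, ENNReal.add_halves]

/-- One step of a program as an action. -/
def stepAct (P : Program) (w : ℕ) : Act := fun b s =>
  match P[s.pc]? with
  | none => s
  | some i => i.exec w b s

theorem step_eq_stepAct (P : Program) (w : ℕ) (ω : ℕ → Bool) (s : State) :
    step P w ω s = stepAct P w (ω s.time) s := rfl

theorem time_exec (i : Instr) (w : ℕ) (b : Bool) (s : State) :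
    (i.exec w b s).time = s.time + 1 := by
  cases i <;> rfl

theorem stepAct_of_halted {P : Program} {s : State} (h : Halted P s) (w : ℕ) (b : Bool) :
    stepAct P w b s = s := by
  simp [stepAct, List.getElem?_eq_none h]

theorem stepAct_of_getElem? {P : Program} {s : State} {i : Instr} (h : P[s.pc]? = some i) (w : ℕ)
    (b : Bool) : stepAct P w b s = i.exec w b s := by
  simp [stepAct, h]

theorem fresh_stepAct (P : Program) (w : ℕ) : (stepAct P w).Fresh := by
  intro s
  by_cases h : Halted P s
  · exact .inr fun b => by simp [stepAct_of_halted h]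
  · left
    intro b
    have h' : P[s.pc]? = some (P[s.pc]'(not_le.1 h)) := List.getElem?_eq_getElem _
    rw [stepAct_of_getElem? h', time_exec]
    omega

theorem runActs_replicate_stepAct (P : Program) (w : ℕ) (ω : ℕ → Bool) (k : ℕ) (s : State) :
    runActs ω (List.replicate k (stepAct P w)) s = (step P w ω)^[k] s := by
  induction k generalizing s with
  | zero => rfl
  | succ k ih => exact ih _

theorem step_of_halted {P : Program} {s : State} (h : Halted P s) (w : ℕ) (ω : ℕ → Bool) :
    step P w ω s = s := by
  rw [step_eq_stepAct, stepAct_of_halted h]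

theorem iterate_step_of_halted {P : Program} {s : State} (h : Halted P s) (w : ℕ) (ω : ℕ → Bool)
    (k : ℕ) : (step P w ω)^[k] s = s := by
  induction k with
  | zero => rfl
  | succ k ih => rw [Function.iterate_succ_apply, step_of_halted h, ih]

/-- A step of a machine that has not halted takes one unit of time, and a halted machine stays as it
is. So any budget of at least `T` steps gives the final state, which allows runs of unknown length
to be replaced by fixed lists of actions. -/
theorem HaltsIn.runActs_eq {P : Program} {w : ℕ} {ω : ℕ → Bool} {s s' : State} {T k : ℕ}
    (h : HaltsIn P w ω s T s') (hk : T ≤ k) :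
    runActs ω (List.replicate k (stepAct P w)) s = s' := by
  rw [runActs_replicate_stepAct]
  obtain ⟨⟨j, hj⟩, hh, ht⟩ := h
  induction j generalizing s T k with
  | zero =>
    cases hj
    exact iterate_step_of_halted hh _ _ _
  | succ j ih =>
    rw [Function.iterate_succ_apply] at hj
    by_cases hs : Halted P s
    · rw [step_of_halted hs, iterate_step_of_halted hs] at hj
      rw [iterate_step_of_halted hs, hj]
    · have h1 : (step P w ω s).time = s.time + 1 := by
        have h' : P[s.pc]? = some (P[s.pc]'(not_le.1 hs)) := List.getElem?_eq_getElem _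
        rw [step_eq_stepAct, stepAct_of_getElem? h', time_exec]
      have hmono : ∀ j s, s.time ≤ ((step P w ω)^[j] s).time := by
        intro j
        induction j with
        | zero => intro s; exact le_rfl
        | succ j ih =>
          intro s
          exact ((fresh_stepAct P w).time_le (ω s.time) s).trans (ih (step P w ω s))
      have h2 := hmono j (step P w ω s)
      rw [hj] at h2
      -- A step is still to be made and time is monotone, so `T`, and with it the budget, is
      -- positive.
      obtain ⟨k, rfl⟩ : ∃ k', k = k' + 1 := ⟨k - 1, by omega⟩
      rw [Function.iterate_succ_apply]
      exact ih (T := T - 1) (by omega) hj (by omega)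

/-- The probability that a program, started in `s`, halts in a state with property `G`. -/
noncomputable def reach (P : Program) (w : ℕ) (G : State → Prop) (s : State) : ℝ≥0∞ :=
  ⨆ k, prob (fun s => Halted P s ∧ G s) (List.replicate k (stepAct P w)) s

theorem one_le_reach {P : Program} {w : ℕ} {G : State → Prop} {s : State} (h : Halted P s)
    (hG : G s) : 1 ≤ reach P w G s :=
  le_iSup_of_le 0 (by simp [prob, h, hG])

theorem monotone_prob_replicate (P : Program) (w : ℕ) (G : State → Prop) (s : State) :
    Monotone fun k => prob (fun s => Halted P s ∧ G s) (List.replicate k (stepAct P w)) s := by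
  refine monotone_nat_of_le_succ fun k => ?_
  induction k generalizing s with
  | zero =>
    by_cases h : Halted P s ∧ G s
    · simp [prob, stepAct_of_halted h.1, h, one_add_one_eq_two, ENNReal.div_self]
    · simp [prob, h]
  | succ k ih =>
    rw [List.replicate_succ, List.replicate_succ]
    simp only [prob]
    gcongr
    · exact ih _
    · exact ih _

/-- The probabilities increase with the number of steps, so the supremum commutes with the average
over the two values of the bit. -/
theorem reach_step (P : Program) (w : ℕ) (G : State → Prop) (s : State) :
    (reach P w G (stepAct P w false s) + reach P w G (stepAct P w true s)) / 2 ≤ reach P w G s := by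
  unfold reach
  rw [ENNReal.iSup_add_iSup_of_monotone (monotone_prob_replicate _ _ _ _)
    (monotone_prob_replicate _ _ _ _), ENNReal.iSup_div]
  exact iSup_le fun k => le_iSup_of_le (k + 1) le_rfl

theorem reach_step_of_const {P : Program} {w : ℕ} {G : State → Prop} {s s' : State}
    (h : ∀ b, stepAct P w b s = s') : reach P w G s' ≤ reach P w G s := by
  refine le_trans ?_ (reach_step P w G s)
  rw [h, h, ENNReal.add_div, ENNReal.add_halves]

/-- For each number of steps the probability is, by `coins_runActs`, that of an event contained in
the one on the right. -/
theorem reach_le_coins (P : Program) (w : ℕ) (G : State → Prop) (s : State) :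
    reach P w G s ≤ coins {ω | ∃ T s', HaltsIn P w ω s T s' ∧ G s'} := by
  refine iSup_le fun k => ?_
  rw [← coins_runActs _ (fun f hf => (List.mem_replicate.1 hf).2 ▸ fresh_stepAct P w)]
  refine measure_mono fun ω hω => ?_
  rw [Set.mem_ofPred_eq, runActs_replicate_stepAct] at hω
  refine ⟨((step P w ω)^[k] s).time - s.time, _, ⟨⟨k, rfl⟩, hω.1, ?_⟩, hω.2⟩
  have : ∀ j s, s.time ≤ ((step P w ω)^[j] s).time := by
    intro j
    induction j with
    | zero => intro s; exact le_rfl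
    | succ j ih =>
      intro s
      exact ((fresh_stepAct P w).time_le (ω s.time) s).trans (ih (step P w ω s))
  have := this k s
  omega

end WordRAM

/-! ## Finite probability trees -/

/-- A finite computation with fair coin flips. -/
inductive CoinTree (α : Type)
  | leaf (a : α)
  | flip (t₀ t₁ : CoinTree α)

namespace CoinTree

variable {α β : Type}

def bind (k : α → CoinTree β) : CoinTree α → CoinTree β
  | leaf a => k a
  | flip t₀ t₁ => flip (bind k t₀) (bind k t₁)

/-- All outcomes have the property `Q`. -/
def All (Q : α → Prop) : CoinTree α → Prop
  | leaf a => Q a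
  | flip t₀ t₁ => All Q t₀ ∧ All Q t₁

/-- The expected value of a function of the outcome. -/
noncomputable def expect (f : α → ℝ≥0∞) : CoinTree α → ℝ≥0∞
  | leaf a => f a
  | flip t₀ t₁ => (expect f t₀ + expect f t₁) / 2

theorem all_bind (Q : β → Prop) (k : α → CoinTree β) (t : CoinTree α) :
    (t.bind k).All Q ↔ t.All fun a => (k a).All Q := by
  induction t with
  | leaf a => rfl
  | flip t₀ t₁ h₀ h₁ => exact and_congr h₀ h₁

theorem expect_bind (f : β → ℝ≥0∞) (k : α → CoinTree β) (t : CoinTree α) :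
    (t.bind k).expect f = t.expect fun a => (k a).expect f := by
  induction t with
  | leaf a => rfl
  | flip t₀ t₁ h₀ h₁ => simp only [bind, expect, h₀, h₁]

theorem All.mono {Q Q' : α → Prop} {t : CoinTree α} (h : t.All Q) (hQ : ∀ a, Q a → Q' a) :
    t.All Q' := by
  induction t with
  | leaf a => exact hQ a h
  | flip t₀ t₁ h₀ h₁ => exact ⟨h₀ h.1, h₁ h.2⟩

theorem All.and {Q Q' : α → Prop} {t : CoinTree α} (h : t.All Q) (h' : t.All Q') :
    t.All fun a => Q a ∧ Q' a := by
  induction t with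
  | leaf a => exact ⟨h, h'⟩
  | flip t₀ t₁ h₀ h₁ => exact ⟨h₀ h.1 h'.1, h₁ h.2 h'.2⟩

theorem all_of_forall {Q : α → Prop} (h : ∀ a, Q a) (t : CoinTree α) : t.All Q := by
  induction t with
  | leaf a => exact h a
  | flip t₀ t₁ h₀ h₁ => exact ⟨h₀, h₁⟩

theorem All.expect_le {Q : α → Prop} {f g : α → ℝ≥0∞} {t : CoinTree α} (h : t.All Q)
    (hfg : ∀ a, Q a → f a ≤ g a) : t.expect f ≤ t.expect g := by
  induction t with
  | leaf a => exact hfg a h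
  | flip t₀ t₁ h₀ h₁ =>
    simp only [expect]
    gcongr
    · exact h₀ h.1
    · exact h₁ h.2

theorem All.le_expect {Q : α → Prop} {f : α → ℝ≥0∞} {c : ℝ≥0∞} {t : CoinTree α} (h : t.All Q)
    (hf : ∀ a, Q a → c ≤ f a) : c ≤ t.expect f := by
  refine le_trans (le_of_eq ?_) (h.expect_le (f := fun _ => c) hf)
  clear h
  induction t with
  | leaf a => rfl
  | flip t₀ t₁ h₀ h₁ => simp only [expect, ← h₀, ← h₁, ENNReal.add_div, ENNReal.add_halves]

end CoinTree

/-! ## A structured language for the word RAM -/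

/-- Expressions. -/
inductive Expr
  | lit (x : ℕ)
  | reg (r : ℕ)
  | bin (o : BinOp) (e₁ e₂ : Expr)
  | load (e : Expr)

/-- Commands; `loop r e c` performs `c` as often as the value of `e` says, and the register `r`
counts downwards to zero. -/
inductive Cmd
  | skip
  | set (r : ℕ) (e : Expr)
  | store (a e : Expr)
  | coin (r : ℕ)
  | seq (c₁ c₂ : Cmd)
  | ite (e : Expr) (c₁ c₂ : Cmd)
  | loop (r : ℕ) (e : Expr) (c : Cmd)

/-- The memory of a structured program, and its time. -/
structure Store where
  reg : ℕ → ℕ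
  mem : ℕ → ℕ
  time : ℕ

namespace Store

def setReg (st : Store) (r x : ℕ) : Store := ⟨Function.update st.reg r x, st.mem, st.time⟩

def setMem (st : Store) (a x : ℕ) : Store := ⟨st.reg, Function.update st.mem a x, st.time⟩

def tick (st : Store) (t : ℕ) : Store := ⟨st.reg, st.mem, st.time + t⟩

/-- All registers and memory cells hold values less than `X`. -/
def Below (X : ℕ) (st : Store) : Prop := (∀ r, st.reg r < X) ∧ ∀ a, st.mem a < X

theorem Below.setReg {X : ℕ} {st : Store} (h : st.Below X) {x : ℕ} (hx : x < X) (r : ℕ) :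
    (st.setReg r x).Below X := by
  refine ⟨fun r' => ?_, h.2⟩
  by_cases hr : r' = r
  · subst hr; simpa [Store.setReg] using hx
  · simpa [Store.setReg, hr] using h.1 r'

theorem Below.setMem {X : ℕ} {st : Store} (h : st.Below X) {x : ℕ} (hx : x < X) (a : ℕ) :
    (st.setMem a x).Below X := by
  refine ⟨h.1, fun a' => ?_⟩
  by_cases ha : a' = a
  · subst ha; simpa [Store.setMem] using hx
  · simpa [Store.setMem, ha] using h.2 a'

theorem Below.tick {X : ℕ} {st : Store} (h : st.Below X) (t : ℕ) : (st.tick t).Below X := h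

end Store

namespace Expr

/-- The value of an expression for word size `w`. -/
def eval (w : ℕ) (st : Store) : Expr → ℕ
  | lit x => x % 2 ^ w
  | reg r => st.reg r
  | bin o e₁ e₂ => o.eval w (e₁.eval w st) (e₂.eval w st)
  | load e => st.mem (e.eval w st)

/-- The register that holds the value after `code`. -/
def res (k : ℕ) : Expr → ℕ
  | reg r => r
  | _ => k

/-- Code that evaluates an expression, using the registers from `k` on. -/
def code : Expr → ℕ → List Instr
  | lit x, k => [.const k x]
  | reg _, _ => []
  | bin o e₁ e₂, k => e₁.code k ++ (e₂.code (k + 1) ++ [.bin o k (e₁.res k) (e₂.res (k + 1))])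
  | load e, k => e.code k ++ [.load k (e.res k)]

def size : Expr → ℕ
  | lit _ => 1
  | reg _ => 0
  | bin _ e₁ e₂ => e₁.size + e₂.size + 1
  | load e => e.size + 1

theorem length_code (e : Expr) (k : ℕ) : (e.code k).length = e.size := by
  induction e generalizing k with
  | lit | reg => rfl
  | bin o e₁ e₂ h₁ h₂ => simp [code, size, h₁, h₂]; omega
  | load e h => simp [code, size, h]

/-- Only registers below `T` are used. -/
def RegsBelow (T : ℕ) : Expr → Prop
  | lit _ => True
  | reg r => r < T
  | bin _ e₁ e₂ => e₁.RegsBelow T ∧ e₂.RegsBelow T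
  | load e => e.RegsBelow T

theorem eval_lt {w : ℕ} {st : Store} (h : st.Below (2 ^ w)) (e : Expr) : e.eval w st < 2 ^ w := by
  have hp : 0 < 2 ^ w := by positivity
  cases e with
  | lit x => exact Nat.mod_lt _ hp
  | reg r => exact h.1 r
  | bin o e₁ e₂ => cases o <;> exact Nat.mod_lt _ hp
  | load e => exact h.2 _

end Expr

/-- The registers from this number on are used for the evaluation of expressions. -/
def tmp : ℕ := 64

namespace Cmd

/-- The number of instructions of the compiled command. -/
def len : Cmd → ℕ
  | skip => 0
  | set _ e => e.size + 1
  | store a e => a.size + e.size + 1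
  | coin _ => 1
  | seq c₁ c₂ => c₁.len + c₂.len
  | ite e c₁ c₂ => e.size + 1 + c₁.len + 2 + c₂.len
  | loop _ e c => e.size + 4 + c.len + 2

/-- The instructions of a command that is put at the position `off`. -/
def compile : Cmd → ℕ → List Instr
  | skip, _ => []
  | set r e, _ => e.code tmp ++ [.bin .or r (e.res tmp) (e.res tmp)]
  | store a e, _ =>
      a.code tmp ++ (e.code (tmp + 1) ++ [.store (a.res tmp) (e.res (tmp + 1))])
  | coin r, _ => [.coin r]
  | seq c₁ c₂, off => c₁.compile off ++ c₂.compile (off + c₁.len)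
  | ite e c₁ c₂, off =>
      e.code tmp ++ ([.jz (e.res tmp) (off + e.size + 1 + c₁.len + 2)] ++
        (c₁.compile (off + e.size + 1) ++
          ([.const tmp 0, .jz tmp (off + e.size + 1 + c₁.len + 2 + c₂.len)] ++
            c₂.compile (off + e.size + 1 + c₁.len + 2))))
  | loop r e c, off =>
      e.code tmp ++ ([.bin .or r (e.res tmp) (e.res tmp),
        .jz r (off + e.size + 4 + c.len + 2), .const tmp 1, .bin .sub r r tmp] ++
          (c.compile (off + e.size + 4) ++ [.const tmp 0, .jz tmp (off + e.size + 1)]))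

theorem length_compile (c : Cmd) (off : ℕ) : (c.compile off).length = c.len := by
  induction c generalizing off <;> simp [compile, len, Expr.length_code, *] <;> omega

/-- Repetitions of a command with a counter in register `r`. -/
def iter (body : Store → CoinTree Store) (r : ℕ) : ℕ → Store → CoinTree Store
  | 0, st => .leaf (st.tick 1)
  | n + 1, st => (body ((st.setReg r n).tick 3)).bind fun st' => iter body r n (st'.tick 2)

/-- The outcomes of a command for word size `w`. -/
def exec (w : ℕ) : Cmd → Store → CoinTree Store
  | skip, st => .leaf st
  | set r e, st => .leaf ((st.setReg r (e.eval w st)).tick (e.size + 1))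
  | store a e, st => .leaf ((st.setMem (a.eval w st) (e.eval w st)).tick (a.size + e.size + 1))
  | coin r, st => .flip (.leaf ((st.setReg r 0).tick 1)) (.leaf ((st.setReg r (1 % 2 ^ w)).tick 1))
  | seq c₁ c₂, st => (c₁.exec w st).bind (c₂.exec w)
  | ite e c₁ c₂, st =>
      if e.eval w st = 0 then c₂.exec w (st.tick (e.size + 1))
      else (c₁.exec w (st.tick (e.size + 1))).bind fun st' => .leaf (st'.tick 2)
  | loop r e c, st =>
      iter (c.exec w) r (e.eval w st) ((st.setReg r (e.eval w st)).tick (e.size + 1))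

/-- The register `r` may be changed. -/
def Writes (r : ℕ) : Cmd → Prop
  | skip => False
  | set r' _ => r = r'
  | store _ _ => False
  | coin r' => r = r'
  | seq c₁ c₂ => c₁.Writes r ∨ c₂.Writes r
  | ite _ c₁ c₂ => c₁.Writes r ∨ c₂.Writes r
  | loop r' _ c => r = r' ∨ c.Writes r

/-- Only registers below `tmp` are used, and counters of loops are not changed inside. -/
def WF : Cmd → Prop
  | skip => True
  | set r e => r < tmp ∧ e.RegsBelow tmp
  | store a e => a.RegsBelow tmp ∧ e.RegsBelow tmp
  | coin r => r < tmp
  | seq c₁ c₂ => c₁.WF ∧ c₂.WF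
  | ite e c₁ c₂ => e.RegsBelow tmp ∧ c₁.WF ∧ c₂.WF
  | loop r e c => r < tmp ∧ e.RegsBelow tmp ∧ ¬ c.Writes r ∧ c.WF

theorem all_iter {I : ℕ → Store → Prop} {Q : Store → Prop} {body : Store → CoinTree Store} {r : ℕ}
    (hbody : ∀ n st, I (n + 1) st →
      (body ((st.setReg r n).tick 3)).All fun st' => I n (st'.tick 2))
    (hQ : ∀ st, I 0 st → Q (st.tick 1)) (n : ℕ) (st : Store) (h : I n st) :
    (iter body r n st).All Q := by
  induction n generalizing st with
  | zero => exact hQ st h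
  | succ n ih =>
    rw [iter, CoinTree.all_bind]
    exact (hbody n st h).mono fun st' h' => ih _ h'

theorem exec_reg {w : ℕ} (c : Cmd) (st : Store) :
    (c.exec w st).All fun st' => ∀ r, ¬ c.Writes r → st'.reg r = st.reg r := by
  induction c generalizing st with
  | skip => exact fun _ _ => rfl
  | set r e => exact fun r' h => Function.update_of_ne h _ _
  | store a e => exact fun _ _ => rfl
  | coin r => exact ⟨fun r' h => Function.update_of_ne h _ _, fun r' h => Function.update_of_ne h _ _⟩
  | seq c₁ c₂ h₁ h₂ =>
    rw [exec, CoinTree.all_bind]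
    refine (h₁ st).mono fun st' h' => (h₂ st').mono fun st'' h'' r hr => ?_
    rw [Writes, not_or] at hr
    rw [h'' r hr.2, h' r hr.1]
  | ite e c₁ c₂ h₁ h₂ =>
    rw [exec]
    split_ifs
    · exact (h₂ (st.tick _)).mono fun st'' h'' r hr => h'' r fun h => hr (.inr h)
    · rw [CoinTree.all_bind]
      exact (h₁ (st.tick _)).mono fun st'' h'' r hr => h'' r fun h => hr (.inl h)
  | loop r e c hc =>
    rw [exec]
    refine all_iter (I := fun n st' => ∀ r', ¬ (loop r e c).Writes r' → st'.reg r' = st.reg r')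
      ?_ (fun st' h => h) _ _ fun r' h => Function.update_of_ne (fun h' => h (.inl h')) _ _
    intro n st' h'
    refine (hc _).mono fun st'' h'' r' hr => ?_
    rw [← h' r' hr]
    exact (h'' r' fun h => hr (.inr h)).trans (Function.update_of_ne (fun h' => hr (.inl h')) _ _)

end Cmd

/-! ## Correctness of the compilation -/

/-- The instructions `l` stand at position `off` of the program. -/
def CodeAt (P : Program) (off : ℕ) (l : List Instr) : Prop := ∀ i x, l[i]? = some x → P[off + i]? = some x

namespace CodeAt

variable {P : Program} {off : ℕ} {l l' : List Instr}

theorem left (h : CodeAt P off (l ++ l')) : CodeAt P off l := by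
  intro i x hx
  refine h i x ?_
  rw [List.getElem?_append_left (List.getElem?_eq_some_iff.1 hx).1, hx]

theorem right (h : CodeAt P off (l ++ l')) {off' : ℕ} (ho : off' = off + l.length) :
    CodeAt P off' l' := by
  intro i x hx
  rw [ho, add_assoc]
  refine h _ x ?_
  rw [List.getElem?_append_right (by omega), Nat.add_sub_cancel_left, hx]

end CodeAt

/-- A machine state holds a store. -/
def Matches (st : Store) (s : State) : Prop :=
  (∀ r < tmp, s.reg r = st.reg r) ∧ s.mem = st.mem ∧ s.time = st.time

section Compile

variable {P : Program} {w : ℕ} {G : State → Prop}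

/-- Programs are treated backwards: a lower bound after an instruction that ignores its random bit
is also one before it. -/
theorem le_reach_of_codeAt {c : ℝ≥0∞} {s : State} {off : ℕ} {l : List Instr} (hP : CodeAt P off l)
    (j : ℕ) (i : Instr) (hi : l[j]? = some i) (hpc : s.pc = off + j)
    (hs : ∀ b, i.exec w b s = i.exec w false s) (h : c ≤ reach P w G (i.exec w false s)) :
    c ≤ reach P w G s :=
  h.trans (reach_step_of_const fun b =>
    (stepAct_of_getElem? (hpc ▸ hP j i hi) w b).trans (hs b))

/-- Intermediate results are put into registers from `k` on. The value of `e₁` lies in register `k`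
or in a program register below `T ≤ k`, and the code of `e₂` only touches registers from `k + 1` on.
-/
theorem le_reach_code {c : ℝ≥0∞} (e : Expr) {T k : ℕ} (hk : T ≤ k) (he : e.RegsBelow T) {st : Store}
    {s : State} (hreg : ∀ r < T, s.reg r = st.reg r) (hmem : s.mem = st.mem)
    (hP : CodeAt P s.pc (e.code k))
    (h : ∀ s' : State, s'.pc = s.pc + e.size → s'.time = s.time + e.size → s'.mem = s.mem →
      (∀ r < k, s'.reg r = s.reg r) → s'.reg (e.res k) = e.eval w st → c ≤ reach P w G s') :
    c ≤ reach P w G s := by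
  induction e generalizing k s with
  | lit x =>
    refine le_reach_of_codeAt hP 0 (.const k x) rfl rfl (fun _ => rfl) (h _ rfl rfl rfl (fun r hr => ?_) ?_)
    · exact Function.update_of_ne hr.ne _ _
    · exact Function.update_self _ _ _
  | reg r => exact h s rfl rfl rfl (fun _ _ => rfl) (hreg r he)
  | load e ih =>
    refine ih hk he hreg hmem hP.left fun s₁ hpc ht hm hr hv => ?_
    refine le_reach_of_codeAt (hP.right (off' := s.pc + e.size) (by rw [Expr.length_code])) 0
      (.load k (e.res k)) rfl hpc (fun _ => rfl) (h _ ?_ ?_ hm (fun r hr' => ?_) ?_)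
    · simp only [Instr.exec, hpc, Expr.size]; omega
    · simp only [Instr.exec, ht, Expr.size]; omega
    · rw [← hr r hr']; exact Function.update_of_ne hr'.ne _ _
    · rw [show (Expr.load e).res k = k from rfl]
      simp only [Instr.exec, Function.update_self, Expr.eval]
      rw [hv, hm, hmem]
  | bin o e₁ e₂ h₁ h₂ =>
    refine h₁ hk he.1 hreg hmem hP.left fun s₁ hpc₁ ht₁ hm₁ hr₁ hv₁ => ?_
    have hP₂ := hP.right (off' := s.pc + e₁.size) (by rw [Expr.length_code])
    refine h₂ (k := k + 1) (by omega) he.2 (fun r hr => (hr₁ r (by omega)).trans (hreg r hr))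
      (hm₁.trans hmem) (hpc₁ ▸ hP₂.left) fun s₂ hpc₂ ht₂ hm₂ hr₂ hv₂ => ?_
    have hres : e₁.res k < k + 1 := by
      cases e₁ <;> simp only [Expr.res] <;> first | omega | skip
      have := he.1
      simp only [Expr.RegsBelow] at this
      omega
    refine le_reach_of_codeAt (hP₂.right (off' := s₂.pc) ?_) 0
      (.bin o k (e₁.res k) (e₂.res (k + 1))) rfl rfl (fun _ => rfl)
      (h _ ?_ ?_ (hm₂.trans hm₁) (fun r hr' => ?_) ?_)
    · rw [Expr.length_code, hpc₂, hpc₁]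
    · simp only [Instr.exec, hpc₂, hpc₁, Expr.size]; omega
    · simp only [Instr.exec, ht₂, ht₁, Expr.size]; omega
    · rw [← hr₁ r hr', ← hr₂ r (by omega)]; exact Function.update_of_ne hr'.ne _ _
    · rw [show (Expr.bin o e₁ e₂).res k = k from rfl]
      simp only [Instr.exec, Function.update_self, Expr.eval]
      rw [hr₂ _ hres, hv₁, hv₂]

/-- There is no instruction that copies a register; the bitwise disjunction of a word with itself
takes its place. -/
theorem or_self_eval {x : ℕ} (hx : x < 2 ^ w) : BinOp.or.eval w x x = x := by
  simp [BinOp.eval, Nat.mod_eq_of_lt hx]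

theorem sub_one_eval {n : ℕ} (hn : n + 1 < 2 ^ w) : BinOp.sub.eval w (n + 1) (1 % 2 ^ w) = n := by
  have h1 : 1 % 2 ^ w = 1 := Nat.mod_eq_of_lt (by omega)
  simp only [BinOp.eval, h1]
  rw [show n + 1 + (2 ^ w - 1) = n + 2 ^ w by omega, Nat.add_mod_right, Nat.mod_eq_of_lt (by omega)]

theorem Matches.update {st : Store} {s : State} (h : Matches st s) {r x : ℕ} :
    ∀ r' < tmp, Function.update s.reg r x r' = Function.update st.reg r x r' := by
  intro r' hr'
  by_cases hr : r' = r
  · subst hr; simp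
  · simp [hr, h.1 r' hr']

/-- The function `f` is a lower bound for what the rest of the program achieves from the position
after the command. With such a continuation the induction on commands passes through sequences and
branches without knowing what follows. A coin flip is an average on both sides by `reach_step`. -/
theorem expect_exec_le_reach (c : Cmd) (hc : c.WF) {off : ℕ} (hP : CodeAt P off (c.compile off))
    (f : Store → ℝ≥0∞) {st : Store} {s : State} (hb : st.Below (2 ^ w)) (hm : Matches st s)
    (hpc : s.pc = off)
    (hf : ∀ st' s', st'.Below (2 ^ w) → Matches st' s' → s'.pc = off + c.len →
      f st' ≤ reach P w G s') :
    (c.exec w st).expect f ≤ reach P w G s := by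
  induction c generalizing off f st s with
  | skip => exact hf st s hb hm hpc
  | set r e =>
    subst hpc
    refine le_reach_code (k := tmp) e le_rfl hc.2 hm.1 hm.2.1 hP.left fun s₁ hpc ht hm₁ hr hv => ?_
    refine le_reach_of_codeAt (hP.right (off' := s.pc + e.size) (by rw [Expr.length_code])) 0
      (.bin .or r (e.res tmp) (e.res tmp)) rfl hpc (fun _ => rfl)
      (hf ((st.setReg r (e.eval w st)).tick (e.size + 1)) _ (hb.setReg (e.eval_lt hb) r)
        ⟨?_, hm₁.trans hm.2.1, ?_⟩ ?_)
    · simp only [Instr.exec]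
      rw [hv, or_self_eval (e.eval_lt hb)]
      intro r' hr'
      simp only [Store.setReg, Store.tick, Function.update_apply, hr r' hr', hm.1 r' hr']
    · simp only [Instr.exec, ht, hm.2.2, Store.setReg, Store.tick]; omega
    · simp only [Instr.exec, hpc, Cmd.len]; omega
  | store a e =>
    subst hpc
    refine le_reach_code (k := tmp) a le_rfl hc.1 hm.1 hm.2.1 hP.left fun s₁ hpc ht hm₁ hr hv => ?_
    have hP₂ := hP.right (off' := s.pc + a.size) (by rw [Expr.length_code])
    refine le_reach_code (T := tmp) (k := tmp + 1) (st := st) e (by omega) hc.2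
      (fun r h => (hr r h).trans (hm.1 r h))
      (hm₁.trans hm.2.1) (hpc ▸ hP₂.left) fun s₂ hpc₂ ht₂ hm₂ hr₂ hv₂ => ?_
    have hres : a.res tmp < tmp + 1 := by
      have := hc.1
      cases a <;> simp only [Expr.res] <;> first | omega | skip
      simp only [Expr.RegsBelow] at this
      omega
    refine le_reach_of_codeAt (hP₂.right (off' := s₂.pc) ?_) 0
      (.store (a.res tmp) (e.res (tmp + 1))) rfl rfl (fun _ => rfl)
      (hf ((st.setMem (a.eval w st) (e.eval w st)).tick (a.size + e.size + 1)) _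
        (hb.setMem (e.eval_lt hb) (a.eval w st)) ⟨?_, ?_, ?_⟩ ?_)
    · rw [Expr.length_code, hpc₂, hpc]
    · intro r' hr'
      simp only [Instr.exec, Store.setMem, Store.tick, hr r' hr', hr₂ r' (by omega), hm.1 r' hr']
    · simp only [Instr.exec, Store.setMem, Store.tick, hr₂ _ hres, hv, hv₂, hm₂, hm₁, hm.2.1]
    · simp only [Instr.exec, ht₂, ht, hm.2.2, Store.setMem, Store.tick]; omega
    · simp only [Instr.exec, hpc₂, hpc, Cmd.len]; omega
  | coin r =>
    subst hpc
    refine le_trans ?_ (reach_step P w G s)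
    have hi : P[s.pc]? = some (.coin r) := hP 0 _ rfl
    have hp : 0 < 2 ^ w := by positivity
    simp only [Cmd.exec, CoinTree.expect, stepAct_of_getElem? hi]
    refine ENNReal.div_le_div_right (add_le_add ?_ ?_) _
    · refine hf _ _ (hb.setReg hp r) ⟨?_, hm.2.1, ?_⟩ rfl
      · simpa [Instr.exec, Store.setReg, Store.tick] using hm.update
      · simp [Instr.exec, Store.setReg, Store.tick, hm.2.2]
    · refine hf _ _ (hb.setReg (Nat.mod_lt _ hp) r) ⟨?_, hm.2.1, ?_⟩ rfl
      · simpa [Instr.exec, Store.setReg, Store.tick] using hm.update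
      · simp [Instr.exec, Store.setReg, Store.tick, hm.2.2]
  | seq c₁ c₂ h₁ h₂ =>
    rw [Cmd.exec, CoinTree.expect_bind]
    refine h₁ hc.1 hP.left _ hb hm hpc fun st₁ s₁ hb₁ hm₁ hpc₁ => ?_
    refine h₂ hc.2 (hP.right (by rw [Cmd.length_compile])) _ hb₁ hm₁ hpc₁
      fun st₂ s₂ hb₂ hm₂ hpc₂ => hf st₂ s₂ hb₂ hm₂ ?_
    rw [hpc₂, Cmd.len, add_assoc]
  | ite e c₁ c₂ h₁ h₂ =>
    subst hpc
    refine le_reach_code (k := tmp) e le_rfl hc.1 hm.1 hm.2.1 hP.left fun s₁ hpc ht hm₁ hr hv => ?_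
    have hP₁ := hP.right (off' := s.pc + e.size) (by rw [Expr.length_code])
    have hP₂ := hP₁.right (off' := s.pc + e.size + 1) (by simp)
    have hP₃ := hP₂.right (off' := s.pc + e.size + 1 + c₁.len) (by rw [Cmd.length_compile])
    have hP₄ := hP₃.right (off' := s.pc + e.size + 1 + c₁.len + 2) (by simp)
    have hmt : ∀ pc, Matches (st.tick (e.size + 1)) ⟨pc, s₁.time + 1, s₁.reg, s₁.mem⟩ := fun pc =>
      ⟨fun r h => (hr r h).trans (hm.1 r h), hm₁.trans hm.2.1, by
        simp only [ht, hm.2.2, Store.tick]; omega⟩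
    refine le_reach_of_codeAt hP₁.left 0 _ rfl hpc (fun _ => rfl) ?_
    simp only [Instr.exec]
    rw [Cmd.exec, hv]
    split_ifs with h0
    · refine h₂ hc.2.2 hP₄ f (hb.tick _) (hmt _) rfl
        fun st₂ s₂ hb₂ hm₂ hpc₂ => hf st₂ s₂ hb₂ hm₂ ?_
      rw [hpc₂, Cmd.len]; omega
    · rw [CoinTree.expect_bind]
      refine h₁ hc.2.1 hP₂.left _ (hb.tick _) (hmt _) (by simp only [hpc])
        fun st₂ s₂ hb₂ hm₂ hpc₂ => ?_
      -- Setting a register to zero and testing it for zero amounts to an unconditional jump, here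
      -- over the second branch.
      refine le_reach_of_codeAt hP₃.left 0 (.const tmp 0) rfl hpc₂ (fun _ => rfl) ?_
      refine le_reach_of_codeAt hP₃.left 1 _ rfl (congrArg (· + 1) hpc₂) (fun _ => rfl)
        (hf (st₂.tick 2) _ (hb₂.tick 2) ⟨?_, hm₂.2.1, ?_⟩ ?_)
      · intro r hr
        simp only [Instr.exec, Function.update_of_ne hr.ne]
        exact hm₂.1 r hr
      · simp only [Instr.exec, hm₂.2.2, Store.tick]
      · simp [Instr.exec, Function.update_self, Cmd.len]; omega
  | loop r e c ih =>
    subst hpc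
    refine le_reach_code (k := tmp) e le_rfl hc.2.1 hm.1 hm.2.1 hP.left fun s₁ hpc ht hm₁ hr hv => ?_
    have hP₁ := hP.right (off' := s.pc + e.size) (by rw [Expr.length_code])
    have hP₂ := hP₁.right (off' := s.pc + e.size + 4) (by simp)
    have hP₃ := hP₂.right (off' := s.pc + e.size + 4 + c.len) (by rw [Cmd.length_compile])
    refine le_reach_of_codeAt hP₁.left 0 (.bin .or r (e.res tmp) (e.res tmp)) rfl hpc
      (fun _ => rfl) ?_
    have key : ∀ n (st₁ : Store) (s₁ : State), st₁.Below (2 ^ w) → Matches st₁ s₁ →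
        s₁.pc = s.pc + e.size + 1 → st₁.reg r = n →
        (Cmd.iter (c.exec w) r n st₁).expect f ≤ reach P w G s₁ := by
      intro n
      induction n with
      | zero =>
        intro st₁ s₁ hb₁ hm₁ hpc₁ hn
        refine le_reach_of_codeAt hP₁.left 1 _ rfl hpc₁ (fun _ => rfl)
          (hf (st₁.tick 1) _ (hb₁.tick 1) ⟨hm₁.1, hm₁.2.1, ?_⟩ ?_)
        · simp [Instr.exec, Store.tick, hm₁.2.2]
        · simp only [Instr.exec, hm₁.1 r hc.1, hn, if_true, Cmd.len]; omega
      | succ n ihn =>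
        intro st₁ s₁ hb₁ hm₁ hpc₁ hn
        have hn' := hb₁.1 r
        rw [hn] at hn'
        have hrt : r ≠ tmp := hc.1.ne
        refine le_reach_of_codeAt hP₁.left 1 _ rfl hpc₁ (fun _ => rfl) ?_
        simp only [Instr.exec, hm₁.1 r hc.1, hn, Nat.succ_ne_zero, if_false]
        refine le_reach_of_codeAt hP₁.left 2 (.const tmp 1) rfl (congrArg (· + 1) hpc₁)
          (fun _ => rfl) ?_
        refine le_reach_of_codeAt hP₁.left 3 (.bin .sub r r tmp) rfl (congrArg (· + 2) hpc₁)
          (fun _ => rfl) ?_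
        simp only [Instr.exec, Function.update_of_ne hrt, Function.update_self, hm₁.1 r hc.1, hn, sub_one_eval hn']
        rw [Cmd.iter, CoinTree.expect_bind]
        -- The continuation of the body has to be bounded for every store, but `ihn` applies only if
        -- the counter is still `n`. Other outcomes do not occur, since the body does not write `r`;
        -- they are given the value 0.
        refine ((c.exec_reg ((st₁.setReg r n).tick 3)).expect_le (g := fun st' => open Classical in
          if st'.reg r = n then (Cmd.iter (c.exec w) r n (st'.tick 2)).expect f else 0)
          fun st' h' => ?_).trans ?_
        · rw [if_pos]
          rw [h' r hc.2.2.1]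
          simp [Store.setReg, Store.tick]
        refine ih hc.2.2.2 hP₂.left _ ((hb₁.setReg (by omega) r).tick 3) ⟨?_, hm₁.2.1, ?_⟩ ?_
          fun st₂ s₂ hb₂ hm₂ hpc₂ => ?_
        · intro r' hr'
          simp only [Store.setReg, Store.tick, Function.update_apply, hr'.ne, if_false, hm₁.1 r' hr']
        · simp [Store.setReg, Store.tick, hm₁.2.2]
        · simp [hpc₁]
        · by_cases hn₂ : st₂.reg r = n
          · rw [if_pos hn₂]
            refine le_reach_of_codeAt hP₃ 0 (.const tmp 0) rfl hpc₂ (fun _ => rfl) ?_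
            refine le_reach_of_codeAt hP₃ 1 (.jz tmp (s.pc + e.size + 1)) rfl
              (congrArg (· + 1) hpc₂) (fun _ => rfl) (ihn _ _ (hb₂.tick 2) ⟨?_, hm₂.2.1, ?_⟩ ?_ hn₂)
            · intro r' hr'
              simp only [Instr.exec, Function.update_of_ne hr'.ne]
              exact hm₂.1 r' hr'
            · simp [Instr.exec, Store.tick, hm₂.2.2]
            · simp [Instr.exec]
          · simp [hn₂]
    refine key _ _ _ (hb.setReg (e.eval_lt hb) r) ⟨?_, hm₁.trans hm.2.1, ?_⟩
      (by simp only [Instr.exec, hpc]) ?_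
    · simp only [Instr.exec]
      rw [hv, or_self_eval (e.eval_lt hb)]
      intro r' hr'
      simp only [Store.setReg, Store.tick, Function.update_apply, hr r' hr', hm.1 r' hr']
    · simp only [Instr.exec, ht, hm.2.2, Store.setReg, Store.tick]; omega
    · simp [Store.setReg, Store.tick]

end Compile

/-! ## Evaluation without overflow -/

namespace Expr

instance : Add Expr := ⟨bin .add⟩
instance : Mul Expr := ⟨bin .mul⟩
instance : Div Expr := ⟨bin .div⟩
instance : Mod Expr := ⟨bin .mod⟩

/-- The expression for the truth value of `a < b`. -/
def lt (a b : Expr) : Expr := bin .lt a b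

/-- The expression for the truth value of `a = b`. -/
def eq (a b : Expr) : Expr := bin .eq a b

/-- The expression for `a` shifted to the right by `b` bits. -/
def shr (a b : Expr) : Expr := bin .shr a b

/-- Operations on natural numbers without reduction to words. -/
def ideal : BinOp → ℕ → ℕ → ℕ
  | .add, a, b => a + b
  | .sub, a, b => a - b
  | .mul, a, b => a * b
  | .div, a, b => a / b
  | .mod, a, b => a % b
  | .and, a, b => a &&& b
  | .or, a, b => a ||| b
  | .xor, a, b => a ^^^ b
  | .shl, a, b => a <<< b
  | .shr, a, b => a >>> b
  | .lt, a, b => if a < b then 1 else 0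
  | .eq, a, b => if a = b then 1 else 0

/-- The value of an expression without reduction to words. -/
def ival (st : Store) : Expr → ℕ
  | lit x => x
  | reg r => st.reg r
  | bin o e₁ e₂ => ideal o (e₁.ival st) (e₂.ival st)
  | load e => st.mem (e.ival st)

section

variable (st : Store) (a b : Expr)

@[simp] theorem ival_add : (a + b).ival st = a.ival st + b.ival st := rfl
@[simp] theorem ival_mul : (a * b).ival st = a.ival st * b.ival st := rfl
@[simp] theorem ival_div : (a / b).ival st = a.ival st / b.ival st := rfl
@[simp] theorem ival_mod : (a % b).ival st = a.ival st % b.ival st := rfl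
@[simp] theorem ival_lit (n : ℕ) : (lit n).ival st = n := rfl
@[simp] theorem ival_reg (r : ℕ) : (reg r).ival st = st.reg r := rfl
@[simp] theorem ival_load : (load a).ival st = st.mem (a.ival st) := rfl
@[simp] theorem ival_lt :
    (lt a b).ival st = if a.ival st < b.ival st then 1 else 0 := rfl
@[simp] theorem ival_eq :
    (eq a b).ival st = if a.ival st = b.ival st then 1 else 0 := rfl
@[simp] theorem ival_shr : (shr a b).ival st = a.ival st >>> b.ival st := rfl

end

/-- An exponent `k` for which the value is less than `X ^ k`, if registers, memory cells and
constants are less than `X`. -/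
def deg : Expr → ℕ
  | lit _ => 1
  | reg _ => 1
  | bin .add e₁ e₂ => max e₁.deg e₂.deg + 1
  | bin .mul e₁ e₂ => e₁.deg + e₂.deg
  | bin .div e₁ e₂ => max e₁.deg e₂.deg
  | bin .mod e₁ e₂ => max e₁.deg e₂.deg
  | bin .shr e₁ e₂ => max e₁.deg e₂.deg
  | bin .lt e₁ e₂ => max e₁.deg e₂.deg
  | bin .eq e₁ e₂ => max e₁.deg e₂.deg
  | bin _ _ _ => 0
  | load e => e.deg

/-- Constants are less than `X`, and only operations occur that increase values polynomially. -/
def Safe (X : ℕ) : Expr → Prop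
  | lit x => x < X
  | reg _ => True
  | bin o e₁ e₂ => (o = .add ∨ o = .mul ∨ o = .div ∨ o = .mod ∨ o = .shr ∨ o = .lt ∨ o = .eq) ∧
      e₁.Safe X ∧ e₂.Safe X
  | load e => e.Safe X

section

variable (X r n : ℕ) (a b : Expr)

@[simp] theorem deg_add : (a + b).deg = max a.deg b.deg + 1 := rfl
@[simp] theorem deg_mul : (a * b).deg = a.deg + b.deg := rfl
@[simp] theorem deg_div : (a / b).deg = max a.deg b.deg := rfl
@[simp] theorem deg_mod : (a % b).deg = max a.deg b.deg := rfl
@[simp] theorem deg_lt : (lt a b).deg = max a.deg b.deg := rfl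
@[simp] theorem deg_eq : (eq a b).deg = max a.deg b.deg := rfl
@[simp] theorem deg_shr : (shr a b).deg = max a.deg b.deg := rfl
@[simp] theorem deg_lit : (lit n).deg = 1 := rfl
@[simp] theorem deg_reg : (reg r).deg = 1 := rfl
@[simp] theorem deg_load : (load a).deg = a.deg := rfl

@[simp] theorem safe_add : (a + b).Safe X ↔ a.Safe X ∧ b.Safe X :=
  ⟨fun h => h.2, fun h => ⟨by simp, h⟩⟩
@[simp] theorem safe_mul : (a * b).Safe X ↔ a.Safe X ∧ b.Safe X :=
  ⟨fun h => h.2, fun h => ⟨by simp, h⟩⟩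
@[simp] theorem safe_div : (a / b).Safe X ↔ a.Safe X ∧ b.Safe X :=
  ⟨fun h => h.2, fun h => ⟨by simp, h⟩⟩
@[simp] theorem safe_mod : (a % b).Safe X ↔ a.Safe X ∧ b.Safe X :=
  ⟨fun h => h.2, fun h => ⟨by simp, h⟩⟩
@[simp] theorem safe_lt : (lt a b).Safe X ↔ a.Safe X ∧ b.Safe X :=
  ⟨fun h => h.2, fun h => ⟨by simp, h⟩⟩
@[simp] theorem safe_eq : (eq a b).Safe X ↔ a.Safe X ∧ b.Safe X :=
  ⟨fun h => h.2, fun h => ⟨by simp, h⟩⟩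
@[simp] theorem safe_shr : (shr a b).Safe X ↔ a.Safe X ∧ b.Safe X :=
  ⟨fun h => h.2, fun h => ⟨by simp, h⟩⟩
@[simp] theorem safe_lit : (lit n).Safe X ↔ n < X := Iff.rfl
@[simp] theorem safe_reg : (reg r).Safe X := trivial
@[simp] theorem safe_load : (load a).Safe X ↔ a.Safe X := Iff.rfl

end

end Expr

/-- Words have many more bits than the numbers below `X`. -/
structure WideWords (w X : ℕ) : Prop where
  four_le : 4 ≤ X
  pow_le : X ^ 24 ≤ 2 ^ w

namespace WideWords

variable {w X : ℕ} (hW : WideWords w X)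
include hW

theorem two_le : 2 ≤ X := by
  have := hW.four_le
  omega

theorem le_two_pow : X ≤ 2 ^ w :=
  (Nat.le_self_pow (by norm_num) X).trans hW.pow_le

theorem below {st : Store} (hb : st.Below X) : st.Below (2 ^ w) :=
  ⟨fun r => (hb.1 r).trans_le hW.le_two_pow, fun a => (hb.2 a).trans_le hW.le_two_pow⟩

end WideWords

namespace Expr

variable {w X : ℕ} {st : Store}

/-- Values are bounded by powers of `X` whose exponents behave like degrees of polynomials, so no
reduction happens while the degree is at most 24. The positivity of the degree is carried along for
loads and comparisons, whose values are bounded by `X` itself. -/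
theorem eval_eq_ival_and (hW : WideWords w X) (hb : st.Below X) {e : Expr} (hs : e.Safe X)
    (hd : e.deg ≤ 24) : e.eval w st = e.ival st ∧ e.ival st < X ^ e.deg ∧ 1 ≤ e.deg := by
  have h2 := hW.two_le
  have hpow {i j : ℕ} (h : i ≤ j) : X ^ i ≤ X ^ j := Nat.pow_le_pow_right (by omega) h
  have hlim {x i : ℕ} (h : x < X ^ i) (hi : i ≤ 24) : x % 2 ^ w = x :=
    Nat.mod_eq_of_lt (h.trans_le ((hpow hi).trans hW.pow_le))
  induction e with
  | lit x =>
    have : x < X ^ 1 := by rw [pow_one]; exact hs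
    exact ⟨hlim this (by norm_num), this, le_rfl⟩
  | reg r => exact ⟨rfl, by simpa [deg] using hb.1 r, le_rfl⟩
  | load e ih =>
    obtain ⟨h1, h2, h3⟩ := ih hs hd
    refine ⟨by rw [eval, ival, h1], (hb.2 _).trans_le ?_, h3⟩
    calc X = X ^ 1 := (pow_one X).symm
      _ ≤ X ^ e.deg := hpow h3
  | bin o e₁ e₂ ih₁ ih₂ =>
    obtain ⟨ho, hs₁, hs₂⟩ := hs
    have hb01 {p : Prop} [Decidable p] {i : ℕ} (hi : 1 ≤ i) : (if p then 1 else 0) < X ^ i := by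
      calc (if p then 1 else 0) ≤ 1 := by split_ifs <;> omega
        _ < X ^ 1 := by rw [pow_one]; omega
        _ ≤ X ^ i := hpow hi
    rcases ho with rfl | rfl | rfl | rfl | rfl | rfl | rfl <;>
      simp only [deg] at hd ⊢ <;>
      obtain ⟨h₁, h₁', h₁''⟩ := ih₁ hs₁ (by omega) <;>
      obtain ⟨h₂, h₂', h₂''⟩ := ih₂ hs₂ (by omega) <;>
      simp only [eval, ival, h₁, h₂, BinOp.eval, ideal]
    · have : e₁.ival st + e₂.ival st < X ^ (max e₁.deg e₂.deg + 1) := by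
        have := hpow (le_max_left e₁.deg e₂.deg)
        have := hpow (le_max_right e₁.deg e₂.deg)
        calc _ < X ^ (max e₁.deg e₂.deg) * 2 := by omega
          _ ≤ _ := by rw [pow_succ]; exact Nat.mul_le_mul_left _ h2
      exact ⟨hlim this hd, this, by omega⟩
    · have : e₁.ival st * e₂.ival st < X ^ (e₁.deg + e₂.deg) := by
        rw [pow_add]
        exact Nat.mul_lt_mul'' h₁' h₂'
      exact ⟨hlim this hd, this, by omega⟩
    · have := ((Nat.div_le_self (e₁.ival st) (e₂.ival st)).trans_lt h₁').trans_le
        (hpow (le_max_left e₁.deg e₂.deg))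
      exact ⟨hlim this hd, this, by omega⟩
    · have := ((Nat.mod_le (e₁.ival st) (e₂.ival st)).trans_lt h₁').trans_le
        (hpow (le_max_left e₁.deg e₂.deg))
      exact ⟨hlim this hd, this, by omega⟩
    · have := ((Nat.shiftRight_le (e₁.ival st) (e₂.ival st)).trans_lt h₁').trans_le
        (hpow (le_max_left e₁.deg e₂.deg))
      exact ⟨hlim this hd, this, by omega⟩
    · have := hb01 (p := e₁.ival st < e₂.ival st) (i := max e₁.deg e₂.deg) (by omega)
      exact ⟨hlim this hd, this, by omega⟩
    · have := hb01 (p := e₁.ival st = e₂.ival st) (i := max e₁.deg e₂.deg) (by omega)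
      exact ⟨hlim this hd, this, by omega⟩

theorem eval_eq_ival (hW : WideWords w X) (hb : st.Below X) {e : Expr} (hs : e.Safe X)
    (hd : e.deg ≤ 24) : e.eval w st = e.ival st :=
  (eval_eq_ival_and hW hb hs hd).1

end Expr

/-! ## Rules for the outcomes of commands -/

namespace Cmd

variable {w X : ℕ} {st : Store} {Q : Store → Prop}

theorem all_set (hW : WideWords w X) (hb : st.Below X) {r : ℕ} {e : Expr} (hs : e.Safe X)
    (hd : e.deg ≤ 24) (hv : e.ival st < X)
    (hQ : (st.setReg r (e.ival st)).Below X → Q ((st.setReg r (e.ival st)).tick (e.size + 1))) :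
    ((set r e).exec w st).All Q := by
  rw [exec, Expr.eval_eq_ival hW hb hs hd]
  exact hQ (hb.setReg hv r)

theorem all_set_of_eval (hb : st.Below X) {r v : ℕ} {e : Expr} (he : e.eval w st = v) (hv : v < X)
    (hQ : (st.setReg r v).Below X → Q ((st.setReg r v).tick (e.size + 1))) :
    ((set r e).exec w st).All Q := by
  rw [exec, he]
  exact hQ (hb.setReg hv r)

theorem all_store (hW : WideWords w X) (hb : st.Below X) {a e : Expr} (hs : a.Safe X)
    (hd : a.deg ≤ 24) (hs' : e.Safe X) (hd' : e.deg ≤ 24) (hv : e.ival st < X)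
    (hQ : (st.setMem (a.ival st) (e.ival st)).Below X →
      Q ((st.setMem (a.ival st) (e.ival st)).tick (a.size + e.size + 1))) :
    ((store a e).exec w st).All Q := by
  rw [exec, Expr.eval_eq_ival hW hb hs hd, Expr.eval_eq_ival hW hb hs' hd']
  exact hQ (hb.setMem hv _)

theorem all_seq {c₁ c₂ : Cmd} (h : (c₁.exec w st).All fun st' => (c₂.exec w st').All Q) :
    ((seq c₁ c₂).exec w st).All Q := by
  rwa [exec, CoinTree.all_bind]

theorem all_ite {e : Expr} {c₁ c₂ : Cmd} (hW : WideWords w X) (hb : st.Below X) (hs : e.Safe X)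
    (hd : e.deg ≤ 24)
    (h₁ : e.ival st ≠ 0 → (c₁.exec w (st.tick (e.size + 1))).All fun st' => Q (st'.tick 2))
    (h₂ : e.ival st = 0 → (c₂.exec w (st.tick (e.size + 1))).All Q) :
    ((ite e c₁ c₂).exec w st).All Q := by
  rw [exec, Expr.eval_eq_ival hW hb hs hd]
  split_ifs with h
  · exact h₂ h
  · rw [CoinTree.all_bind]
    exact h₁ h

/-- The rule for loops, with an invariant `I n` that holds when `n` repetitions remain. -/
theorem all_loop (I : ℕ → Store → Prop) {r : ℕ} {e : Expr} {c : Cmd} (hr : ¬ c.Writes r)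
    (hW : WideWords w X) (hb : st.Below X) (hs : e.Safe X) (hd : e.deg ≤ 24) (hN : e.ival st < X)
    (hI : ∀ n st x t, I n st → I n ((st.setReg r x).tick t))
    (h0 : I (e.ival st) st)
    (hc : ∀ n st', n < e.ival st → st'.Below X →
      (∀ r', ¬ (loop r e c).Writes r' → st'.reg r' = st.reg r') → st'.reg r = n → I (n + 1) st' →
      (c.exec w st').All fun st'' => st''.Below X ∧ I n st'') :
    ((loop r e c).exec w st).All fun st' => st'.Below X ∧
      (∀ r', ¬ (loop r e c).Writes r' → st'.reg r' = st.reg r') ∧ I 0 st' := by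
  rw [exec, Expr.eval_eq_ival hW hb hs hd]
  refine all_iter (I := fun n st' => n ≤ e.ival st ∧ st'.Below X ∧
    (∀ r', ¬ (loop r e c).Writes r' → st'.reg r' = st.reg r') ∧ I n st' ∧ st'.reg r = n) ?_ ?_ _ _
    ⟨le_rfl, hb.setReg hN r, fun r' hr' => Function.update_of_ne (fun h => hr' (.inl h)) _ _,
      hI _ _ _ _ h0, Function.update_self _ _ _⟩
  · rintro n st' ⟨hn, hb', hreg, hi, hrn⟩
    have hreg' : ∀ r', ¬ (loop r e c).Writes r' → ((st'.setReg r n).tick 3).reg r' = st.reg r' :=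
      fun r' hr' => (Function.update_of_ne (fun h => hr' (.inl h)) _ _).trans (hreg r' hr')
    refine ((hc n _ (by omega) ((hb'.setReg (by omega) r).tick 3) hreg'
      (Function.update_self _ _ _) (hI _ _ _ _ hi)).and (exec_reg c _)).mono ?_
    rintro st'' ⟨⟨hb'', hi''⟩, hw⟩
    refine ⟨by omega, hb'', fun r' hr' => ?_, ?_, ?_⟩
    · exact (hw r' fun h => hr' (.inr h)).trans (hreg' r' hr')
    -- The hypothesis is used with the value that register `r` already has, so that only the time
    -- changes.
    · have := hI n st'' (st''.reg r) 2 hi''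
      simpa [Store.setReg] using this
    · exact (hw r hr).trans (Function.update_self _ _ _)
  · rintro st' ⟨-, hb', hreg, hi, -⟩
    refine ⟨hb', hreg, ?_⟩
    have := hI 0 st' (st'.reg r) 1 hi
    simpa [Store.setReg] using this

/-! ### Running times -/

/-- An expression without memory access over registers in `K`. -/
def _root_.Expr.RegsIn (K : ℕ → Prop) : Expr → Prop
  | .lit _ => True
  | .reg r => K r
  | .bin _ e₁ e₂ => e₁.RegsIn K ∧ e₂.RegsIn K
  | .load _ => False

/-- The numbers of repetitions depend only on registers in `K`. -/
def Static (K : ℕ → Prop) : Cmd → Prop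
  | seq c₁ c₂ => c₁.Static K ∧ c₂.Static K
  | ite _ c₁ c₂ => c₁.Static K ∧ c₂.Static K
  | loop _ e c => e.RegsIn K ∧ c.Static K
  | _ => True

/-- A bound for the time, if the registers in loop bounds have the values `σ`. -/
def cost (w : ℕ) (σ : ℕ → ℕ) : Cmd → ℕ
  | skip => 0
  | set _ e => e.size + 1
  | store a e => a.size + e.size + 1
  | coin _ => 1
  | seq c₁ c₂ => c₁.cost w σ + c₂.cost w σ
  | ite e c₁ c₂ => e.size + 3 + (c₁.cost w σ + c₂.cost w σ)
  | loop _ e c => e.size + 2 + e.eval w ⟨σ, fun _ => 0, 0⟩ * (c.cost w σ + 5)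

theorem _root_.Expr.eval_congr {K : ℕ → Prop} {e : Expr} (he : e.RegsIn K) {st st' : Store}
    (h : ∀ r, K r → st.reg r = st'.reg r) : e.eval w st = e.eval w st' := by
  induction e with
  | lit x => rfl
  | reg r => exact h r he
  | bin o e₁ e₂ h₁ h₂ => simp only [Expr.eval, h₁ he.1, h₂ he.2]
  | load e => exact he.elim

/-- The numbers of repetitions are determined by registers that the command never writes, so they
can be computed from the initial values `σ`. The bound holds for every outcome of the coins. Each
repetition has five steps of its own, three before and two after the body. -/
theorem exec_time_le {K : ℕ → Prop} (c : Cmd) (hc : c.Static K) (hK : ∀ r, K r → ¬ c.Writes r)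
    {σ : ℕ → ℕ} {st : Store} (hσ : ∀ r, K r → st.reg r = σ r) :
    (c.exec w st).All fun st' => st'.time ≤ st.time + c.cost w σ := by
  induction c generalizing st with
  | skip => exact le_rfl
  | set r e => exact le_rfl
  | store a e => exact le_rfl
  | coin r => exact ⟨le_rfl, le_rfl⟩
  | seq c₁ c₂ h₁ h₂ =>
    rw [exec, CoinTree.all_bind]
    refine ((h₁ hc.1 (fun r hr h => hK r hr (.inl h)) hσ).and (exec_reg c₁ st)).mono ?_
    rintro st' ⟨ht, hreg⟩
    refine (h₂ hc.2 (fun r hr h => hK r hr (.inr h)) fun r hr => ?_).mono fun st'' ht' => ?_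
    · rw [hreg r fun h => hK r hr (.inl h), hσ r hr]
    · simp only [cost]; omega
  | ite e c₁ c₂ h₁ h₂ =>
    rw [exec]
    split_ifs
    · refine (h₂ hc.2 (fun r hr h => hK r hr (.inr h)) (st := st.tick _) hσ).mono fun st' ht => ?_
      simp only [cost, Store.tick] at ht ⊢; omega
    · rw [CoinTree.all_bind]
      refine (h₁ hc.1 (fun r hr h => hK r hr (.inl h)) (st := st.tick _) hσ).mono fun st' ht => ?_
      simp only [cost, Store.tick, CoinTree.All] at ht ⊢; omega
  | loop r e c ih =>
    rw [exec]
    have hKr (r') (hr' : K r') : r' ≠ r := fun h => hK r' hr' (.inl h)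
    have he : e.eval w ⟨σ, fun _ => 0, 0⟩ = e.eval w st :=
      Expr.eval_congr hc.1 fun r hr => (hσ r hr).symm
    simp only [cost, he]
    -- The summand 1 is kept for the last test of the counter.
    refine all_iter (I := fun n st' => (∀ r, K r → st'.reg r = σ r) ∧
      st'.time + n * (c.cost w σ + 5) + 1 ≤
        st.time + (e.size + 2 + e.eval w st * (c.cost w σ + 5))) ?_ ?_ _ _ ⟨fun r' hr' => ?_, ?_⟩
    · rintro n st' ⟨hreg, ht⟩
      have hreg' : ∀ r', K r' → ((st'.setReg r n).tick 3).reg r' = σ r' := fun r' hr' =>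
        (Function.update_of_ne (hKr r' hr') _ _).trans (hreg r' hr')
      refine ((ih hc.2 (fun r hr h => hK r hr (.inr h)) hreg').and (exec_reg c _)).mono ?_
      rintro st'' ⟨ht', hw⟩
      refine ⟨fun r' hr' => (hw r' fun h => hK r' hr' (.inr h)).trans (hreg' r' hr'), ?_⟩
      simp only [Store.tick, Store.setReg, add_mul, one_mul] at ht' ht ⊢
      omega
    · rintro st' ⟨-, ht⟩
      simp only [Store.tick] at ht ⊢; omega
    · exact (Function.update_of_ne (hKr r' hr') _ _).trans (hσ r' hr')
    · simp only [Store.tick, Store.setReg]; omega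

end Cmd

/-! ## Versioned memory -/

/-- A cell of the versioned memory, which begins at the address in register `10`. A cell consists
of a basic value, a current value and a stamp; the current value counts if the stamp equals the
number of the stage in register `41` and this is not zero. -/
def Store.cell (st : Store) (x : ℕ) : ℕ :=
  st.mem (st.reg 10 + 3 * x +
    if 0 < st.reg 41 ∧ st.mem (st.reg 10 + 3 * x + 2) = st.reg 41 then 1 else 0)

namespace Expr

/-- The content of a cell of the versioned memory. -/
def vload (e : Expr) : Expr :=
  load (reg 10 + lit 3 * e +
    lt (lit 0) (reg 41) * eq (load (reg 10 + lit 3 * e + lit 2)) (reg 41))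

@[simp] theorem ival_vload (st : Store) (e : Expr) : (vload e).ival st = st.cell (e.ival st) := by
  by_cases h₁ : 0 < st.reg 41 <;>
    by_cases h₂ : st.mem (st.reg 10 + 3 * e.ival st + 2) = st.reg 41 <;>
    simp [vload, Store.cell, h₁, h₂]

@[simp] theorem deg_vload (e : Expr) : (vload e).deg = e.deg + 5 := by
  simp only [vload, deg_load, deg_add, deg_mul, deg_lt, deg_eq, deg_lit, deg_reg]
  omega

theorem Safe.vload {X : ℕ} (hX : 4 ≤ X) {e : Expr} (h : e.Safe X) : (vload e).Safe X := by
  have h0 : 0 < X := by omega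
  have h2 : 2 < X := by omega
  have h3 : 3 < X := by omega
  simp [Expr.vload, h0, h2, h3, h]

end Expr

namespace Cmd

/-- Write `v` to the cell number `k + e` of the versioned memory. -/
def vstore (k : ℕ) (e v : Expr) : Cmd :=
  seq (set 43 e) (seq (set 44 v) (seq
    (store (.reg 10 + .lit 3 * (.lit k + .reg 43) + .lt (.lit 0) (.reg 41)) (.reg 44))
    (store (.reg 10 + .lit 3 * (.lit k + .reg 43) + .lit 2) (.reg 41))))

end Cmd

/-- What the simulation of a program may change. -/
structure Evolves (st st' : Store) : Prop where
  reg : ∀ r, ¬ (40 ≤ r ∧ r ≤ 45 ∧ r ≠ 41) → st'.reg r = st.reg r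
  low : ∀ a < st.reg 10, st'.mem a = st.mem a
  base : 0 < st.reg 41 → ∀ x, st'.mem (st.reg 10 + 3 * x) = st.mem (st.reg 10 + 3 * x)
  stamp : ∀ x, st'.mem (st.reg 10 + 3 * x + 2) = st.mem (st.reg 10 + 3 * x + 2) ∨
    st'.mem (st.reg 10 + 3 * x + 2) = st.reg 41

namespace Evolves

theorem refl (st : Store) : Evolves st st :=
  ⟨fun _ _ => rfl, fun _ _ => rfl, fun _ _ => rfl, fun _ => .inl rfl⟩

theorem trans {st st' st'' : Store} (h : Evolves st st') (h' : Evolves st' st'') :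
    Evolves st st'' := by
  have h10 : st'.reg 10 = st.reg 10 := h.reg 10 (by norm_num)
  have h41 : st'.reg 41 = st.reg 41 := h.reg 41 (by norm_num)
  obtain ⟨h1, h2, h3, h4⟩ := h'
  rw [h10] at h2 h3 h4
  rw [h41] at h3 h4
  refine ⟨fun r hr => (h1 r hr).trans (h.reg r hr), fun a ha => (h2 a ha).trans (h.low a ha),
    fun h0 x => (h3 h0 x).trans (h.base h0 x), fun x => ?_⟩
  rcases h4 x with h5 | h5
  · rw [h5]; exact h.stamp x
  · exact .inr h5

theorem setReg (st : Store) {r : ℕ} (hr : 40 ≤ r ∧ r ≤ 45 ∧ r ≠ 41) (x : ℕ) :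
    Evolves st (st.setReg r x) :=
  ⟨fun r' hr' => Function.update_of_ne (by rintro rfl; exact hr' hr) _ _, fun _ _ => rfl,
    fun _ _ => rfl, fun _ => .inl rfl⟩

theorem tick {st st' : Store} (h : Evolves st st') (t : ℕ) : Evolves st (st'.tick t) :=
  ⟨h.reg, h.low, h.base, h.stamp⟩

end Evolves

theorem Store.cell_setReg (st : Store) {r : ℕ} (hr : 40 ≤ r ∧ r ≤ 45 ∧ r ≠ 41) (x y : ℕ) :
    (st.setReg r x).cell y = st.cell y := by
  have h10 : 10 ≠ r := by omega
  have h41 : 41 ≠ r := by omega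
  simp [Store.cell, Store.setReg, h10, h41]

section

variable {w X : ℕ} {st : Store}

/-- The store after a write to the versioned memory. -/
theorem Store.cell_write {st st' : Store} {x y δ : ℕ} (hδ : δ = if 0 < st.reg 41 then 1 else 0)
    (h10 : st'.reg 10 = st.reg 10) (h41 : st'.reg 41 = st.reg 41)
    (hm : st'.mem = Function.update (Function.update st.mem (st.reg 10 + 3 * x + δ) y)
      (st.reg 10 + 3 * x + 2) (st.reg 41)) (z : ℕ) :
    st'.cell z = Function.update st.cell x y z := by
  have e₁ (z δ δ' : ℕ) (h : δ < 3) (h' : δ' < 3) :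
      st.reg 10 + 3 * z + δ = st.reg 10 + 3 * x + δ' ↔ z = x ∧ δ = δ' := by omega
  have e₀ (z δ' : ℕ) (h' : δ' < 3) :
      st.reg 10 + 3 * z = st.reg 10 + 3 * x + δ' ↔ z = x ∧ 0 = δ' := by omega
  unfold Store.cell
  rw [h10, h41, hm]
  by_cases hS : 0 < st.reg 41 <;> by_cases hz : z = x
  · subst hz
    simp [hS, Function.update_apply, hδ]
  · have h2 : st.reg 10 + 3 * z + 2 ≠ st.reg 10 + 3 * x + 1 := by omega
    have h3 : st.reg 10 + 3 * z + 1 ≠ st.reg 10 + 3 * x + 2 := by omega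
    have h4 : st.reg 10 + 3 * z ≠ st.reg 10 + 3 * x + 2 := by omega
    have h5 : st.reg 10 + 3 * z ≠ st.reg 10 + 3 * x + 1 := by omega
    by_cases h6 : st.mem (st.reg 10 + 3 * z + 2) = st.reg 41 <;>
      simp [hS, hδ, hz, h2, h3, h4, h5, h6]
  · subst hz
    simp [hS, Function.update_apply, hδ]
  · have h4 : st.reg 10 + 3 * z ≠ st.reg 10 + 3 * x + 2 := by omega
    simp [hS, hδ, hz, h4]

/-- The cell number is saved in register `43` before the value is computed, so `v` has to be
evaluated in a store that may differ there. In stage zero the basic value is written and otherwise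
the current one; the stamp is set in both cases. -/
theorem Cmd.all_vstore (hW : WideWords w X) (hb : st.Below X) {k : ℕ} (hk : k < X)
    {e v : Expr} {x y : ℕ} (he : e.eval w st = x) (hx : x < X) (hy : y < X)
    (hv : ∀ st' : Store, st'.Below X → st'.mem = st.mem → (∀ r ≠ 43, st'.reg r = st.reg r) →
      v.eval w st' = y) :
    ((vstore k e v).exec w st).All fun st' => st'.Below X ∧ Evolves st st' ∧
      (∀ r, r ≠ 43 → r ≠ 44 → st'.reg r = st.reg r) ∧
      ∀ z, st'.cell z = Function.update st.cell (k + x) y z := by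
  have h4 := hW.four_le
  have h0 : 0 < X := by omega
  have h2 : 2 < X := by omega
  have h3 : 3 < X := by omega
  refine all_seq (all_set_of_eval hb he hx fun hb₁ => all_seq (all_set_of_eval (hb₁.tick _)
    (hv _ (hb₁.tick _) rfl fun r hr => Function.update_of_ne hr _ _) hy fun hb₂ =>
    all_seq (all_store hW (hb₂.tick _) ?_ ?_ ?_ ?_ ?_ fun hb₃ =>
    all_store hW (hb₃.tick _) ?_ ?_ ?_ ?_ ?_ fun hb₄ => ⟨hb₄.tick _, ?_⟩)))
  any_goals simp [h0, h2, h3, hk]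
  · simpa [Store.setReg, Store.tick] using hy
  · simpa [Store.setReg, Store.tick, Store.setMem] using hb.1 41
  set st' := (Store.tick _ _) with hst'
  have hmem : st'.mem = Function.update (Function.update st.mem
      (st.reg 10 + 3 * (k + x) + if 0 < st.reg 41 then 1 else 0) y)
      (st.reg 10 + 3 * (k + x) + 2) (st.reg 41) := by
    simp [hst', Store.setReg, Store.tick, Store.setMem]
  have hreg : ∀ r, r ≠ 43 → r ≠ 44 → st'.reg r = st.reg r := by
    intro r h h'
    simp [hst', Store.setReg, Store.tick, Store.setMem, h, h']
  refine ⟨⟨fun r hr => hreg r (by omega) (by omega), fun a ha => ?_, fun hS z => ?_, fun z => ?_⟩,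
    hreg, Store.cell_write rfl (hreg _ (by norm_num) (by norm_num))
      (hreg _ (by norm_num) (by norm_num)) hmem⟩
  · rw [hmem, Function.update_of_ne (by omega), Function.update_of_ne (by omega)]
  · rw [hmem, if_pos hS, Function.update_of_ne (by omega), Function.update_of_ne (by omega)]
  · rw [hmem]
    by_cases hz : z = k + x
    · subst hz; right; simp
    · left
      rw [Function.update_of_ne (by omega), Function.update_of_ne]
      split_ifs <;> omega

end

/-! ## Simulation of programs with shorter words -/

/-- As `2^w'` divides `2^w`, the longer reduction is absorbed by the shorter one. Only subtraction
needs an argument: both `2^w - b % 2^w` and `2^w' - b % 2^w'` represent `-b` modulo `2^w'`. -/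
theorem WordRAM.BinOp.eval_mod_two_pow {w w' : ℕ} (h : w' ≤ w) (o : BinOp) (a b : ℕ) :
    o.eval w a b % 2 ^ w' = o.eval w' a b := by
  have hd : 2 ^ w' ∣ 2 ^ w := pow_dvd_pow 2 h
  cases o <;> simp only [BinOp.eval, Nat.mod_mod_of_dvd _ hd]
  have h1 : b % 2 ^ w ≤ 2 ^ w := (Nat.mod_lt _ (by positivity)).le
  have h2 : b % 2 ^ w' ≤ 2 ^ w' := (Nat.mod_lt _ (by positivity)).le
  refine Nat.ModEq.add_left a (Nat.ModEq.add_right_cancel' b ?_)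
  have e1 : 2 ^ w - b % 2 ^ w + b ≡ 0 [MOD 2 ^ w'] := by
    have : 2 ^ w - b % 2 ^ w + b ≡ 2 ^ w - b % 2 ^ w + b % 2 ^ w [MOD 2 ^ w] :=
      (Nat.mod_modEq b _).symm.add_left _
    rw [Nat.sub_add_cancel h1] at this
    exact (this.of_dvd hd).trans ((Nat.modEq_zero_iff_dvd).2 hd)
  have e2 : 2 ^ w' - b % 2 ^ w' + b ≡ 0 [MOD 2 ^ w'] := by
    have : 2 ^ w' - b % 2 ^ w' + b ≡ 2 ^ w' - b % 2 ^ w' + b % 2 ^ w' [MOD 2 ^ w'] :=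
      (Nat.mod_modEq b _).symm.add_left _
    rw [Nat.sub_add_cancel h2] at this
    exact this.trans ((Nat.modEq_zero_iff_dvd).2 dvd_rfl)
  exact e1.trans e2.symm

/-- The registers of the instruction are below `k`, and its constants are below `X`. -/
def WordRAM.Instr.Fits (k X : ℕ) : Instr → Prop
  | .const r x => r < k ∧ x < X
  | .bin _ r a b => r < k ∧ a < k ∧ b < k
  | .load r a => r < k ∧ a < k
  | .store a r => a < k ∧ r < k
  | .jz r l => r < k ∧ l < X
  | .coin r => r < k

namespace Cmd

open Expr

/-- The simulation of one instruction. Register `r` of the simulated machine is the cell `r`, the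
memory cell number `x` is the cell `k + x`, the position in the program is in register `40`, and
`2 ^ w'` for its word size `w'` is in register `11`. -/
def simInstr (k : ℕ) : Instr → Cmd
  | .const r x => seq (vstore 0 (lit r) (lit x % reg 11)) (set 40 (reg 40 + lit 1))
  | .bin o r a b =>
      seq (vstore 0 (lit r) (bin o (vload (lit a)) (vload (lit b)) % reg 11)) (set 40 (reg 40 + lit 1))
  | .load r a => seq (vstore 0 (lit r) (vload (lit k + vload (lit a)))) (set 40 (reg 40 + lit 1))
  | .store a r => seq (vstore k (vload (lit a)) (vload (lit r))) (set 40 (reg 40 + lit 1))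
  | .jz r l => ite (vload (lit r)) (set 40 (reg 40 + lit 1)) (set 40 (lit l))
  | .coin r => seq (coin 42) (seq (vstore 0 (lit r) (reg 42 % reg 11)) (set 40 (reg 40 + lit 1)))

/-- The simulation of one step of a program. -/
def simStep (k : ℕ) : List Instr → ℕ → Cmd
  | [], _ => skip
  | x :: l, i => ite (eq (reg 40) (lit i)) (simInstr k x) (simStep k l (i + 1))

/-- The simulation of a program for a number of steps. -/
def simulate (k : ℕ) (P : Program) (e : Expr) : Cmd :=
  seq (set 40 (lit 0)) (loop 45 e (simStep k P 0))

/-- The simulation of a program that is called with two arguments. -/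
def simCall (k : ℕ) (P : Program) (e x y : Expr) : Cmd :=
  seq (vstore 0 (lit 0) x) (seq (vstore 0 (lit 1) y) (simulate k P e))

end Cmd

/-- The registers and the memory of `s` are held by the versioned memory. -/
structure Holds (k : ℕ) (st : Store) (s : State) : Prop where
  reg : ∀ r < k, st.cell r = s.reg r
  mem : ∀ x, st.cell (k + x) = s.mem x

theorem Holds.congr {k : ℕ} {st st' : Store} {s : State} (h : Holds k st s)
    (hc : ∀ x, st'.cell x = st.cell x) {s' : State} (hr : s'.reg = s.reg) (hm : s'.mem = s.mem) :
    Holds k st' s' :=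
  ⟨fun r hr' => (hc r).trans (hr ▸ h.reg r hr'), fun x => (hc _).trans (hm ▸ h.mem x)⟩

theorem Holds.setReg {k : ℕ} {st : Store} {s : State} (h : Holds k st s) {r : ℕ} (hr : r < k)
    (y : ℕ) {st' : Store} (hc : ∀ x, st'.cell x = Function.update st.cell (0 + r) y x) (pc t : ℕ) :
    Holds k st' ⟨pc, t, Function.update s.reg r y, s.mem⟩ := by
  refine ⟨fun r' hr' => ?_, fun x => ?_⟩
  · simp only [hc, zero_add, Function.update_apply, h.reg r' hr']
  · rw [hc, Function.update_of_ne (by omega), h.mem]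

theorem Holds.setMem {k : ℕ} {st : Store} {s : State} (h : Holds k st s) (a y : ℕ) {st' : Store}
    (hc : ∀ x, st'.cell x = Function.update st.cell (k + a) y x) (pc t : ℕ) :
    Holds k st' ⟨pc, t, s.reg, Function.update s.mem a y⟩ := by
  refine ⟨fun r' hr' => ?_, fun x => ?_⟩
  · rw [hc, Function.update_of_ne (by omega), h.reg r' hr']
  · simp only [hc, Function.update_apply, h.mem, Nat.add_left_cancel_iff]

/-- Besides holding the state, the store has small entries, has evolved from `st₀`, and has the
position in the program in register `40`. -/
structure Simulates (X k : ℕ) (st₀ st : Store) (s : State) : Prop where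
  below : st.Below X
  evolves : Evolves st₀ st
  holds : Holds k st s
  pc : st.reg 40 = s.pc

/-- The outcomes are related to those of an action. -/
inductive CoinTree.Follows (R : Store → State → Prop) (f : Bool → State) : CoinTree Store → Prop
  | all {t : CoinTree Store} : (t.All fun st => ∀ b, R st (f b)) → Follows R f t
  | flip {t₀ t₁ : CoinTree Store} : (t₀.All fun st => R st (f false)) →
      (t₁.All fun st => R st (f true)) → Follows R f (.flip t₀ t₁)

namespace CoinTree.Follows

variable {R : Store → State → Prop} {f : Bool → State} {t : CoinTree Store}

theorem all_exists (h : t.Follows R f) : t.All fun st => ∃ b, R st (f b) := by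
  cases h with
  | all h => exact h.mono fun st h => ⟨false, h false⟩
  | flip h₀ h₁ => exact ⟨h₀.mono fun st h => ⟨_, h⟩, h₁.mono fun st h => ⟨_, h⟩⟩

theorem le_expect (h : t.Follows R f) {F : State → ℝ≥0∞} {g : Store → ℝ≥0∞}
    (hF : ∀ st s, R st s → F s ≤ g st) : (F (f false) + F (f true)) / 2 ≤ t.expect g := by
  cases h with
  | all h =>
    refine h.le_expect fun st h => ?_
    refine (ENNReal.div_le_div_right (add_le_add (hF st _ (h false)) (hF st _ (h true))) _).trans ?_
    rw [ENNReal.add_div, ENNReal.add_halves]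
  | flip h₀ h₁ =>
    rw [expect]
    exact ENNReal.div_le_div_right (add_le_add (h₀.le_expect fun st h => hF st _ h)
      (h₁.le_expect fun st h => hF st _ h)) _

theorem mono {R' : Store → State → Prop} (h : t.Follows R f) (hR : ∀ st s, R st s → R' st s) :
    t.Follows R' f := by
  cases h with
  | all h => exact .all (h.mono fun st h b => hR st _ (h b))
  | flip h₀ h₁ => exact .flip (h₀.mono fun st h => hR st _ h) (h₁.mono fun st h => hR st _ h)

theorem bind_leaf (k : Store → Store) (h : t.Follows (fun st s => R (k st) s) f) :
    (t.bind fun st => .leaf (k st)).Follows R f := by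
  cases h with
  | all h => exact .all ((all_bind _ _ _).2 h)
  | flip h₀ h₁ => exact .flip ((all_bind _ _ _).2 h₀) ((all_bind _ _ _).2 h₁)

end CoinTree.Follows

section

variable {w w' X k : ℕ} {st₀ st : Store} {s : State}

theorem Store.cell_lt (hb : st.Below X) (x : ℕ) : st.cell x < X := hb.2 _

theorem Store.cell_tick (t x : ℕ) : (st.tick t).cell x = st.cell x := rfl

theorem Store.cell_congr {st' : Store} (hm : st'.mem = st.mem) (hr : ∀ r ≠ 43, st'.reg r = st.reg r)
    (x : ℕ) : st'.cell x = st.cell x := by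
  unfold Store.cell
  rw [hm, hr 10 (by norm_num), hr 41 (by norm_num)]

theorem Simulates.tick (h : Simulates X k st₀ st s) (t : ℕ) : Simulates X k st₀ (st.tick t) s :=
  ⟨h.below, h.evolves.tick t, h.holds.congr (Store.cell_tick _) rfl rfl, h.pc⟩

theorem eval_vload_lit (hW : WideWords w X) (hb : st.Below X) {a : ℕ} (ha : a < X) :
    (Expr.vload (.lit a)).eval w st = st.cell a := by
  rw [Expr.eval_eq_ival hW hb (Expr.Safe.vload hW.four_le (by simpa)) (by simp)]
  simp

theorem eval_lit (hW : WideWords w X) {a : ℕ} (ha : a < X) :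
    (Expr.lit a).eval w st = a :=
  Nat.mod_eq_of_lt (ha.trans_le hW.le_two_pow)

/-- The position is increased and the state of the simulated machine is known. -/
theorem all_next (hW : WideWords w X) (hb : st.Below X) (he : Evolves st₀ st)
    (hh : Holds k st s) (hpc : s.pc = st.reg 40 + 1) (hpcX : s.pc < X) :
    ((Cmd.set 40 (.reg 40 + .lit 1)).exec w st).All fun st' => Simulates X k st₀ st' s := by
  have h4 := hW.four_le
  have h1 : 1 < X := by omega
  refine Cmd.all_set hW hb (by simpa) (by simp) (by simpa [← hpc]) fun hb' => ?_
  refine ⟨hb'.tick _, (he.trans (Evolves.setReg _ (by norm_num) _)).tick _, hh.congr (fun x => ?_) rfl rfl, ?_⟩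
  · rw [Store.cell_tick, Store.cell_setReg _ (by norm_num)]
  · simp [Store.setReg, Store.tick, hpc]

/-- Every result is reduced modulo the content `2^w'` of register `11`, which reproduces the
arithmetic of the shorter words. Only a coin instruction yields a genuine flip; all other outcomes
agree with the simulated step for both values of the bit. -/
theorem follows_simInstr (hW : WideWords w X) (hw : w' ≤ w) (hwX : 2 ^ w' < X) (hk : k < X)
    (hM : st₀.reg 11 = 2 ^ w') (h : Simulates X k st₀ st s) (hpc : s.pc + 1 < X) (i : Instr)
    (hi : i.Fits k X) :
    ((Cmd.simInstr k i).exec w st).Follows (Simulates X k st₀) fun b => i.exec w' b s := by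
  have h4 := hW.four_le
  have h1 : 1 < X := by omega
  have h0 : 0 < 2 ^ w' := by positivity
  have hb := h.below
  have hlt (x : ℕ) : x % 2 ^ w' < X := (Nat.mod_lt _ h0).trans hwX
  have hM' : st.reg 11 = 2 ^ w' := by rw [h.evolves.reg 11 (by norm_num), hM]
  have hmod (x : ℕ) : x % 2 ^ w' % 2 ^ w = x % 2 ^ w' :=
    Nat.mod_eq_of_lt ((hlt x).trans_le hW.le_two_pow)
  have hreg {r : ℕ} (hr : r < k) : st.cell r = s.reg r := h.holds.reg r hr
  cases i with
  | const r x =>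
    refine .all (Cmd.all_seq ((Cmd.all_vstore hW hb (by omega : 0 < X) (eval_lit hW (hi.1.trans hk)) (hi.1.trans hk)
      (hlt x) fun st' hb' _ hr => ?_).mono fun st' h' => ?_))
    · change (Expr.lit x).eval w st' % st'.reg 11 % 2 ^ w = _
      rw [hr 11 (by norm_num), hM', hmod, eval_lit hW hi.2]
    · refine (all_next (s := (Instr.const r x).exec w' false s) hW h'.1 (h.evolves.trans h'.2.1)
        (h.holds.setReg hi.1 _ h'.2.2.2 _ _) ?_ hpc).mono fun st' h _ => h
      rw [h'.2.2.1 40 (by norm_num) (by norm_num), h.pc]; rfl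
  | bin o r a b =>
    refine .all (Cmd.all_seq ((Cmd.all_vstore (y := o.eval w' (s.reg a) (s.reg b)) hW hb (by omega : 0 < X)
      (eval_lit hW (hi.1.trans hk)) (hi.1.trans hk)
      ?_ fun st' hb' hm hr => ?_).mono fun st' h' => ?_))
    · rw [← BinOp.eval_mod_two_pow hw]; exact hlt _
    · change o.eval w ((Expr.vload (.lit a)).eval w st') ((Expr.vload (.lit b)).eval w st') %
        st'.reg 11 % 2 ^ w = _
      rw [hr 11 (by norm_num), hM', hmod, eval_vload_lit hW hb' (hi.2.1.trans hk),
        eval_vload_lit hW hb' (hi.2.2.trans hk), Store.cell_congr hm hr, Store.cell_congr hm hr,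
        hreg hi.2.1, hreg hi.2.2, BinOp.eval_mod_two_pow hw]
    · refine (all_next (s := (Instr.bin o r a b).exec w' false s) hW h'.1 (h.evolves.trans h'.2.1)
        (h.holds.setReg hi.1 _ h'.2.2.2 _ _) ?_ hpc).mono fun st' h _ => h
      rw [h'.2.2.1 40 (by norm_num) (by norm_num), h.pc]; rfl
  | load r a =>
    refine .all (Cmd.all_seq ((Cmd.all_vstore (y := s.mem (s.reg a)) hW hb (by omega : 0 < X)
      (eval_lit hW (hi.1.trans hk)) (hi.1.trans hk)
      ?_ fun st' hb' hm hr => ?_).mono fun st' h' => ?_))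
    · rw [← h.holds.mem]; exact Store.cell_lt hb _
    · rw [Expr.eval_eq_ival hW hb' (Expr.Safe.vload h4 ((Expr.safe_add _ _ _).2
        ⟨(Expr.safe_lit _ _).2 hk, Expr.Safe.vload h4 ((Expr.safe_lit _ _).2 (hi.2.trans hk))⟩))
        (by simp)]
      simp only [Expr.ival_vload, Expr.ival_add, Expr.ival_lit, Store.cell_congr hm hr]
      rw [h.holds.mem, hreg hi.2]
    · refine (all_next (s := (Instr.load r a).exec w' false s) hW h'.1 (h.evolves.trans h'.2.1)
        (h.holds.setReg hi.1 _ h'.2.2.2 _ _) ?_ hpc).mono fun st' h _ => h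
      rw [h'.2.2.1 40 (by norm_num) (by norm_num), h.pc]; rfl
  | store a r =>
    refine .all (Cmd.all_seq ((Cmd.all_vstore (y := s.reg r) hW hb hk
      (eval_vload_lit hW hb (hi.1.trans hk)) (Store.cell_lt hb _)
      ?_ fun st' hb' hm hr => ?_).mono fun st' h' => ?_))
    · rw [← hreg hi.2]; exact Store.cell_lt hb _
    · rw [eval_vload_lit hW hb' (hi.2.trans hk), Store.cell_congr hm hr, hreg hi.2]
    · rw [hreg hi.1] at h'
      refine (all_next (s := (Instr.store a r).exec w' false s) hW h'.1 (h.evolves.trans h'.2.1)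
        (h.holds.setMem _ _ h'.2.2.2 _ _) ?_ hpc).mono fun st' h _ => h
      rw [h'.2.2.1 40 (by norm_num) (by norm_num), h.pc]; rfl
  | jz r l =>
    have hr := hreg hi.1
    refine .all (Cmd.all_ite hW hb (Expr.Safe.vload h4 (hi.1.trans hk)) (by simp)
      (fun h0 => ?_) fun h0 => ?_)
    · refine (all_next (s := (Instr.jz r l).exec w' false s) hW (hb.tick _) (h.evolves.tick _)
        (h.holds.congr (Store.cell_tick _) rfl rfl) ?_ ?_).mono fun st' h _ => h.tick 2
      all_goals simp only [Expr.ival_vload, Expr.ival_lit, hr] at h0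
      · simp [Instr.exec, h0, Store.tick, h.pc]
      · simpa [Instr.exec, h0] using hpc
    · simp only [Expr.ival_vload, Expr.ival_lit, hr] at h0
      refine Cmd.all_set hW (hb.tick _) (by simpa using hi.2) (by simp) (by simpa using hi.2)
        fun hb' _ => ⟨hb'.tick _, ((h.evolves.tick _).trans (Evolves.setReg _ (by norm_num) _)).tick _,
          h.holds.congr (fun x => ?_) rfl rfl, ?_⟩
      · rw [Store.cell_tick, Store.cell_setReg _ (by norm_num)]; rfl
      · simp [Store.setReg, Store.tick, Instr.exec, h0]
  | coin r =>
    have key (b : Bool) : b.toNat % 2 ^ w < X := by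
      have : b.toNat ≤ 1 := Bool.toNat_le b
      exact (Nat.mod_le _ _).trans_lt (by omega)
    have key' (b : Bool) : ((Cmd.seq (Cmd.vstore 0 (.lit r) (.reg 42 % .reg 11))
        (Cmd.set 40 (.reg 40 + .lit 1))).exec w ((st.setReg 42 (b.toNat % 2 ^ w)).tick 1)).All
          fun st' => Simulates X k st₀ st' ((Instr.coin r).exec w' b s) := by
      have hb₁ : ((st.setReg 42 (b.toNat % 2 ^ w)).tick 1).Below X := hb.setReg (key b) 42
      have hc₁ (x) : ((st.setReg 42 (b.toNat % 2 ^ w)).tick 1).cell x = st.cell x := by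
        rw [Store.cell_tick, Store.cell_setReg _ (by norm_num)]
      refine Cmd.all_seq ((Cmd.all_vstore (y := b.toNat % 2 ^ w') hW hb₁ (by omega : 0 < X)
        (eval_lit hW (hi.trans hk)) (hi.trans hk)
        (hlt _) fun st' hb' hm hr => ?_).mono fun st' h' => ?_)
      · change st'.reg 42 % st'.reg 11 % 2 ^ w = _
        rw [hr 11 (by norm_num), hr 42 (by norm_num)]
        simp only [Store.tick, Store.setReg, Function.update_self, ne_eq, Nat.reduceEqDiff,
          not_false_eq_true, Function.update_of_ne, hM', hmod]
        rw [Nat.mod_mod_of_dvd _ (pow_dvd_pow 2 hw)]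
      · refine all_next hW h'.1 ((h.evolves.trans ((Evolves.setReg _ (by norm_num) _).tick _)).trans
          h'.2.1) ((h.holds.congr hc₁ rfl rfl).setReg hi _ h'.2.2.2 _ _) ?_ hpc
        rw [h'.2.2.1 40 (by norm_num) (by norm_num)]
        simp [Store.setReg, Store.tick, h.pc, Instr.exec]
    have k0 := key' false
    rw [show (false.toNat % 2 ^ w) = 0 from Nat.zero_mod _] at k0
    exact .flip k0 (key' true)

/-- The position is compared with the numbers of the instructions one by one; `l` is the rest of the
program from `i` on. When nothing is left the simulated machine has halted, and doing nothing is
correct. -/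
theorem follows_simStep (hW : WideWords w X) (hw : w' ≤ w) (hwX : 2 ^ w' < X) (hk : k < X)
    (hM : st₀.reg 11 = 2 ^ w') {P : Program} (hP : ∀ i ∈ P, i.Fits k X) (hlen : P.length < X)
    {l : List Instr} {i : ℕ} (hl : P.drop i = l) (hi : i ≤ s.pc) (h : Simulates X k st₀ st s) :
    ((Cmd.simStep k l i).exec w st).Follows (Simulates X k st₀) fun b => stepAct P w' b s := by
  induction l generalizing i st with
  | nil =>
    refine .all fun b => ?_
    have : Halted P s := (List.drop_eq_nil_iff.1 hl).trans hi
    rwa [stepAct_of_halted this]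
  | cons x l ih =>
    have hPi : P[i]? = some x := by
      rw [← zero_add i, add_comm, ← List.getElem?_drop, hl]; rfl
    have hiP := (List.getElem?_eq_some_iff.1 hPi).1
    have he : (Expr.eq (.reg 40) (.lit i)).eval w st = if s.pc = i then 1 else 0 := by
      rw [Expr.eval_eq_ival hW h.below (by simp; omega) (by simp)]
      simp [h.pc]
    rw [Cmd.simStep, Cmd.exec, he]
    by_cases hpc : s.pc = i
    · subst hpc
      have hx : ∀ b, stepAct P w' b s = x.exec w' b s := stepAct_of_getElem? hPi w'
      simp only [if_true, one_ne_zero, if_false, hx]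
      refine CoinTree.Follows.bind_leaf _ ((follows_simInstr hW hw hwX hk hM (h.tick _) (by omega) x
        (hP x (List.mem_of_getElem? hPi))).mono fun st s h => h.tick 2)
    · simp only [hpc, if_false, if_true]
      refine ih ?_ (by omega) (h.tick _)
      rw [← List.drop_drop, hl]
      rfl

variable {P : Program}

theorem Simulates.setReg_counter (h : Simulates X k st₀ st s) {n : ℕ} (hn : n < X) :
    Simulates X k st₀ (st.setReg 45 n) s := by
  refine ⟨h.below.setReg hn _, h.evolves.trans (Evolves.setReg _ (by norm_num) _),
    h.holds.congr (Store.cell_setReg _ (by norm_num) _) rfl rfl, ?_⟩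
  simp [Store.setReg, h.pc]

/-- The actions `l` stand for what is simulated later. With this tail the simulations of several
calls can be composed: `f` has to dominate the probability that the remaining actions succeed. -/
theorem le_expect_iter_simStep (hW : WideWords w X) (hw : w' ≤ w) (hwX : 2 ^ w' < X) (hk : k < X)
    (hM : st₀.reg 11 = 2 ^ w') (hP : ∀ i ∈ P, i.Fits k X) (hlen : P.length < X)
    (G : State → Prop) (l : List Act) (f : Store → ℝ≥0∞)
    (hf : ∀ st s, Simulates X k st₀ st s → prob G l s ≤ f st) {n : ℕ} (hn : n < X)
    (h : Simulates X k st₀ st s) :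
    prob G (List.replicate n (stepAct P w') ++ l) s ≤
      (Cmd.iter ((Cmd.simStep k P 0).exec w) 45 n st).expect f := by
  induction n generalizing st s with
  | zero => exact hf _ _ (h.tick 1)
  | succ n ih =>
    rw [List.replicate_succ, List.cons_append, prob, Cmd.iter, CoinTree.expect_bind]
    exact (follows_simStep hW hw hwX hk hM hP hlen (i := 0) rfl (Nat.zero_le _)
      ((h.setReg_counter (by omega)).tick 3)).le_expect (F := prob G _)
      fun st' s' h' => ih (by omega) (h'.tick 2)

/-- This is for statements about all outcomes: whatever the simulated program does, the store keeps
its shape. -/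
theorem all_iter_simStep (hW : WideWords w X) (hw : w' ≤ w) (hwX : 2 ^ w' < X) (hk : k < X)
    (hM : st₀.reg 11 = 2 ^ w') (hP : ∀ i ∈ P, i.Fits k X) (hlen : P.length < X) {n : ℕ} (hn : n < X)
    (h : Simulates X k st₀ st s) :
    (Cmd.iter ((Cmd.simStep k P 0).exec w) 45 n st).All fun st' => ∃ s', Simulates X k st₀ st' s' := by
  refine Cmd.all_iter (I := fun n st' => n < X ∧ ∃ s', Simulates X k st₀ st' s') ?_ ?_ _ _ ⟨hn, s, h⟩
  · rintro n st' ⟨hn, s', h'⟩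
    refine (follows_simStep hW hw hwX hk hM hP hlen (i := 0) rfl (Nat.zero_le _)
      ((h'.setReg_counter (by omega)).tick 3)).all_exists.mono fun st'' h'' => ⟨by omega, ?_⟩
    obtain ⟨b, h''⟩ := h''
    exact ⟨_, h''.tick 2⟩
  · rintro st' ⟨-, s', h'⟩
    exact ⟨s', h'.tick 1⟩

theorem Simulates.start (hb : st.Below X) (he : Evolves st₀ st) (hh : Holds k st s) (hX : 0 < X)
    (hpc : s.pc = 0) : Simulates X k st₀ (st.setReg 40 0) s :=
  ⟨hb.setReg hX 40, he.trans (Evolves.setReg _ (by norm_num) _),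
    hh.congr (Store.cell_setReg _ (by norm_num) _) rfl rfl, by simp [Store.setReg, hpc]⟩

/-- The machine and the register with the number of steps to be simulated are as required. -/
structure SimSetup (w w' X k j : ℕ) (P : Program) (st₀ : Store) : Prop where
  wide : WideWords w X
  le : w' ≤ w
  lt : 2 ^ w' < X
  two_le : 2 ≤ k
  k_lt : k < X
  word : st₀.reg 11 = 2 ^ w'
  fits : ∀ i ∈ P, i.Fits k X
  length_lt : P.length < X
  budget : j < 40

theorem Simulates.exec_simulate {j : ℕ} (H : SimSetup w w' X k j P st₀) :
    (Cmd.simulate k P (.reg j)).exec w st =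
      Cmd.iter ((Cmd.simStep k P 0).exec w) 45 (st.reg j)
        ((((st.setReg 40 0).tick 2).setReg 45 (st.reg j)).tick 1) := by
  have := H.budget
  have h40 : j ≠ 40 := by omega
  simp only [Cmd.simulate, Cmd.exec, CoinTree.bind, Expr.eval, Nat.zero_mod, Expr.size]
  simp [Store.setReg, Store.tick, h40]

theorem le_expect_simulate {j : ℕ} (H : SimSetup w w' X k j P st₀)
    (G : State → Prop) (l : List Act) (f : Store → ℝ≥0∞)
    (hf : ∀ st s, Simulates X k st₀ st s → prob G l s ≤ f st)
    (hb : st.Below X) (he : Evolves st₀ st) (hh : Holds k st s) (hpc : s.pc = 0) :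
    prob G (List.replicate (st₀.reg j) (stepAct P w') ++ l) s ≤
      ((Cmd.simulate k P (.reg j)).exec w st).expect f := by
  have := H.budget
  rw [Simulates.exec_simulate H, ← he.reg j (by omega)]
  have h4 := H.wide.four_le
  exact le_expect_iter_simStep H.wide H.le H.lt H.k_lt H.word H.fits H.length_lt G l f hf (hb.1 j)
    ((((Simulates.start hb he hh (by omega) hpc).tick 2).setReg_counter (hb.1 j)).tick 1)

theorem all_simulate {j : ℕ} (H : SimSetup w w' X k j P st₀)
    (hb : st.Below X) (he : Evolves st₀ st) (hh : Holds k st s) (hpc : s.pc = 0) :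
    ((Cmd.simulate k P (.reg j)).exec w st).All fun st' => ∃ s', Simulates X k st₀ st' s' := by
  rw [Simulates.exec_simulate H]
  have h4 := H.wide.four_le
  exact all_iter_simStep H.wide H.le H.lt H.k_lt H.word H.fits H.length_lt (hb.1 j)
    ((((Simulates.start hb he hh (by omega) hpc).tick 2).setReg_counter (hb.1 j)).tick 1)

/-- The call of a program with two arguments as an action. -/
def callAct (a b : ℕ) : Act := fun _ s => s.call a b

theorem fresh_callAct (a b : ℕ) : (callAct a b).Fresh := fun _ => .inr fun _ => ⟨rfl, le_rfl⟩

theorem all_call {j : ℕ} (H : SimSetup w w' X k j P st₀) {x y : Expr} {a b : ℕ}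
    (hx : ∀ st' : Store, st'.Below X → Evolves st₀ st' → (∀ r < 40, st'.reg r = st.reg r) →
      x.eval w st' = a)
    (hy : ∀ st' : Store, st'.Below X → Evolves st₀ st' → (∀ r < 40, st'.reg r = st.reg r) →
      y.eval w st' = b) (ha : a < X) (hb' : b < X)
    (hb : st.Below X) (he : Evolves st₀ st) (hh : Holds k st s) :
    ((Cmd.seq (Cmd.vstore 0 (.lit 0) x) (Cmd.vstore 0 (.lit 1) y)).exec w st).All fun st' =>
      st'.Below X ∧ Evolves st₀ st' ∧ Holds k st' (s.call a b) := by
  have h4 := H.wide.four_le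
  have hk := H.two_le
  have hset {st' : Store} (h : Evolves st₀ st') (z : ℕ) : Evolves st₀ (st'.setReg 43 z) :=
    h.trans (Evolves.setReg _ (by norm_num) _)
  refine Cmd.all_seq ((Cmd.all_vstore H.wide hb (by omega : 0 < X) (eval_lit H.wide (by omega : 0 < X))
    (by omega) ha fun st₁ hb₁ hm₁ hr₁ => ?_).mono fun st₂ h₂ => ?_)
  · refine hx st₁ hb₁ ⟨fun r hr => ?_, ?_, ?_, ?_⟩ fun r hr => hr₁ r (by omega)
    · rw [hr₁ r (by omega), he.reg r hr]
    all_goals rw [hm₁]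
    exacts [he.low, he.base, he.stamp]
  · obtain ⟨hb₂, he₂, hr₂, hc₂⟩ := h₂
    have he₂' := he.trans he₂
    refine (Cmd.all_vstore H.wide hb₂ (by omega : 0 < X) (eval_lit H.wide (by omega : 1 < X))
      (by omega) hb' fun st₃ hb₃ hm₃ hr₃ => ?_).mono fun st₄ h₄ => ?_
    · refine hy st₃ hb₃ ⟨fun r hr => ?_, ?_, ?_, ?_⟩ fun r hr => ?_
      · rw [hr₃ r (by omega), he₂'.reg r hr]
      · rw [hm₃]; exact he₂'.low
      · rw [hm₃]; exact he₂'.base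
      · rw [hm₃]; exact he₂'.stamp
      · rw [hr₃ r (by omega), hr₂ r (by omega) (by omega)]
    · obtain ⟨hb₄, he₄, -, hc₄⟩ := h₄
      exact ⟨hb₄, he₂'.trans he₄, (hh.setReg (by omega) _ hc₂ 0 s.time).setReg (by omega) _ hc₄ 0 s.time⟩

theorem exec_simCall (x y e : Expr) :
    (Cmd.simCall k P e x y).exec w st =
      ((Cmd.seq (Cmd.vstore 0 (.lit 0) x) (Cmd.vstore 0 (.lit 1) y)).exec w st).bind
        ((Cmd.simulate k P e).exec w) := by
  simp only [Cmd.simCall, Cmd.exec]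
  generalize (Cmd.vstore 0 (.lit 0) x).exec w st = t
  induction t with
  | leaf a => rfl
  | flip t₀ t₁ h₀ h₁ => simp only [CoinTree.bind, h₀, h₁]

theorem le_expect_simCall {j : ℕ} (H : SimSetup w w' X k j P st₀) {x y : Expr} {a b : ℕ}
    (hx : ∀ st' : Store, st'.Below X → Evolves st₀ st' → (∀ r < 40, st'.reg r = st.reg r) →
      x.eval w st' = a)
    (hy : ∀ st' : Store, st'.Below X → Evolves st₀ st' → (∀ r < 40, st'.reg r = st.reg r) →
      y.eval w st' = b) (ha : a < X) (hb' : b < X)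
    (G : State → Prop) (l : List Act) (f : Store → ℝ≥0∞)
    (hf : ∀ st s, Simulates X k st₀ st s → prob G l s ≤ f st)
    (hb : st.Below X) (he : Evolves st₀ st) (hh : Holds k st s) :
    prob G (callAct a b :: (List.replicate (st₀.reg j) (stepAct P w') ++ l)) s ≤
      ((Cmd.simCall k P (.reg j) x y).exec w st).expect f := by
  rw [exec_simCall, CoinTree.expect_bind, prob]
  simp only [callAct]
  rw [ENNReal.add_div, ENNReal.add_halves]
  exact (all_call H hx hy ha hb' hb he hh).le_expect fun st' h =>
    le_expect_simulate H G l f hf h.1 h.2.1 h.2.2 rfl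

theorem all_simCall {j : ℕ} (H : SimSetup w w' X k j P st₀) {x y : Expr} {a b : ℕ}
    (hx : ∀ st' : Store, st'.Below X → Evolves st₀ st' → (∀ r < 40, st'.reg r = st.reg r) →
      x.eval w st' = a)
    (hy : ∀ st' : Store, st'.Below X → Evolves st₀ st' → (∀ r < 40, st'.reg r = st.reg r) →
      y.eval w st' = b) (ha : a < X) (hb' : b < X)
    (hb : st.Below X) (he : Evolves st₀ st) :
    ((Cmd.simCall k P (.reg j) x y).exec w st).All fun st' => st'.Below X ∧ Evolves st₀ st' := by
  rw [exec_simCall, CoinTree.all_bind]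
  -- Every store holds some state, namely the one read off from its cells. So nothing has to be
  -- known about earlier simulations.
  refine (all_call H hx hy ha hb' hb he (s := ⟨0, 0, st.cell, fun x => st.cell (k + x)⟩)
    ⟨fun _ _ => rfl, fun _ => rfl⟩).mono fun st' h => ?_
  exact (all_simulate H h.1 h.2.1 h.2.2 rfl).mono fun st'' ⟨s', h'⟩ => ⟨h'.below, h'.evolves⟩

end

/-! ## Numbering the vertices of the gadget -/

theorem hasWalk_equiv {V V' : Type*} {G : Digraph V} {G' : Digraph V'} (e : V ≃ V')
    (h : ∀ x y, G'.Adj (e x) (e y) ↔ G.Adj x y) (k : ℕ) (x y : V) :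
    HasWalk G' k (e x) (e y) ↔ HasWalk G k x y := by
  induction k generalizing x with
  | zero => exact e.apply_eq_iff_eq
  | succ k ih =>
    simp only [HasWalk, e.surjective.exists, h, ih]

theorem ecc_equiv {V V' : Type*} {G : Digraph V} {G' : Digraph V'} (e : V ≃ V')
    (h : ∀ x y, G'.Adj (e x) (e y) ↔ G.Adj x y) (x : V) : ecc G' (e x) = ecc G x := by
  unfold ecc ddist
  rw [← e.iSup_comp]
  simp only [hasWalk_equiv e h]

namespace GadgetVertex

variable {p d a : ℕ}

/-- The row of a vertex: there is a row for each vector and each coordinate, and one row for `x`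
and `y`. -/
def row : GadgetVertex p p d a → ℕ
  | uNode u _ => u
  | vNode v _ => p + v
  | cU c => 2 * p + c
  | cV c => 2 * p + c
  | x => 2 * p + d
  | y => 2 * p + d
  | inner c _ => 2 * p + c

/-- The position of a vertex in its row. -/
def col : GadgetVertex p p d a → ℕ
  | uNode _ i => i
  | vNode _ i => i
  | cU _ => 0
  | cV _ => a
  | x => 0
  | y => 1
  | inner _ i => i + 1

theorem col_le (ha : 1 ≤ a) (z : GadgetVertex p p d a) : z.col ≤ a := by
  cases z with
  | uNode u i | vNode u i => have := i.isLt; simp only [col]; omega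
  | inner c i => have := i.isLt; simp only [col]; omega
  | _ => simp only [col]; omega

theorem row_col_lt (z : GadgetVertex p p d a) :
    z.row < 2 * p + d ∨ z.row = 2 * p + d ∧ z.col < 2 := by
  cases z with
  | uNode u i | vNode u i => have := u.isLt; simp only [row]; omega
  | inner c i | cU c | cV c => have := c.isLt; simp only [row]; omega
  | x | y => simp [row, col]

theorem row_col_injective (ha : 1 ≤ a) {z z' : GadgetVertex p p d a} (hr : z.row = z'.row)
    (hc : z.col = z'.col) : z = z' := by
  cases z with
  | uNode u i | vNode u i | cU u | cV u | inner u i =>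
    have := u.isLt
    cases z' with
    | uNode u' i' | vNode u' i' | cU u' | cV u' | inner u' i' =>
      have := u'.isLt
      try have := i.isLt
      try have := i'.isLt
      simp only [row, col] at hr hc
      first
      | (exfalso; omega)
      | (congr 1 <;> apply Fin.ext <;> omega)
    | x | y => simp only [row, col] at hr hc; omega
  | x | y =>
    cases z' with
    | uNode u' i' | vNode u' i' | cU u' | cV u' | inner u' i' =>
      have := u'.isLt
      simp only [row, col] at hr hc; omega
    | x | y => first | rfl | (simp only [row, col] at hr hc; omega)

theorem exists_row_col {r c : ℕ} (hc : c ≤ a) (h : r < 2 * p + d ∨ r = 2 * p + d ∧ c < 2) :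
    ∃ z : GadgetVertex p p d a, z.row = r ∧ z.col = c := by
  by_cases h1 : r < p
  · exact ⟨uNode ⟨r, h1⟩ ⟨c, by omega⟩, rfl, rfl⟩
  by_cases h2 : r < 2 * p
  · exact ⟨vNode ⟨r - p, by omega⟩ ⟨c, by omega⟩, by simp only [row]; omega, rfl⟩
  by_cases h3 : r < 2 * p + d
  · by_cases h4 : c = 0
    · exact ⟨cU ⟨r - 2 * p, by omega⟩, by simp only [row]; omega, h4.symm⟩
    by_cases h5 : c = a
    · exact ⟨cV ⟨r - 2 * p, by omega⟩, by simp only [row]; omega, h5.symm⟩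
    exact ⟨inner ⟨r - 2 * p, by omega⟩ ⟨c - 1, by omega⟩, by simp only [row]; omega,
      by simp only [col]; omega⟩
  · by_cases h4 : c = 0
    · exact ⟨x, by simp only [row]; omega, h4.symm⟩
    · exact ⟨y, by simp only [row]; omega, by simp only [col]; omega⟩

end GadgetVertex

/-- The edges of the gadget in terms of rows and positions in rows. -/
def GridAdj (p d a : ℕ) (U V : ℕ → ℕ → Bool) (W : ℕ → Bool) (r c r' c' : ℕ) : Prop :=
  (r < 2 * p + d ∧ r' = r ∧ c' = c + 1 ∧ (r < 2 * p ∨ 0 < c)) ∨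
  (r = 2 * p + d ∧ c = 1 ∧ 2 * p ≤ r' ∧ r' < 2 * p + d ∧ c' = 1) ∨
  (2 * p ≤ r ∧ r < 2 * p + d ∧ c = 0 ∧ r' = 2 * p + d ∧ c' = 1) ∨
  (r < p ∧ c = a ∧ r' = 2 * p + d ∧ c' = 0) ∨
  (r = 2 * p + d ∧ c = 0 ∧ r' < p ∧ c' = 0) ∨
  (r < p ∧ c = a ∧ 2 * p ≤ r' ∧ r' < 2 * p + d ∧ c' = 0 ∧ U r (r' - 2 * p) = true) ∨
  (2 * p ≤ r ∧ r < 2 * p + d ∧ c = a ∧ p ≤ r' ∧ r' < 2 * p ∧ c' = 0 ∧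
    V (r' - p) (r - 2 * p) = true) ∨
  (2 * p ≤ r ∧ r < 2 * p + d ∧ c = 0 ∧ r' = r ∧ c' = a ∧ W (r - 2 * p) = true)

/-- Row and column determine the vertex, so each disjunct fixes the kinds of its two ends. The steps
along a row comprise the edges of all paths, including the last one into `c_V` in column `a`; in the
row of a coordinate they start at column 1, because `c_U` in column 0 is not on the path. The vertex
in column 1 is `c_V` if `a = 1` and inner otherwise. -/
theorem gridAdj_row_col {p d a : ℕ} (ha : 1 ≤ a) (U V : ℕ → ℕ → Bool) (W : ℕ → Bool)
    (z z' : GadgetVertex p p d a) :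
    GridAdj p d a U V W z.row z.col z'.row z'.col ↔
      GadgetAdj a (fun (u : Fin p) (c : Fin d) => U u c) (fun (v : Fin p) (c : Fin d) => V v c)
        (fun c : Fin d => W c) z z' := by
  constructor
  · have hz := z.row_col_lt
    have hz' := z'.row_col_lt
    have hc := GadgetVertex.col_le ha z
    have hc' := GadgetVertex.col_le ha z'
    have eq_x {z : GadgetVertex p p d a} (h : z.row = 2 * p + d) (h' : z.col = 0) : z = .x :=
      GadgetVertex.row_col_injective ha h h'
    have eq_y {z : GadgetVertex p p d a} (h : z.row = 2 * p + d) (h' : z.col = 1) : z = .y :=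
      GadgetVertex.row_col_injective ha h h'
    have eq_u {z : GadgetVertex p p d a} (hz : z.col ≤ a) (h : z.row < p) :
        ∃ u i, z = .uNode u i :=
      ⟨⟨z.row, h⟩, ⟨z.col, by omega⟩, GadgetVertex.row_col_injective ha rfl rfl⟩
    have eq_v {z : GadgetVertex p p d a} (hz : z.col ≤ a) (h : p ≤ z.row) (h' : z.row < 2 * p) :
        ∃ v i, z = .vNode v i :=
      ⟨⟨z.row - p, by omega⟩, ⟨z.col, by omega⟩, GadgetVertex.row_col_injective ha
        (show z.row = p + (z.row - p) by omega) rfl⟩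
    have eq_cU {z : GadgetVertex p p d a} (h : 2 * p ≤ z.row) (h' : z.row < 2 * p + d)
        (hc : z.col = 0) : ∃ c, z = .cU c :=
      ⟨⟨z.row - 2 * p, by omega⟩, GadgetVertex.row_col_injective ha
        (show z.row = 2 * p + (z.row - 2 * p) by omega) hc⟩
    have eq_cV {z : GadgetVertex p p d a} (h : 2 * p ≤ z.row) (h' : z.row < 2 * p + d)
        (hc : z.col = a) : ∃ c, z = .cV c :=
      ⟨⟨z.row - 2 * p, by omega⟩, GadgetVertex.row_col_injective ha
        (show z.row = 2 * p + (z.row - 2 * p) by omega) hc⟩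
    have eq_inner {z : GadgetVertex p p d a} (h : 2 * p ≤ z.row) (h' : z.row < 2 * p + d)
        (hc : 0 < z.col) (hc' : z.col < a) : ∃ c i, z = .inner c i :=
      ⟨⟨z.row - 2 * p, by omega⟩, ⟨z.col - 1, by omega⟩, GadgetVertex.row_col_injective ha
        (show z.row = 2 * p + (z.row - 2 * p) by omega) (show z.col = z.col - 1 + 1 by omega)⟩
    rintro (⟨h1, h2, h3, h4⟩ | ⟨h1, h2, h3, h4, h5⟩ | ⟨h1, h2, h3, h4, h5⟩ | ⟨h1, h2, h3, h4⟩ |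
      ⟨h1, h2, h3, h4⟩ | ⟨h1, h2, h3, h4, h5, h6⟩ | ⟨h1, h2, h3, h4, h5, h6, h7⟩ |
      ⟨h1, h2, h3, h4, h5, h6⟩)
    · rcases lt_or_ge z.row p with hp | hp
      · obtain ⟨u, i, rfl⟩ := eq_u hc hp
        obtain ⟨u', j, rfl⟩ := eq_u hc' (by omega)
        obtain rfl : u' = u := Fin.ext h2
        exact .uPath _ _ _ h3
      rcases lt_or_ge z.row (2 * p) with hp' | hp'
      · obtain ⟨u, i, rfl⟩ := eq_v hc hp hp'
        obtain ⟨u', j, rfl⟩ := eq_v hc' (by omega) (by omega)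
        obtain rfl : u' = u := Fin.ext (Nat.add_left_cancel h2)
        exact .vPath _ _ _ h3
      · obtain ⟨c, i, rfl⟩ := eq_inner hp' h1 (by omega) (by omega)
        rcases lt_or_ge z'.col a with hca | hca
        · obtain ⟨c', j, rfl⟩ := eq_inner (z := z') (by omega) (by omega) (by omega) hca
          obtain rfl : c' = c := Fin.ext (Nat.add_left_cancel h2)
          exact .yPath _ _ _ (Nat.add_right_cancel h3)
        · obtain ⟨c', rfl⟩ := eq_cV (z := z') (by omega) (by omega) (by omega)
          obtain rfl : c' = c := Fin.ext (Nat.add_left_cancel h2)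
          have h3 : a = i + 1 + 1 := h3
          exact .yLast _ _ (by omega)
    · obtain rfl := eq_y h1 h2
      rcases ha.eq_or_lt with hca | hca
      · obtain ⟨c', rfl⟩ := eq_cV h3 h4 (by omega)
        exact .yDirect _ hca.symm
      · obtain ⟨c', j, rfl⟩ := eq_inner h3 h4 (by omega) (by omega)
        exact .yFirst _ _ (Nat.add_right_cancel h5)
    · obtain ⟨c, rfl⟩ := eq_cU h1 h2 h3
      obtain rfl := eq_y h4 h5
      exact .toY _
    · obtain ⟨u, i, rfl⟩ := eq_u hc h1
      obtain rfl := eq_x h3 h4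
      obtain rfl : i = Fin.last a := Fin.ext h2
      exact .toX _
    · obtain rfl := eq_x h1 h2
      obtain ⟨u, i, rfl⟩ := eq_u hc' h3
      obtain rfl : i = 0 := Fin.ext h4
      exact .fromX _
    · obtain ⟨u, i, rfl⟩ := eq_u hc h1
      obtain ⟨c, rfl⟩ := eq_cU h3 h4 h5
      obtain rfl : i = Fin.last a := Fin.ext h2
      have h6 : U u (2 * p + c - 2 * p) = true := h6
      exact .uCoord _ _ (by rwa [Nat.add_sub_cancel_left] at h6)
    · obtain ⟨c, rfl⟩ := eq_cV h1 h2 h3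
      obtain ⟨v, i, rfl⟩ := eq_v hc' h4 h5
      obtain rfl : i = 0 := Fin.ext h6
      have h7 : V (p + v - p) (2 * p + c - 2 * p) = true := h7
      exact .vCoord _ _ (by rwa [Nat.add_sub_cancel_left, Nat.add_sub_cancel_left] at h7)
    · obtain ⟨c, rfl⟩ := eq_cU h1 h2 h3
      obtain ⟨c', rfl⟩ := eq_cV (z := z') (by omega) (by omega) h5
      obtain rfl : c' = c := Fin.ext (Nat.add_left_cancel h4)
      have h6 : W (2 * p + c' - 2 * p) = true := h6
      exact .stage _ (by rwa [Nat.add_sub_cancel_left] at h6)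
  · rintro (⟨u', i, j, hij⟩ | ⟨v', i, j, hij⟩ | ⟨u', c, hc⟩ | ⟨v', c, hc⟩ | u' | u' | c | ⟨c, h1⟩ |
        ⟨c, i, hi⟩ | ⟨c, i, j, hij⟩ | ⟨c, i, hi⟩ | ⟨c, hc⟩)
    all_goals
      simp only [GridAdj, GadgetVertex.row, GadgetVertex.col]
      have hsub (c : ℕ) : 2 * p + c - 2 * p = c := by omega
      have hsub' (c : ℕ) : p + c - p = c := by omega
    · exact .inl ⟨by omega, trivial, hij, .inl (by omega)⟩
    · exact .inl ⟨by omega, trivial, hij, .inl (by omega)⟩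
    · simp [hsub, hc]
    · simp [hsub, hsub', hc]; omega
    · simp
    · simp
    · simp
    · exact .inr (.inl ⟨trivial, trivial, by omega, by omega, h1⟩)
    · exact .inr (.inl ⟨trivial, trivial, by omega, by omega, by omega⟩)
    · exact .inl ⟨by omega, trivial, by omega, .inr (by omega)⟩
    · exact .inl ⟨by omega, trivial, by omega, .inr (by omega)⟩
    · simp [hsub, hc]

/-! ## The gadget as a dynamic graph -/

/-- The number of vertices of the gadget. -/
def gridSize (p d a : ℕ) : ℕ := (2 * p + d) * (a + 1) + 2

namespace GadgetVertex

variable {p d a : ℕ}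

theorem row_mul_add_col_lt (ha : 1 ≤ a) (z : GadgetVertex p p d a) :
    z.row * (a + 1) + z.col < gridSize p d a := by
  have h1 := z.col_le ha
  unfold gridSize
  rcases z.row_col_lt with h | ⟨h, h'⟩
  · have := Nat.mul_le_mul_right (a + 1) (Nat.succ_le_of_lt h)
    rw [Nat.succ_eq_add_one, add_one_mul] at this
    omega
  · rw [h]; omega

/-- The numbering of the vertices. -/
noncomputable def number (ha : 1 ≤ a) : GadgetVertex p p d a ≃ Fin (gridSize p d a) :=
  Equiv.ofBijective (fun z => ⟨z.row * (a + 1) + z.col, z.row_mul_add_col_lt ha⟩) <| by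
    constructor
    · intro z z' h
      have h : z.row * (a + 1) + z.col = z'.row * (a + 1) + z'.col := congrArg Fin.val h
      have h1 : z.col < a + 1 := Nat.lt_succ_of_le (z.col_le ha)
      have h2 : z'.col < a + 1 := Nat.lt_succ_of_le (z'.col_le ha)
      refine row_col_injective ha ?_ ?_
      · have := congrArg (· / (a + 1)) h
        simpa [Nat.mul_add_div, mul_comm _ (a + 1), Nat.div_eq_of_lt h1, Nat.div_eq_of_lt h2]
          using this
      · have := congrArg (· % (a + 1)) h
        simpa [Nat.mul_add_mod, mul_comm _ (a + 1), Nat.mod_eq_of_lt h1, Nat.mod_eq_of_lt h2]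
          using this
    · rintro ⟨x, hx⟩
      have h1 : x % (a + 1) < a + 1 := Nat.mod_lt _ (by omega)
      have h2 := Nat.div_add_mod' x (a + 1)
      obtain ⟨z, h3, h4⟩ := exists_row_col (p := p) (d := d) (r := x / (a + 1))
        (Nat.le_of_lt_succ h1) (by
          unfold gridSize at hx
          rcases lt_trichotomy (x / (a + 1)) (2 * p + d) with h | h | h
          · exact .inl h
          · rw [h] at h2; exact .inr ⟨h, by omega⟩
          · have := Nat.mul_le_mul_right (a + 1) (Nat.succ_le_of_lt h)
            rw [Nat.succ_eq_add_one, add_one_mul] at this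
            have ha' : x < (2 * p + d) * (a + 1) + (a + 1) := by omega
            omega)
      exact ⟨z, Fin.ext (by simp only [h3, h4]; exact h2)⟩

theorem number_val (ha : 1 ≤ a) (z : GadgetVertex p p d a) :
    (number ha z : ℕ) = z.row * (a + 1) + z.col := rfl

theorem number_div (ha : 1 ≤ a) (z : GadgetVertex p p d a) : (number ha z : ℕ) / (a + 1) = z.row := by
  have h1 : z.col < a + 1 := Nat.lt_succ_of_le (z.col_le ha)
  rw [number_val, mul_comm, Nat.mul_add_div (by omega), Nat.div_eq_of_lt h1, add_zero]

theorem number_mod (ha : 1 ≤ a) (z : GadgetVertex p p d a) : (number ha z : ℕ) % (a + 1) = z.col := by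
  have h1 : z.col < a + 1 := Nat.lt_succ_of_le (z.col_le ha)
  rw [number_val, mul_comm, Nat.mul_add_mod, Nat.mod_eq_of_lt h1]

end GadgetVertex

/-- The adjacency of the gadget in terms of numbers of vertices. -/
def NumAdj (p d a : ℕ) (U V : ℕ → ℕ → Bool) (W : ℕ → Bool) (x y : ℕ) : Prop :=
  GridAdj p d a U V W (x / (a + 1)) (x % (a + 1)) (y / (a + 1)) (y % (a + 1))

open Classical in
/-- The edges of the gadget. -/
noncomputable def gridEdges (p d a : ℕ) (U V : ℕ → ℕ → Bool) (W : ℕ → Bool) :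
    EdgeSet (gridSize p d a) :=
  Finset.univ.filter fun e => NumAdj p d a U V W e.1 e.2

section

variable {p d a : ℕ} {U V : ℕ → ℕ → Bool} {W : ℕ → Bool}

theorem mem_gridEdges {x y : Fin (gridSize p d a)} :
    (x, y) ∈ gridEdges p d a U V W ↔ NumAdj p d a U V W x y := by
  simp [gridEdges]

theorem number_mem_gridEdges (ha : 1 ≤ a) {z z' : GadgetVertex p p d a} :
    (GadgetVertex.number ha z, GadgetVertex.number ha z') ∈ gridEdges p d a U V W ↔
      GadgetAdj a (fun (u : Fin p) (c : Fin d) => U u c) (fun (v : Fin p) (c : Fin d) => V v c)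
        (fun c : Fin d => W c) z z' := by
  rw [mem_gridEdges, NumAdj, GadgetVertex.number_div, GadgetVertex.number_mod,
    GadgetVertex.number_div, GadgetVertex.number_mod, gridAdj_row_col ha]

theorem ecc_gridEdges (ha : 1 ≤ a) (z : GadgetVertex p p d a) :
    ecc (EdgeSet.toDigraph (gridEdges p d a U V W)) (GadgetVertex.number ha z) =
      ecc (gadget a (fun (u : Fin p) (c : Fin d) => U u c)
        (fun (v : Fin p) (c : Fin d) => V v c) (fun c : Fin d => W c)) z :=
  ecc_equiv _ (fun _ _ => number_mem_gridEdges ha) z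

/-- Separates the edges that vary with `w` from the fixed part of the gadget, which is the gadget
for the zero vector. -/
theorem gadgetAdj_iff_stage {p q d : ℕ} {U : Fin p → Fin d → Bool} {V : Fin q → Fin d → Bool}
    {W : Fin d → Bool} {z z' : GadgetVertex p q d a} :
    GadgetAdj a U V W z z' ↔ GadgetAdj a U V (fun _ => false) z z' ∨
      ∃ c, z = .cU c ∧ z' = .cV c ∧ W c = true := by
  constructor
  · rintro (⟨u', i, j, hij⟩ | ⟨v', i, j, hij⟩ | ⟨u', c, hc⟩ | ⟨v', c, hc⟩ | u' | u' | c | ⟨c, h1⟩ |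
        ⟨c, i, hi⟩ | ⟨c, i, j, hij⟩ | ⟨c, i, hi⟩ | ⟨c, hc⟩)
    · exact .inl (.uPath _ _ _ hij)
    · exact .inl (.vPath _ _ _ hij)
    · exact .inl (.uCoord _ _ hc)
    · exact .inl (.vCoord _ _ hc)
    · exact .inl (.toX _)
    · exact .inl (.fromX _)
    · exact .inl (.toY _)
    · exact .inl (.yDirect _ h1)
    · exact .inl (.yFirst _ _ hi)
    · exact .inl (.yPath _ _ _ hij)
    · exact .inl (.yLast _ _ hi)
    · exact .inr ⟨c, rfl, rfl, hc⟩
  · rintro (h | ⟨c, rfl, rfl, hc⟩)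
    · cases h with
      | uPath u i j h => exact .uPath _ _ _ h
      | vPath u i j h => exact .vPath _ _ _ h
      | uCoord _ _ h => exact .uCoord _ _ h
      | vCoord _ _ h => exact .vCoord _ _ h
      | toX => exact .toX _
      | fromX => exact .fromX _
      | toY => exact .toY _
      | yDirect _ h => exact .yDirect _ h
      | yFirst _ _ h => exact .yFirst _ _ h
      | yPath _ _ _ h => exact .yPath _ _ _ h
      | yLast _ _ h => exact .yLast _ _ h
      | stage _ h => exact absurd h (by simp)
    · exact .stage _ hc

theorem not_gadgetAdj_cU_cV {p q d : ℕ} {U : Fin p → Fin d → Bool} {V : Fin q → Fin d → Bool}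
    {c c' : Fin d} : ¬ GadgetAdj a U V (fun _ => false) (.cU c) (.cV c') := by
  rintro (_ | _ | _ | _ | _ | _ | _ | _ | _ | _ | _ | ⟨_, h⟩)
  exact absurd h (by simp)

/-- The ends of the edge for a coordinate that is inserted or deleted. -/
noncomputable def stageEdge (ha : 1 ≤ a) (c : Fin d) :
    Fin (gridSize p d a) × Fin (gridSize p d a) :=
  (GadgetVertex.number ha (.cU c), GadgetVertex.number ha (.cV c))

theorem stageEdge_mem (ha : 1 ≤ a) {c : Fin d} :
    stageEdge ha c ∈ gridEdges p d a U V W ↔ W c = true := by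
  rw [stageEdge, number_mem_gridEdges, gadgetAdj_iff_stage]
  simp [not_gadgetAdj_cU_cV]

theorem insert_stageEdge (ha : 1 ≤ a) (c : Fin d) :
    insert (stageEdge ha c) (gridEdges p d a U V W) =
      gridEdges p d a U V (Function.update W c true) := by
  ext ⟨x, y⟩
  obtain ⟨z, rfl⟩ := (GadgetVertex.number ha).surjective x
  obtain ⟨z', rfl⟩ := (GadgetVertex.number ha).surjective y
  rw [Finset.mem_insert, number_mem_gridEdges, number_mem_gridEdges, gadgetAdj_iff_stage,
    gadgetAdj_iff_stage (W := fun c' : Fin d => Function.update W c true c'), stageEdge, Prod.mk.injEq,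
    EmbeddingLike.apply_eq_iff_eq, EmbeddingLike.apply_eq_iff_eq, or_left_comm]
  refine or_congr_right ⟨?_, ?_⟩
  · rintro (⟨rfl, rfl⟩ | ⟨c', rfl, rfl, h⟩)
    · exact ⟨c, rfl, rfl, Function.update_self _ _ _⟩
    · exact ⟨c', rfl, rfl, by by_cases hc : (c' : ℕ) = c <;> simp [Function.update_apply, hc, h]⟩
  · rintro ⟨c', rfl, rfl, h⟩
    by_cases hc : c' = c
    · exact .inl ⟨by rw [hc], by rw [hc]⟩
    · rw [Function.update_of_ne (fun h => hc (Fin.ext h))] at h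
      exact .inr ⟨c', rfl, rfl, h⟩

theorem erase_stageEdge (ha : 1 ≤ a) (c : Fin d) :
    (gridEdges p d a U V W).erase (stageEdge ha c) =
      gridEdges p d a U V (Function.update W c false) := by
  ext ⟨x, y⟩
  obtain ⟨z, rfl⟩ := (GadgetVertex.number ha).surjective x
  obtain ⟨z', rfl⟩ := (GadgetVertex.number ha).surjective y
  rw [Finset.mem_erase, number_mem_gridEdges, number_mem_gridEdges, gadgetAdj_iff_stage,
    gadgetAdj_iff_stage (W := fun c' : Fin d => Function.update W c false c'), stageEdge, Ne, Prod.mk.injEq,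
    EmbeddingLike.apply_eq_iff_eq, EmbeddingLike.apply_eq_iff_eq]
  constructor
  · rintro ⟨h, h' | ⟨c', rfl, rfl, h'⟩⟩
    · exact .inl h'
    · have hc : (c' : ℕ) ≠ c := fun hc => h ⟨by rw [Fin.ext hc], by rw [Fin.ext hc]⟩
      exact .inr ⟨c', rfl, rfl, by rwa [Function.update_of_ne hc]⟩
  · rintro (h | ⟨c', rfl, rfl, h⟩)
    · refine ⟨?_, .inl h⟩
      rintro ⟨rfl, rfl⟩
      exact not_gadgetAdj_cU_cV h
    · by_cases hc : (c' : ℕ) = c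
      · rw [hc, Function.update_self] at h
        exact absurd h (by simp)
      · rw [Function.update_of_ne hc] at h
        refine ⟨fun h' => hc ?_, .inr ⟨c', rfl, rfl, h⟩⟩
        rw [GadgetVertex.cU.inj h'.1]

theorem ne_of_mem_gridEdges (ha : 1 ≤ a) {e : Fin (gridSize p d a) × Fin (gridSize p d a)}
    (he : e ∈ gridEdges p d a U V W) : e.1 ≠ e.2 := by
  obtain ⟨x, y⟩ := e
  intro h
  obtain rfl : x = y := h
  obtain ⟨z, rfl⟩ := (GadgetVertex.number ha).surjective x
  rw [number_mem_gridEdges] at he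
  rcases z with _ | _ | _ | _ | _ | _ | _ <;> cases he <;> omega

/-- The edges occur in an explicit list: consecutive numbers for the steps inside rows, three kinds
of edges for each coordinate, two for each index of a vector, and two for each pair of an index and
a coordinate. -/
theorem card_gridEdges_le :
    (gridEdges p d a U V W).card ≤ gridSize p d a + (3 * d + 2 * p + 2 * (p * d)) := by
  classical
  let f : Fin (gridSize p d a) × Fin (gridSize p d a) → ℕ × ℕ := fun e => (e.1, e.2)
  have hf : f.Injective := fun e e' h =>
    Prod.ext (Fin.ext (congrArg Prod.fst h)) (Fin.ext (congrArg Prod.snd h))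
  let g (r c : ℕ) : ℕ := r * (a + 1) + c
  let L : List (ℕ × ℕ) := (List.range (gridSize p d a)).map (fun x => (x, x + 1)) ++
    ((List.range d).map (fun c => (g (2 * p + d) 1, g (2 * p + c) 1)) ++
    ((List.range d).map (fun c => (g (2 * p + c) 0, g (2 * p + d) 1)) ++
    ((List.range d).map (fun c => (g (2 * p + c) 0, g (2 * p + c) a)) ++
    ((List.range p).map (fun u => (g u a, g (2 * p + d) 0)) ++
    ((List.range p).map (fun u => (g (2 * p + d) 0, g u 0)) ++
    ((List.range p ×ˢ List.range d).map (fun e => (g e.1 a, g (2 * p + e.2) 0)) ++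
    (List.range p ×ˢ List.range d).map (fun e => (g (2 * p + e.2) a, g (p + e.1) 0))))))))
  have hL : L.length = gridSize p d a + (3 * d + 2 * p + 2 * (p * d)) := by
    simp [L, List.length_product]; ring
  rw [← hL, ← Finset.card_image_of_injective _ hf]
  refine (Finset.card_le_card fun e he => ?_).trans L.toFinset_card_le
  obtain ⟨⟨x, y⟩, h, rfl⟩ := Finset.mem_image.1 he
  rw [mem_gridEdges, NumAdj] at h
  have hx := Nat.div_add_mod' (x : ℕ) (a + 1)
  have hy := Nat.div_add_mod' (y : ℕ) (a + 1)
  have hxl := x.isLt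
  simp only [f]
  generalize (x : ℕ) = x at *
  generalize (y : ℕ) = y at *
  generalize x / (a + 1) = r at *
  generalize x % (a + 1) = c at *
  generalize y / (a + 1) = r' at *
  generalize y % (a + 1) = c' at *
  subst hx hy
  simp only [L, List.mem_toFinset, List.mem_append, List.mem_map, List.mem_range, List.mem_product, Prod.exists,
    Prod.mk.injEq]
  rcases h with ⟨h1, h2, h3, h4⟩ | ⟨h1, h2, h3, h4, h5⟩ | ⟨h1, h2, h3, h4, h5⟩ | ⟨h1, h2, h3, h4⟩ |
      ⟨h1, h2, h3, h4⟩ | ⟨h1, h2, h3, h4, h5, h6⟩ | ⟨h1, h2, h3, h4, h5, h6, h7⟩ |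
      ⟨h1, h2, h3, h4, h5, h6⟩
  · exact .inl ⟨_, hxl, rfl, by subst h2 h3; ring⟩
  · exact .inr (.inl ⟨r' - 2 * p, by omega, by subst h1 h2; rfl, by
      rw [Nat.add_sub_cancel' h3, h5]⟩)
  · exact .inr (.inr (.inl ⟨r - 2 * p, by omega, by rw [Nat.add_sub_cancel' h1, h3],
      by subst h4 h5; rfl⟩))
  · exact .inr (.inr (.inr (.inr (.inl ⟨r, h1, by subst h2; rfl, by subst h3 h4; rfl⟩))))
  · exact .inr (.inr (.inr (.inr (.inr (.inl ⟨r', h3, by subst h1 h2; rfl, by subst h4; rfl⟩)))))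
  · exact .inr (.inr (.inr (.inr (.inr (.inr (.inl ⟨r, r' - 2 * p, ⟨h1, by omega⟩,
      by subst h2; rfl, by rw [Nat.add_sub_cancel' h3, h5]⟩))))))
  · exact .inr (.inr (.inr (.inr (.inr (.inr (.inr ⟨r' - p, r - 2 * p, ⟨by omega, by omega⟩,
      by rw [Nat.add_sub_cancel' h1, h3], by rw [Nat.add_sub_cancel' h4, h6]⟩))))))
  · exact .inr (.inr (.inr (.inl ⟨r - 2 * p, by omega, by rw [Nat.add_sub_cancel' h1, h3],
      by rw [Nat.add_sub_cancel' h1, h4, h5]⟩)))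

/-- The edges between vectors and coordinates are the only ones whose number is a product `pd`. The
paths of length `a ≥ d` provide at least as many vertices, so there are at most `2n` edges. -/
theorem sparse_gridEdges (hp : 1 ≤ p) (had : d ≤ a) (ha : 2 ≤ a) {k : ℕ} (hk : 1 ≤ k) :
    (gridEdges p d a U V W).Sparse k := by
  refine ⟨fun e he => ne_of_mem_gridEdges (by omega) he, card_gridEdges_le.trans ?_⟩
  have h1 : 3 * d + 2 * p + 2 * (p * d) ≤ gridSize p d a := by
    unfold gridSize
    have h1 : p * d ≤ p * a := Nat.mul_le_mul_left p had
    have h2 : d * 2 ≤ d * a := Nat.mul_le_mul_left d ha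
    have h3 : (2 * p + d) * (a + 1) = 2 * (p * a) + 2 * p + (d * a + d) := by ring
    omega
  -- The gadget has at least eight vertices, so one logarithmic factor already pays for the factor
  -- 2.
  have h2 : 2 ≤ Nat.log 2 (gridSize p d a) := by
    refine Nat.le_log_of_pow_le (by norm_num) ?_
    unfold gridSize
    have : 2 * 3 ≤ (2 * p + d) * (a + 1) := Nat.mul_le_mul (by omega) (by omega)
    omega
  calc _ ≤ gridSize p d a * 2 := by omega
    _ ≤ gridSize p d a * 2 ^ k := Nat.mul_le_mul_left _ (Nat.le_self_pow (by omega) 2)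
    _ ≤ _ := Nat.mul_le_mul_left _ (Nat.pow_le_pow_left h2 k)

/-- The update for a coordinate, an insertion or a deletion depending on `s`. -/
noncomputable def stageOp (ha : 1 ≤ a) (s : Bool) (c : Fin d) : DynOp (gridSize p d a) :=
  bif s then .insert (stageEdge ha c).1 (stageEdge ha c).2
  else .delete (stageEdge ha c).1 (stageEdge ha c).2

theorem apply_stageOp (ha : 1 ≤ a) (s : Bool) (c : Fin d) :
    (stageOp ha s c).apply (gridEdges p d a U V W) =
      gridEdges p d a U V (Function.update W c s) := by
  cases s
  · exact erase_stageEdge ha c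
  · exact insert_stageEdge ha c

/-- The updates for those of the first coordinates where `w` has the value `s`, the last coordinate
first. -/
noncomputable def stageOps (p : ℕ) (ha : 1 ≤ a) (s : Bool) (w : ℕ → Bool) :
    ∀ j, j ≤ d → List (DynOp (gridSize p d a))
  | 0, _ => []
  | j + 1, h => bif w j == s then stageOp ha s ⟨j, h⟩ :: stageOps p ha s w j (Nat.le_of_succ_le h)
      else stageOps p ha s w j (Nat.le_of_succ_le h)

/-- The coordinates still to be treated have the value `!s`, so each update really changes the
graph. All intermediate graphs are gadgets for some `W`, hence sparse. -/
theorem legal_stageOps (hp : 1 ≤ p) (had : d ≤ a) (ha : 2 ≤ a) {k : ℕ} (hk : 1 ≤ k) (s : Bool)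
    (w : ℕ → Bool) (j : ℕ) (hj : j ≤ d) (W : ℕ → Bool) (hW : ∀ c < j, W c = !s) :
    DynOp.Legal k (gridEdges p d a U V W) (stageOps p (Nat.le_of_succ_le ha) s w j hj) ∧
      (stageOps p (Nat.le_of_succ_le ha) s w j hj).foldl DynOp.apply (gridEdges p d a U V W) =
        gridEdges p d a U V (fun c => if c < j ∧ w c = s then s else W c) := by
  induction j generalizing W with
  | zero => exact ⟨sparse_gridEdges hp had ha hk, by simp [stageOps]⟩
  | succ j ih =>
    by_cases h : w j = s
    · have h1 := ih (Nat.le_of_succ_le hj) (Function.update W j s) fun c hc => by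
        rw [Function.update_of_ne (by omega), hW c (by omega)]
      simp only [stageOps, h, beq_self_eq_true, cond_true, List.foldl_cons, DynOp.Legal, apply_stageOp]
      refine ⟨⟨sparse_gridEdges hp had ha hk, ?_, h1.1⟩, h1.2.trans ?_⟩
      · have h2 := hW j (by omega)
        cases s
        · exact (stageEdge_mem _).2 (by simpa using h2)
        · exact fun h3 => by simpa [h2] using (stageEdge_mem _).1 h3
      · congr 1
        funext c
        by_cases hc : c = j
        · simp [hc, h]
        · have : c < j + 1 ↔ c < j := by omega
          simp [Function.update_of_ne hc, this]
    · have h1 := ih (Nat.le_of_succ_le hj) W fun c hc => hW c (by omega)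
      have h' : (w j == s) = false := by simpa using h
      simp only [stageOps, h', cond_false]
      refine ⟨h1.1, h1.2.trans ?_⟩
      congr 1
      funext c
      by_cases hc : c = j
      · simp [hc, h]
      · have : c < j + 1 ↔ c < j := by omega
        simp [this]

theorem length_stageOps (ha : 1 ≤ a) (s : Bool) (w : ℕ → Bool) (j : ℕ) (hj : j ≤ d) :
    (stageOps p ha s w j hj).length ≤ j := by
  induction j with
  | zero => exact le_rfl
  | succ j ih =>
    have := ih (Nat.le_of_succ_le hj)
    cases h : (w j == s) <;> simp [stageOps, h] <;> omega

theorem exists_of_mem_stageOps {ha : 1 ≤ a} {s : Bool} {w : ℕ → Bool} {j : ℕ} {hj : j ≤ d}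
    {o : DynOp (gridSize p d a)} (h : o ∈ stageOps p ha s w j hj) : ∃ c, o = stageOp ha s c := by
  induction j with
  | zero => simp [stageOps] at h
  | succ j ih =>
    cases hs : (w j == s) <;> simp only [stageOps, hs, cond_true, cond_false, List.mem_cons] at h
    · exact ih h
    · rcases h with h | h
      · exact ⟨_, h⟩
      · exact ih h

end

/-! ## Satisfiability and orthogonal vectors -/

/-- A clause has a literal with a variable in `[lo, hi)` that is true if the bits of `α` are
assigned to the variables. -/
def clauseTrue {N : ℕ} (α lo hi : ℕ) (C : List (Fin N × Bool)) : Bool :=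
  C.any fun l => decide (lo ≤ l.1) && decide ((l.1 : ℕ) < hi) && (α.testBit l.1 == l.2)

theorem clauseTrue_eq_true {N α lo hi : ℕ} {C : List (Fin N × Bool)} :
    clauseTrue α lo hi C = true ↔ ∃ l ∈ C, lo ≤ l.1 ∧ (l.1 : ℕ) < hi ∧ α.testBit l.1 = l.2 := by
  simp [clauseTrue, and_assoc]

theorem exists_testBit {N : ℕ} (f : Fin N → Bool) : ∃ α < 2 ^ N, ∀ x : Fin N, α.testBit x = f x := by
  refine ⟨(BitVec.ofFnLE f).toNat, (BitVec.ofFnLE f).isLt, fun x => ?_⟩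
  rw [BitVec.testBit_toNat, BitVec.getLsbD_eq_getElem x.2]
  simp

theorem CNF.satisfiable_iff {N : ℕ} {φ : CNF N} :
    φ.Satisfiable ↔ ∃ α < 2 ^ N, ∀ C ∈ φ, clauseTrue α 0 N C = true := by
  simp only [clauseTrue_eq_true]
  constructor
  · rintro ⟨f, hf⟩
    obtain ⟨α, hα, h⟩ := exists_testBit f
    refine ⟨α, hα, fun C hC => ?_⟩
    obtain ⟨l, hl, h'⟩ := hf C hC
    exact ⟨l, hl, Nat.zero_le _, l.1.2, by rw [h, h']⟩
  · rintro ⟨α, -, h⟩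
    refine ⟨fun x => α.testBit x, fun C hC => ?_⟩
    obtain ⟨l, hl, -, -, h'⟩ := h C hC
    exact ⟨l, hl, h'⟩

section

variable {N : ℕ} (φ : CNF N) (b : ℕ)

/-- The vectors for the assignments of the first `b` variables, and a vector of ones. A coordinate
is one if the clause is not satisfied; the last coordinate is always one. -/
def uVec (u c : ℕ) : Bool := !clauseTrue u 0 (if u < 2 ^ b then b else 0) (φ.getD c [])

/-- The vectors for the assignments of the next `b` variables, and a vector of ones. -/
def vVec (v c : ℕ) : Bool :=
  !clauseTrue (v * 2 ^ b) b (if v < 2 ^ b then b + b else b) (φ.getD c [])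

/-- The vectors for the assignments of the remaining variables; the last coordinate is zero. -/
def wVec (i c : ℕ) : Bool :=
  decide (c < φ.length) && !clauseTrue (i * (2 ^ b * 2 ^ b)) (b + b) N (φ.getD c [])

variable {φ b}

/-- An assignment of no variables satisfies no clause; the additional vectors of ones, with number
`2^b`, arise in this way. -/
theorem clauseTrue_self (α lo : ℕ) (C : List (Fin N × Bool)) : clauseTrue α lo lo C = false := by
  rw [Bool.eq_false_iff, Ne, clauseTrue_eq_true]
  rintro ⟨l, -, h1, h2, -⟩
  omega

/-- The last coordinate belongs to the empty clause, which is never satisfied, so every vector has a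
one there. The last vector has a one in every coordinate. -/
theorem nonDegenerate_uVec :
    NonDegenerate fun (u : Fin (2 ^ b + 1)) (c : Fin (φ.length + 1)) => uVec φ b u c := by
  refine ⟨fun u => ⟨Fin.last _, ?_⟩, fun c => ⟨Fin.last _, ?_⟩⟩
  · simp [uVec, clauseTrue]
  · simp [uVec, clauseTrue_self]

theorem nonDegenerate_vVec :
    NonDegenerate fun (v : Fin (2 ^ b + 1)) (c : Fin (φ.length + 1)) => vVec φ b v c := by
  refine ⟨fun v => ⟨Fin.last _, ?_⟩, fun c => ⟨Fin.last _, ?_⟩⟩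
  · simp [vVec, clauseTrue]
  · simp [vVec, clauseTrue_self]

theorem testBit_combine {u v i x : ℕ} (hu : u < 2 ^ b) (hv : v < 2 ^ b) :
    (u + v * 2 ^ b + i * (2 ^ b * 2 ^ b)).testBit x =
      if x < b then u.testBit x else if x < b + b then (v * 2 ^ b).testBit x
      else (i * (2 ^ b * 2 ^ b)).testBit x := by
  have e1 : u + v * 2 ^ b + i * (2 ^ b * 2 ^ b) = 2 ^ b * (2 ^ b * i + v) + u := by ring
  have e2 : i * (2 ^ b * 2 ^ b) = 2 ^ (b + b) * i := by ring
  rw [e1, e2, Nat.testBit_two_pow_mul_add _ hu, mul_comm v, Nat.testBit_two_pow_mul,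
    Nat.testBit_two_pow_mul]
  split_ifs with h1 h2
  · rfl
  · rw [Nat.testBit_two_pow_mul_add _ hv, if_pos (by omega)]
    simp; omega
  · rw [Nat.testBit_two_pow_mul_add _ hv, if_neg (by omega), Nat.sub_sub]
    simp; omega

theorem clauseTrue_combine {u v i : ℕ} (hu : u < 2 ^ b) (hv : v < 2 ^ b)
    (C : List (Fin N × Bool)) :
    clauseTrue (u + v * 2 ^ b + i * (2 ^ b * 2 ^ b)) 0 N C = true ↔
      clauseTrue u 0 b C = true ∨ clauseTrue (v * 2 ^ b) b (b + b) C = true ∨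
        clauseTrue (i * (2 ^ b * 2 ^ b)) (b + b) N C = true := by
  simp only [clauseTrue_eq_true, testBit_combine hu hv]
  constructor
  · rintro ⟨l, hl, -, -, h⟩
    split_ifs at h with h1 h2
    · exact .inl ⟨l, hl, Nat.zero_le _, h1, h⟩
    · exact .inr (.inl ⟨l, hl, not_lt.1 h1, h2, h⟩)
    · exact .inr (.inr ⟨l, hl, not_lt.1 h2, l.1.2, h⟩)
  · rintro (⟨l, hl, h1, h2, h⟩ | ⟨l, hl, h1, h2, h⟩ | ⟨l, hl, h1, h2, h⟩)
    · exact ⟨l, hl, Nat.zero_le _, l.1.2, by rw [if_pos h2, h]⟩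
    · exact ⟨l, hl, Nat.zero_le _, l.1.2, by rw [if_neg (by omega), if_pos h2, h]⟩
    · exact ⟨l, hl, Nat.zero_le _, l.1.2, by rw [if_neg (by omega), if_neg (by omega), h]⟩

/-- The assignment of `u`, `v` and `i` to the three parts of the variables satisfies all clauses. -/
def GoodTriple (φ : CNF N) (b u v i : ℕ) : Prop :=
  ∀ c < φ.length, clauseTrue (u + v * 2 ^ b + i * (2 ^ b * 2 ^ b)) 0 N (φ.getD c []) = true

/-- Making the families nondegenerate does no harm: `w` vanishes in the additional coordinate, and
the additional vector of `V` dominates all others, so it is orthogonal only if they are. -/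
theorem exists_orthogonalTriple_iff {u : ℕ} (hu : u < 2 ^ b) (i : ℕ) :
    (∃ v : Fin (2 ^ b + 1), OrthogonalTriple (fun c : Fin (φ.length + 1) => uVec φ b u c)
      (fun c => vVec φ b v c) fun c => wVec φ b i c) ↔ ∃ v < 2 ^ b, GoodTriple φ b u v i := by
  constructor
  · rintro ⟨v, hv⟩
    have key (v' : ℕ) (hv' : v' < 2 ^ b) (h : ∀ c, vVec φ b v' c = true → vVec φ b v c = true) :
        GoodTriple φ b u v' i := by
      intro c hc
      rw [clauseTrue_combine hu hv']
      by_contra! hcon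
      refine hv ⟨c, by omega⟩ ⟨?_, h c ?_, ?_⟩
      · simpa [uVec, hu] using hcon.1
      · simpa [vVec, hv'] using hcon.2.1
      · simpa [wVec, hc] using hcon.2.2
    by_cases hv' : (v : ℕ) < 2 ^ b
    · exact ⟨v, hv', key v hv' fun c h => h⟩
    -- The vector of ones is orthogonal, hence so is the vector with number 0 below it.
    · exact ⟨0, by positivity, key 0 (by positivity) fun c _ => by simp [vVec, hv', clauseTrue_self]⟩
  · rintro ⟨v, hv, h⟩
    refine ⟨⟨v, by omega⟩, ?_⟩
    rintro c ⟨h1, h2, h3⟩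
    simp only [wVec, Bool.and_eq_true, decide_eq_true_eq] at h3
    have h4 := h c h3.1
    rw [clauseTrue_combine hu hv] at h4
    simp only [uVec, vVec, hu, hv, if_true] at h1 h2
    rcases h4 with h4 | h4 | h4
    · rw [h4] at h1; simp at h1
    · rw [h4] at h2; simp at h2
    · rw [h4] at h3; simp at h3

theorem satisfiable_iff_goodTriple (hb : b + b ≤ N) :
    φ.Satisfiable ↔ ∃ i < 2 ^ (N - (b + b)), ∃ u < 2 ^ b, ∃ v < 2 ^ b, GoodTriple φ b u v i := by
  rw [CNF.satisfiable_iff]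
  have hmem {Q : List (Fin N × Bool) → Prop} : (∀ C ∈ φ, Q C) ↔ ∀ c < φ.length, Q (φ.getD c []) := by
    rw [List.forall_mem_iff_getElem]
    refine forall₂_congr fun c hc => ?_
    rw [List.getD_eq_getElem _ _ hc]
  simp only [hmem]
  constructor
  · rintro ⟨α, hα, h⟩
    refine ⟨α / 2 ^ b / 2 ^ b, ?_, α % 2 ^ b, Nat.mod_lt _ (by positivity), α / 2 ^ b % 2 ^ b,
      Nat.mod_lt _ (by positivity), fun c hc => ?_⟩
    · rw [Nat.div_div_eq_div_mul, ← pow_add]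
      refine Nat.div_lt_of_lt_mul ?_
      rwa [← pow_add, Nat.add_sub_cancel' hb]
    · convert h c hc using 2
      have h1 := Nat.mod_add_div α (2 ^ b)
      have h2 := Nat.mod_add_div (α / 2 ^ b) (2 ^ b)
      calc _ = α % 2 ^ b + 2 ^ b * (α / 2 ^ b % 2 ^ b + 2 ^ b * (α / 2 ^ b / 2 ^ b)) := by ring
        _ = α := by rw [h2, h1]
  · rintro ⟨i, hi, u, hu, v, hv, h⟩
    refine ⟨_, ?_, h⟩
    have e : 2 ^ N = 2 ^ b * (2 ^ b * 2 ^ (N - (b + b))) := by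
      rw [← mul_assoc, ← pow_add, ← pow_add, Nat.add_sub_cancel' hb]
    rw [e]
    calc u + v * 2 ^ b + i * (2 ^ b * 2 ^ b) < 2 ^ b * (v + 2 ^ b * i + 1) := by
          rw [Nat.mul_add_one]; linarith
      _ ≤ _ := by
        refine Nat.mul_le_mul_left _ ?_
        calc v + 2 ^ b * i + 1 ≤ 2 ^ b * (i + 1) := by rw [Nat.mul_add_one]; omega
          _ ≤ _ := Nat.mul_le_mul_left _ hi

end

/-- There are polynomially many clauses. -/
theorem CNF.IsK.length_le {N K : ℕ} {φ : CNF N} (h : φ.IsK K) : φ.length ≤ (2 * N + 1) ^ K := by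
  classical
  -- A clause with at most `K` literals is determined by its entries at the first `K` places, where
  -- `none` marks that the clause has ended.
  let f (C : List (Fin N × Bool)) : Fin K → Option (Fin N × Bool) := fun j => C[(j : ℕ)]?
  have hf : Set.InjOn f {C | C ∈ φ} := by
    intro C hC C' hC' hCC
    refine List.ext_getElem? fun j => ?_
    by_cases hj : j < K
    · exact congrFun hCC ⟨j, hj⟩
    · rw [List.getElem?_eq_none ((h.2 C hC).trans (not_lt.1 hj)),
        List.getElem?_eq_none ((h.2 C' hC').trans (not_lt.1 hj))]
  rw [← List.toFinset_card_of_nodup h.1]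
  calc φ.toFinset.card = (φ.toFinset.image f).card :=
        (Finset.card_image_of_injOn fun C hC C' hC' => hf (by simpa using hC) (by simpa using hC')).symm
    _ ≤ Fintype.card (Fin K → Option (Fin N × Bool)) := Finset.card_le_univ _
    _ = (2 * N + 1) ^ K := by simp [mul_comm]

theorem CNF.IsK.length_encode_le {N K : ℕ} {φ : CNF N} (h : φ.IsK K) :
    φ.encode.length ≤ φ.length * (K + 1) := by
  rw [CNF.encode, List.length_flatMap]
  refine (List.sum_le_card_nsmul _ (K + 1) ?_).trans (by simp)
  intro x hx
  obtain ⟨C, hC, rfl⟩ := List.mem_map.1 hx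
  simpa using h.2 C hC

theorem CNF.lt_of_mem_encode {N : ℕ} {φ : CNF N} {x : ℕ} (h : x ∈ φ.encode) : x < 2 * N + 2 := by
  obtain ⟨C, -, h⟩ := List.mem_flatMap.1 h
  rcases List.mem_append.1 h with h | h
  · obtain ⟨⟨y, s⟩, -, rfl⟩ := List.mem_map.1 h
    cases s <;> simp
  · simp at h
    simp [h]

/-! ### Scanning the code of a formula -/

/-- The effect of one number of the code on the number of complete clauses and on the truth of
clause `c`, if `t` tells which literals are true. -/
def scanStep (t : ℕ → Bool) (c : ℕ) (s : ℕ × Bool) (x : ℕ) : ℕ × Bool :=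
  (s.1 + if x = 0 then 1 else 0, s.2 || (s.1 == c && t x))

theorem foldl_scanStep_clause {t : ℕ → Bool} (ht : t 0 = false) {c i : ℕ} {r : Bool} {l : List ℕ}
    (hl : ∀ x ∈ l, x ≠ 0) :
    (l ++ [0]).foldl (scanStep t c) (i, r) = (i + 1, r || (i == c && l.any t)) := by
  induction l generalizing r with
  | nil => simp [scanStep, ht]
  | cons x l ih =>
    have hx := hl x (by simp)
    simp only [List.cons_append, List.foldl_cons, scanStep, hx, if_false, add_zero]
    rw [ih fun y hy => hl y (by simp [hy])]
    cases i == c <;> simp [Bool.or_assoc]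

theorem foldl_scanStep_zeros {t : ℕ → Bool} (ht : t 0 = false) (c i k : ℕ) (r : Bool) :
    ((List.replicate k 0).foldl (scanStep t c) (i, r)).2 = r := by
  induction k generalizing i with
  | zero => rfl
  | succ k ih =>
    have h : scanStep t c (i, r) 0 = (i + 1, r) := by simp [scanStep, ht]
    rw [List.replicate_succ, List.foldl_cons, h, ih]

/-- The first component counts the clauses that have ended, so clause `c` is being read as long as
it equals `c`. An arbitrary initial count is needed for the induction. -/
theorem foldl_scanStep_encode {N : ℕ} {t : ℕ → Bool} (ht : t 0 = false) (φ : CNF N) (c i : ℕ)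
    (r : Bool) :
    φ.encode.foldl (scanStep t c) (i, r) = (i + φ.length,
      r || (decide (i ≤ c) &&
        (φ.getD (c - i) []).any fun l => t (2 * (l.1 : ℕ) + 1 + l.2.toNat))) := by
  induction φ generalizing i r with
  | nil => simp [CNF.encode]
  | cons C φ ih =>
    rw [CNF.encode, List.flatMap_cons, List.foldl_append, foldl_scanStep_clause ht
      (by simp only [List.mem_map]; rintro x ⟨l, -, rfl⟩; omega)]
    refine (ih _ _).trans ?_
    rw [List.any_map]
    have e : (fun l : Fin N × Bool => t (2 * (l.1 : ℕ) + 1 + l.2.toNat)) =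
      t ∘ fun l => 2 * (l.1 : ℕ) + 1 + l.2.toNat := rfl
    refine Prod.ext (by simp; omega) ?_
    simp only [e]
    rcases lt_trichotomy i c with h | h | h
    · obtain ⟨j, rfl⟩ : ∃ j, c = i + 1 + j := ⟨c - (i + 1), by omega⟩
      have h1 : i + 1 + j - i = j + 1 := by omega
      have h2 : (i == i + 1 + j) = false := by simp; omega
      have h3 : i ≤ i + 1 + j := by omega
      simp [h1, h2, h3]
    · subst h; simp
    · have h2 : (i == c) = false := by simp; omega
      have h3 : ¬ i ≤ c := by omega
      have h4 : ¬ i + 1 ≤ c := by omega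
      simp [h2, h3, h4]

/-- The test whether a literal, given by its code, is true. -/
def litTrue (α lo hi x : ℕ) : Bool :=
  decide (lo < (x + 1) / 2) && decide ((x + 1) / 2 < hi + 1) &&
    decide ((2 * α) >>> ((x + 1) / 2) % 2 = (x + 1) % 2)

theorem litTrue_zero (α lo hi : ℕ) : litTrue α lo hi 0 = false := by simp [litTrue]

/-- For the code `z` of a literal, `(z + 1) / 2` is the variable plus one and the parity of `z + 1`
is the sign. Shifting `2α` by the variable plus one avoids a subtraction, which is not among the
safe operations. The end mark 0 fails the first comparison. -/
theorem litTrue_code (α lo hi x : ℕ) (s : Bool) :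
    litTrue α lo hi (2 * x + 1 + s.toNat) =
      (decide (lo ≤ x) && decide (x < hi) && (α.testBit x == s)) := by
  have h1 : (2 * x + 1 + s.toNat + 1) / 2 = x + 1 := by cases s <;> simp <;> omega
  have h2 : (2 * x + 1 + s.toNat + 1) % 2 = s.toNat := by cases s <;> simp <;> omega
  have h3 : (2 * α) >>> (x + 1) % 2 = (α.testBit x).toNat := by
    rw [add_comm, Nat.shiftRight_add, Nat.shiftRight_eq_div_pow (2 * α) 1, pow_one,
      Nat.mul_div_cancel_left _ two_pos, Nat.toNat_testBit, Nat.shiftRight_eq_div_pow]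
  rw [litTrue, h1, h2, h3]
  cases α.testBit x <;> cases s <;> simp [Nat.lt_succ_iff]

/-- A scan of the code, possibly followed by zeros, evaluates a clause. -/
theorem foldl_scanStep_eq {N : ℕ} (φ : CNF N) (α lo hi c k : ℕ) {m : ℕ → ℕ} {B : ℕ}
    (hB : B = φ.encode.length + k) (hm : ∀ x < B, m x = φ.encode.getD x 0) :
    (((List.range B).map m).foldl (scanStep (litTrue α lo hi) c) (0, false)).2 =
      clauseTrue α lo hi (φ.getD c []) := by
  have e : (List.range B).map m = φ.encode ++ List.replicate k 0 := by
    refine List.ext_getElem (by simp [hB]) fun i h1 h2 => ?_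
    simp only [List.length_map, List.length_range] at h1
    simp only [List.getElem_map, List.getElem_range, hm i h1, List.getElem_append]
    split_ifs with h
    · rw [List.getD_eq_getElem _ _ h]
    · rw [List.getD_eq_default _ _ (by omega)]; simp
  rw [e, List.foldl_append, foldl_scanStep_encode (litTrue_zero _ _ _),
    foldl_scanStep_zeros (litTrue_zero _ _ _)]
  simp [clauseTrue, litTrue_code]

/-! ### Thresholds -/

/-- Estimates of eccentricities that are coded by larger words are counted as large. -/
def threshold : Convention → ℕ → ℕ
  | .under, a => a + 4
  | .over, a => 2 * a + 3

/-- The code of an estimate. -/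
def estimate : ℕ → ℕ∞
  | 0 => ⊤
  | e + 1 => (e : ℕ∞)

/-- From `εa ≥ 3` it follows that `(2 - ε)(a + 3) < 2a + 3`. The code of an estimate is larger by
one, which explains the two thresholds: `a + 3` is the largest possible lower estimate of a small
eccentricity, and `2a + 3` the smallest possible upper estimate of a large one. Infinity, coded by
0, cannot be an estimate here, although it would fall below the threshold. -/
theorem threshold_lt {ε : ℝ} (hε : 0 < ε) {a : ℕ} (ha : 3 ≤ ε * a) (conv : Convention) {x : ℕ}
    (h : IsApprox (2 - ε) conv ((2 * a + 3 : ℕ) : ℕ∞) (estimate x)) : threshold conv a < x := by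
  rcases conv with _ | _
  · obtain ⟨h1, h2⟩ := h
    cases x with
    | zero => exact absurd (top_le_iff.1 h1) (ENat.natCast_ne_top _)
    | succ e =>
      simp only [estimate, threshold] at h2 ⊢
      by_contra! hcon
      have h3 : ((2 * a + 3 : ℕ) : ℝ≥0∞) ≤ ENNReal.ofReal (2 - ε) * (e : ℝ≥0∞) := by
        simpa using h2
      rw [← ENNReal.ofReal_natCast, ← ENNReal.ofReal_natCast,
        ← ENNReal.ofReal_mul' (by positivity)] at h3
      have h4 : ((2 * a + 3 : ℕ) : ℝ) ≤ (2 - ε) * e := by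
        by_contra! h5
        exact absurd h3 (not_le.2 ((ENNReal.ofReal_lt_ofReal_iff (by positivity)).2 h5))
      have h5 : (e : ℝ) ≤ a + 3 := by exact_mod_cast (by omega : e ≤ a + 3)
      push_cast at h4
      have he : (0:ℝ) ≤ e := by positivity
      -- For `ε > 2` the factor is negative, and no estimate is admissible at all.
      rcases le_or_gt ε 2 with h6 | h6
      · nlinarith
      · nlinarith
  · obtain ⟨h1, h2⟩ := h
    cases x with
    | zero =>
      simp only [estimate] at h2
      have h2' : (⊤ : ℝ≥0∞) ≤ ENNReal.ofReal (2 - ε) * ((2 * a + 3 : ℕ) : ℝ≥0∞) := by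
        simpa using h2
      exact absurd h2' (not_le.2 (ENNReal.mul_lt_top ENNReal.ofReal_lt_top (ENNReal.natCast_lt_top _)))
    | succ e =>
      simp only [estimate, Nat.cast_le, threshold] at h1 ⊢
      omega

/-- By the same inequality as before an upper estimate of `a + 3` stays below `2a + 3`. The code 0
exceeds no threshold, so infinity needs no separate argument. -/
theorem not_threshold_lt {ε : ℝ} (hε : 0 < ε) {a : ℕ} (ha : 3 ≤ ε * a) (conv : Convention) {x : ℕ}
    (h : IsApprox (2 - ε) conv ((a + 3 : ℕ) : ℕ∞) (estimate x)) : ¬ threshold conv a < x := by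
  rcases conv with _ | _
  · obtain ⟨h1, h2⟩ := h
    cases x with
    | zero => simp
    | succ e =>
      simp only [estimate, Nat.cast_le, threshold] at h1 ⊢
      omega
  · obtain ⟨h1, h2⟩ := h
    cases x with
    | zero => simp
    | succ e =>
      simp only [estimate, threshold] at h1 h2 ⊢
      intro hcon
      have h3 : (e : ℝ≥0∞) ≤ ENNReal.ofReal (2 - ε) * ((a + 3 : ℕ) : ℝ≥0∞) := by
        simpa using h2
      rw [← ENNReal.ofReal_natCast, ← ENNReal.ofReal_natCast,
        ← ENNReal.ofReal_mul' (by positivity)] at h3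
      have he : (0 : ℝ) < e := by exact_mod_cast (by omega : 0 < e)
      have h4 : (e : ℝ) ≤ (2 - ε) * (a + 3 : ℕ) := by
        by_contra! h5
        exact absurd h3 (not_le.2 ((ENNReal.ofReal_lt_ofReal_iff he).2 h5))
      have h5 : (2 * a + 3 : ℝ) ≤ e := by exact_mod_cast (by omega : 2 * a + 3 ≤ e)
      push_cast at h4
      nlinarith

/-! ## The program of the reduction -/

namespace Cmd

open Expr

theorem all_set_update {w X : ℕ} {st : Store} {Q : Store → Prop} (hW : WideWords w X)
    (hb : st.Below X) {r v : ℕ} {e : Expr} (hs : e.Safe X) (hd : e.deg ≤ 24) (he : e.ival st = v)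
    (hv : v < X) (hQ : ∀ st' : Store, st'.Below X → st'.mem = st.mem →
      st'.reg = Function.update st.reg r v → Q st') : ((set r e).exec w st).All Q := by
  subst he
  exact all_set hW hb hs hd hv fun hb' => hQ _ (hb'.tick _) rfl rfl

/-- One step of the evaluation of a clause. -/
def evalStep : Cmd :=
  seq (set 28 (load (reg 26))) <| seq
    (set 24 (lt (lit 0) (reg 24 + Expr.eq (reg 25) (reg 23) * (lt (reg 21) ((reg 28 + lit 1) / lit 2) *
      lt ((reg 28 + lit 1) / lit 2) (reg 22 + lit 1) *
      Expr.eq (shr (lit 2 * reg 20) ((reg 28 + lit 1) / lit 2) % lit 2) ((reg 28 + lit 1) % lit 2))))) <|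
  seq (set 25 (reg 25 + Expr.eq (reg 28) (lit 0))) (set 26 (reg 26 + lit 1))

/-- The evaluation of the clause in register `23` for the assignment in register `20`, restricted
to the variables from register `21` to register `22`; the formula is at the beginning of the memory.
The result is put into register `24`. -/
def evalClause : Cmd :=
  seq (set 24 (lit 0)) <| seq (set 25 (lit 0)) <| seq (set 26 (lit 0)) (loop 27 (reg 10) evalStep)

theorem evalClause_writes (r : ℕ) : evalClause.Writes r ↔ 24 ≤ r ∧ r ≤ 28 := by
  simp only [evalClause, evalStep, Writes]
  omega

end Cmd

/-- The formula is at the beginning of the memory, followed by zeros. -/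
structure HoldsCNF {N : ℕ} (φ : CNF N) (st : Store) : Prop where
  mem : ∀ x < st.reg 10, st.mem x = φ.encode.getD x 0
  le : φ.encode.length ≤ st.reg 10

section

variable {w X N : ℕ} {φ : CNF N} {st : Store}

/-- The loop performs the fold of `scanStep` over the memory up to register `10`: register `26` is
the position, `25` the number of complete clauses and `24` the truth value. It runs over the zeros
behind the code as well, which do not change the result. -/
theorem all_evalClause (hW : WideWords w X) (hb : st.Below X) (hφ : HoldsCNF φ st) :
    (Cmd.evalClause.exec w st).All fun st' => st'.Below X ∧ st'.mem = st.mem ∧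
      (∀ r, ¬ (24 ≤ r ∧ r ≤ 28) → st'.reg r = st.reg r) ∧
      st'.reg 24 =
        (clauseTrue (st.reg 20) (st.reg 21) (st.reg 22) (φ.getD (st.reg 23) [])).toNat := by
  have h4 := hW.four_le
  have h0 : 0 < X := by omega
  have h1 : 1 < X := by omega
  have h2 : 2 < X := by omega
  set t := litTrue (st.reg 20) (st.reg 21) (st.reg 22) with ht
  -- The state of the scan after `p` cells.
  set F : ℕ → ℕ × Bool := fun p =>
    ((List.range p).map st.mem).foldl (scanStep t (st.reg 23)) (0, false) with hF
  have hF1 (p : ℕ) : F (p + 1) = scanStep t (st.reg 23) (F p) (st.mem p) := by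
    simp [hF, List.range_succ]
  -- This keeps the number of clauses below `X`.
  have hF2 (p : ℕ) : (F p).1 ≤ p := by
    induction p with
    | zero => simp [hF]
    | succ p ih =>
      rw [hF1, scanStep]
      dsimp only
      split_ifs <;> omega
  have hreg := Cmd.exec_reg (w := w) Cmd.evalClause st
  simp only [Cmd.evalClause_writes] at hreg
  suffices (Cmd.evalClause.exec w st).All fun st' => st'.Below X ∧ st'.mem = st.mem ∧
      st'.reg 24 = (F (st.reg 10)).2.toNat by
    refine (hreg.and this).mono fun st' h => ⟨h.2.1, h.2.2.1, h.1, h.2.2.2.trans ?_⟩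
    rw [hF]
    simp only
    rw [ht, foldl_scanStep_eq φ _ _ _ _ (st.reg 10 - φ.encode.length) (by have := hφ.le; omega) hφ.mem]
  refine Cmd.all_seq (Cmd.all_set_update hW hb (by simpa) (by simp) rfl h0 fun st₁ hb₁ hm₁ hr₁ => ?_)
  refine Cmd.all_seq (Cmd.all_set_update hW hb₁ (by simpa) (by simp) rfl h0 fun st₂ hb₂ hm₂ hr₂ => ?_)
  refine Cmd.all_seq (Cmd.all_set_update hW hb₂ (by simpa) (by simp) rfl h0 fun st₃ hb₃ hm₃ hr₃ => ?_)
  have hm : st₃.mem = st.mem := by rw [hm₃, hm₂, hm₁]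
  have hr3 (r : ℕ) (h : ¬ (24 ≤ r ∧ r ≤ 26)) : st₃.reg r = st.reg r := by
    rw [hr₃, hr₂, hr₁, Function.update_of_ne (by omega), Function.update_of_ne (by omega),
      Function.update_of_ne (by omega)]
  refine (Cmd.all_loop (fun n st' => n + st'.reg 26 = st.reg 10 ∧ st'.mem = st.mem ∧
      st'.reg 25 = (F (st'.reg 26)).1 ∧ st'.reg 24 = (F (st'.reg 26)).2.toNat) ?_ hW hb₃
      (by simp) (by simp) (by simpa using hb₃.1 10) ?_ ?_ ?_).mono ?_
  · simp [Cmd.evalStep, Cmd.Writes]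
  · intro n st' x t h
    simpa [Store.setReg, Store.tick] using h
  · simp [hr₃, hr₂, hr₁, hm, hF]
  · rintro n st' - hb' hr - ⟨hp, hm, h25, h24⟩
    have e {r : ℕ} (h : ¬ (24 ≤ r ∧ r ≤ 28)) : st'.reg r = st.reg r :=
      (hr r (by simp only [Cmd.evalStep, Cmd.Writes]; omega)).trans (hr3 r (by omega))
    have hX := hb.1 10
    have hp' := hF2 (st'.reg 26)
    have hm' := hb'.2 (st'.reg 26)
    refine Cmd.all_seq (Cmd.all_set_update hW hb' (by simp) (by simp) rfl hm' fun st₁ hb₁ hm₁ hr₁ => ?_)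
    refine Cmd.all_seq (Cmd.all_set_update hW hb₁ (by simp [h0, h1, h2]) (by simp)
      (v := (F (st'.reg 26 + 1)).2.toNat) ?_ (by have := Bool.toNat_lt (F (st'.reg 26 + 1)).2; omega)
      fun st₂ hb₂ hm₂ hr₂ => ?_)
    · rw [hF1]
      simp only [scanStep, ht, litTrue, ← h25]
      simp [hr₁, h24, e, hm]
      cases (F (st'.reg 26)).2
      · by_cases c1 : st'.reg 25 = st.reg 23
        · by_cases c2 : st.reg 21 < (st.mem (st'.reg 26) + 1) / 2
          · by_cases c3 : (st.mem (st'.reg 26) + 1) / 2 ≤ st.reg 22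
            · by_cases c4 : (2 * st.reg 20) >>> ((st.mem (st'.reg 26) + 1) / 2) % 2 =
                (st.mem (st'.reg 26) + 1) % 2 <;> simp [c1, c2, c3, c4]
            · simp [c1, c2, c3]
          · simp [c1, c2]
        · have c1' : (st'.reg 25 == st.reg 23) = false := by simpa using c1
          simp [c1, c1']
      · simp
    refine Cmd.all_seq (Cmd.all_set_update hW hb₂ (by simp [h0]) (by simp)
      (v := (F (st'.reg 26 + 1)).1) ?_ (by have := hF2 (st'.reg 26 + 1); omega)
      fun st₃ hb₃ hm₃ hr₃ => ?_)
    · simp [hF1, scanStep, hr₁, hr₂, h25, hm]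
    refine Cmd.all_set_update hW hb₃ (by simp [h1]) (by simp) (v := st'.reg 26 + 1) ?_ (by omega)
      fun st₄ hb₄ hm₄ hr₄ => ?_
    · simp [hr₁, hr₂, hr₃]
    refine ⟨hb₄, ?_, by rw [hm₄, hm₃, hm₂, hm₁, hm], ?_, ?_⟩
    · simp [hr₄]
      omega
    · simp [hr₄, hr₃]
    · simp [hr₄, hr₃, hr₂]
  · rintro st' ⟨hb', -, hp, hm, -, h24⟩
    rw [zero_add] at hp
    exact ⟨hb', hm, by rw [h24, hp]⟩

end

/-! ### Testing single edges of the gadget. -/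

/-- The numbers that are kept in registers. -/
structure Layout (N m b a : ℕ) (st : Store) : Prop where
  r1 : st.reg 1 = m
  r2 : st.reg 2 = b
  r3 : st.reg 3 = 2 ^ b
  r4 : st.reg 4 = 2 ^ b + 1
  r6 : st.reg 6 = a
  r7 : st.reg 7 = a + 1
  r8 : st.reg 8 = 2 * (2 ^ b + 1) + (m + 1)
  r9 : st.reg 9 = gridSize (2 ^ b + 1) (m + 1) a
  r16 : st.reg 16 = b + b
  r17 : st.reg 17 = 2 ^ b * 2 ^ b
  r18 : st.reg 18 = N
  r19 : st.reg 19 = 2 * (2 ^ b + 1)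

theorem Layout.congr {N m b a : ℕ} {st st' : Store} (h : Layout N m b a st)
    (hr : ∀ r < 20, st'.reg r = st.reg r) : Layout N m b a st' := by
  constructor <;> rw [hr _ (by norm_num)]
  exacts [h.r1, h.r2, h.r3, h.r4, h.r6, h.r7, h.r8, h.r9, h.r16, h.r17, h.r18, h.r19]

theorem HoldsCNF.congr {N : ℕ} {φ : CNF N} {st st' : Store} (h : HoldsCNF φ st)
    (hr : st'.reg 10 = st.reg 10) (hm : ∀ x < st.reg 10, st'.mem x = st.mem x) :
    HoldsCNF φ st' :=
  ⟨fun x hx => (hm x (hr ▸ hx)).trans (h.mem x (hr ▸ hx)), hr.symm ▸ h.le⟩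

/-- The coordinates whose edge is present before the updates of a stage. -/
def initialStage (s : Bool) (m c : ℕ) : Bool := decide (c < m) && !s

namespace Cmd

open Expr

/-- The test for those edges of the gadget that do not depend on the vectors. -/
def plainEdge (s : Bool) : Expr :=
  lt (reg 32) (reg 8) * Expr.eq (reg 34) (reg 32) * Expr.eq (reg 35) (reg 33 + lit 1) *
    (lt (reg 32) (reg 19) + lt (lit 0) (reg 33)) +
  Expr.eq (reg 32) (reg 8) * Expr.eq (reg 33) (lit 1) * lt (reg 19) (reg 34 + lit 1) *
    lt (reg 34) (reg 8) * Expr.eq (reg 35) (lit 1) +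
  lt (reg 19) (reg 32 + lit 1) * lt (reg 32) (reg 8) * Expr.eq (reg 33) (lit 0) *
    Expr.eq (reg 34) (reg 8) * Expr.eq (reg 35) (lit 1) +
  lt (reg 32) (reg 4) * Expr.eq (reg 33) (reg 6) * Expr.eq (reg 34) (reg 8) *
    Expr.eq (reg 35) (lit 0) +
  Expr.eq (reg 32) (reg 8) * Expr.eq (reg 33) (lit 0) * lt (reg 34) (reg 4) *
    Expr.eq (reg 35) (lit 0) +
  lt (reg 19) (reg 32 + lit 1) * lt (reg 32) (reg 19 + reg 1) * Expr.eq (reg 33) (lit 0) *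
    Expr.eq (reg 34) (reg 32) * Expr.eq (reg 35) (reg 6) * lit (!s).toNat

/-- The test for a possible edge from the path of a vector `u` to a coordinate. -/
def uEdge : Expr :=
  lt (reg 32) (reg 4) * Expr.eq (reg 33) (reg 6) * lt (reg 19) (reg 34 + lit 1) *
    lt (reg 34) (reg 8) * Expr.eq (reg 35) (lit 0)

/-- The test for a possible edge from a coordinate to the path of a vector `v`. -/
def vEdge : Expr :=
  lt (reg 19) (reg 32 + lit 1) * lt (reg 32) (reg 8) * Expr.eq (reg 33) (reg 6) *
    lt (reg 4) (reg 34 + lit 1) * lt (reg 34) (reg 19) * Expr.eq (reg 35) (lit 0)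

/-- Compute rows and positions of the vertices in registers `30` and `31`. -/
def coordinates : Cmd :=
  seq (set 32 (reg 30 / reg 7)) <| seq (set 33 (reg 30 % reg 7)) <|
  seq (set 34 (reg 31 / reg 7)) (set 35 (reg 31 % reg 7))

/-- Adds the entry of the vector to register `36`. For the vector with number `2^b` register `22`
becomes zero, so that the range of variables is empty. -/
def uTest : Cmd :=
  seq (set 20 (reg 32)) <| seq (set 21 (lit 0)) <| seq (set 22 (reg 2 * lt (reg 32) (reg 3))) <|
  seq (set 23 (bin .sub (reg 34) (reg 19))) <| seq evalClause (set 36 (reg 36 + Expr.eq (reg 24) (lit 0)))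

/-- The vector with number `2^b` gets the empty range from `b` to `b`. The assignment is shifted by
`b` bits to its place among the variables. -/
def vTest : Cmd :=
  seq (set 29 (bin .sub (reg 34) (reg 4))) <|
  seq (set 20 (reg 29 * reg 3)) <| seq (set 21 (reg 2)) <|
  seq (set 22 (reg 2 + reg 2 * lt (reg 29) (reg 3))) <|
  seq (set 23 (bin .sub (reg 32) (reg 19))) <| seq evalClause (set 36 (reg 36 + Expr.eq (reg 24) (lit 0)))

/-- Test whether there is an edge between the vertices in registers `30` and `31`. -/
def edgeTest (s : Bool) : Cmd :=
  seq coordinates <| seq (set 36 (lt (lit 0) (plainEdge s))) <|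
    seq (ite uEdge uTest skip) (ite vEdge vTest skip)

/-- Append an edge to the list of edges. -/
def emitEdge (k : ℕ) : Cmd :=
  seq (vstore k (lit 2 * reg 37) (reg 30)) <|
    seq (vstore k (lit 2 * reg 37 + lit 1) (reg 31)) (set 37 (reg 37 + lit 1))

/-- Write the list of edges of the gadget before the updates of a stage. -/
def buildGraph (k : ℕ) (s : Bool) : Cmd :=
  seq (set 37 (lit 0)) <| loop 30 (reg 9) <| loop 31 (reg 9) <|
    seq (edgeTest s) (ite (reg 36) (emitEdge k) skip)

/-- Subtraction is excluded from the safe expressions, as it wraps around; without underflow the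
additional `2^w` is removed by the reduction. -/
theorem all_set_sub {w X : ℕ} {st : Store} {Q : Store → Prop} (hW : WideWords w X)
    (hb : st.Below X) {r r₁ r₂ v : ℕ} (h : st.reg r₂ ≤ st.reg r₁) (hv : st.reg r₁ - st.reg r₂ = v)
    (hQ : ∀ st' : Store, st'.Below X → st'.mem = st.mem →
      st'.reg = Function.update st.reg r v → Q st') :
    ((set r (bin .sub (reg r₁) (reg r₂))).exec w st).All Q := by
  subst hv
  have h1 := (hW.below hb).1 r₁
  have h2 := (hW.below hb).1 r₂
  refine all_set_of_eval hb (v := st.reg r₁ - st.reg r₂) ?_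
    ((Nat.sub_le _ _).trans_lt (hb.1 r₁)) fun hb' => hQ _ (hb'.tick _) rfl rfl
  simp only [Expr.eval, BinOp.eval]
  rw [Nat.mod_eq_of_lt h2, show st.reg r₁ + (2 ^ w - st.reg r₂) =
    st.reg r₁ - st.reg r₂ + 2 ^ w by omega, Nat.add_mod_right, Nat.mod_eq_of_lt (by omega)]

end Cmd

section

variable {w X N b a : ℕ} {φ : CNF N} {st : Store} {s : Bool}

theorem Cmd.all_uTest (hW : WideWords w X) (hb : st.Below X) (hφ : HoldsCNF φ st)
    (hL : Layout N φ.length b a st) (h : st.reg 19 ≤ st.reg 34) (h36 : st.reg 36 ≤ 1) :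
    (Cmd.uTest.exec w st).All fun st' => st'.Below X ∧ st'.mem = st.mem ∧
      (∀ r, ¬ (20 ≤ r ∧ r ≤ 28) → r ≠ 36 → st'.reg r = st.reg r) ∧
      st'.reg 36 = st.reg 36 + (uVec φ b (st.reg 32) (st.reg 34 - 2 * (2 ^ b + 1))).toNat := by
  have h4 := hW.four_le
  have h0 : 0 < X := by omega
  have hb2 := hb.1 2
  refine Cmd.all_seq (Cmd.all_set_update hW hb (by simp) (by simp) rfl (hb.1 32)
    fun st₁ hb₁ hm₁ hr₁ => ?_)
  refine Cmd.all_seq (Cmd.all_set_update hW hb₁ (by simpa) (by simp) rfl h0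
    fun st₂ hb₂ hm₂ hr₂ => ?_)
  refine Cmd.all_seq (Cmd.all_set_update hW hb₂ (by simp) (by simp)
    (v := if st.reg 32 < 2 ^ b then b else 0) ?_ ?_ fun st₃ hb₃ hm₃ hr₃ => ?_)
  · simp [hr₁, hr₂, hL.r2, hL.r3]
  · rw [hL.r2] at hb2
    split_ifs <;> omega
  refine Cmd.all_seq (Cmd.all_set_sub hW hb₃ (v := st.reg 34 - 2 * (2 ^ b + 1)) ?_ ?_
    fun st₄ hb₄ hm₄ hr₄ => ?_)
  · simpa [hr₁, hr₂, hr₃] using h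
  · simp [hr₁, hr₂, hr₃, hL.r19]
  have hm : st₄.mem = st.mem := by rw [hm₄, hm₃, hm₂, hm₁]
  have h10 : st₄.reg 10 = st.reg 10 := by simp [hr₁, hr₂, hr₃, hr₄]
  refine Cmd.all_seq ((all_evalClause hW hb₄ (hφ.congr h10 fun x _ => by rw [hm])).mono ?_)
  rintro st₅ ⟨hb₅, hm₅, hr₅, h24⟩
  have h24' : st₅.reg 24 = (!uVec φ b (st.reg 32) (st.reg 34 - 2 * (2 ^ b + 1))).toNat := by
    rw [h24]
    simp [hr₁, hr₂, hr₃, hr₄, uVec]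
  have h36' : st₅.reg 36 = st.reg 36 := by
    rw [hr₅ 36 (by norm_num)]
    simp [hr₁, hr₂, hr₃, hr₄]
  refine Cmd.all_set_update hW hb₅ (by simpa) (by simp)
    (v := st.reg 36 + (uVec φ b (st.reg 32) (st.reg 34 - 2 * (2 ^ b + 1))).toNat) ?_ ?_
    fun st₆ hb₆ hm₆ hr₆ => ⟨hb₆, by rw [hm₆, hm₅, hm], fun r h h' => ?_, ?_⟩
  · simp only [Expr.ival_add, Expr.ival_reg, Expr.ival_eq, Expr.ival_lit, h24', h36']
    cases uVec φ b (st.reg 32) (st.reg 34 - 2 * (2 ^ b + 1)) <;> rfl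
  · have := Bool.toNat_lt (uVec φ b (st.reg 32) (st.reg 34 - 2 * (2 ^ b + 1)))
    omega
  · rw [hr₆, Function.update_of_ne h', hr₅ r (by omega), hr₄, hr₃, hr₂, hr₁,
      Function.update_of_ne (by omega), Function.update_of_ne (by omega),
      Function.update_of_ne (by omega), Function.update_of_ne (by omega)]
  · rw [hr₆, Function.update_self]

theorem Cmd.all_vTest (hW : WideWords w X) (hb : st.Below X) (hφ : HoldsCNF φ st)
    (hL : Layout N φ.length b a st) (h : st.reg 19 ≤ st.reg 32) (h' : st.reg 4 ≤ st.reg 34)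
    (h'' : st.reg 34 < st.reg 19) (h36 : st.reg 36 ≤ 2) :
    (Cmd.vTest.exec w st).All fun st' => st'.Below X ∧ st'.mem = st.mem ∧
      (∀ r, ¬ (20 ≤ r ∧ r ≤ 29) → r ≠ 36 → st'.reg r = st.reg r) ∧
      st'.reg 36 = st.reg 36 +
        (vVec φ b (st.reg 34 - (2 ^ b + 1)) (st.reg 32 - 2 * (2 ^ b + 1))).toNat := by
  have h4 := hW.four_le
  have h0 : 0 < X := by omega
  have hb2 := hb.1 2
  have hb16 := hb.1 16
  have hb17 := hb.1 17
  rw [hL.r2] at hb2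
  rw [hL.r16] at hb16
  rw [hL.r17] at hb17
  refine Cmd.all_seq (Cmd.all_set_sub hW hb (v := st.reg 34 - (2 ^ b + 1)) h' (by rw [hL.r4])
    fun st₀ hb₀ hm₀ hr₀ => ?_)
  refine Cmd.all_seq (Cmd.all_set_update hW hb₀ (by simp) (by simp)
    (v := (st.reg 34 - (2 ^ b + 1)) * 2 ^ b) ?_ ?_ fun st₁ hb₁ hm₁ hr₁ => ?_)
  · simp [hr₀, hL.r3]
  · refine (Nat.mul_le_mul_right _ ?_).trans_lt hb17
    have := hL.r19
    omega
  refine Cmd.all_seq (Cmd.all_set_update hW hb₁ (by simp) (by simp) rfl (hb₁.1 2)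
    fun st₂ hb₂ hm₂ hr₂ => ?_)
  refine Cmd.all_seq (Cmd.all_set_update hW hb₂ (by simp) (by simp)
    (v := if st.reg 34 - (2 ^ b + 1) < 2 ^ b then b + b else b) ?_ ?_ fun st₃ hb₃ hm₃ hr₃ => ?_)
  · simp [hr₀, hr₁, hr₂, hL.r2, hL.r3]
    split_ifs <;> rfl
  · split_ifs <;> omega
  refine Cmd.all_seq (Cmd.all_set_sub hW hb₃ (v := st.reg 32 - 2 * (2 ^ b + 1)) ?_ ?_
    fun st₄ hb₄ hm₄ hr₄ => ?_)
  · simpa [hr₀, hr₁, hr₂, hr₃] using h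
  · simp [hr₀, hr₁, hr₂, hr₃, hL.r19]
  have hm : st₄.mem = st.mem := by rw [hm₄, hm₃, hm₂, hm₁, hm₀]
  have h10 : st₄.reg 10 = st.reg 10 := by simp [hr₀, hr₁, hr₂, hr₃, hr₄]
  refine Cmd.all_seq ((all_evalClause hW hb₄ (hφ.congr h10 fun x _ => by rw [hm])).mono ?_)
  rintro st₅ ⟨hb₅, hm₅, hr₅, h24⟩
  have h24' : st₅.reg 24 =
      (!vVec φ b (st.reg 34 - (2 ^ b + 1)) (st.reg 32 - 2 * (2 ^ b + 1))).toNat := by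
    rw [h24]
    simp [hr₀, hr₁, hr₂, hr₃, hr₄, vVec, hL.r2]
  have h36' : st₅.reg 36 = st.reg 36 := by
    rw [hr₅ 36 (by norm_num)]
    simp [hr₀, hr₁, hr₂, hr₃, hr₄]
  refine Cmd.all_set_update hW hb₅ (by simpa) (by simp) (v := st.reg 36 +
      (vVec φ b (st.reg 34 - (2 ^ b + 1)) (st.reg 32 - 2 * (2 ^ b + 1))).toNat) ?_ ?_
    fun st₆ hb₆ hm₆ hr₆ => ⟨hb₆, by rw [hm₆, hm₅, hm], fun r h h' => ?_, ?_⟩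
  · simp only [Expr.ival_add, Expr.ival_reg, Expr.ival_eq, Expr.ival_lit, h24', h36']
    cases vVec φ b (st.reg 34 - (2 ^ b + 1)) (st.reg 32 - 2 * (2 ^ b + 1)) <;> rfl
  · have := Bool.toNat_lt (vVec φ b (st.reg 34 - (2 ^ b + 1)) (st.reg 32 - 2 * (2 ^ b + 1)))
    omega
  · rw [hr₆, Function.update_of_ne h', hr₅ r (by omega), hr₄, hr₃, hr₂, hr₁, hr₀,
      Function.update_of_ne (by omega), Function.update_of_ne (by omega),
      Function.update_of_ne (by omega), Function.update_of_ne (by omega),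
      Function.update_of_ne (by omega)]
  · rw [hr₆, Function.update_self]

theorem or_rearrange {p₁ p₂ p₃ p₄ p₅ p₆ p₇ p₈ : Prop} :
    ((p₁ ∨ p₂ ∨ p₃ ∨ p₄ ∨ p₅ ∨ p₆) ∨ p₇) ∨ p₈ ↔ p₁ ∨ p₂ ∨ p₃ ∨ p₄ ∨ p₅ ∨ p₇ ∨ p₈ ∨ p₆ := by
  tauto

/-- Register `36` adds up the results of the tests, so it is nonzero iff one of the disjuncts of
`GridAdj` holds. Vectors are evaluated only after the ranges have been tested, which keeps the
subtractions from underflowing. -/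
theorem Cmd.all_edgeTest (hW : WideWords w X) (hb : st.Below X) (hφ : HoldsCNF φ st)
    (hL : Layout N φ.length b a st) :
    ((Cmd.edgeTest s).exec w st).All fun st' => st'.Below X ∧ st'.mem = st.mem ∧
      (∀ r, ¬ (20 ≤ r ∧ r ≤ 29) → ¬ (32 ≤ r ∧ r ≤ 36) → st'.reg r = st.reg r) ∧
      (st'.reg 36 ≠ 0 ↔ NumAdj (2 ^ b + 1) (φ.length + 1) a (uVec φ b) (vVec φ b)
        (initialStage s φ.length) (st.reg 30) (st.reg 31)) := by
  have h4 := hW.four_le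
  have h0 : 0 < X := by omega
  have h1 : 1 < X := by omega
  have hs : (!s).toNat < X := (Bool.toNat_lt _).trans_le (by omega)
  have ha : 0 < a + 1 := by omega
  unfold NumAdj
  set r := st.reg 30 / (a + 1) with hr
  set c := st.reg 30 % (a + 1) with hc
  set r' := st.reg 31 / (a + 1) with hr'
  set c' := st.reg 31 % (a + 1) with hc'
  refine Cmd.all_seq ((?_ : (Cmd.coordinates.exec w st).All fun st' => st'.Below X ∧
    st'.mem = st.mem ∧ (∀ r, ¬ (32 ≤ r ∧ r ≤ 36) → st'.reg r = st.reg r) ∧ st'.reg 32 = r ∧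
    st'.reg 33 = c ∧ st'.reg 34 = r' ∧ st'.reg 35 = c').mono ?_)
  · refine Cmd.all_seq (Cmd.all_set_update hW hb (by simp) (by simp) (v := r) (by simp [hL.r7, hr])
      ((Nat.div_le_self _ _).trans_lt (hb.1 30)) fun st₁ hb₁ hm₁ hr₁ => ?_)
    refine Cmd.all_seq (Cmd.all_set_update hW hb₁ (by simp) (by simp) (v := c) (by simp [hr₁, hL.r7, hc])
      ((Nat.mod_le _ _).trans_lt (hb.1 30)) fun st₂ hb₂ hm₂ hr₂ => ?_)
    refine Cmd.all_seq (Cmd.all_set_update hW hb₂ (by simp) (by simp) (v := r') (by simp [hr₁, hr₂, hL.r7, hr'])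
      ((Nat.div_le_self _ _).trans_lt (hb.1 31)) fun st₃ hb₃ hm₃ hr₃ => ?_)
    refine Cmd.all_set_update hW hb₃ (by simp) (by simp) (v := c') (by simp [hr₁, hr₂, hr₃, hL.r7, hc'])
      ((Nat.mod_le _ _).trans_lt (hb.1 31)) fun st₄ hb₄ hm₄ hr₄ =>
      ⟨hb₄, by rw [hm₄, hm₃, hm₂, hm₁], fun r h => ?_, ?_, ?_, ?_, ?_⟩
    · rw [hr₄, hr₃, hr₂, hr₁,
        Function.update_of_ne (by omega), Function.update_of_ne (by omega),
        Function.update_of_ne (by omega), Function.update_of_ne (by omega)]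
    all_goals simp [hr₁, hr₂, hr₃, hr₄]
  rintro st₁ ⟨hb₁, hm₁, hr₁, h32, h33, h34, h35⟩
  have hL₁ : Layout N φ.length b a st₁ := hL.congr fun r hr => hr₁ r (by omega)
  have hφ₁ : HoldsCNF φ st₁ := hφ.congr (hr₁ 10 (by norm_num)) fun x _ => by rw [hm₁]
  have e1 := hL₁.r1
  have e4 := hL₁.r4
  have e6 := hL₁.r6
  have e8 := hL₁.r8
  have e19 := hL₁.r19
  refine Cmd.all_seq (Cmd.all_set_update hW hb₁ (by simp [Cmd.plainEdge, h0, h1, hs])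
    (by simp [Cmd.plainEdge]) rfl (by simp only [Expr.ival_lt]; split_ifs <;> omega)
    fun st₂ hb₂ hm₂ hr₂ => ?_)
  have hL₂ : Layout N φ.length b a st₂ := hL₁.congr fun r hr => by
    rw [hr₂, Function.update_of_ne (by omega)]
  have hφ₂ : HoldsCNF φ st₂ := hφ₁.congr (by simp [hr₂]) fun x _ => by rw [hm₂]
  have h36 : st₂.reg 36 ≤ 1 := by
    simp only [hr₂, Function.update_self, Expr.ival_lt]
    split_ifs <;> omega
  have h36' : st₂.reg 36 ≠ 0 ↔ (Cmd.plainEdge s).ival st₁ ≠ 0 := by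
    simp [hr₂, Nat.pos_iff_ne_zero]
  have hu : Cmd.uEdge.ival st₂ ≠ 0 ↔ r < 2 ^ b + 1 ∧ c = a ∧ 2 * (2 ^ b + 1) ≤ r' ∧
      r' < 2 * (2 ^ b + 1) + (φ.length + 1) ∧ c' = 0 := by
    simp [Cmd.uEdge, hr₂, h32, h33, h34, h35, e4, e6, e8, e19, and_assoc, Nat.lt_succ_iff]
    tauto
  refine Cmd.all_seq ((?_ : ((Cmd.ite Cmd.uEdge Cmd.uTest Cmd.skip).exec w st₂).All fun st' =>
    st'.Below X ∧ st'.mem = st₂.mem ∧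
    (∀ r, ¬ (20 ≤ r ∧ r ≤ 28) → r ≠ 36 → st'.reg r = st₂.reg r) ∧ st'.reg 36 ≤ 2 ∧
    (st'.reg 36 ≠ 0 ↔ st₂.reg 36 ≠ 0 ∨ Cmd.uEdge.ival st₂ ≠ 0 ∧
      uVec φ b r (r' - 2 * (2 ^ b + 1)) = true)).mono ?_)
  · refine Cmd.all_ite hW hb₂ (by simp [Cmd.uEdge, h0, h1]) (by simp [Cmd.uEdge]) (fun h => ?_)
      fun h => ?_
    · refine (Cmd.all_uTest hW (hb₂.tick _) (hφ₂.congr rfl fun _ _ => rfl)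
        (hL₂.congr fun _ _ => rfl) ?_ h36).mono ?_
      · have := hu.1 h
        simp only [Store.tick, hr₂]
        simp [h34, e19]; omega
      · rintro st₃ ⟨hb₃, hm₃, hr₃, h3⟩
        have e32 : st₂.reg 32 = r := by simp [hr₂, h32]
        have e34 : st₂.reg 34 = r' := by simp [hr₂, h34]
        simp only [Store.tick, e32, e34] at h3
        refine ⟨hb₃.tick _, hm₃, hr₃, ?_, ?_⟩
        · have := Bool.toNat_lt (uVec φ b r (r' - 2 * (2 ^ b + 1)))
          simp only [Store.tick]; omega
        · simp only [Store.tick, h3]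
          cases uVec φ b r (r' - 2 * (2 ^ b + 1)) <;> simp [h]
    · refine ⟨hb₂.tick _, rfl, fun _ _ _ => rfl, ?_, ?_⟩
      · simp only [Store.tick]; omega
      · simp [Store.tick, h]
  rintro st₃ ⟨hb₃, hm₃, hr₃, h3, h3'⟩
  have hL₃ : Layout N φ.length b a st₃ := hL₂.congr fun r hr => hr₃ r (by omega) (by omega)
  have hφ₃ : HoldsCNF φ st₃ := hφ₂.congr (hr₃ 10 (by norm_num) (by norm_num)) fun x _ => by rw [hm₃]
  have f32 : st₃.reg 32 = r := by rw [hr₃ _ (by norm_num) (by norm_num)]; simp [hr₂, h32]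
  have f33 : st₃.reg 33 = c := by rw [hr₃ _ (by norm_num) (by norm_num)]; simp [hr₂, h33]
  have f34 : st₃.reg 34 = r' := by rw [hr₃ _ (by norm_num) (by norm_num)]; simp [hr₂, h34]
  have f35 : st₃.reg 35 = c' := by rw [hr₃ _ (by norm_num) (by norm_num)]; simp [hr₂, h35]
  have hv : Cmd.vEdge.ival st₃ ≠ 0 ↔ 2 * (2 ^ b + 1) ≤ r ∧ r < 2 * (2 ^ b + 1) + (φ.length + 1) ∧
      c = a ∧ 2 ^ b + 1 ≤ r' ∧ r' < 2 * (2 ^ b + 1) ∧ c' = 0 := by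
    simp [Cmd.vEdge, f32, f33, f34, f35, hL₃.r4, hL₃.r6, hL₃.r8, hL₃.r19, and_assoc, Nat.lt_succ_iff]
    tauto
  have hfin {x : ℕ} (hx : x ≠ 0 ↔ st₃.reg 36 ≠ 0 ∨ Cmd.vEdge.ival st₃ ≠ 0 ∧
      vVec φ b (r' - (2 ^ b + 1)) (r - 2 * (2 ^ b + 1)) = true) :
      x ≠ 0 ↔ GridAdj (2 ^ b + 1) (φ.length + 1) a (uVec φ b) (vVec φ b)
        (initialStage s φ.length) r c r' c' := by
    rw [hx, h3', h36', hu, hv]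
    have hp : (Cmd.plainEdge s).ival st₁ ≠ 0 ↔
        (r < 2 * (2 ^ b + 1) + (φ.length + 1) ∧ r' = r ∧ c' = c + 1 ∧ (r < 2 * (2 ^ b + 1) ∨ 0 < c)) ∨
        (r = 2 * (2 ^ b + 1) + (φ.length + 1) ∧ c = 1 ∧ 2 * (2 ^ b + 1) ≤ r' ∧
          r' < 2 * (2 ^ b + 1) + (φ.length + 1) ∧ c' = 1) ∨
        (2 * (2 ^ b + 1) ≤ r ∧ r < 2 * (2 ^ b + 1) + (φ.length + 1) ∧ c = 0 ∧
          r' = 2 * (2 ^ b + 1) + (φ.length + 1) ∧ c' = 1) ∨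
        (r < 2 ^ b + 1 ∧ c = a ∧ r' = 2 * (2 ^ b + 1) + (φ.length + 1) ∧ c' = 0) ∨
        (r = 2 * (2 ^ b + 1) + (φ.length + 1) ∧ c = 0 ∧ r' < 2 ^ b + 1 ∧ c' = 0) ∨
        (2 * (2 ^ b + 1) ≤ r ∧ r < 2 * (2 ^ b + 1) + φ.length ∧ c = 0 ∧ r' = r ∧ c' = a ∧
          s = false) := by
      simp only [Cmd.plainEdge, Expr.ival_add, Expr.ival_mul, Expr.ival_lt, Expr.ival_eq, Expr.ival_reg,
        Expr.ival_lit, h32, h33, h34, h35, e1, e4, e6, e8, e19, ne_eq, Nat.add_eq_zero_iff, Nat.mul_eq_zero,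
        ite_eq_right_iff, one_ne_zero, imp_false, not_and_or, not_or, not_not, Nat.lt_succ_iff,
        and_assoc, or_assoc, Bool.toNat_eq_zero, Bool.not_eq_false']
      simp
    rw [hp]
    have hst : initialStage s φ.length (r - 2 * (2 ^ b + 1)) = true ↔
      r - 2 * (2 ^ b + 1) < φ.length ∧ s = false := by simp [initialStage]
    -- The program compares with `m` instead of `m + 1`, since the additional coordinate never has a
    -- stage edge.
    have hw : (2 * (2 ^ b + 1) ≤ r ∧ r < 2 * (2 ^ b + 1) + φ.length ∧ c = 0 ∧ r' = r ∧ c' = a ∧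
          s = false) ↔ (2 * (2 ^ b + 1) ≤ r ∧ r < 2 * (2 ^ b + 1) + (φ.length + 1) ∧ c = 0 ∧ r' = r ∧
          c' = a ∧ initialStage s φ.length (r - 2 * (2 ^ b + 1)) = true) := by
      rw [hst]
      constructor
      · rintro ⟨h1, h2, h3, h4, h5, h6⟩
        exact ⟨h1, by omega, h3, h4, h5, by omega, h6⟩
      · rintro ⟨h1, h2, h3, h4, h5, h6, h7⟩
        exact ⟨h1, by omega, h3, h4, h5, h7⟩
    rw [hw, GridAdj]
    simp only [and_assoc]
    exact or_rearrange
  refine Cmd.all_ite hW hb₃ (by simp [Cmd.vEdge, h0, h1]) (by simp [Cmd.vEdge]) (fun h => ?_)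
    fun h => ?_
  · obtain ⟨g1, g2, g3, g4, g5, g6⟩ := hv.1 h
    refine (Cmd.all_vTest hW (hb₃.tick _) (hφ₃.congr rfl fun _ _ => rfl)
      (hL₃.congr fun _ _ => rfl) ?_ ?_ ?_ h3).mono ?_
    · simpa only [Store.tick, f32, hL₃.r19] using g1
    · simpa only [Store.tick, f34, hL₃.r4] using g4
    · simpa only [Store.tick, f34, hL₃.r19] using g5
    · rintro st₄ ⟨hb₄, hm₄, hr₄, h4'⟩
      simp only [Store.tick, f32, f34] at h4' hm₄ hr₄
      refine ⟨hb₄.tick _, by simp only [Store.tick, hm₄, hm₃, hm₂, hm₁], fun r h h' => ?_, hfin ?_⟩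
      · simp only [Store.tick]
        rw [hr₄ r h (by omega), hr₃ r (by omega) (by omega), hr₂, Function.update_of_ne (by omega),
          hr₁ r (by omega)]
      · simp only [Store.tick, h4']
        cases vVec φ b (r' - (2 ^ b + 1)) (r - 2 * (2 ^ b + 1)) <;> simp [h]
  · refine ⟨hb₃.tick _, by simp only [Store.tick, hm₃, hm₂, hm₁], fun r h h' => ?_, hfin ?_⟩
    · simp only [Store.tick]
      rw [hr₃ r (by omega) (by omega), hr₂, Function.update_of_ne (by omega),
          hr₁ r (by omega)]
    · simp [Store.tick, h]

end

/-! ### Writing the list of edges into the versioned memory. -/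

/-- The state before the preprocessing is called. -/
def edgeState {n : ℕ} (L : List (Fin n × Fin n)) : State :=
  ⟨0, 0, fun _ => 0, fun x => (L.flatMap fun e => [(e.1 : ℕ), (e.2 : ℕ)]).getD x 0⟩

theorem edgeState_call {n : ℕ} (L : List (Fin n × Fin n)) :
    (edgeState L).call n L.length = DynAlg.start L := rfl

/-- The versioned memory holds a list of edges, and nothing else has happened. -/
structure Built (k : ℕ) {n : ℕ} (st₀ st : Store) (L : List (Fin n × Fin n)) : Prop where
  reg : ∀ r, r < 20 ∨ r = 41 → st.reg r = st₀.reg r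
  low : ∀ a < st₀.reg 10, st.mem a = st₀.mem a
  stamp : ∀ x, st.mem (st₀.reg 10 + 3 * x + 2) = 0
  holds : Holds k st (edgeState L)
  count : st.reg 37 = L.length

section

variable {w X k n N b a : ℕ} {φ : CNF N} {st₀ st : Store} {s : Bool} {L : List (Fin n × Fin n)}

theorem Built.congr {st' : Store} (h : Built k st₀ st L)
    (hm : st'.mem = st.mem) (hr : ∀ r, r < 20 ∨ r = 41 ∨ r = 37 → st'.reg r = st.reg r) :
    Built k st₀ st' L where
  reg r hr' := (hr r (by omega)).trans (h.reg r hr')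
  low x hx := by rw [hm, h.low x hx]
  stamp x := by rw [hm, h.stamp x]
  holds := h.holds.congr (fun x => by
    unfold Store.cell
    rw [hm, hr 10 (by norm_num), hr 41 (by norm_num)]) rfl rfl
  count := (hr 37 (by norm_num)).trans h.count

theorem length_flatMap_pair (L : List (Fin n × Fin n)) :
    (L.flatMap fun e => [(e.1 : ℕ), (e.2 : ℕ)]).length = 2 * L.length := by
  induction L with
  | nil => rfl
  | cons e L ih => simp [ih]; omega

theorem getD_append_pair (l : List ℕ) (u v x : ℕ) :
    (l ++ [u, v]).getD x 0 =
      Function.update (Function.update (fun x => l.getD x 0) l.length u) (l.length + 1) v x := by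
  rcases lt_trichotomy x l.length with h | h | h
  · rw [Function.update_of_ne (by omega), Function.update_of_ne (by omega),
      List.getD_append _ _ _ _ h]
  · rw [Function.update_of_ne (by omega), h, Function.update_self,
      List.getD_append_right _ _ _ _ le_rfl]
    simp
  · by_cases h' : x = l.length + 1
    · rw [h', Function.update_self, List.getD_append_right _ _ _ _ (by omega)]
      simp
    · rw [Function.update_of_ne h', Function.update_of_ne (by omega),
        List.getD_eq_default _ _ (by simp; omega), List.getD_eq_default _ _ h.le]

/-- The number of the stage is zero here, so basic values are written and all stamps stay zero. -/
theorem Cmd.all_emitEdge (hW : WideWords w X) (hk : k < X) (hb : st.Below X)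
    (h : Built k st₀ st L)
    (h41 : st₀.reg 41 = 0) (hX : 2 * L.length + 1 < X) (x y : Fin n) (hx : st.reg 30 = x)
    (hy : st.reg 31 = y) :
    ((Cmd.emitEdge k).exec w st).All fun st' => st'.Below X ∧
      Built k st₀ st' (L ++ [(x, y)]) ∧ st'.reg 30 = x := by
  have h4 := hW.four_le
  have h1 : 1 < X := by omega
  have h2 : 2 < X := by omega
  have hst41 : st.reg 41 = 0 := (h.reg 41 (by norm_num)).trans h41
  refine Cmd.all_seq ((Cmd.all_vstore hW hb hk (x := 2 * L.length) (y := x)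
    ((Expr.eval_eq_ival hW hb (by simp [h2]) (by simp)).trans (by simp [h.count])) (by omega)
    (hx ▸ hb.1 30) (v := .reg 30) fun st' _ _ hr => (hr 30 (by norm_num)).trans hx).mono ?_)
  rintro st₁ ⟨hb₁, he₁, hr₁, hc₁⟩
  refine Cmd.all_seq ((Cmd.all_vstore hW hb₁ hk (x := 2 * L.length + 1) (y := y)
    ((Expr.eval_eq_ival hW hb₁ (by simp [h1, h2]) (by simp)).trans
      (by simp [hr₁ 37 (by norm_num) (by norm_num), h.count])) (by omega)
    (hy ▸ hb.1 31) (v := .reg 31) fun st' _ _ hr => ?_).mono ?_)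
  · exact (hr 31 (by norm_num)).trans ((hr₁ 31 (by norm_num) (by norm_num)).trans hy)
  rintro st₂ ⟨hb₂, he₂, hr₂, hc₂⟩
  have hr (r : ℕ) (h : r ≠ 43) (h' : r ≠ 44) : st₂.reg r = st.reg r :=
    (hr₂ r h h').trans (hr₁ r h h')
  have he := he₁.trans he₂
  have hc37 : st₂.reg 37 = L.length := (hr 37 (by norm_num) (by norm_num)).trans h.count
  refine Cmd.all_set_update hW hb₂ (by simp [h1]) (by simp) (v := L.length + 1) (by simp [hc37])
    (by omega) fun st₃ hb₃ hm₃ hr₃ => ⟨hb₃, ⟨fun r h' => ?_, fun z hz => ?_, fun z => ?_, ?_, ?_⟩, ?_⟩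
  · rw [hr₃, Function.update_of_ne (by omega), hr r (by omega) (by omega), h.reg r h']
  · rw [hm₃, he.low z (by rwa [h.reg 10 (by norm_num)]), h.low z hz]
  · rw [hm₃]
    have h10 := h.reg 10 (by norm_num)
    rcases he.stamp z with h' | h'
    · rw [← h10, h', h10, h.stamp]
    · rw [← h10, h', hst41]
  · have hcell (z : ℕ) : st₃.cell z = st₂.cell z := by
      unfold Store.cell
      rw [hm₃, hr₃, Function.update_of_ne (by norm_num), Function.update_of_ne (by norm_num)]
    refine ⟨fun r hr => ?_, fun z => ?_⟩
    · rw [hcell, hc₂, Function.update_of_ne (by omega), hc₁, Function.update_of_ne (by omega),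
        h.holds.reg r hr]
      rfl
    · have hst := h.holds.mem
      simp only [edgeState] at hst ⊢
      rw [List.flatMap_append, List.flatMap_singleton, getD_append_pair, length_flatMap_pair, hcell,
        hc₂]
      simp only [Function.update_apply, Nat.add_left_cancel_iff, hc₁, hst]
  · rw [hr₃, Function.update_self, List.length_append, List.length_singleton]
  · rw [hr₃, Function.update_of_ne (by norm_num), hr 30 (by norm_num) (by norm_num), hx]

/-- All pairs of vertices are tested. The counters run downwards, so the list is in decreasing
lexicographic order; any order is allowed as an input of the preprocessing. The quadratic time is at
most `2^(2b)` up to polynomial factors and therefore affordable. -/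
theorem Cmd.all_buildGraph (hW : WideWords w X) (hk : k < X) (hb : st.Below X) (hφ : HoldsCNF φ st)
    (hL : Layout N φ.length b a st) (h41 : st.reg 41 = 0) (hz : ∀ x, st.reg 10 ≤ x → st.mem x = 0)
    (hn : 2 * (gridSize (2 ^ b + 1) (φ.length + 1) a * gridSize (2 ^ b + 1) (φ.length + 1) a) + 1 < X) :
    ((Cmd.buildGraph k s).exec w st).All fun st' => st'.Below X ∧
      ∃ L : List (Fin (gridSize (2 ^ b + 1) (φ.length + 1) a) ×
      Fin (gridSize (2 ^ b + 1) (φ.length + 1) a)), Built k st st' L ∧ L.Nodup ∧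
        L.toFinset = gridEdges (2 ^ b + 1) (φ.length + 1) a (uVec φ b) (vVec φ b)
          (initialStage s φ.length) := by
  set n := gridSize (2 ^ b + 1) (φ.length + 1) a with hndef
  set E := gridEdges (2 ^ b + 1) (φ.length + 1) a (uVec φ b) (vVec φ b)
    (initialStage s φ.length) with hE
  have h4 := hW.four_le
  -- A list without repetitions has at most `n^2` entries, so the addresses stay below `X`.
  have hlen {L : List (Fin n × Fin n)} (h : L.Nodup) : 2 * L.length + 1 < X := by
    have := h.length_le_card
    rw [Fintype.card_prod, Fintype.card_fin] at this
    omega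
  refine Cmd.all_seq (Cmd.all_set_update hW hb (by simp; omega) (by simp) rfl (by simp; omega)
    fun st₁ hb₁ hm₁ hr₁ => ?_)
  have hr (r : ℕ) (h : r ≠ 37) : st₁.reg r = st.reg r := by rw [hr₁, Function.update_of_ne h]
  have h9 : (Expr.reg 9).ival st₁ = n := by rw [Expr.ival_reg, hr 9 (by norm_num), hL.r9]
  have hB₁ : Built k st st₁ ([] : List (Fin n × Fin n)) := by
    refine ⟨fun r h => hr r (by omega), fun z _ => by rw [hm₁],
      fun z => by rw [hm₁, hz _ (by omega)], ⟨fun r _ => ?_, fun z => ?_⟩, by simp [hr₁]⟩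
    all_goals
      unfold Store.cell
      rw [hm₁, hz _ (by rw [hr 10 (by norm_num)]; omega)]
      simp [edgeState]
  refine (Cmd.all_loop (fun i st' => ∃ L : List (Fin n × Fin n), Built k st st' L ∧ L.Nodup ∧
    ∀ e, e ∈ L ↔ e ∈ E ∧ i ≤ (e.1 : ℕ)) ?_ hW hb₁ (by simp) (by simp) (by simpa using hb₁.1 9) ?_ ?_ ?_).mono ?_
  · simp [Cmd.Writes, Cmd.edgeTest, Cmd.emitEdge, Cmd.coordinates, Cmd.uTest, Cmd.vTest, Cmd.vstore,
      Cmd.evalClause_writes]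
  · rintro i st' x t ⟨L, hB, h⟩
    exact ⟨L, hB.congr rfl fun r hr => Function.update_of_ne (by omega) _ _, h⟩
  · exact ⟨[], hB₁, List.nodup_nil, fun e => by simp [h9]⟩
  · rintro i st₂ hi hb₂ - h30 ⟨L, hB₂, hnd, hLE⟩
    rw [h9] at hi
    have h9' : (Expr.reg 9).ival st₂ = n := by
      rw [Expr.ival_reg, hB₂.reg 9 (by norm_num), hL.r9]
    -- The list consists of the edges that are at least `(i, j)` in the lexicographic order.
    refine (Cmd.all_loop (fun j st' => ∃ L : List (Fin n × Fin n), Built k st st' L ∧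
      st'.reg 30 = i ∧ L.Nodup ∧ ∀ e, e ∈ L ↔ e ∈ E ∧ (i < (e.1 : ℕ) ∨ (e.1 : ℕ) = i ∧ j ≤ (e.2 : ℕ)))
      ?_ hW hb₂ (by simp) (by simp) (by simpa using hb₂.1 9) ?_ ?_ ?_).mono ?_
    · simp [Cmd.Writes, Cmd.edgeTest, Cmd.emitEdge, Cmd.coordinates, Cmd.uTest, Cmd.vTest, Cmd.vstore,
        Cmd.evalClause_writes]
    · rintro i st' x t ⟨L, hB, h, h'⟩
      exact ⟨L, hB.congr rfl fun r hr => Function.update_of_ne (by omega) _ _,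
        (Function.update_of_ne (by norm_num : (30 : ℕ) ≠ 31) x st'.reg).trans h, h'⟩
    · refine ⟨L, hB₂, h30, hnd, fun e => (hLE e).trans (and_congr_right fun _ => ?_)⟩
      rw [h9']
      have := e.2.2
      omega
    · rintro j st₃ hj hb₃ - h31 ⟨L', hB₃, h30', hnd', hLE'⟩
      rw [h9'] at hj
      refine Cmd.all_seq ((Cmd.all_edgeTest (s := s) hW hb₃ (hφ.congr (hB₃.reg 10 (by norm_num)) hB₃.low)
        (hL.congr fun r hr => hB₃.reg r (.inl hr))).mono ?_)
      rintro st₄ ⟨hb₄, hm₄, hr₄, h36⟩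
      have hB₄ : Built k st st₄ L' := hB₃.congr hm₄ fun r h => hr₄ r (by omega) (by omega)
      rw [h30', h31] at h36
      have hadj : st₄.reg 36 ≠ 0 ↔ ((⟨i, hi⟩, ⟨j, hj⟩) : Fin n × Fin n) ∈ E := by
        rw [h36, hE, mem_gridEdges]
      have hnew (e : Fin n × Fin n) : e = (⟨i, hi⟩, ⟨j, hj⟩) ↔ (e.1 : ℕ) = i ∧ (e.2 : ℕ) = j := by
        rw [Prod.ext_iff, Fin.ext_iff, Fin.ext_iff]
      refine Cmd.all_ite hW hb₄ (by simp) (by simp) (fun h => ?_) fun h => ?_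
      · refine (Cmd.all_emitEdge hW hk (hb₄.tick _) (hB₄.congr rfl fun _ _ => rfl) h41 (hlen hnd')
          ⟨i, hi⟩ ⟨j, hj⟩ ?_ ?_).mono ?_
        · exact (hr₄ 30 (by norm_num) (by norm_num)).trans h30'
        · exact (hr₄ 31 (by norm_num) (by norm_num)).trans h31
        rintro st₅ ⟨hb₅, hB₅, h30''⟩
        have hmem := hadj.1 h
        refine ⟨hb₅.tick _, _, hB₅.congr rfl fun _ _ => rfl, h30'', ?_, ?_⟩
        · refine List.nodup_append.2 ⟨hnd', List.nodup_singleton _, ?_⟩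
          rintro e he e' he' rfl
          rw [List.mem_singleton, hnew] at he'
          have := ((hLE' e).1 he).2
          omega
        · intro e
          rw [List.mem_append, List.mem_singleton, hLE']
          constructor
          · rintro (⟨h1, h2⟩ | rfl)
            · exact ⟨h1, by omega⟩
            · exact ⟨hmem, .inr ⟨rfl, le_rfl⟩⟩
          · rintro ⟨h1, h2⟩
            by_cases he : e = (⟨i, hi⟩, ⟨j, hj⟩)
            · exact .inr he
            · rw [hnew] at he
              exact .inl ⟨h1, by omega⟩
      · have hmem : ((⟨i, hi⟩, ⟨j, hj⟩) : Fin n × Fin n) ∉ E := fun h' => hadj.2 h' h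
        refine ⟨hb₄.tick _, L', hB₄.congr rfl fun _ _ => rfl,
          (hr₄ 30 (by norm_num) (by norm_num)).trans h30', hnd', fun e => (hLE' e).trans ?_⟩
        refine and_congr_right fun h1 => ?_
        have : ¬ ((e.1 : ℕ) = i ∧ (e.2 : ℕ) = j) := fun h' => hmem ((hnew e).2 h' ▸ h1)
        omega
    · rintro st₃ ⟨hb₃, -, L', hB₃, -, hnd', hLE'⟩
      refine ⟨hb₃, L', hB₃, hnd', fun e => (hLE' e).trans (and_congr_right fun _ => ?_)⟩
      omega
  · rintro st₂ ⟨hb₂, -, L, hB₂, hnd, hLE⟩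
    refine ⟨hb₂, L, hB₂, hnd, ?_⟩
    ext e
    rw [List.mem_toFinset, hLE]
    simp

end

/-! ### Choosing a candidate and checking it. -/

namespace Cmd

open Expr

/-- The word that codes the estimate of the eccentricity of the end of a path. -/
def estimateExpr (k : ℕ) : Expr :=
  vload (lit k + (vload (lit 0) + (reg 32 * reg 7 + reg 6)))

/-- Choose a path whose end has a large estimate, and put its number into register `31`. -/
def pick (k : ℕ) : Cmd :=
  seq (set 31 (lit 0)) (loop 32 (reg 3) (ite (lt (reg 15) (estimateExpr k)) (set 31 (reg 32)) skip))

/-- Test whether the assignment in register `20` satisfies all clauses. -/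
def evalFormula : Cmd :=
  seq (set 35 (lit 1)) (loop 34 (reg 1)
    (seq (set 23 (reg 34)) (seq evalClause (set 35 (reg 35 * reg 24)))))

/-- Test whether the partial assignments with numbers in registers `31` and `39` can be extended to
a satisfying assignment. If so, put `1` into register `38`. -/
def verify : Cmd :=
  loop 33 (reg 3) <| seq (set 20 (reg 31 + reg 33 * reg 3 + reg 39 * reg 17)) <|
    seq (set 21 (lit 0)) <| seq (set 22 (reg 18)) <|
    seq evalFormula (set 38 (lt (lit 0) (reg 38 + reg 35)))

end Cmd

section

variable {w X k N b a : ℕ} {φ : CNF N} {st : Store}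

/-- The word that codes the estimate of the eccentricity of the end of a path. -/
def Store.word (k a : ℕ) (st : Store) (u : ℕ) : ℕ := st.cell (k + (st.cell 0 + (u * (a + 1) + a)))

theorem Store.cell_eq {st st' : Store} (hm : st'.mem = st.mem) (h10 : st'.reg 10 = st.reg 10)
    (h41 : st'.reg 41 = st.reg 41) (x : ℕ) : st'.cell x = st.cell x := by
  unfold Store.cell
  rw [hm, h10, h41]

theorem Store.word_eq {st st' : Store} (hm : st'.mem = st.mem) (h10 : st'.reg 10 = st.reg 10)
    (h41 : st'.reg 41 = st.reg 41) (u : ℕ) : st'.word k a u = st.word k a u := by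
  unfold Store.word
  rw [Store.cell_eq hm h10 h41, Store.cell_eq hm h10 h41]

/-- It suffices to keep a single candidate: if all estimates are correct, then every large one
belongs to a vector that can be completed. If none is large, register `31` still contains a valid
number. -/
theorem Cmd.all_pick (hW : WideWords w X) (hk : k < X) (hb : st.Below X) {m : ℕ}
    (hL : Layout N m b a st) :
    ((Cmd.pick k).exec w st).All fun st' => st'.Below X ∧ st'.mem = st.mem ∧
      (∀ r, r ≠ 31 → r ≠ 32 → st'.reg r = st.reg r) ∧ st'.reg 31 < 2 ^ b ∧
      ∀ u < 2 ^ b, st.reg 15 < st.word k a u → st.reg 15 < st.word k a (st'.reg 31) := by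
  have h4 := hW.four_le
  have h0 : 0 < X := by omega
  refine Cmd.all_seq (Cmd.all_set_update hW hb (by simpa) (by simp) rfl h0 fun st₁ hb₁ hm₁ hr₁ => ?_)
  have hr (r : ℕ) (h : r ≠ 31) : st₁.reg r = st.reg r := by rw [hr₁, Function.update_of_ne h]
  have h3 : (Expr.reg 3).ival st₁ = 2 ^ b := by rw [Expr.ival_reg, hr 3 (by norm_num), hL.r3]
  refine (Cmd.all_loop (fun n st' => st'.mem = st.mem ∧ st'.reg 31 < 2 ^ b ∧
      ∀ u < 2 ^ b, n ≤ u → st.reg 15 < st.word k a u → st.reg 15 < st.word k a (st'.reg 31))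
      ?_ hW hb₁ (by simp) (by simp) (by simpa using hb₁.1 3) ?_ ?_ ?_).mono ?_
  · simp [Cmd.Writes]
  · intro n st' x t h
    have e : ((st'.setReg 32 x).tick t).reg 31 = st'.reg 31 :=
      Function.update_of_ne (by norm_num : (31 : ℕ) ≠ 32) x st'.reg
    rw [e]
    exact h
  · refine ⟨hm₁, ?_, fun u hu hn => ?_⟩
    · rw [hr₁, Function.update_self]
      simp
    · rw [h3] at hn; omega
  · rintro n st' hn hb' hr' h32 ⟨hm', h31, hu⟩
    rw [h3] at hn
    have e {r : ℕ} (h : r ≠ 31) (h' : r ≠ 32) : st'.reg r = st.reg r :=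
      (hr' r (by simp only [Cmd.Writes, or_false]; omega)).trans (hr r h)
    have hword : (Cmd.estimateExpr k).ival st' = st.word k a n := by
      rw [← Store.word_eq hm' (e (by norm_num) (by norm_num)) (e (by norm_num) (by norm_num))]
      simp only [Cmd.estimateExpr, Expr.ival_vload, Expr.ival_add, Expr.ival_lit, Expr.ival_mul,
        Expr.ival_reg, h32, Store.word]
      rw [e (r := 7) (by norm_num) (by norm_num), hL.r7, e (r := 6) (by norm_num) (by norm_num), hL.r6]
    have hsafe : (Cmd.estimateExpr k).Safe X := by
      refine Expr.Safe.vload h4 ?_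
      simp only [Expr.safe_add, Expr.safe_lit, Expr.safe_mul, Expr.safe_reg, and_true]
      exact ⟨hk, Expr.Safe.vload h4 (by simpa)⟩
    have h15 : (Expr.reg 15).ival st' = st.reg 15 := e (by norm_num) (by norm_num)
    have hcond : (Expr.lt (.reg 15) (Cmd.estimateExpr k)).ival st' ≠ 0 ↔ st.reg 15 < st.word k a n := by
      rw [Expr.ival_lt, hword, h15]
      simp
    refine Cmd.all_ite hW hb' (by simp [hsafe]) (by simp [Cmd.estimateExpr]) (fun h => ?_) fun h => ?_
    · have h' := hcond.1 h
      refine Cmd.all_set_update hW (hb'.tick _) (by simp) (by simp) (v := n) (by simp [Store.tick, h32])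
        (h32 ▸ hb'.1 32) fun st₂ hb₂ hm₂ hr₂ => ⟨hb₂.tick _, hm₂.trans hm', ?_, ?_⟩
      · simpa [Store.tick, hr₂] using hn
      · intro u _ _ _
        simpa [Store.tick, hr₂] using h'
    · refine ⟨hb'.tick _, hm', h31, fun u hu' hn' ht => ?_⟩
      by_cases hun : u = n
      · subst hun
        exact absurd h (hcond.2 ht)
      · exact hu u hu' (by omega) ht
  · rintro st' ⟨hb', hr', hm', h31, hu⟩
    exact ⟨hb', hm', fun r h h' => (hr' r (by simp only [Cmd.Writes, or_false]; omega)).trans (hr r h), h31,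
      fun u hu' => hu u hu' (Nat.zero_le _)⟩

theorem Cmd.all_evalFormula (hW : WideWords w X) (hb : st.Below X) (hφ : HoldsCNF φ st)
    (h1 : st.reg 1 = φ.length) :
    (Cmd.evalFormula.exec w st).All fun st' => st'.Below X ∧ st'.mem = st.mem ∧
      (∀ r, ¬ (23 ≤ r ∧ r ≤ 28) → r ≠ 34 → r ≠ 35 → st'.reg r = st.reg r) ∧
      st'.reg 35 ≤ 1 ∧ (st'.reg 35 = 1 ↔ ∀ c < φ.length,
        clauseTrue (st.reg 20) (st.reg 21) (st.reg 22) (φ.getD c []) = true) := by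
  have h4 := hW.four_le
  refine Cmd.all_seq (Cmd.all_set_update hW hb (by simp; omega) (by simp) rfl (by simp; omega)
    fun st₁ hb₁ hm₁ hr₁ => ?_)
  have hr (r : ℕ) (h : r ≠ 35) : st₁.reg r = st.reg r := by rw [hr₁, Function.update_of_ne h]
  have h1' : (Expr.reg 1).ival st₁ = φ.length := by rw [Expr.ival_reg, hr 1 (by norm_num), h1]
  refine (Cmd.all_loop (fun n st' => st'.mem = st.mem ∧ st'.reg 35 ≤ 1 ∧ (st'.reg 35 = 1 ↔
      ∀ c < φ.length, n ≤ c →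
        clauseTrue (st.reg 20) (st.reg 21) (st.reg 22) (φ.getD c []) = true))
      ?_ hW hb₁ (by simp) (by simp) (by simpa using hb₁.1 1) ?_ ?_ ?_).mono ?_
  · simp [Cmd.Writes, Cmd.evalClause_writes]
  · intro n st' x t h
    have e : ((st'.setReg 34 x).tick t).reg 35 = st'.reg 35 :=
      Function.update_of_ne (by norm_num : (35 : ℕ) ≠ 34) x st'.reg
    rw [e]
    exact h
  · refine ⟨hm₁, by simp [hr₁], ?_⟩
    simp only [hr₁, Function.update_self, Expr.ival_lit, true_iff]
    intro c hc hn
    rw [h1'] at hn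
    omega
  · rintro n st' hn hb' hr' h34 ⟨hm', h35, hu⟩
    rw [h1'] at hn
    have e {r : ℕ} (h : ¬ (23 ≤ r ∧ r ≤ 28)) (h' : r ≠ 34) (h'' : r ≠ 35) : st'.reg r = st.reg r :=
      (hr' r (by simp only [Cmd.Writes, Cmd.evalClause_writes]; omega)).trans (hr r h'')
    refine Cmd.all_seq (Cmd.all_set_update hW hb' (by simp) (by simp) (v := n) h34
      (h34 ▸ hb'.1 34) fun st₂ hb₂ hm₂ hr₂ => ?_)
    have e₂ {r : ℕ} (h : ¬ (23 ≤ r ∧ r ≤ 28)) (h' : r ≠ 34) (h'' : r ≠ 35) : st₂.reg r = st.reg r := by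
      rw [hr₂, Function.update_of_ne (by omega), e h h' h'']
    refine Cmd.all_seq ((all_evalClause hW hb₂ (hφ.congr (e₂ (by norm_num) (by norm_num) (by norm_num))
      fun x _ => by rw [hm₂, hm'])).mono ?_)
    rintro st₃ ⟨hb₃, hm₃, hr₃, h24⟩
    have h23 : st₂.reg 23 = n := by rw [hr₂, Function.update_self]
    rw [e₂ (by norm_num) (by norm_num) (by norm_num), e₂ (by norm_num) (by norm_num) (by norm_num),
      e₂ (by norm_num) (by norm_num) (by norm_num), h23] at h24
    have h35' : st₃.reg 35 = st'.reg 35 := by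
      rw [hr₃ 35 (by norm_num), hr₂, Function.update_of_ne (by norm_num)]
    set t := clauseTrue (st.reg 20) (st.reg 21) (st.reg 22) (φ.getD n []) with ht
    have hle : st'.reg 35 * t.toNat ≤ 1 := by
      cases t <;> simp [h35]
    refine Cmd.all_set_update hW hb₃ (by simp) (by simp) (v := st'.reg 35 * t.toNat)
      (by simp [h35', h24]) (by omega) fun st₄ hb₄ hm₄ hr₄ =>
      ⟨hb₄, by rw [hm₄, hm₃, hm₂, hm'], by rw [hr₄, Function.update_self]; exact hle, ?_⟩
    rw [hr₄, Function.update_self]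
    have hsplit : (st'.reg 35 * t.toNat = 1) ↔ st'.reg 35 = 1 ∧ t = true := by
      cases t <;> simp
    rw [hsplit, hu]
    constructor
    · rintro ⟨h1, h2⟩ c hc hnc
      by_cases hcn : c = n
      · rw [hcn, ← ht, h2]
      · exact h1 c hc (by omega)
    · intro h
      exact ⟨fun c hc hnc => h c hc (by omega), h n hn le_rfl⟩
  · rintro st' ⟨hb', hr', hm', h35, hu⟩
    refine ⟨hb', hm', fun r h h' h'' => (hr' r (by simp only [Cmd.Writes, Cmd.evalClause_writes]; omega)).trans
      (hr r h''), h35, by simpa using hu⟩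

/-- All `v` are tried, and the complete assignment `u + v 2^b + i 2^(2b)` is tested in the formula
itself. Register `38` is never reset, so it remembers the success of earlier stages. -/
theorem Cmd.all_verify (hW : WideWords w X) (hb : st.Below X) (hφ : HoldsCNF φ st)
    (hL : Layout N φ.length b a st) (h31 : st.reg 31 < 2 ^ b)
    (hα : (st.reg 39 + 1) * (2 ^ b * 2 ^ b) ≤ X) :
    (Cmd.verify.exec w st).All fun st' => st'.Below X ∧ st'.mem = st.mem ∧
      (∀ r, ¬ (20 ≤ r ∧ r ≤ 28) → ¬ (33 ≤ r ∧ r ≤ 35) → r ≠ 38 → st'.reg r = st.reg r) ∧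
      (st'.reg 38 ≠ 0 ↔ st.reg 38 ≠ 0 ∨ ∃ v < 2 ^ b, GoodTriple φ b (st.reg 31) v (st.reg 39)) ∧
      (st.reg 38 ≤ 1 → st'.reg 38 ≤ 1) := by
  have h4 := hW.four_le
  have h0 : 0 < X := by omega
  have h3 : (Expr.reg 3).ival st = 2 ^ b := hL.r3
  refine (Cmd.all_loop (fun n st' => st'.mem = st.mem ∧ (st'.reg 38 ≠ 0 ↔ st.reg 38 ≠ 0 ∨
      ∃ v < 2 ^ b, n ≤ v ∧ GoodTriple φ b (st.reg 31) v (st.reg 39)) ∧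
      (st.reg 38 ≤ 1 → st'.reg 38 ≤ 1))
      ?_ hW hb (by simp) (by simp) (by simpa using hb.1 3) ?_ ?_ ?_).mono ?_
  · simp [Cmd.Writes, Cmd.evalFormula, Cmd.evalClause_writes]
  · intro n st' x t h
    have e : ((st'.setReg 33 x).tick t).reg 38 = st'.reg 38 :=
      Function.update_of_ne (by norm_num : (38 : ℕ) ≠ 33) x st'.reg
    rw [e]
    exact h
  · refine ⟨rfl, (or_iff_left ?_).symm, id⟩
    rintro ⟨v, h1, h2, -⟩
    rw [h3] at h2; omega
  · rintro n st' hn hb' hr' h33 ⟨hm', hu, hle⟩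
    rw [h3] at hn
    have e {r : ℕ} (h : ¬ (20 ≤ r ∧ r ≤ 28)) (h' : ¬ (33 ≤ r ∧ r ≤ 35)) (h'' : r ≠ 38) :
        st'.reg r = st.reg r :=
      hr' r (by simp only [Cmd.Writes, Cmd.evalFormula, Cmd.evalClause_writes]; omega)
    have hαn : st.reg 31 + n * 2 ^ b + st.reg 39 * (2 ^ b * 2 ^ b) < X := by
      have : (n + 1) * 2 ^ b ≤ 2 ^ b * 2 ^ b := Nat.mul_le_mul_right _ hn
      rw [add_one_mul] at this hα
      omega
    refine Cmd.all_seq (Cmd.all_set_update hW hb' (by simp) (by simp)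
      (v := st.reg 31 + n * 2 ^ b + st.reg 39 * (2 ^ b * 2 ^ b)) ?_ hαn fun st₁ hb₁ hm₁ hr₁ => ?_)
    · simp only [Expr.ival_add, Expr.ival_mul, Expr.ival_reg, h33]
      rw [e (by norm_num) (by norm_num) (by norm_num), e (by norm_num) (by norm_num) (by norm_num),
        e (by norm_num) (by norm_num) (by norm_num), e (by norm_num) (by norm_num) (by norm_num),
        hL.r3, hL.r17]
    refine Cmd.all_seq (Cmd.all_set_update hW hb₁ (by simpa) (by simp) rfl h0 fun st₂ hb₂ hm₂ hr₂ => ?_)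
    refine Cmd.all_seq (Cmd.all_set_update hW hb₂ (by simp) (by simp) (v := N) ?_
      (hL.r18 ▸ hb.1 18) fun st₃ hb₃ hm₃ hr₃ => ?_)
    · simp [hr₂, hr₁]
      rw [e (by norm_num) (by norm_num) (by norm_num), hL.r18]
    have hm : st₃.mem = st.mem := by rw [hm₃, hm₂, hm₁, hm']
    have e₃ {r : ℕ} (h : ¬ (20 ≤ r ∧ r ≤ 28)) : st₃.reg r = st'.reg r := by
      rw [hr₃, hr₂, hr₁, Function.update_of_ne (by omega), Function.update_of_ne (by omega),
        Function.update_of_ne (by omega)]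
    refine Cmd.all_seq ((Cmd.all_evalFormula hW hb₃ (φ := φ) (hφ.congr ?_ fun x _ => by rw [hm]) ?_).mono ?_)
    · rw [e₃ (by norm_num), e (by norm_num) (by norm_num) (by norm_num)]
    · rw [e₃ (by norm_num), e (by norm_num) (by norm_num) (by norm_num), hL.r1]
    rintro st₄ ⟨hb₄, hm₄, hr₄, h35, h35'⟩
    have hgood : st₄.reg 35 = 1 ↔ GoodTriple φ b (st.reg 31) n (st.reg 39) := by
      rw [h35']
      simp [hr₃, hr₂, hr₁, GoodTriple]
    have h38 : st₄.reg 38 = st'.reg 38 := by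
      rw [hr₄ _ (by norm_num) (by norm_num) (by norm_num), e₃ (by norm_num)]
    refine Cmd.all_set_update hW hb₄ (by simpa) (by simp) rfl (by simp only [Expr.ival_lt]; split_ifs <;> omega)
      fun st₅ hb₅ hm₅ hr₅ => ⟨hb₅, by rw [hm₅, hm₄, hm], ?_, fun _ => ?_⟩
    · have : st₅.reg 38 ≠ 0 ↔ st'.reg 38 ≠ 0 ∨ st₄.reg 35 = 1 := by
        simp [hr₅, h38]
        omega
      rw [this, hu, hgood, or_assoc]
      refine or_congr_right ⟨?_, ?_⟩
      · rintro (⟨v, h1, h2, h3⟩ | h)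
        · exact ⟨v, h1, by omega, h3⟩
        · exact ⟨n, hn, le_rfl, h⟩
      · rintro ⟨v, h1, h2, h3⟩
        by_cases hv : v = n
        · exact .inr (hv ▸ h3)
        · exact .inl ⟨v, h1, by omega, h3⟩
    · rw [hr₅, Function.update_self, Expr.ival_lt]
      split_ifs <;> omega
  · rintro st' ⟨hb', hr', hm', hu, hle⟩
    refine ⟨hb', hm', fun r h h' h'' => hr' r (by
      simp only [Cmd.Writes, Cmd.evalFormula, Cmd.evalClause_writes]; omega), by simpa using hu, hle⟩

end

/-! ### Simulating the operations of a stage. -/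

theorem SimSetup.congr {w w' X k j : ℕ} {P : Program} {st st' : Store}
    (H : SimSetup w w' X k j P st) (h : st'.reg 11 = st.reg 11) : SimSetup w w' X k j P st' :=
  ⟨H.wide, H.le, H.lt, H.two_le, H.k_lt, h.trans H.word, H.fits, H.length_lt, H.budget⟩

theorem Holds.tick {k : ℕ} {st : Store} {s : State} (h : Holds k st s) (t : ℕ) :
    Holds k (st.tick t) s :=
  h.congr (Store.cell_tick t) rfl rfl

/-- What a stage may change. -/
structure StageRel (st st' : Store) : Prop where
  reg : ∀ r, r < 20 ∨ r = 38 ∨ r = 39 ∨ r = 41 → st'.reg r = st.reg r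
  low : ∀ a < st.reg 10, st'.mem a = st.mem a
  base : 0 < st.reg 41 → ∀ x, st'.mem (st.reg 10 + 3 * x) = st.mem (st.reg 10 + 3 * x)
  stamp : ∀ x, st'.mem (st.reg 10 + 3 * x + 2) = st.mem (st.reg 10 + 3 * x + 2) ∨
    st'.mem (st.reg 10 + 3 * x + 2) = st.reg 41

namespace StageRel

variable {st st' st'' : Store}

theorem refl (st : Store) : StageRel st st :=
  ⟨fun _ _ => rfl, fun _ _ => rfl, fun _ _ => rfl, fun _ => .inl rfl⟩

theorem trans (h : StageRel st st') (h' : StageRel st' st'') : StageRel st st'' := by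
  have h10 : st'.reg 10 = st.reg 10 := h.reg 10 (by norm_num)
  have h41 : st'.reg 41 = st.reg 41 := h.reg 41 (by norm_num)
  obtain ⟨h1, h2, h3, h4⟩ := h'
  rw [h10] at h2 h3 h4
  rw [h41] at h3 h4
  refine ⟨fun r hr => (h1 r hr).trans (h.reg r hr), fun a ha => (h2 a ha).trans (h.low a ha),
    fun h0 x => (h3 h0 x).trans (h.base h0 x), fun x => ?_⟩
  rcases h4 x with h5 | h5
  · rw [h5]; exact h.stamp x
  · exact .inr h5

theorem of_evolves (h : Evolves st st') : StageRel st st' :=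
  ⟨fun r hr => h.reg r (by omega), h.low, h.base, h.stamp⟩

theorem of_mem_eq (hm : st'.mem = st.mem)
    (hr : ∀ r, r < 20 ∨ r = 38 ∨ r = 39 ∨ r = 41 → st'.reg r = st.reg r) : StageRel st st' :=
  ⟨hr, fun _ _ => by rw [hm], fun _ _ => by rw [hm], fun _ => .inl (by rw [hm])⟩

end StageRel

/-- The actions of the updates of a stage. -/
def updateActs (P : Program) (w' T : ℕ) (x y : ℕ → ℕ) (v : ℕ → Bool) (s : Bool) : ℕ → List Act
  | 0 => []
  | c + 1 => (bif v c == s then callAct (x c) (y c) :: List.replicate T (stepAct P w') else []) ++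
      updateActs P w' T x y v s c

namespace Cmd

open Expr

/-- The update for the coordinate in register `30`. -/
def update (k : ℕ) (s : Bool) (P : Program) : Cmd :=
  ite (Expr.eq (reg 24) (lit (!s).toNat))
    (simCall k P (reg 13) ((reg 19 + reg 30) * reg 7) ((reg 19 + reg 30) * reg 7 + reg 6)) skip

/-- Decide on the update for the coordinate in register `30`. -/
def stageClause : Cmd :=
  seq (set 20 (reg 39 * reg 17)) <| seq (set 21 (reg 16)) <| seq (set 22 (reg 18)) <|
    seq (set 23 (reg 30)) evalClause

def updateStep (k : ℕ) (s : Bool) (P : Program) : Cmd := seq stageClause (update k s P)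

/-- A stage. -/
def stage (k : ℕ) (s : Bool) (P Q : Program) : Cmd :=
  seq (set 41 (reg 39 + lit 1)) <| seq (loop 30 (reg 1) (updateStep k s P)) <|
    seq (simCall k Q (reg 13) (lit 0) (lit 0)) (seq (pick k) verify)

theorem vstore_writes {k r : ℕ} {e v : Expr} (h : (vstore k e v).Writes r) : r = 43 ∨ r = 44 := by
  simpa [vstore, Writes] using h

theorem simInstr_writes {k r : ℕ} {i : Instr} (h : (simInstr k i).Writes r) :
    r = 40 ∨ 42 ≤ r ∧ r ≤ 44 := by
  cases i <;> simp only [simInstr, vstore, Writes, or_false] at h <;> omega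

theorem simStep_writes {k r : ℕ} {P : Program} {j : ℕ} (h : (simStep k P j).Writes r) :
    r = 40 ∨ 42 ≤ r ∧ r ≤ 44 := by
  induction P generalizing j with
  | nil => exact h.elim
  | cons i P ih => exact h.elim simInstr_writes ih

theorem simCall_writes {k r : ℕ} {P : Program} {e x y : Expr} (h : (simCall k P e x y).Writes r) :
    40 ≤ r ∧ r ≤ 45 ∧ r ≠ 41 := by
  rcases h with h | h | h | h | h
  · have := vstore_writes h; omega
  · have := vstore_writes h; omega
  · have : r = 40 := h
    omega
  · have : r = 45 := h
    omega
  · have := simStep_writes h; omega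

end Cmd

section

variable {w w' X k N b a : ℕ} {φ : CNF N} {st st₁ : Store} {s : Bool} {P Q : Program}

/-- Register `24` is one iff the clause is satisfied, that is, iff the entry of `w` is zero. So the
edge is updated iff register `24` is the negation of `s`. -/
theorem Cmd.all_stageClause (hW : WideWords w X) (hb : st.Below X) (hφ : HoldsCNF φ st)
    (hL : Layout N φ.length b a st) (hα : (st.reg 39 + 1) * (2 ^ b * 2 ^ b) ≤ X)
    (h30 : st.reg 30 < φ.length) :
    (Cmd.stageClause.exec w st).All fun st' => st'.Below X ∧ st'.mem = st.mem ∧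
      (∀ r, ¬ (20 ≤ r ∧ r ≤ 28) → st'.reg r = st.reg r) ∧
      ∀ s : Bool, ((Expr.eq (.reg 24) (.lit (!s).toNat)).ival st' ≠ 0 ↔
        wVec φ b (st.reg 39) (st.reg 30) = s) := by
  have hpos : 0 < 2 ^ b * 2 ^ b := by positivity
  refine Cmd.all_seq (Cmd.all_set_update hW hb (by simp) (by simp)
    (v := st.reg 39 * (2 ^ b * 2 ^ b)) (by simp [hL.r17]) (by rw [add_one_mul] at hα; omega)
    fun st₁ hb₁ hm₁ hr₁ => ?_)
  refine Cmd.all_seq (Cmd.all_set_update hW hb₁ (by simp) (by simp) (v := b + b)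
    (by simp [hr₁, hL.r16]) (hL.r16 ▸ hb.1 16) fun st₂ hb₂ hm₂ hr₂ => ?_)
  refine Cmd.all_seq (Cmd.all_set_update hW hb₂ (by simp) (by simp) (v := N)
    (by simp [hr₂, hr₁, hL.r18]) (hL.r18 ▸ hb.1 18) fun st₃ hb₃ hm₃ hr₃ => ?_)
  refine Cmd.all_seq (Cmd.all_set_update hW hb₃ (by simp) (by simp) (v := st.reg 30)
    (by simp [hr₃, hr₂, hr₁]) (hb.1 30) fun st₄ hb₄ hm₄ hr₄ => ?_)
  have hm : st₄.mem = st.mem := by rw [hm₄, hm₃, hm₂, hm₁]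
  refine (all_evalClause hW hb₄ (hφ.congr (by simp [hr₄, hr₃, hr₂, hr₁]) fun x _ => by rw [hm])).mono ?_
  rintro st₅ ⟨hb₅, hm₅, hr₅, h24⟩
  refine ⟨hb₅, by rw [hm₅, hm], fun r hr => ?_, fun s => ?_⟩
  · rw [hr₅ r (by omega), hr₄, hr₃, hr₂, hr₁, Function.update_of_ne (by omega),
      Function.update_of_ne (by omega), Function.update_of_ne (by omega),
      Function.update_of_ne (by omega)]
  · simp [hr₄, hr₃, hr₂, hr₁] at h24
    simp only [Expr.ival_eq, Expr.ival_reg, Expr.ival_lit, h24, wVec, h30, decide_true, Bool.true_and,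
      List.getD_eq_getElem?_getD]
    cases clauseTrue (st.reg 39 * (2 ^ b * 2 ^ b)) (b + b) N (φ[st.reg 30]?.getD []) <;> cases s <;>
      simp

/-- The numbers of the ends of the edge for a coordinate. -/
theorem stageEdge_val {p d a : ℕ} (ha : 1 ≤ a) (c : Fin d) :
    ((stageEdge (p := p) ha c).1 : ℕ) = (2 * p + c) * (a + 1) ∧
      ((stageEdge (p := p) ha c).2 : ℕ) = (2 * p + c) * (a + 1) + a :=
  ⟨rfl, rfl⟩

theorem Cmd.le_expect_update (H : SimSetup w w' X k 13 P st) (hL : Layout N φ.length b a st)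
    (ha : 1 ≤ a) (hb : st.Below X) {c : ℕ} (hc : c < φ.length) (h30 : st.reg 30 = c) {v : Bool}
    (h24 : (Expr.eq (.reg 24) (.lit (!s).toNat)).ival st ≠ 0 ↔ v = s) {σ : State}
    (hh : Holds k st σ) (G : State → Prop) (l : List Act) (f : Store → ℝ≥0∞)
    (hf : ∀ st' σ', st'.Below X → Evolves st st' → Holds k st' σ' → prob G l σ' ≤ f st') :
    prob G ((bif v == s then callAct ((2 * (2 ^ b + 1) + c) * (a + 1))
        ((2 * (2 ^ b + 1) + c) * (a + 1) + a) :: List.replicate (st.reg 13) (stepAct P w') else []) ++ l) σ ≤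
      ((Cmd.update k s P).exec w st).expect f := by
  have hW := H.wide
  have h4 := hW.four_le
  have hs : (!s).toNat < X := (Bool.toNat_lt _).trans_le (by omega)
  -- The number of `c_V` is less than the number of vertices, which register `9` contains.
  have hn : (2 * (2 ^ b + 1) + c) * (a + 1) + a < X := by
    have h1 := (stageEdge (p := 2 ^ b + 1) ha (⟨c, by omega⟩ : Fin (φ.length + 1))).2.2
    rw [(stageEdge_val ha _).2] at h1
    have h2 := hb.1 9
    rw [hL.r9] at h2
    exact h1.trans h2
  unfold Cmd.update
  rw [Cmd.exec, Expr.eval_eq_ival hW hb (by simpa) (by simp)]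
  split_ifs with h
  · have hv : (v == s) = false := by simpa using fun h' => h24.2 h' h
    rw [hv, cond_false, List.nil_append]
    exact hf _ σ (hb.tick _) ((Evolves.refl st).tick _) (hh.tick _)
  · have hv : (v == s) = true := by simpa using h24.1 h
    rw [hv, cond_true, List.cons_append, CoinTree.expect_bind]
    refine le_expect_simCall (st₀ := st) (H := H) (st := st.tick _) ?_ ?_ (by omega) hn G l
      _ ?_ (hb.tick _) ((Evolves.refl st).tick _) (hh.tick _)
    · intro st' hb' _ hr
      rw [Expr.eval_eq_ival hW hb' (by simp) (by simp)]
      simp only [Expr.ival_mul, Expr.ival_add, Expr.ival_reg, hr 19 (by norm_num), hr 30 (by norm_num),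
        hr 7 (by norm_num), Store.tick, hL.r19, hL.r7, h30]
    · intro st' hb' _ hr
      rw [Expr.eval_eq_ival hW hb' (by simp) (by simp)]
      simp only [Expr.ival_mul, Expr.ival_add, Expr.ival_reg, hr 19 (by norm_num), hr 30 (by norm_num),
        hr 7 (by norm_num), hr 6 (by norm_num), Store.tick, hL.r19, hL.r7, hL.r6, h30]
    · intro st' σ' h
      exact hf _ σ' (h.below.tick 2) (h.evolves.tick 2) (h.holds.tick 2)

theorem Cmd.all_update (H : SimSetup w w' X k 13 P st) (hL : Layout N φ.length b a st)
    (ha : 1 ≤ a) (hb : st.Below X) (h30 : st.reg 30 < φ.length) :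
    ((Cmd.update k s P).exec w st).All fun st' => st'.Below X ∧ Evolves st st' := by
  have hW := H.wide
  have h4 := hW.four_le
  have hs : (!s).toNat < X := (Bool.toNat_lt _).trans_le (by omega)
  have hn : (2 * (2 ^ b + 1) + st.reg 30) * (a + 1) + a < X := by
    have h1 := (stageEdge (p := 2 ^ b + 1) ha (⟨st.reg 30, by omega⟩ : Fin (φ.length + 1))).2.2
    rw [(stageEdge_val ha _).2] at h1
    have h2 := hb.1 9
    rw [hL.r9] at h2
    exact h1.trans h2
  refine Cmd.all_ite hW hb (by simpa) (by simp) (fun h => ?_)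
    fun h => ⟨hb.tick _, (Evolves.refl st).tick _⟩
  refine (all_simCall (st₀ := st) (H := H) (st := st.tick _) (a := (2 * (2 ^ b + 1) + st.reg 30) * (a + 1))
    (b := (2 * (2 ^ b + 1) + st.reg 30) * (a + 1) + a) ?_ ?_ (by omega) hn
      (hb.tick _) ((Evolves.refl st).tick _)).mono fun st' h => ⟨h.1.tick _, h.2.tick _⟩
  · intro st' hb' _ hr
    rw [Expr.eval_eq_ival hW hb' (by simp) (by simp)]
    simp only [Expr.ival_mul, Expr.ival_add, Expr.ival_reg, hr 19 (by norm_num), hr 30 (by norm_num),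
      hr 7 (by norm_num), Store.tick, hL.r19, hL.r7]
  · intro st' hb' _ hr
    rw [Expr.eval_eq_ival hW hb' (by simp) (by simp)]
    simp only [Expr.ival_mul, Expr.ival_add, Expr.ival_reg, hr 19 (by norm_num), hr 30 (by norm_num),
      hr 7 (by norm_num), hr 6 (by norm_num), Store.tick, hL.r19, hL.r7, hL.r6]

/-- The counter runs downwards, so the updates come in the order of `updateActs` and `stageOps`, the
last coordinate first. The actions `l` are those of the query. -/
theorem Cmd.le_expect_iter_updateStep (H : SimSetup w w' X k 13 P st₁) (hφ : HoldsCNF φ st₁)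
    (hL : Layout N φ.length b a st₁) (ha : 1 ≤ a) (hα : (st₁.reg 39 + 1) * (2 ^ b * 2 ^ b) ≤ X)
    (G : State → Prop) (l : List Act) (f : Store → ℝ≥0∞)
    (hf : ∀ st' σ', st'.Below X → StageRel st₁ st' → Holds k st' σ' → prob G l σ' ≤ f st')
    {c : ℕ} (hc : c ≤ φ.length) (hb : st.Below X) (hrel : StageRel st₁ st) {σ : State}
    (hh : Holds k st σ) :
    prob G (updateActs P w' (st₁.reg 13) (fun c => (2 * (2 ^ b + 1) + c) * (a + 1))
        (fun c => (2 * (2 ^ b + 1) + c) * (a + 1) + a) (wVec φ b (st₁.reg 39)) s c ++ l) σ ≤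
      (Cmd.iter ((Cmd.updateStep k s P).exec w) 30 c st).expect f := by
  have hW := H.wide
  induction c generalizing st σ with
  | zero => exact hf _ _ (hb.tick 1) (hrel.trans (.of_mem_eq rfl fun _ _ => rfl)) (hh.tick 1)
  | succ c ih =>
    have hX : φ.length < X := by
      have := hb.1 1
      rwa [hrel.reg 1 (by norm_num), hL.r1] at this
    rw [Cmd.iter, updateActs, List.append_assoc, CoinTree.expect_bind, Cmd.updateStep, Cmd.exec,
      CoinTree.expect_bind]
    set st₂ := (st.setReg 30 c).tick 3 with hst₂
    have hr₂ (r : ℕ) (h : r ≠ 30) : st₂.reg r = st.reg r := Function.update_of_ne h _ _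
    have h30 : st₂.reg 30 = c := by simp [hst₂, Store.setReg, Store.tick]
    have hrel₂ : StageRel st₁ st₂ := hrel.trans (.of_mem_eq rfl fun r h => hr₂ r (by omega))
    have hb₂ : st₂.Below X := (hb.setReg (by omega) 30).tick 3
    refine (Cmd.all_stageClause hW hb₂ (hφ.congr (hrel₂.reg 10 (by norm_num)) hrel₂.low)
      (hL.congr fun r hr => hrel₂.reg r (.inl hr)) (by rwa [hrel₂.reg 39 (by norm_num)])
      (by omega)).le_expect ?_
    rintro st₃ ⟨hb₃, hm₃, hr₃, h24⟩
    have hrel₃ : StageRel st₁ st₃ := hrel₂.trans (.of_mem_eq hm₃ fun r h => hr₃ r (by omega))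
    have h24 := h24 s
    rw [hrel₂.reg 39 (by norm_num), h30] at h24
    have hh₃ : Holds k st₃ σ := hh.congr (fun x => Store.cell_eq hm₃
      ((hr₃ 10 (by norm_num)).trans (hr₂ 10 (by norm_num)))
      ((hr₃ 41 (by norm_num)).trans (hr₂ 41 (by norm_num))) x) rfl rfl
    rw [← hrel₃.reg 13 (by norm_num)]
    refine Cmd.le_expect_update (H.congr (hrel₃.reg 11 (by norm_num)))
      (hL.congr fun r hr => hrel₃.reg r (.inl hr)) ha hb₃ hc
      ((hr₃ 30 (by norm_num)).trans h30) h24 hh₃ G _ _ fun st₄ σ' hb₄ he₄ hh₄ => ?_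
    rw [hrel₃.reg 13 (by norm_num)]
    exact ih (by omega) (hb₄.tick 2)
      (hrel₃.trans ((StageRel.of_evolves he₄).trans (.of_mem_eq rfl fun _ _ => rfl))) (hh₄.tick 2)

theorem Cmd.all_updates (H : SimSetup w w' X k 13 P st) (hφ : HoldsCNF φ st)
    (hL : Layout N φ.length b a st) (ha : 1 ≤ a) (hα : (st.reg 39 + 1) * (2 ^ b * 2 ^ b) ≤ X)
    (hb : st.Below X) :
    ((Cmd.loop 30 (.reg 1) (Cmd.updateStep k s P)).exec w st).All fun st' =>
      st'.Below X ∧ StageRel st st' := by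
  have hW := H.wide
  refine (Cmd.all_loop (fun _ st' => StageRel st st') ?_ hW hb (by simp) (by simp)
    (by simpa using hb.1 1) ?_ (.refl st) ?_).mono fun st' h => ⟨h.1, h.2.2⟩
  · rintro (h | h | h | h)
    any_goals simp [Cmd.stageClause, Cmd.Writes, Cmd.evalClause_writes] at h
    have := Cmd.simCall_writes h
    omega
  · intro _ st' x t h
    exact h.trans (.of_mem_eq rfl fun r hr => Function.update_of_ne (by omega) _ _)
  · rintro c st₂ hc hb₂ - h30 hrel₂
    rw [Expr.ival_reg, hL.r1] at hc
    refine Cmd.all_seq ((Cmd.all_stageClause hW hb₂ (hφ.congr (hrel₂.reg 10 (by norm_num)) hrel₂.low)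
      (hL.congr fun r hr => hrel₂.reg r (.inl hr)) (by rwa [hrel₂.reg 39 (by norm_num)])
      (by omega)).mono ?_)
    rintro st₃ ⟨hb₃, hm₃, hr₃, -⟩
    have hrel₃ : StageRel st st₃ := hrel₂.trans (.of_mem_eq hm₃ fun r h => hr₃ r (by omega))
    refine (Cmd.all_update (H.congr (hrel₃.reg 11 (by norm_num)))
      (hL.congr fun r hr => hrel₃.reg r (.inl hr)) ha hb₃
      (by rw [hr₃ 30 (by norm_num)]; omega)).mono fun st₄ h => ⟨h.1, hrel₃.trans (.of_evolves h.2)⟩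

end

/-! ### The search through all stages. -/

/-- The store is ready for the stages before the `n`-th: outside the changes that were made by other
stages, the versioned memory holds `σ`. -/
structure Ready (k n : ℕ) (st₀ st : Store) (σ : State) : Prop where
  reg : ∀ r < 20, st.reg r = st₀.reg r
  low : ∀ a < st₀.reg 10, st.mem a = st₀.mem a
  baseReg : ∀ r < k, st.mem (st₀.reg 10 + 3 * r) = σ.reg r
  baseMem : ∀ x, st.mem (st₀.reg 10 + 3 * (k + x)) = σ.mem x
  stamp : ∀ x, st.mem (st₀.reg 10 + 3 * x + 2) = 0 ∨ n < st.mem (st₀.reg 10 + 3 * x + 2)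

/-- The word that codes the estimate of the eccentricity of the end of a path. -/
def WordRAM.State.word (a : ℕ) (σ : State) (u : ℕ) : ℕ := σ.mem (σ.reg 0 + (u * (a + 1) + a))

/-- The actions of the operations of a stage. -/
def stageActs (P Q : Program) (w' T : ℕ) (b a : ℕ) (v : ℕ → Bool) (s : Bool) (m : ℕ) : List Act :=
  updateActs P w' T (fun c => (2 * (2 ^ b + 1) + c) * (a + 1))
    (fun c => (2 * (2 ^ b + 1) + c) * (a + 1) + a) v s m ++
    (callAct 0 0 :: List.replicate T (stepAct Q w'))

/-- The estimates after a query show that there is a satisfying assignment. -/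
def Reveals {N : ℕ} (φ : CNF N) (b a thr i : ℕ) (σ : State) : Prop :=
  (∃ u < 2 ^ b, thr < σ.word a u) ∧
    ∀ u < 2 ^ b, thr < σ.word a u → ∃ v < 2 ^ b, GoodTriple φ b u v i

section

variable {w w' X k N b a i : ℕ} {φ : CNF N} {st st₀ : Store} {s : Bool} {P Q : Program} {σ : State}

theorem Ready.congr {n : ℕ} {st' : Store} (h : Ready k n st₀ st σ) (hm : st'.mem = st.mem)
    (hr : ∀ r < 20, st'.reg r = st.reg r) : Ready k n st₀ st' σ :=
  ⟨fun r h' => (hr r h').trans (h.reg r h'), fun x h' => by rw [hm, h.low x h'],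
    fun r h' => by rw [hm, h.baseReg r h'], fun x => by rw [hm, h.baseMem x], fun x => by
      rw [hm]; exact h.stamp x⟩

/-- This is the rollback: all stamps are zero or larger than the current number, so no current value
counts and every cell shows its basic value. -/
theorem Ready.holds {n : ℕ} (h : Ready k n st₀ st σ) (h41 : st.reg 41 = n) (hn : 0 < n) :
    Holds k st σ := by
  have key (x : ℕ) : st.cell x = st.mem (st₀.reg 10 + 3 * x) := by
    unfold Store.cell
    rw [h.reg 10 (by norm_num), h41, if_neg, add_zero]
    have := h.stamp x
    omega
  exact ⟨fun r hr => (key r).trans (h.baseReg r hr), fun x => (key _).trans (h.baseMem x)⟩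

/-- The stage for `i` leaves the basic values alone and uses the stamp `i + 1`. As the stages run
downwards, all stamps left behind exceed the numbers of the stages before it in the numbering. -/
theorem Ready.of_stageRel {st' : Store} (h : Ready k (i + 1) st₀ st σ) (hrel : StageRel st st')
    (h41 : st.reg 41 = i + 1) : Ready k i st₀ st' σ := by
  have h10 := h.reg 10 (by norm_num)
  have hpos : 0 < st.reg 41 := by omega
  refine ⟨fun r hr => (hrel.reg r (.inl hr)).trans (h.reg r hr), fun x hx => ?_, fun r hr => ?_,
    fun x => ?_, fun x => ?_⟩
  · rw [hrel.low x (by rwa [h10]), h.low x hx]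
  · rw [← h10, hrel.base hpos, h10, h.baseReg r hr]
  · rw [← h10, hrel.base hpos, h10, h.baseMem]
  · have h1 := hrel.stamp x
    rw [h10] at h1
    have h2 := h.stamp x
    omega

/-- The initialization is complete. -/
structure Initialized (w w' X k b a : ℕ) {N : ℕ} (φ : CNF N) (A : Program) (P Q : Program)
    (st : Store) : Prop where
  below : st.Below X
  cnf : HoldsCNF φ st
  layout : Layout N φ.length b a st
  stage : st.reg 41 = 0
  empty : ∀ x, st.reg 10 ≤ x → st.mem x = 0
  size : 2 * (gridSize (2 ^ b + 1) (φ.length + 1) a * gridSize (2 ^ b + 1) (φ.length + 1) a) + 1 < X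
  prep : SimSetup w w' X k 12 A st
  update : SimSetup w w' X k 13 P st
  query : SimSetup w w' X k 13 Q st
  stages : st.reg 14 = 2 ^ (N - (b + b))
  two_mul_le : b + b ≤ N
  pow_le : 2 ^ N ≤ X
  one_le : 1 ≤ a

variable {A : Program}

theorem Initialized.succ_mul_le (H : Initialized w w' X k b a φ A P Q st₀) (hi : i < 2 ^ (N - (b + b))) :
    (i + 1) * (2 ^ b * 2 ^ b) ≤ X := by
  refine le_trans ?_ H.pow_le
  calc (i + 1) * (2 ^ b * 2 ^ b) ≤ 2 ^ (N - (b + b)) * (2 ^ b * 2 ^ b) := Nat.mul_le_mul_right _ hi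
    _ = 2 ^ N := by rw [← pow_add, ← pow_add, Nat.sub_add_cancel H.two_mul_le]

theorem Cmd.all_pick_verify (H : Initialized w w' X k b a φ A P Q st₀)
    (hb : st.Below X) (hφ : HoldsCNF φ st) (hL : Layout N φ.length b a st)
    (hi : i < 2 ^ (N - (b + b))) (h39 : st.reg 39 = i) :
    ((Cmd.seq (Cmd.pick k) Cmd.verify).exec w st).All fun st' => st'.Below X ∧ st'.mem = st.mem ∧
      (∀ r, r < 20 ∨ r = 39 ∨ r = 41 → st'.reg r = st.reg r) ∧ (st.reg 38 ≤ 1 → st'.reg 38 ≤ 1) ∧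
      (st.reg 38 ≠ 0 → st'.reg 38 ≠ 0) ∧
      (st'.reg 38 ≠ 0 → st.reg 38 ≠ 0 ∨ ∃ u < 2 ^ b, ∃ v < 2 ^ b, GoodTriple φ b u v i) ∧
      ∀ σ, Holds k st σ → 0 < k → Reveals φ b a (st.reg 15) i σ → st'.reg 38 ≠ 0 := by
  have hW := H.prep.wide
  refine Cmd.all_seq ((Cmd.all_pick hW H.prep.k_lt hb hL).mono ?_)
  rintro st₁ ⟨hb₁, hm₁, hr₁, h31, hu⟩
  refine (Cmd.all_verify hW hb₁ (hφ.congr (hr₁ 10 (by norm_num) (by norm_num)) fun x _ => by rw [hm₁])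
    (hL.congr fun r hr => hr₁ r (by omega) (by omega)) h31 ?_).mono ?_
  · rw [hr₁ 39 (by norm_num) (by norm_num), h39]
    exact H.succ_mul_le hi
  rintro st₂ ⟨hb₂, hm₂, hr₂, h38, hle⟩
  rw [hr₁ 39 (by norm_num) (by norm_num), h39, hr₁ 38 (by norm_num) (by norm_num)] at h38
  rw [hr₁ 38 (by norm_num) (by norm_num)] at hle
  refine ⟨hb₂, by rw [hm₂, hm₁], fun r hr => ?_, hle, fun h => h38.2 (.inl h), fun h => ?_, ?_⟩
  · rw [hr₂ r (by omega) (by omega) (by omega), hr₁ r (by omega) (by omega)]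
  · exact (h38.1 h).imp_right fun h' => ⟨_, h31, h'⟩
  · rintro σ hh hk ⟨⟨u, hu1, hu2⟩, h2⟩
    have hword (u : ℕ) : st.word k a u = σ.word a u := by
      unfold Store.word State.word
      rw [hh.reg 0 hk, hh.mem]
    have := hu u hu1 (by rwa [hword])
    rw [hword] at this
    exact h38.2 (.inr (h2 _ h31 this))

/-- This holds for every outcome, also if the simulated algorithm errs or does not halt within its
budget: the basic state survives, success is never revoked, and it is reported only for a triple
that was verified. -/
theorem Cmd.all_stage (H : Initialized w w' X k b a φ A P Q st₀) (hb : st.Below X)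
    (hR : Ready k (i + 1) st₀ st σ) (hi : i < 2 ^ (N - (b + b))) (h39 : st.reg 39 = i) :
    ((Cmd.stage k s P Q).exec w st).All fun st' => st'.Below X ∧ Ready k i st₀ st' σ ∧
      (st.reg 38 ≤ 1 → st'.reg 38 ≤ 1) ∧ (st.reg 38 ≠ 0 → st'.reg 38 ≠ 0) ∧
      (st'.reg 38 ≠ 0 → st.reg 38 ≠ 0 ∨ ∃ u < 2 ^ b, ∃ v < 2 ^ b, GoodTriple φ b u v i) := by
  have hW := H.prep.wide
  have h4 := hW.four_le
  have hX := H.below.1 14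
  rw [H.stages] at hX
  refine Cmd.all_seq (Cmd.all_set_update hW hb (by simp; omega) (by simp) (v := i + 1) (by simp [h39])
    (by omega) fun st₁ hb₁ hm₁ hr₁ => ?_)
  have hr₁' (r : ℕ) (h : r ≠ 41) : st₁.reg r = st.reg r := by rw [hr₁, Function.update_of_ne h]
  have h41 : st₁.reg 41 = i + 1 := by rw [hr₁, Function.update_self]
  have h39' : st₁.reg 39 = i := (hr₁' 39 (by norm_num)).trans h39
  have hR₁ : Ready k (i + 1) st₀ st₁ σ := hR.congr hm₁ fun r h => hr₁' r (by omega)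
  have hφ {st : Store} (h : StageRel st₁ st) : HoldsCNF φ st := by
    refine (H.cnf.congr (hR₁.reg 10 (by norm_num)) hR₁.low).congr (h.reg 10 (by norm_num)) h.low
  have hL {st : Store} (h : StageRel st₁ st) : Layout N φ.length b a st :=
    H.layout.congr fun r hr => (h.reg r (.inl hr)).trans (hR₁.reg r hr)
  refine Cmd.all_seq ((Cmd.all_updates (H.update.congr (hR₁.reg 11 (by norm_num))) (hφ (.refl _)) (hL (.refl _))
    H.one_le (by rw [h39']; exact H.succ_mul_le hi) hb₁).mono ?_)
  rintro st₂ ⟨hb₂, hrel₂⟩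
  refine Cmd.all_seq ((all_simCall (st₀ := st₂) (H.query.congr ((hrel₂.reg 11 (by norm_num)).trans
    (hR₁.reg 11 (by norm_num)))) (a := 0) (b := 0) (fun _ _ _ _ => Nat.zero_mod _) (fun _ _ _ _ => Nat.zero_mod _)
    (by omega) (by omega) hb₂ (.refl st₂)).mono ?_)
  rintro st₃ ⟨hb₃, he₃⟩
  have hrel₃ : StageRel st₁ st₃ := hrel₂.trans (.of_evolves he₃)
  have h38 : st₃.reg 38 = st.reg 38 := (hrel₃.reg 38 (by norm_num)).trans (hr₁' 38 (by norm_num))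
  refine (Cmd.all_pick_verify H hb₃ (hφ hrel₃) (hL hrel₃) hi
    ((hrel₃.reg 39 (by norm_num)).trans h39')).mono ?_
  rintro st₄ ⟨hb₄, hm₄, hr₄, h1, h2, h3, -⟩
  rw [h38] at h1 h2 h3
  exact ⟨hb₄, (hR₁.of_stageRel hrel₃ h41).congr hm₄ fun r hr => hr₄ r (.inl hr), h1, h2, h3⟩

/-- The stage starts from the basic state `σ` by `Ready.holds`. If the simulated query ends with
revealing estimates, then the picked vector has a completion, which the verification finds with
certainty. -/
theorem Cmd.le_expect_stage (H : Initialized w w' X k b a φ A P Q st₀) (hb : st.Below X)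
    (hR : Ready k (i + 1) st₀ st σ) (hi : i < 2 ^ (N - (b + b))) (h39 : st.reg 39 = i) :
    prob (Reveals φ b a (st₀.reg 15) i)
        (stageActs P Q w' (st₀.reg 13) b a (wVec φ b i) s φ.length) σ ≤
      ((Cmd.stage k s P Q).exec w st).expect fun st' => if st'.reg 38 = 0 then 0 else 1 := by
  have hW := H.prep.wide
  have h4 := hW.four_le
  have hX := H.below.1 14
  rw [H.stages] at hX
  rw [Cmd.stage, Cmd.exec, CoinTree.expect_bind]
  refine (Cmd.all_set_update (Q := fun st₁ => st₁.Below X ∧ st₁.mem = st.mem ∧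
    st₁.reg = Function.update st.reg 41 (i + 1)) hW hb (by simp; omega) (by simp) (v := i + 1) (by simp [h39])
    (by omega) fun st₁ hb₁ hm₁ hr₁ => ⟨hb₁, hm₁, hr₁⟩).le_expect ?_
  rintro st₁ ⟨hb₁, hm₁, hr₁⟩
  have hr₁' (r : ℕ) (h : r ≠ 41) : st₁.reg r = st.reg r := by rw [hr₁, Function.update_of_ne h]
  have h41 : st₁.reg 41 = i + 1 := by rw [hr₁, Function.update_self]
  have h39' : st₁.reg 39 = i := (hr₁' 39 (by norm_num)).trans h39
  have hR₁ : Ready k (i + 1) st₀ st₁ σ := hR.congr hm₁ fun r h => hr₁' r (by omega)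
  have hφ {st : Store} (h : StageRel st₁ st) : HoldsCNF φ st := by
    refine (H.cnf.congr (hR₁.reg 10 (by norm_num)) hR₁.low).congr (h.reg 10 (by norm_num)) h.low
  have hL {st : Store} (h : StageRel st₁ st) : Layout N φ.length b a st :=
    H.layout.congr fun r hr => (h.reg r (.inl hr)).trans (hR₁.reg r hr)
  have h13 : st₁.reg 13 = st₀.reg 13 := hR₁.reg 13 (by norm_num)
  have h1 : (Expr.reg 1).eval w st₁ = φ.length := (hL (.refl _)).r1
  have hlen : φ.length < X := (hL (.refl st₁)).r1 ▸ hb₁.1 1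
  rw [Cmd.exec, CoinTree.expect_bind, Cmd.exec, h1, stageActs, ← h13, ← h39']
  refine Cmd.le_expect_iter_updateStep (H.update.congr (hR₁.reg 11 (by norm_num))) (hφ (.refl _))
    (hL (.refl _)) H.one_le (by rw [h39']; exact H.succ_mul_le hi) _ _ _ ?_ le_rfl
    ((hb₁.setReg hlen 30).tick _) (.of_mem_eq rfl fun r hr => Function.update_of_ne (by omega) _ _)
    (Holds.tick ((hR₁.holds h41 (by omega)).congr (st' := st₁.setReg 30 φ.length)
      (fun x => Store.cell_eq rfl
        (Function.update_of_ne (by norm_num : (10 : ℕ) ≠ 30) φ.length st₁.reg)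
        (Function.update_of_ne (by norm_num : (41 : ℕ) ≠ 30) φ.length st₁.reg) x) rfl rfl) _)
  intro st₂ σ₂ hb₂ hrel₂ hh₂
  rw [Cmd.exec, CoinTree.expect_bind, ← List.append_nil (List.replicate _ _), ← hrel₂.reg 13 (by norm_num)]
  refine le_expect_simCall (st₀ := st₂) (H.query.congr ((hrel₂.reg 11 (by norm_num)).trans
    (hR₁.reg 11 (by norm_num)))) (fun _ _ _ _ => Nat.zero_mod _) (fun _ _ _ _ => Nat.zero_mod _)
    (by omega) (by omega) _ _ _ ?_ hb₂ (.refl st₂) hh₂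
  intro st₃ σ₃ h₃
  have hrel₃ : StageRel st₁ st₃ := hrel₂.trans (.of_evolves h₃.evolves)
  rw [prob]
  split_ifs with hG
  · refine (Cmd.all_pick_verify H h₃.below (hφ hrel₃) (hL hrel₃) hi
      ((hrel₃.reg 39 (by norm_num)).trans h39')).le_expect ?_
    rintro st₄ ⟨-, -, -, -, -, -, h5⟩
    rw [if_neg]
    refine h5 _ h₃.holds (by have := H.prep.two_le; omega) ?_
    rwa [hrel₃.reg 15 (by norm_num), hR₁.reg 15 (by norm_num), ← h39']
  · exact zero_le

open Classical in
/-- A loop reaches its aim with some probability, if one of its repetitions does. -/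
theorem Cmd.le_expect_iter {J F : ℕ → Store → Prop} {body : Store → CoinTree Store} {r i : ℕ}
    {c : ℝ≥0∞} {f : Store → ℝ≥0∞}
    (hJ : ∀ n st, i < n → J (n + 1) st →
      (body ((st.setReg r n).tick 3)).All fun st' => J n (st'.tick 2))
    (hi : ∀ st, J (i + 1) st →
      c ≤ (body ((st.setReg r i).tick 3)).expect fun st' => if F i (st'.tick 2) then 1 else 0)
    (hF : ∀ n st, n < i → F (n + 1) st →
      (body ((st.setReg r n).tick 3)).All fun st' => F n (st'.tick 2))
    (h0 : ∀ st, F 0 st → 1 ≤ f (st.tick 1)) {n : ℕ} (hn : i < n) {st : Store} (h : J n st) :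
    c ≤ (Cmd.iter body r n st).expect f := by
  -- After the success of repetition `i` nothing random matters any more: `F` persists until the
  -- end.
  have key (n : ℕ) (hn : n ≤ i) (st : Store) (h : F n st) : 1 ≤ (Cmd.iter body r n st).expect f := by
    induction n generalizing st with
    | zero => exact h0 st h
    | succ n ih =>
      rw [Cmd.iter, CoinTree.expect_bind]
      exact (hF n st (by omega) h).le_expect fun st' h' => ih (by omega) _ h'
  induction n generalizing st with
  | zero => omega
  | succ n ih =>
    rw [Cmd.iter, CoinTree.expect_bind]
    by_cases hni : n = i
    · subst hni
      -- The outcomes of repetition `i` with `F` are continued with certain success, the others are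
      -- counted as failures.
      refine (hi st h).trans ((CoinTree.all_of_forall (Q := fun _ => True) (fun _ => trivial) _).expect_le
        fun st' _ => ?_)
      split_ifs with h'
      · exact key n le_rfl _ h'
      · exact zero_le
    · exact (hJ n st (by omega) h).le_expect fun st' h' => ih (by omega) h'

namespace Cmd

open Expr

/-- All stages. -/
def stages (k : ℕ) (s : Bool) (P Q : Program) : Cmd := loop 39 (reg 14) (stage k s P Q)

/-- The program after the initialization. -/
def main (k : ℕ) (s : Bool) (A P Q : Program) : Cmd :=
  seq (buildGraph k s) <| seq (simCall k A (reg 12) (reg 9) (reg 37)) <|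
    seq (set 38 (lit 0)) <| seq (stages k s P Q) (set 0 (reg 38))

end Cmd

/-- The state of the search for a satisfying assignment. -/
structure Searching (X k n : ℕ) {N : ℕ} (φ : CNF N) (st₀ st : Store) (σ : State) : Prop where
  below : st.Below X
  ready : Ready k n st₀ st σ
  le_one : st.reg 38 ≤ 1
  sound : st.reg 38 ≠ 0 → φ.Satisfiable

theorem Searching.congr {n : ℕ} {st' : Store} (h : Searching X k n φ st₀ st σ) (hb : st'.Below X)
    (hm : st'.mem = st.mem) (hr : ∀ r, r < 20 ∨ r = 38 → st'.reg r = st.reg r) :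
    Searching X k n φ st₀ st' σ :=
  ⟨hb, h.ready.congr hm fun r h => hr r (.inl h), hr 38 (by norm_num) ▸ h.le_one,
    hr 38 (by norm_num) ▸ h.sound⟩

theorem Searching.all_stage (H : Initialized w w' X k b a φ A P Q st₀)
    (hi : i < 2 ^ (N - (b + b))) (h : Searching X k (i + 1) φ st₀ st σ) :
    ((Cmd.stage k s P Q).exec w ((st.setReg 39 i).tick 3)).All fun st' =>
      Searching X k i φ st₀ (st'.tick 2) σ ∧ (st.reg 38 ≠ 0 → (st'.tick 2).reg 38 ≠ 0) := by
  have hX := H.below.1 14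
  rw [H.stages] at hX
  set st₁ := (st.setReg 39 i).tick 3 with hst₁
  have h38 : st₁.reg 38 = st.reg 38 := by simp [hst₁, Store.setReg, Store.tick]
  have h₁ := h.congr (st' := st₁) ((h.below.setReg (by omega) _).tick _) rfl
    fun r hr => Function.update_of_ne (by omega) _ _
  refine (Cmd.all_stage H h₁.below h₁.ready hi (by simp [hst₁, Store.setReg, Store.tick])).mono ?_
  rintro st₂ ⟨hb₂, hR₂, h1, h2, h3⟩
  rw [h38] at h1 h2 h3
  refine ⟨⟨hb₂.tick _, hR₂.congr rfl fun _ _ => rfl, h1 h.le_one, fun h' => ?_⟩, h2⟩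
  rcases h3 h' with h4 | ⟨u, hu, v, hv, h4⟩
  · exact h.sound h4
  · exact (satisfiable_iff_goodTriple H.two_mul_le).2 ⟨i, hi, u, hu, v, hv, h4⟩

theorem Cmd.all_stages (H : Initialized w w' X k b a φ A P Q st₀)
    (h : Searching X k (2 ^ (N - (b + b))) φ st₀ st σ) :
    ((Cmd.stages k s P Q).exec w st).All fun st' => Searching X k 0 φ st₀ st' σ := by
  have h14 : (Expr.reg 14).eval w st = 2 ^ (N - (b + b)) :=
    (h.ready.reg 14 (by norm_num)).trans H.stages
  have hX := H.below.1 14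
  rw [H.stages] at hX
  rw [Cmd.stages, Cmd.exec, h14]
  refine Cmd.all_iter (I := fun n st' => n ≤ 2 ^ (N - (b + b)) ∧ Searching X k n φ st₀ st' σ) ?_ ?_ _ _
    ⟨le_rfl, h.congr ((h.below.setReg hX _).tick _) rfl fun r hr => Function.update_of_ne (by omega) _ _⟩
  · rintro n st' ⟨hn, h'⟩
    exact (h'.all_stage H (by omega)).mono fun st'' h'' => ⟨by omega, h''.1⟩
  · rintro st' ⟨-, h'⟩
    exact h'.congr (h'.below.tick _) rfl fun _ _ => rfl

theorem Cmd.le_expect_stages (H : Initialized w w' X k b a φ A P Q st₀)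
    (hi : i < 2 ^ (N - (b + b))) (h : Searching X k (2 ^ (N - (b + b))) φ st₀ st σ) :
    prob (Reveals φ b a (st₀.reg 15) i)
        (stageActs P Q w' (st₀.reg 13) b a (wVec φ b i) s φ.length) σ ≤
      ((Cmd.stages k s P Q).exec w st).expect fun st' => if st'.reg 38 = 0 then 0 else 1 := by
  have h14 : (Expr.reg 14).eval w st = 2 ^ (N - (b + b)) :=
    (h.ready.reg 14 (by norm_num)).trans H.stages
  have hX := H.below.1 14
  rw [H.stages] at hX
  rw [Cmd.stages, Cmd.exec, h14]
  refine Cmd.le_expect_iter (i := i)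
    (J := fun n st' => n ≤ 2 ^ (N - (b + b)) ∧ Searching X k n φ st₀ st' σ)
    (F := fun n st' => Searching X k n φ st₀ st' σ ∧ st'.reg 38 ≠ 0) ?_ ?_ ?_ ?_ hi
    ⟨le_rfl, h.congr ((h.below.setReg hX _).tick _) rfl fun r hr => Function.update_of_ne (by omega) _ _⟩
  · rintro n st' - ⟨hn, h'⟩
    exact (h'.all_stage H (by omega)).mono fun st'' h'' => ⟨by omega, h''.1⟩
  · rintro st' ⟨-, h'⟩
    set st₁ := (st'.setReg 39 i).tick 3 with hst₁
    have h₁ := h'.congr (st' := st₁) ((h'.below.setReg (by omega) _).tick _) rfl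
      fun r hr => Function.update_of_ne (by omega) _ _
    refine (Cmd.le_expect_stage H h₁.below h₁.ready hi (by simp [hst₁, Store.setReg, Store.tick])).trans
      ((h'.all_stage H hi).expect_le fun st'' h'' => ?_)
    by_cases h38 : st''.reg 38 = 0
    · simp [h38]
    · rw [if_neg h38, if_pos ⟨h''.1, h38⟩]
  · rintro n st' hn ⟨h', h38⟩
    exact (h'.all_stage H (by omega)).mono fun st'' h'' => ⟨h''.1, h''.2 h38⟩
  · rintro st' ⟨h', h38⟩
    have h38 : (st'.tick 1).reg 38 ≠ 0 := h38
    rw [if_neg h38]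

/-- The preprocessing is simulated in stage zero, where only basic values are written and all stamps
remain zero. Thus its final state becomes the basic state for all stages. -/
theorem Initialized.searching (H : Initialized w w' X k b a φ A P Q st₀) {n : ℕ} {L : List (Fin n × Fin n)}
    {st₁ st₂ st₃ : Store} (hB : Built k st₀ st₁ L) (he : Evolves st₁ st₂) (hb₃ : st₃.Below X)
    (hm₃ : st₃.mem = st₂.mem) (hr₃ : st₃.reg = Function.update st₂.reg 38 0) {σ : State}
    (hσ : Holds k st₂ σ) (j : ℕ) : Searching X k j φ st₀ st₃ σ := by
  have h10 : st₁.reg 10 = st₀.reg 10 := hB.reg 10 (by norm_num)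
  have h41 : st₁.reg 41 = 0 := (hB.reg 41 (by norm_num)).trans H.stage
  have hcell (x : ℕ) : st₂.cell x = st₂.mem (st₀.reg 10 + 3 * x) := by
    unfold Store.cell
    rw [he.reg 10 (by norm_num), h10, if_neg, add_zero]
    rw [he.reg 41 (by norm_num), h41]
    simp
  refine ⟨hb₃, ⟨fun r hr => ?_, fun x hx => ?_, fun r hr => ?_, fun x => ?_, fun x => .inl ?_⟩, ?_, ?_⟩
  · rw [hr₃, Function.update_of_ne (by omega), he.reg r (by omega), hB.reg r (.inl hr)]
  · rw [hm₃, he.low x (by rwa [h10]), hB.low x hx]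
  · rw [hm₃, ← hcell, hσ.reg r hr]
  · rw [hm₃, ← hcell, hσ.mem]
  · rw [hm₃]
    have h1 := he.stamp x
    rw [h10, h41, hB.stamp, or_self] at h1
    exact h1
  · simp [hr₃]
  · simp [hr₃]

/-- One-sided error: nothing is assumed about the correctness of the dynamic algorithm, because
every acceptance has been verified. -/
theorem Cmd.all_main (H : Initialized w w' X k b a φ A P Q st) :
    ((Cmd.main k s A P Q).exec w st).All fun st' => st'.reg 0 ≠ 0 → φ.Satisfiable := by
  have hW := H.prep.wide
  have h4 := hW.four_le
  refine Cmd.all_seq ((Cmd.all_buildGraph hW H.prep.k_lt H.below H.cnf H.layout H.stage H.empty H.size).mono ?_)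
  rintro st₁ ⟨hb₁, L, hB, -, -⟩
  refine Cmd.all_seq ((all_simCall (st₀ := st₁) (H.prep.congr (hB.reg 11 (by norm_num)))
    (x := .reg 9) (y := .reg 37) (a := st₁.reg 9) (b := st₁.reg 37) (fun _ _ _ hr => hr 9 (by norm_num))
    (fun _ _ _ hr => hr 37 (by norm_num)) (hb₁.1 9) (hb₁.1 37) hb₁ (.refl st₁)).mono ?_)
  rintro st₂ ⟨hb₂, he⟩
  -- For soundness any basic state will do, so it is read off from the cells.
  refine Cmd.all_seq (Cmd.all_set_update hW hb₂ (by simp; omega) (by simp) (v := 0) rfl (by omega)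
    fun st₃ hb₃ hm₃ hr₃ => Cmd.all_seq ((Cmd.all_stages H (H.searching hB he hb₃ hm₃ hr₃
      (σ := ⟨0, 0, st₂.cell, fun x => st₂.cell (k + x)⟩) ⟨fun _ _ => rfl, fun _ => rfl⟩ _)).mono ?_))
  intro st₄ h₄
  refine Cmd.all_set_update hW h₄.below (by simp) (by simp) (v := st₄.reg 38) rfl (h₄.below.1 38)
    fun st₅ hb₅ hm₅ hr₅ => ?_
  rw [hr₅, Function.update_self]
  exact h₄.sound

/-- Only the preprocessing and the stage for `i` appear in the assumption. The other stages
influence neither the basic state nor a success already achieved, so their random bits are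
irrelevant. -/
theorem Cmd.le_expect_main (H : Initialized w w' X k b a φ A P Q st)
    (hi : i < 2 ^ (N - (b + b))) {c : ℝ≥0∞}
    (hc : ∀ L : List (Fin (gridSize (2 ^ b + 1) (φ.length + 1) a) ×
        Fin (gridSize (2 ^ b + 1) (φ.length + 1) a)), L.Nodup →
      L.toFinset = gridEdges (2 ^ b + 1) (φ.length + 1) a (uVec φ b) (vVec φ b)
        (initialStage s φ.length) →
      c ≤ prob (Reveals φ b a (st.reg 15) i) (List.replicate (st.reg 12) (stepAct A w') ++
        stageActs P Q w' (st.reg 13) b a (wVec φ b i) s φ.length) (DynAlg.start L)) :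
    c ≤ ((Cmd.main k s A P Q).exec w st).expect fun st' => if st'.reg 0 = 1 then 1 else 0 := by
  have hW := H.prep.wide
  have h4 := hW.four_le
  rw [Cmd.main, Cmd.exec, CoinTree.expect_bind]
  refine (Cmd.all_buildGraph hW H.prep.k_lt H.below H.cnf H.layout H.stage H.empty H.size).le_expect ?_
  rintro st₁ ⟨hb₁, L, hB, hnd, hL⟩
  refine (hc L hnd hL).trans ?_
  rw [← edgeState_call]
  have h12 : st₁.reg 12 = st.reg 12 := hB.reg 12 (by norm_num)
  rw [Cmd.exec, CoinTree.expect_bind, ← h12]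
  have h9 : st₁.reg 9 = gridSize (2 ^ b + 1) (φ.length + 1) a := by
    rw [hB.reg 9 (by norm_num), H.layout.r9]
  refine le_trans ?_ (le_expect_simCall (st₀ := st₁) (H.prep.congr (hB.reg 11 (by norm_num)))
    (x := .reg 9) (y := .reg 37) (a := st₁.reg 9) (b := st₁.reg 37) (fun _ _ _ hr => hr 9 (by norm_num))
    (fun _ _ _ hr => hr 37 (by norm_num)) (hb₁.1 9) (hb₁.1 37) (Reveals φ b a (st.reg 15) i)
    (stageActs P Q w' (st.reg 13) b a (wVec φ b i) s φ.length) _ ?_ hb₁ (.refl st₁) hB.holds)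
  · rw [prob]
    simp only [callAct]
    rw [ENNReal.add_div, ENNReal.add_halves, h9, hB.count]
  intro st₂ σ h₂
  rw [Cmd.exec, CoinTree.expect_bind]
  refine (Cmd.all_set_update (Q := fun st₃ => st₃.Below X ∧ st₃.mem = st₂.mem ∧
    st₃.reg = Function.update st₂.reg 38 0) hW h₂.below (by simp; omega) (by simp) (v := 0) rfl (by omega)
    fun st₃ hb₃ hm₃ hr₃ => ⟨hb₃, hm₃, hr₃⟩).le_expect ?_
  rintro st₃ ⟨hb₃, hm₃, hr₃⟩
  have h₃ := H.searching hB h₂.evolves hb₃ hm₃ hr₃ h₂.holds (2 ^ (N - (b + b)))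
  rw [Cmd.exec, CoinTree.expect_bind]
  refine (Cmd.le_expect_stages H hi h₃).trans ((Cmd.all_stages H h₃).expect_le fun st₄ h₄ => ?_)
  split_ifs with h38
  · exact zero_le
  · refine (Cmd.all_set_update hW h₄.below (by simp) (by simp) (v := st₄.reg 38) rfl (h₄.below.1 38)
      (Q := fun st₅ => st₅.reg 0 = 1) fun st₅ hb₅ hm₅ hr₅ => ?_).le_expect fun st₅ h₅ => ?_
    · rw [hr₅, Function.update_self]
      have := h₄.le_one
      omega
    · rw [if_pos h₅]

end

/-! ## Bounds up to polynomial factors -/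

section

variable {ι : Type*} {N f f' g g' : ι → ℕ}

/-- The function `f` is at most `g`, up to a polynomial in `N`. -/
def PolyTimes (N g f : ι → ℕ) : Prop := ∃ C, ∀ i, f i ≤ C * (N i + 1) ^ C * g i

namespace PolyTimes

theorem mono (h : PolyTimes N g f) (hg : ∀ i, g i ≤ g' i) : PolyTimes N g' f :=
  let ⟨C, hC⟩ := h
  ⟨C, fun i => (hC i).trans (Nat.mul_le_mul_left _ (hg i))⟩

theorem of_le (hf : ∀ i, f i ≤ g i) : PolyTimes N g f :=
  ⟨1, fun i => (hf i).trans (by rw [one_mul]; exact Nat.le_mul_of_pos_left _ (by positivity))⟩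

theorem add (h : PolyTimes N g f) (h' : PolyTimes N g f') : PolyTimes N g fun i => f i + f' i := by
  obtain ⟨C, hC⟩ := h
  obtain ⟨C', hC'⟩ := h'
  refine ⟨C + C', fun i => ?_⟩
  rw [add_mul, add_mul]
  refine Nat.add_le_add ((hC i).trans ?_) ((hC' i).trans ?_) <;>
    exact Nat.mul_le_mul_right _ (Nat.mul_le_mul_left _ (Nat.pow_le_pow_right (by omega) (by omega)))

theorem mul (h : PolyTimes N g f) (h' : PolyTimes N g' f') :
    PolyTimes N (fun i => g i * g' i) fun i => f i * f' i := by
  obtain ⟨C, hC⟩ := h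
  obtain ⟨C', hC'⟩ := h'
  refine ⟨C * C' + (C + C'), fun i => ?_⟩
  calc f i * f' i ≤ (C * (N i + 1) ^ C * g i) * (C' * (N i + 1) ^ C' * g' i) := Nat.mul_le_mul (hC i) (hC' i)
    _ = (C * C') * (N i + 1) ^ (C + C') * (g i * g' i) := by rw [pow_add]; ring
    _ ≤ _ := Nat.mul_le_mul_right _ (Nat.mul_le_mul (by omega)
      (Nat.pow_le_pow_right (by omega) (by omega)))

theorem mul_poly (h : PolyTimes N g f) (h' : PolyTimes N (fun _ => 1) f') :
    PolyTimes N g fun i => f i * f' i :=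
  (h.mul h').mono fun i => by rw [mul_one]

theorem pow (h : PolyTimes N g f) (T : ℕ) : PolyTimes N (fun i => g i ^ T) fun i => f i ^ T := by
  induction T with
  | zero => exact of_le fun i => by simp
  | succ T ih => simpa only [pow_succ] using ih.mul h

theorem const (c : ℕ) (hg : ∀ i, 1 ≤ g i) : PolyTimes N g fun _ => c := by
  refine ⟨c, fun i => ?_⟩
  rw [mul_assoc]
  exact Nat.le_mul_of_pos_right _ (Nat.mul_pos (by positivity) (hg i))

theorem self : PolyTimes N (fun _ => 1) N :=
  ⟨1, fun i => by simp⟩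

theorem trans (h : PolyTimes N g f) (h' : PolyTimes N g' g) : PolyTimes N g' f := by
  obtain ⟨C, hC⟩ := h
  have : PolyTimes N (fun _ => 1) fun i => C * (N i + 1) ^ C := ⟨C, fun i => by rw [mul_one]⟩
  obtain ⟨C', h⟩ := h'.mul_poly this
  exact ⟨C', fun i => (hC i).trans (by rw [mul_comm]; exact h i)⟩

/-- Exponential bounds. -/
theorem exists_lt_two_pow {x : ℕ} (h : PolyTimes N (fun i => 2 ^ (x * N i)) f) :
    ∃ c, ∀ i, f i < 2 ^ (c * (N i + 1)) := by
  obtain ⟨C, hC⟩ := h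
  refine ⟨C + C + x, fun i => (hC i).trans_lt ?_⟩
  have h1 : C < 2 ^ (C * (N i + 1)) := Nat.lt_two_pow_self.trans_le
    (Nat.pow_le_pow_right (by norm_num) (Nat.le_mul_of_pos_right _ (by omega)))
  have h2 : (N i + 1) ^ C ≤ 2 ^ (C * (N i + 1)) := by
    rw [mul_comm, pow_mul]
    exact Nat.pow_le_pow_left Nat.lt_two_pow_self.le _
  have h3 : 2 ^ (x * N i) ≤ 2 ^ (x * (N i + 1)) :=
    Nat.pow_le_pow_right (by norm_num) (Nat.mul_le_mul_left _ (by omega))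
  rw [add_mul, add_mul, pow_add, pow_add]
  refine Nat.mul_lt_mul_of_lt_of_le ?_ h3 (by positivity)
  exact Nat.mul_lt_mul_of_lt_of_le h1 h2 (by positivity)

end PolyTimes

end

/-! ## The running time of the program -/

namespace Cmd

open Expr

section

variable {ι : Type*} {N g : ι → ℕ} {w : ι → ℕ} {σ : ι → ℕ → ℕ}

/-- The time of a command is at most `g`, up to a polynomial. -/
def Takes (N w : ι → ℕ) (σ : ι → ℕ → ℕ) (g : ι → ℕ) (c : Cmd) : Prop :=
  PolyTimes N g fun i => c.cost (w i) (σ i)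

theorem Takes.mono {c : Cmd} {g' : ι → ℕ} (h : Takes N w σ g c) (hg : ∀ i, g i ≤ g' i) :
    Takes N w σ g' c := PolyTimes.mono h hg

theorem takes_skip : Takes N w σ (fun _ => 1) skip := .const _ fun _ => le_rfl
theorem takes_set (r : ℕ) (e : Expr) : Takes N w σ (fun _ => 1) (set r e) := .const _ fun _ => le_rfl
theorem takes_store (a e : Expr) : Takes N w σ (fun _ => 1) (store a e) := .const _ fun _ => le_rfl
theorem takes_coin (r : ℕ) : Takes N w σ (fun _ => 1) (coin r) := .const _ fun _ => le_rfl

theorem Takes.seq {c₁ c₂ : Cmd} (h₁ : Takes N w σ g c₁) (h₂ : Takes N w σ g c₂) :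
    Takes N w σ g (seq c₁ c₂) := h₁.add h₂

theorem Takes.ite {e : Expr} {c₁ c₂ : Cmd} (h₁ : Takes N w σ (fun _ => 1) c₁)
    (h₂ : Takes N w σ (fun _ => 1) c₂) : Takes N w σ (fun _ => 1) (ite e c₁ c₂) :=
  (PolyTimes.const _ fun _ => le_rfl).add (h₁.add h₂)

theorem Takes.ite_skip {e : Expr} {c : Cmd} (h : Takes N w σ g c) (hg : ∀ i, 1 ≤ g i) :
    Takes N w σ g (.ite e c skip) :=
  (PolyTimes.const _ hg).add (h.add (.const _ hg))

theorem Takes.loop {r r' : ℕ} {g' : ι → ℕ} {c : Cmd} (hr : PolyTimes N g fun i => σ i r')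
    (hc : Takes N w σ g' c) (hg : ∀ i, 1 ≤ g i) (hg' : ∀ i, 1 ≤ g' i) :
    Takes N w σ (fun i => g i * g' i) (loop r (.reg r') c) :=
  (PolyTimes.const _ fun i => Nat.mul_pos (hg i) (hg' i)).add
    (hr.mul (PolyTimes.add hc (.const _ hg')))

theorem Takes.loop_poly {r r' : ℕ} {c : Cmd} (hr : PolyTimes N (fun _ => 1) fun i => σ i r')
    (hc : Takes N w σ g c) (hg : ∀ i, 1 ≤ g i) : Takes N w σ g (.loop r (.reg r') c) :=
  (Takes.loop hr hc (fun _ => le_rfl) hg).mono fun i => by rw [one_mul]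

theorem takes_vstore (k : ℕ) (e v : Expr) : Takes N w σ (fun _ => 1) (vstore k e v) :=
  .seq (takes_set _ _) (.seq (takes_set _ _) (.seq (takes_store _ _) (takes_store _ _)))

theorem takes_simInstr (k : ℕ) (i : Instr) : Takes N w σ (fun _ => 1) (simInstr k i) := by
  cases i with
  | const | bin | load | store => exact .seq (takes_vstore _ _ _) (takes_set _ _)
  | jz => exact .ite (takes_set _ _) (takes_set _ _)
  | coin => exact .seq (takes_coin _) (.seq (takes_vstore _ _ _) (takes_set _ _))

theorem takes_simStep (k : ℕ) (P : Program) (j : ℕ) : Takes N w σ (fun _ => 1) (simStep k P j) := by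
  induction P generalizing j with
  | nil => exact takes_skip
  | cons i P ih => exact .ite (takes_simInstr _ _) (ih _)

theorem takes_simCall {k r : ℕ} {P : Program} {x y : Expr} (hg : ∀ i, 1 ≤ g i)
    (hr : PolyTimes N g fun i => σ i r) : Takes N w σ g (simCall k P (.reg r) x y) := by
  refine .seq ((takes_vstore _ _ _).mono hg) (.seq ((takes_vstore _ _ _).mono hg)
    (.seq ((takes_set _ _).mono hg) ?_))
  exact (Takes.loop hr (takes_simStep _ _ _) hg fun _ => le_rfl).mono fun i => by rw [mul_one]

variable (h1 : PolyTimes N (fun _ => 1) fun i => σ i 1)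
  (h10 : PolyTimes N (fun _ => 1) fun i => σ i 10)
include h10

theorem takes_evalClause : Takes N w σ (fun _ => 1) evalClause :=
  .seq (takes_set _ _) (.seq (takes_set _ _) (.seq (takes_set _ _) (.loop_poly h10
    (.seq (takes_set _ _) (.seq (takes_set _ _) (.seq (takes_set _ _) (takes_set _ _))))
    fun _ => le_rfl)))

theorem takes_buildGraph {k : ℕ} {s : Bool} (hg : ∀ i, 1 ≤ g i)
    (h9 : PolyTimes N g fun i => σ i 9) :
    Takes N w σ (fun i => g i * g i) (buildGraph k s) := by
  have hc := takes_evalClause (w := w) h10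
  have h : Takes N w σ (fun _ => 1) (.seq (edgeTest s) (.ite (.reg 36) (emitEdge k) .skip)) := by
    refine .seq (.seq ?_ (.seq (takes_set _ _) (.seq (.ite ?_ takes_skip) (.ite ?_ takes_skip))))
      (.ite (.seq (takes_vstore _ _ _) (.seq (takes_vstore _ _ _) (takes_set _ _))) takes_skip)
    · exact .seq (takes_set _ _) (.seq (takes_set _ _) (.seq (takes_set _ _) (takes_set _ _)))
    · exact .seq (takes_set _ _) (.seq (takes_set _ _) (.seq (takes_set _ _) (.seq (takes_set _ _)
        (.seq hc (takes_set _ _)))))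
    · exact .seq (takes_set _ _) (.seq (takes_set _ _) (.seq (takes_set _ _) (.seq (takes_set _ _)
        (.seq (takes_set _ _) (.seq hc (takes_set _ _))))))
  refine .seq ((takes_set _ _).mono fun i => Nat.mul_pos (hg i) (hg i)) (.loop h9 ?_ hg hg)
  exact (Takes.loop h9 h hg fun _ => le_rfl).mono fun i => by rw [mul_one]

include h1

theorem takes_stage {k : ℕ} {s : Bool} {P Q : Program} (hg : ∀ i, 1 ≤ g i)
    (h3 : PolyTimes N g fun i => σ i 3) (h13 : PolyTimes N g fun i => σ i 13) :
    Takes N w σ g (stage k s P Q) := by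
  have hc := takes_evalClause (w := w) h10
  have hf : Takes N w σ (fun _ => 1) evalFormula :=
    .seq (takes_set _ _) (.loop_poly h1 (.seq (takes_set _ _) (.seq hc (takes_set _ _))) fun _ => le_rfl)
  refine .seq ((takes_set _ _).mono hg) (.seq (.loop_poly h1 (.seq ?_ ?_) hg)
    (.seq (takes_simCall hg h13) (.seq (.seq ((takes_set _ _).mono hg) ?_) ?_)))
  · exact Takes.mono (.seq (takes_set _ _) (.seq (takes_set _ _) (.seq (takes_set _ _)
      (.seq (takes_set _ _) hc)))) hg
  · exact .ite_skip (takes_simCall hg h13) hg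
  · exact (Takes.loop h3 (.ite (takes_set _ _) takes_skip) hg fun _ => le_rfl).mono fun i => by
      rw [mul_one]
  · refine (Takes.loop h3 (g' := fun _ => 1) ?_ hg fun _ => le_rfl).mono fun i => by rw [mul_one]
    exact .seq (takes_set _ _) (.seq (takes_set _ _) (.seq (takes_set _ _) (.seq hf (takes_set _ _))))

/-- Three terms dominate: the test of all pairs of vertices, the budget of the preprocessing, and
the number of stages times the time of a stage. -/
theorem takes_main {k : ℕ} {s : Bool} {A P Q : Program} {g₉ g₁₂ g₁₃ g₁₄ : ι → ℕ}
    (hg₉ : ∀ i, 1 ≤ g₉ i) (hg₁₂ : ∀ i, 1 ≤ g₁₂ i) (hg₁₃ : ∀ i, 1 ≤ g₁₃ i) (hg₁₄ : ∀ i, 1 ≤ g₁₄ i)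
    (h3 : PolyTimes N g₁₃ fun i => σ i 3) (h9 : PolyTimes N g₉ fun i => σ i 9)
    (h12 : PolyTimes N g₁₂ fun i => σ i 12) (h13 : PolyTimes N g₁₃ fun i => σ i 13)
    (h14 : PolyTimes N g₁₄ fun i => σ i 14) (hg : ∀ i, g₉ i * g₉ i ≤ g i)
    (hg' : ∀ i, g₁₂ i ≤ g i) (hg'' : ∀ i, g₁₄ i * g₁₃ i ≤ g i) :
    Takes N w σ g (main k s A P Q) := by
  have h0 (i : ι) : 1 ≤ g i := (hg₁₂ i).trans (hg' i)
  exact .seq ((takes_buildGraph h10 hg₉ h9).mono hg) (.seq ((takes_simCall hg₁₂ h12).mono hg')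
    (.seq ((takes_set _ _).mono h0) (.seq
      ((Takes.loop h14 (takes_stage h1 h10 hg₁₃ h3 h13) hg₁₄ hg₁₃).mono hg'')
      ((takes_set _ _).mono h0))))

end

/-! ### Syntactic conditions -/

theorem static_simStep (K : ℕ → Prop) (k : ℕ) (P : Program) (j : ℕ) : (simStep k P j).Static K := by
  induction P generalizing j with
  | nil => trivial
  | cons i P ih => exact ⟨by cases i <;> simp [simInstr, vstore, Static], ih _⟩

theorem wf_simStep (k : ℕ) (P : Program) (j : ℕ) : (simStep k P j).WF := by
  induction P generalizing j with
  | nil => trivial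
  | cons i P ih =>
    refine ⟨⟨by norm_num [RegsBelow, tmp], trivial⟩, ?_, ih _⟩
    cases i <;> simp [simInstr, vstore, vload, WF, RegsBelow, tmp, HAdd.hAdd, Add.add, HMul.hMul,
      Mul.mul, HMod.hMod, Mod.mod, Expr.lt, Expr.eq]

end Cmd

namespace Cmd

open Expr

section

variable {k : ℕ} {s : Bool} {A P Q : Program}

theorem static_simCall {K : ℕ → Prop} {r : ℕ} (hr : K r) (x y : Expr) :
    (simCall k P (.reg r) x y).Static K :=
  ⟨by simp [vstore, Static], by simp [vstore, Static], trivial, hr, static_simStep _ _ _ _⟩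

theorem wf_simCall {e x y : Expr} (he : e.RegsBelow tmp) (hx : x.RegsBelow tmp)
    (hy : y.RegsBelow tmp) : (simCall k P e x y).WF := by
  refine ⟨?_, ?_, ?_, by norm_num [tmp], he, fun h => ?_, wf_simStep _ _ _⟩
  · simp [vstore, WF, RegsBelow, tmp, HAdd.hAdd, Add.add, HMul.hMul, Mul.mul, Expr.lt]
    exact hx
  · simp [vstore, WF, RegsBelow, tmp, HAdd.hAdd, Add.add, HMul.hMul, Mul.mul, Expr.lt]
    exact hy
  · norm_num [WF, RegsBelow, tmp]
  · have := simStep_writes h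
    omega

theorem static_main {K : ℕ → Prop} (hK : ∀ r, 1 ≤ r → r < 20 → K r) : (main k s A P Q).Static K := by
  have h1 := hK 1 (by norm_num) (by norm_num)
  have h3 := hK 3 (by norm_num) (by norm_num)
  have h9 := hK 9 (by norm_num) (by norm_num)
  have h10 := hK 10 (by norm_num) (by norm_num)
  have h14 := hK 14 (by norm_num) (by norm_num)
  have h12 : ∀ P x y, (simCall k P (.reg 12) x y).Static K := fun P x y =>
    static_simCall (hK 12 (by norm_num) (by norm_num)) x y
  have h13 : ∀ P x y, (simCall k P (.reg 13) x y).Static K := fun P x y =>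
    static_simCall (hK 13 (by norm_num) (by norm_num)) x y
  simp [main, buildGraph, edgeTest, coordinates, uTest, vTest, evalClause, evalStep, emitEdge, vstore,
    stages, stage, updateStep, stageClause, update, pick, verify, evalFormula, Static, RegsIn, *]

theorem wf_main : (main k s A P Q).WF := by
  have hS : ∀ P e x y, e.RegsBelow tmp → x.RegsBelow tmp → y.RegsBelow tmp →
    (simCall k P e x y).WF := fun P e x y => wf_simCall
  have hw30 : ∀ P e x y, ¬ (simCall k P e x y).Writes 30 := fun P e x y h => by
    have := simCall_writes h; omega
  have hw39 : ∀ P e x y, ¬ (simCall k P e x y).Writes 39 := fun P e x y h => by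
    have := simCall_writes h; omega
  simp [main, buildGraph, edgeTest, plainEdge, uEdge, vEdge,
    coordinates, uTest, vTest, evalClause,
    evalStep, emitEdge, vstore, stages, stage, updateStep, stageClause, update, pick, estimateExpr,
    verify, evalFormula, WF, RegsBelow, Writes, tmp, vload, HAdd.hAdd, Add.add, HMul.hMul,
    Mul.mul, HMod.hMod, Mod.mod, HDiv.hDiv, Div.div, Expr.lt, Expr.eq, Expr.shr, hw30, hw39]
  refine ⟨hS _ _ _ _ ?_ ?_ ?_, hS _ _ _ _ ?_ ?_ ?_, hS _ _ _ _ ?_ ?_ ?_⟩ <;>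
    norm_num [RegsBelow, tmp]

/-- The registers from `1` to `19` keep the values of the initialization; all loop bounds are taken
from these. -/
theorem main_writes {r : ℕ} (h : (main k s A P Q).Writes r) : r = 0 ∨ 20 ≤ r := by
  by_contra hr
  have hw : ∀ P e x y, ¬ (simCall k P e x y).Writes r := fun P e x y h => by
    have := simCall_writes h; omega
  simp only [main, buildGraph, edgeTest, coordinates, uTest, vTest, evalClause_writes, emitEdge, vstore,
    stages, stage, updateStep, stageClause, update, pick, verify, evalFormula, Writes, or_false, false_or, hw] at h
  omega

end

end Cmd

/-! ## The initialization -/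

namespace Expr

/-- The expression for a power of two. -/
def twoPow (e : Expr) : Expr := bin .shl (lit 1) e

/-- The expression for a power with a fixed exponent. -/
def npow (e : Expr) : ℕ → Expr
  | 0 => lit 1
  | T + 1 => npow e T * e

variable {w : ℕ} {st : Store} {e : Expr}

theorem eval_twoPow (h : 2 ^ e.eval w st < 2 ^ w) : (twoPow e).eval w st = 2 ^ e.eval w st := by
  have h1 : 1 < 2 ^ w := lt_of_le_of_lt Nat.one_le_two_pow h
  simp only [twoPow, eval, BinOp.eval]
  rw [Nat.mod_eq_of_lt h1, Nat.one_shiftLeft, Nat.mod_eq_of_lt h]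

theorem eval_npow (T : ℕ) :
    (npow e T).eval w st = e.eval w st ^ T % 2 ^ w := by
  induction T with
  | zero => rfl
  | succ T ih =>
    show ((npow e T).eval w st * e.eval w st) % 2 ^ w = _
    rw [ih, pow_succ, Nat.mod_mul_mod]

end Expr

namespace Cmd

open Expr

/-- A sequence of assignments. -/
def sets : List (ℕ × Expr) → Cmd
  | [] => skip
  | x :: l => seq (set x.1 x.2) (sets l)

/-- The assignments compute the values `V`, if the registers in `known` hold these values. -/
def Computes (w X : ℕ) (V : ℕ → ℕ) : List (ℕ × Expr) → List ℕ → Prop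
  | [], _ => True
  | x :: l, known => V x.1 < X ∧ (∀ st : Store, st.Below X → (∀ r ∈ known, st.reg r = V r) →
      x.2.eval w st = V x.1) ∧ Computes w X V l (x.1 :: known)

theorem all_sets {w X : ℕ} {V : ℕ → ℕ} {l : List (ℕ × Expr)} {known : List ℕ}
    (h : Computes w X V l known) {st : Store} (hb : st.Below X) (hk : ∀ r ∈ known, st.reg r = V r) :
    ((sets l).exec w st).All fun st' => st'.Below X ∧ st'.mem = st.mem ∧
      (∀ r, r ∈ known ∨ r ∈ l.map Prod.fst → st'.reg r = V r) ∧
      ∀ r, r ∉ l.map Prod.fst → st'.reg r = st.reg r := by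
  induction l generalizing known st with
  | nil => exact ⟨hb, rfl, fun r hr => hk r (by simpa using hr), fun _ _ => rfl⟩
  | cons x l ih =>
    obtain ⟨hX, he, hl⟩ := h
    refine all_seq (all_set_of_eval hb (he st hb hk) hX fun hb' => ?_)
    refine (ih hl (hb'.tick _) fun r hr => ?_).mono ?_
    · by_cases hrx : r = x.1
      · subst hrx; exact Function.update_self _ _ _
      · exact (Function.update_of_ne hrx _ _).trans (hk r (by simpa [hrx] using hr))
    · rintro st' ⟨h1, h2, h3, h4⟩
      refine ⟨h1, h2, fun r hr => h3 r ?_, fun r hr => ?_⟩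
      · simp only [List.map_cons, List.mem_cons] at hr ⊢
        tauto
      · simp only [List.map_cons, List.mem_cons, not_or] at hr
        exact (h4 r hr.2).trans (Function.update_of_ne hr.1 _ _)

/-- Put the smallest power of two that exceeds register `9` into register `20`. -/
def roundUp (e : Expr) : Cmd :=
  seq (set 20 (lit 1)) (loop 39 e (set 20 (reg 20 * (lit 1 + lt (reg 20) (reg 9 + lit 1)))))

/-- There is no instruction for logarithms, so a power of two is doubled while it does not exceed
`n`. The number of rounds is fixed in advance; after `j` rounds the exponent is the minimum of `j`
and `log n + 1`. -/
theorem all_roundUp {w X : ℕ} (hW : WideWords w X) {e : Expr} {st : Store} (hb : st.Below X)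
    (hs : e.Safe X) (hd : e.deg ≤ 24) (he : ∀ x, e.ival ((st.setReg 20 1).tick x) = e.ival st)
    (hX : e.ival st < X) (hn : 2 ^ (Nat.log 2 (st.reg 9) + 1) < X) (h0 : st.reg 9 ≠ 0)
    (hlog : Nat.log 2 (st.reg 9) + 1 ≤ e.ival st) :
    ((roundUp e).exec w st).All fun st' => st'.Below X ∧
      st'.reg 20 = 2 ^ (Nat.log 2 (st.reg 9) + 1) ∧ st'.mem = st.mem ∧
      ∀ r, r ≠ 20 → r ≠ 39 → st'.reg r = st.reg r := by
  have h4 := hW.four_le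
  set n := st.reg 9 with hn'
  refine all_seq (all_set hW hb (by simp; omega) (by simp) (by simp; omega) fun hb₁ => ?_)
  rw [Expr.ival_lit] at hb₁ ⊢
  set st₁ := (st.setReg 20 1).tick ((lit 1).size + 1) with hst₁
  have hv : e.ival st₁ = e.ival st := he _
  refine (all_loop (I := fun j st' => st'.mem = st.mem ∧ st'.reg 9 = n ∧
    st'.reg 20 = 2 ^ min (e.ival st - j) (Nat.log 2 n + 1)) (by simp [Writes]) hW (hb₁.tick _) hs hd
    (by rw [hv]; exact hX) ?_ ?_ ?_).mono ?_
  · rintro j st' x t ⟨h1, h2, h3⟩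
    exact ⟨h1, by simpa [Store.setReg, Store.tick] using h2,
      by simpa [Store.setReg, Store.tick] using h3⟩
  · exact ⟨rfl, by simp [st₁, Store.setReg, Store.tick, n],
      by rw [hv, Nat.sub_self, Nat.zero_min, pow_zero]; simp [st₁, Store.setReg, Store.tick]⟩
  · rintro j st' hj hb' - - ⟨h1, h2, h3⟩
    rw [hv] at hj
    have hstep : 2 ^ min (e.ival st - (j + 1)) (Nat.log 2 n + 1) *
        (1 + if 2 ^ min (e.ival st - (j + 1)) (Nat.log 2 n + 1) < n + 1 then 1 else 0) =
        2 ^ min (e.ival st - j) (Nat.log 2 n + 1) := by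
      split_ifs with h <;>
        rw [Nat.lt_succ_iff, ← Nat.le_log_iff_pow_le (by norm_num) h0] at h
      · rw [show min (e.ival st - j) (Nat.log 2 n + 1) =
          min (e.ival st - (j + 1)) (Nat.log 2 n + 1) + 1 by omega, pow_succ]
      · rw [add_zero, mul_one]
        congr 1
        omega
    have hval : (reg 20 * (lit 1 + lt (reg 20) (reg 9 + lit 1)) : Expr).ival st' =
        2 ^ min (e.ival st - j) (Nat.log 2 n + 1) := by
      simp only [ival_mul, ival_add, ival_reg, ival_lit, ival_lt, h2, h3]
      exact hstep
    refine all_set_update hW hb' (by simp; omega) (by simp) hval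
      ((Nat.pow_le_pow_right (by norm_num) (min_le_right _ _)).trans_lt hn) fun st₂ hb₂ hm₂ hr₂ => ?_
    refine ⟨hb₂, hm₂.trans h1, ?_, ?_⟩
    · rw [hr₂, Function.update_of_ne (by norm_num), h2]
    · rw [hr₂, Function.update_self]
  · rintro st' ⟨hb', hr, h1, -, h3⟩
    refine ⟨hb', ?_, h1, fun r h20 h39 => ?_⟩
    · rw [h3, Nat.sub_zero, min_eq_right hlog]
    · rw [hr r (by simp [Writes, h20, h39])]
      exact Function.update_of_ne h20 _ _

end Cmd

/-! ### The parameters and their computation. -/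

/-- The constants of the reduction. Clauses have at most `width` literals; the dynamic algorithm has
words of `word * (log n + 1)` bits, `prep * n ^ expo` steps suffice for its preprocessing, and the
constant factor in the time of its operations is `upd`. Paths have length `scale * (m + 1)`,
and a share of `denom / modulus` of the variables belongs to the vectors on each side. -/
structure Parameters where
  width : ℕ
  word : ℕ
  expo : ℕ
  prep : ℕ
  upd : ℕ
  scale : ℕ
  denom : ℕ
  conv : Convention

namespace Parameters

variable (p : Parameters) (N m : ℕ)

def modulus : ℕ := (p.expo + 2) * p.denom + 1

/-- The unit for numbers of variables. -/
def unit : ℕ := N / p.modulus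

/-- The number of variables that belong to the vectors on each side. -/
def bits : ℕ := p.denom * p.unit N

/-- The length of the paths. -/
def length : ℕ := p.scale * (m + 1)

/-- The number of vertices. -/
def size : ℕ := gridSize (2 ^ p.bits N + 1) (m + 1) (p.length m)

/-- The number of vertices is at most this number times the number of vectors. -/
def height : ℕ := (4 + (m + 1)) * (p.length m + 1) + 2

/-- The values of the registers after the initialization. -/
def value : ℕ → ℕ
  | 0 => N
  | 1 => m
  | 2 => p.bits N
  | 3 => 2 ^ p.bits N
  | 4 => 2 ^ p.bits N + 1
  | 5 => m + 1
  | 6 => p.length m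
  | 7 => p.length m + 1
  | 8 => 2 * (2 ^ p.bits N + 1) + (m + 1)
  | 9 => p.size N m
  | 10 => (m + 1) * (p.width + 1)
  | 11 => (2 ^ (Nat.log 2 (p.size N m) + 1)) ^ p.word
  | 12 => p.prep * p.size N m ^ p.expo
  | 13 => p.upd * ((m + 1) * (p.height m * p.height m * 2 ^ ((2 * p.denom - 1) * p.unit N)))
  | 14 => 2 ^ (N - (p.bits N + p.bits N))
  | 15 => threshold p.conv (p.length m)
  | 16 => p.bits N + p.bits N
  | 17 => 2 ^ p.bits N * 2 ^ p.bits N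
  | 18 => N
  | 19 => 2 * (2 ^ p.bits N + 1)
  | 20 => 2 ^ (Nat.log 2 (p.size N m) + 1)
  | 21 => p.unit N
  | 22 => p.height m
  | 23 => 2 ^ ((2 * p.denom - 1) * p.unit N)
  | 24 => p.size N m ^ p.expo
  | 25 => N - (p.bits N + p.bits N)
  | 26 => (2 * p.denom - 1) * p.unit N
  | _ => 0

open Expr

/-- The expression for the threshold. -/
def thresholdExpr : Expr :=
  match p.conv with
  | .under => reg 6 + lit 4
  | .over => lit 2 * reg 6 + lit 3

def firstSets : List (ℕ × Expr) :=
  [(18, reg 0), (21, reg 0 / lit p.modulus), (2, lit p.denom * reg 21), (3, twoPow (reg 2)),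
    (4, reg 3 + lit 1), (5, reg 1 + lit 1), (6, lit p.scale * reg 5), (7, reg 6 + lit 1),
    (19, lit 2 * reg 4), (8, reg 19 + reg 5), (9, reg 8 * reg 7 + lit 2)]

def secondSets : List (ℕ × Expr) :=
  [(10, reg 5 * lit (p.width + 1)), (11, npow (reg 20) p.word), (24, npow (reg 9) p.expo),
    (12, lit p.prep * reg 24), (22, (lit 4 + reg 5) * reg 7 + lit 2),
    (26, lit (2 * p.denom - 1) * reg 21), (23, twoPow (reg 26)),
    (13, lit p.upd * (reg 5 * (reg 22 * reg 22 * reg 23))), (16, reg 2 + reg 2),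
    (17, reg 3 * reg 3),
    (25, reg 0 % lit p.modulus + lit (p.expo * p.denom + 1) * reg 21), (14, twoPow (reg 25)),
    (15, p.thresholdExpr)]

/-- The initialization, for numbers less than `2 ^ (L * (N + 1))`. -/
def init (L : ℕ) : Cmd :=
  .seq (.sets p.firstSets) (.seq (.roundUp (lit L * (reg 0 + lit 1))) (.sets p.secondSets))

/-- The constants of the reduction are less than `X`. -/
structure Small (X : ℕ) : Prop where
  width : p.width + 1 < X
  prep : p.prep < X
  upd : p.upd < X
  scale : p.scale < X
  denom : 2 * p.denom < X
  modulus : p.modulus < X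

/-- The right side is what the program computes, as it contains no subtraction. -/
theorem sub_bits : N - (p.bits N + p.bits N) =
    N % p.modulus + (p.expo * p.denom + 1) * p.unit N := by
  have h : p.modulus * p.unit N + N % p.modulus = N := Nat.div_add_mod N p.modulus
  have h2 : p.modulus * p.unit N =
      (p.bits N + p.bits N) + (p.expo * p.denom + 1) * p.unit N := by
    simp only [modulus, bits]; ring
  omega

theorem bits_add_bits_le : p.bits N + p.bits N ≤ N := by
  have h : p.modulus * p.unit N + N % p.modulus = N := Nat.div_add_mod N p.modulus
  have h2 : p.modulus * p.unit N =
      (p.bits N + p.bits N) + (p.expo * p.denom + 1) * p.unit N := by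
    simp only [modulus, bits]; ring
  omega

variable {p N m}
variable {w X : ℕ}

theorem computes_of_safe {V : ℕ → ℕ} {l : List (ℕ × Expr)} {known : List ℕ} {r : ℕ} {e : Expr}
    (hW : WideWords w X) (hX : V r < X) (hs : e.Safe X) (hd : e.deg ≤ 24)
    (h : ∀ st : Store, (∀ r ∈ known, st.reg r = V r) → e.ival st = V r)
    (hl : Cmd.Computes w X V l (r :: known)) : Cmd.Computes w X V ((r, e) :: l) known :=
  ⟨hX, fun st hb hk => (eval_eq_ival hW hb hs hd).trans (h st hk), hl⟩

theorem computes_twoPow {V : ℕ → ℕ} {l : List (ℕ × Expr)} {known : List ℕ} {r r' : ℕ}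
    (hW : WideWords w X) (hX : V r < X) (hr : r' ∈ known) (h : 2 ^ V r' = V r)
    (hl : Cmd.Computes w X V l (r :: known)) :
    Cmd.Computes w X V ((r, twoPow (reg r')) :: l) known := by
  refine ⟨hX, fun st hb hk => ?_, hl⟩
  have h' : (reg r').eval w st = V r' := hk r' hr
  show (twoPow (reg r')).eval w st = V r
  rw [eval_twoPow, h', h]
  rw [h', h]
  exact hX.trans_le hW.le_two_pow

theorem computes_npow {V : ℕ → ℕ} {l : List (ℕ × Expr)} {known : List ℕ} {r r' T : ℕ}
    (hW : WideWords w X) (hX : V r < X) (hr : r' ∈ known) (h : V r' ^ T = V r)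
    (hl : Cmd.Computes w X V l (r :: known)) :
    Cmd.Computes w X V ((r, npow (reg r') T) :: l) known := by
  refine ⟨hX, fun st hb hk => ?_, hl⟩
  have h' : (reg r').eval w st = V r' := hk r' hr
  show (npow (reg r') T).eval w st = V r
  rw [eval_npow, h', h, Nat.mod_eq_of_lt (hX.trans_le hW.le_two_pow)]

theorem computes_firstSets (hW : WideWords w X) (hp : p.Small X) (hV : ∀ r, p.value N m r < X) :
    Cmd.Computes w X (p.value N m) p.firstSets [0, 1] := by
  have h4 := hW.four_le
  have h1 : 1 < X := by omega
  have h2 : 2 < X := by omega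
  have h := hp.modulus
  have h' : p.denom < X := by have := hp.denom; omega
  have h'' := hp.scale
  refine computes_of_safe hW (hV _) (by simp) (by simp) (fun st hk => ?_) ?_
  · simp [hk 0, value]
  refine computes_of_safe hW (hV _) (by simp [h]) (by simp) (fun st hk => ?_) ?_
  · simp [hk 0, value, unit]
  refine computes_of_safe hW (hV _) (by simp [h']) (by simp) (fun st hk => ?_) ?_
  · simp [hk 21, value, bits]
  refine computes_twoPow hW (hV _) (by simp) rfl ?_
  refine computes_of_safe hW (hV _) (by simp [h1]) (by simp) (fun st hk => ?_) ?_
  · simp [hk 3, value]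
  refine computes_of_safe hW (hV _) (by simp [h1]) (by simp) (fun st hk => ?_) ?_
  · simp [hk 1, value]
  refine computes_of_safe hW (hV _) (by simp [h'']) (by simp) (fun st hk => ?_) ?_
  · simp [hk 5, value, length]
  refine computes_of_safe hW (hV _) (by simp [h1]) (by simp) (fun st hk => ?_) ?_
  · simp [hk 6, value]
  refine computes_of_safe hW (hV _) (by simp [h2]) (by simp) (fun st hk => ?_) ?_
  · simp [hk 4, value]
  refine computes_of_safe hW (hV _) (by simp) (by simp) (fun st hk => ?_) ?_
  · simp [hk 19, hk 5, value]
  refine computes_of_safe hW (hV _) (by simp [h2]) (by simp) (fun st hk => ?_) trivial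
  · simp [hk 8, hk 7, value, size, gridSize]

theorem computes_secondSets (hW : WideWords w X) (hp : p.Small X) (hV : ∀ r, p.value N m r < X) :
    Cmd.Computes w X (p.value N m) p.secondSets [0, 2, 3, 5, 6, 7, 9, 20, 21] := by
  -- The strict inequality, needed for the constant 4, is inferred from the content of register
  -- `22`.
  have h4 : 4 < X := by
    refine lt_of_le_of_lt ?_ (hV 22)
    show 4 ≤ (4 + (m + 1)) * (p.length m + 1) + 2
    nlinarith [Nat.zero_le (p.length m), Nat.zero_le m]
  have h1 : 1 < X := by omega
  have h2 : 2 < X := by omega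
  have h3 : 3 < X := by omega
  have hprep := hp.prep
  have hupd := hp.upd
  have hwidth := hp.width
  have hmod := hp.modulus
  have hdenom : 2 * p.denom - 1 < X := by have := hp.denom; omega
  have hlit : p.expo * p.denom + 1 < X := by
    refine lt_of_le_of_lt ?_ hmod
    simp only [modulus, add_mul]; omega
  refine computes_of_safe hW (hV _) (by simp [hwidth]) (by simp) (fun st hk => ?_) ?_
  · simp [hk 5, value]
  refine computes_npow hW (hV _) (by simp) rfl ?_
  refine computes_npow hW (hV _) (by simp) rfl ?_
  refine computes_of_safe hW (hV _) (by simp [hprep]) (by simp) (fun st hk => ?_) ?_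
  · simp [hk 24, value]
  refine computes_of_safe hW (hV _) (by simp [h4, h2]) (by simp) (fun st hk => ?_) ?_
  · simp [hk 5, hk 7, value, height]
  refine computes_of_safe hW (hV _) (by simp [hdenom]) (by simp) (fun st hk => ?_) ?_
  · simp [hk 21, value]
  refine computes_twoPow hW (hV _) (by simp) rfl ?_
  refine computes_of_safe hW (hV _) (by simp [hupd]) (by simp) (fun st hk => ?_) ?_
  · simp [hk 5, hk 22, hk 23, value]
  refine computes_of_safe hW (hV _) (by simp) (by simp) (fun st hk => ?_) ?_
  · simp [hk 2, value]
  refine computes_of_safe hW (hV _) (by simp) (by simp) (fun st hk => ?_) ?_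
  · simp [hk 3, value]
  refine computes_of_safe hW (hV _) (by simp [hmod, hlit]) (by simp) (fun st hk => ?_) ?_
  · simp [hk 0, hk 21, value, sub_bits]
  refine computes_twoPow hW (hV _) (by simp) rfl ?_
  refine computes_of_safe hW (hV _) ?_ ?_ (fun st hk => ?_) trivial
  · cases h : p.conv <;> simp [thresholdExpr, h, h2, h3, h4]
  · cases h : p.conv <;> simp [thresholdExpr, h]
  · have := hk 6 (by simp)
    cases h : p.conv <;> simp [thresholdExpr, h, value, threshold, this]

theorem all_init {L : ℕ} (hW : WideWords w X) (hp : p.Small X) (hV : ∀ r, p.value N m r < X)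
    (hL : X = 2 ^ (L * (N + 1))) {st : Store} (hb : st.Below X) (h0 : st.reg 0 = N)
    (h1 : st.reg 1 = m) :
    ((p.init L).exec w st).All fun st' => st'.Below X ∧ st'.mem = st.mem ∧
      (∀ r < 20, st'.reg r = p.value N m r) ∧ st'.reg 41 = st.reg 41 := by
  have h4 := hW.four_le
  refine Cmd.all_seq ((Cmd.all_sets (computes_firstSets hW hp hV) hb ?_).mono ?_)
  · simp [h0, h1, value]
  rintro st₁ ⟨hb₁, hm₁, hk₁, hr₁⟩
  simp only [firstSets, List.map_cons, List.map_nil, List.mem_cons, List.not_mem_nil, or_false] at hk₁ hr₁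
  have h9 : st₁.reg 9 = p.size N m := hk₁ 9 (by norm_num)
  have h0' : st₁.reg 0 = N := hk₁ 0 (by norm_num)
  have hival : (lit L * (reg 0 + lit 1)).ival st₁ = L * (N + 1) := by simp [h0']
  have hsize : p.size N m ≠ 0 := by simp [size, gridSize]
  refine Cmd.all_seq ((Cmd.all_roundUp hW hb₁ ?_ ?_ ?_ ?_ ?_ ?_ ?_).mono ?_)
  · have hLX : L < X := by
      rw [hL]
      exact Nat.lt_two_pow_self.trans_le (Nat.pow_le_pow_right (by norm_num)
        (Nat.le_mul_of_pos_right _ (by omega)))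
    simp [hLX]; omega
  · simp
  · exact fun x => rfl
  · rw [hival, hL]; exact Nat.lt_two_pow_self
  · rw [h9]; exact hV 20
  · rwa [h9]
  -- Since `n < X = 2^(L (N + 1))`, the number of rounds is sufficient.
  · rw [h9, hival]
    refine Nat.log_lt_of_lt_pow hsize ?_
    rw [← hL]
    exact hV 9
  rintro st₂ ⟨hb₂, h20, hm₂, hr₂⟩
  refine (Cmd.all_sets (computes_secondSets hW hp hV) hb₂ fun r hr => ?_).mono ?_
  · simp only [List.mem_cons, List.not_mem_nil, or_false] at hr
    by_cases h : r = 20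
    · subst h; rw [h20, h9]; rfl
    · rw [hr₂ r h (by omega)]
      exact hk₁ r (by omega)
  rintro st₃ ⟨hb₃, hm₃, hk₃, hr₃⟩
  simp only [secondSets, List.map_cons, List.map_nil, List.mem_cons, List.not_mem_nil, or_false] at hk₃ hr₃
  refine ⟨hb₃, by rw [hm₃, hm₂, hm₁], fun r hr => ?_, ?_⟩
  · by_cases h : r = 0 ∨ r = 2 ∨ r = 3 ∨ r = 5 ∨ r = 6 ∨ r = 7 ∨ 9 ≤ r ∧ r ≤ 17 
    · by_cases h' : r = 10 ∨ r = 11 ∨ r = 12 ∨ r = 13 ∨ r = 14 ∨ r = 15 ∨ r = 16 ∨ r = 17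
      · exact hk₃ r (by omega)
      · exact hk₃ r (by omega)
    · rw [hr₃ r (by omega), hr₂ r (by omega) (by omega)]
      exact hk₁ r (by omega)
  · rw [hr₃ 41 (by norm_num), hr₂ 41 (by norm_num) (by norm_num), hr₁ 41 (by norm_num)]

/-! ### Syntactic conditions -/

theorem init_writes {L r : ℕ} (h : (p.init L).Writes r) : r ≠ 0 := by
  rintro rfl
  simp [init, Cmd.sets, firstSets, secondSets, Cmd.roundUp, Cmd.Writes] at h

theorem static_init {L : ℕ} : (p.init L).Static (· = 0) := by
  simp only [init, Cmd.sets, firstSets, secondSets, Cmd.roundUp, Cmd.Static, true_and, and_true]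
  exact ⟨trivial, rfl, trivial⟩

theorem regsBelow_npow {e : Expr} {T : ℕ} (h : e.RegsBelow T) (j : ℕ) : (npow e j).RegsBelow T := by
  induction j with
  | zero => trivial
  | succ j ih => exact ⟨ih, h⟩

theorem wf_init {L : ℕ} : (p.init L).WF := by
  have h1 := regsBelow_npow (e := reg 20) (T := 64) (by norm_num [RegsBelow]) p.word
  have h2 := regsBelow_npow (e := reg 9) (T := 64) (by norm_num [RegsBelow]) p.expo
  have hadd (T : ℕ) (a b : Expr) : (a + b).RegsBelow T ↔ a.RegsBelow T ∧ b.RegsBelow T := Iff.rfl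
  have hmul (T : ℕ) (a b : Expr) : (a * b).RegsBelow T ↔ a.RegsBelow T ∧ b.RegsBelow T := Iff.rfl
  have hdiv (T : ℕ) (a b : Expr) : (a / b).RegsBelow T ↔ a.RegsBelow T ∧ b.RegsBelow T := Iff.rfl
  have hmod (T : ℕ) (a b : Expr) : (a % b).RegsBelow T ↔ a.RegsBelow T ∧ b.RegsBelow T := Iff.rfl
  cases h : p.conv <;>
  simp [init, Cmd.sets, firstSets, secondSets, Cmd.roundUp, Cmd.WF, RegsBelow, hadd, hmul, hdiv, hmod,
    twoPow, thresholdExpr, tmp, Expr.lt, Cmd.Writes, h, h1, h2]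

end Parameters

/-! ### The decision program for a formula of suitable size. -/

namespace Parameters

/-- The numbers that occur in the reduction for `N` variables and `m` clauses are less than `X`, and
words of `w` bits suffice. -/
structure Admissible (p : Parameters) (N m w X k : ℕ) (l : List Program) : Prop where
  wide : WideWords w X
  small : p.Small X
  value_lt : ∀ r, p.value N m r < X
  size_lt : 2 * (p.size N m * p.size N m) + 1 < X
  pow_le : 2 ^ N ≤ X
  double_lt : 2 * N + 2 < X
  word_le : p.word * (Nat.log 2 (p.size N m) + 1) ≤ w
  two_le : 2 ≤ k
  k_lt : k < X
  fits : ∀ P ∈ l, (∀ i ∈ P, i.Fits k X) ∧ P.length < X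
  scale : 1 ≤ p.scale

variable {p : Parameters} {N w X k L : ℕ} {A P Q : Program} {φ : CNF N} {s : Bool}

/-- The store at the beginning. -/
def start (φ : CNF N) : Store :=
  ⟨(initState N φ.length φ.encode).reg, (initState N φ.length φ.encode).mem, 0⟩

theorem Admissible.initialized (H : p.Admissible N φ.length w X k [A, P, Q]) (hφ : φ.IsK p.width)
    {st : Store} (hb : st.Below X) (hm : st.mem = (start φ).mem)
    (hr : ∀ r < 20, st.reg r = p.value N φ.length r) (h41 : st.reg 41 = 0) :
    Initialized w (p.word * (Nat.log 2 (p.size N φ.length) + 1)) X k (p.bits N) (p.length φ.length) φ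
      A P Q st := by
  have h10 : φ.encode.length ≤ st.reg 10 := by
    rw [hr 10 (by norm_num)]
    refine hφ.length_encode_le.trans ?_
    exact Nat.mul_le_mul_right _ (Nat.le_succ _)
  have key (R : Program) (hR : R ∈ [A, P, Q]) (j : ℕ) (hj : j < 40) :
      SimSetup w (p.word * (Nat.log 2 (p.size N φ.length) + 1)) X k j R st := by
    have h11 := H.value_lt 11
    have he : p.value N φ.length 11 = 2 ^ (p.word * (Nat.log 2 (p.size N φ.length) + 1)) := by
      rw [mul_comm, pow_mul]; rfl
    rw [he] at h11
    exact ⟨H.wide, H.word_le, h11, H.two_le, H.k_lt, (hr 11 (by norm_num)).trans he,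
      (H.fits R hR).1, (H.fits R hR).2, hj⟩
  refine ⟨hb, ⟨fun x _ => by rw [hm]; rfl, h10⟩, ?_, h41, fun x hx => ?_, H.size_lt,
    key A (by simp) 12 (by norm_num), key P (by simp) 13 (by norm_num),
    key Q (by simp) 13 (by norm_num), hr 14 (by norm_num), p.bits_add_bits_le N, H.pow_le,
    Nat.mul_pos H.scale (by omega)⟩
  · exact ⟨hr 1 (by norm_num), hr 2 (by norm_num), hr 3 (by norm_num), hr 4 (by norm_num),
      hr 6 (by norm_num), hr 7 (by norm_num), hr 8 (by norm_num), hr 9 (by norm_num),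
      hr 16 (by norm_num), hr 17 (by norm_num), hr 18 (by norm_num), hr 19 (by norm_num)⟩
  · rw [hm]
    exact List.getD_eq_default _ _ (h10.trans hx)

/-- The program that decides satisfiability. -/
def decide (p : Parameters) (L k : ℕ) (s : Bool) (A P Q : Program) : Cmd :=
  .seq (p.init L) (.main k s A P Q)

/-- A bound for its time. -/
def time (p : Parameters) (L k : ℕ) (s : Bool) (A P Q : Program) (w N m : ℕ) : ℕ :=
  (p.init L).cost w (fun _ => N) + (Cmd.main k s A P Q).cost w (p.value N m)

theorem start_below (H : p.Admissible N φ.length w X k [A, P, Q]) : (start φ).Below X := by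
  have h0 : N < X := H.value_lt 0
  have h1 : φ.length < X := H.value_lt 1
  refine ⟨fun r => ?_, fun x => ?_⟩
  · by_cases hr1 : r = 1
    · subst hr1; simpa [start, initState] using h1
    · by_cases hr0 : r = 0
      · subst hr0; simpa [start, initState] using h0
      · simp [start, initState, hr1, hr0]; omega
  · show φ.encode.getD x 0 < X
    by_cases hx : x < φ.encode.length
    · rw [List.getD_eq_getElem _ _ hx]
      exact (CNF.lt_of_mem_encode (List.getElem_mem hx)).trans H.double_lt
    · rw [List.getD_eq_default _ _ (by omega)]; omega

theorem Admissible.all_init (H : p.Admissible N φ.length w X k [A, P, Q])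
    (hL : X = 2 ^ (L * (N + 1))) (hφ : φ.IsK p.width) :
    ((p.init L).exec w (start φ)).All fun st =>
      Initialized w (p.word * (Nat.log 2 (p.size N φ.length) + 1)) X k (p.bits N)
        (p.length φ.length) φ A P Q st ∧ (∀ r < 20, st.reg r = p.value N φ.length r) ∧
      st.time ≤ (p.init L).cost w (fun _ => N) := by
  refine ((Parameters.all_init H.wide H.small H.value_lt hL (start_below H) ?_ ?_).and
    (Cmd.exec_time_le (p.init L) static_init (σ := fun _ => N) ?_ ?_)).mono ?_
  · simp [start, initState]
  · simp [start, initState]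
  · rintro r rfl h
    exact init_writes h rfl
  · rintro r rfl
    simp [start, initState]
  · rintro st ⟨⟨hb, hm, hr, h41⟩, ht⟩
    refine ⟨H.initialized hφ hb hm hr (h41.trans (by simp [start, initState])), hr, ?_⟩
    simpa [start] using ht

theorem main_time {st : Store} {m : ℕ} (hr : ∀ r < 20, st.reg r = p.value N m r) :
    ((Cmd.main k s A P Q).exec w st).All fun st' =>
      st'.time ≤ st.time + (Cmd.main k s A P Q).cost w (p.value N m) := by
  refine Cmd.exec_time_le _ (Cmd.static_main (K := fun r => 1 ≤ r ∧ r < 20) fun r h h' => ⟨h, h'⟩)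
    (fun r h h' => ?_) fun r h => hr r h.2
  have := Cmd.main_writes h'
  omega

/-- For a satisfiable formula some `i` belongs to a good triple, and the probability comes from its
stage. For an unsatisfiable one the answer is always correct. The time bound holds for every outcome
and costs no probability. -/
theorem Admissible.decides (H : p.Admissible N φ.length w X k [A, P, Q])
    (hL : X = 2 ^ (L * (N + 1))) (hφ : φ.IsK p.width)
    (hc : ∀ i < 2 ^ (N - (p.bits N + p.bits N)),
      (∃ u < 2 ^ p.bits N, ∃ v < 2 ^ p.bits N, GoodTriple φ (p.bits N) u v i) →
      ∀ L : List (Fin (p.size N φ.length) × Fin (p.size N φ.length)), L.Nodup →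
        L.toFinset = gridEdges (2 ^ p.bits N + 1) (φ.length + 1) (p.length φ.length)
          (uVec φ (p.bits N)) (vVec φ (p.bits N)) (initialStage s φ.length) →
        2 / 3 ≤ prob (Reveals φ (p.bits N) (p.length φ.length) (threshold p.conv (p.length φ.length)) i)
          (List.replicate (p.prep * p.size N φ.length ^ p.expo)
            (stepAct A (p.word * (Nat.log 2 (p.size N φ.length) + 1))) ++
          stageActs P Q (p.word * (Nat.log 2 (p.size N φ.length) + 1)) (p.value N φ.length 13)
            (p.bits N) (p.length φ.length) (wVec φ (p.bits N) i) s φ.length) (DynAlg.start L)) :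
    2 / 3 ≤ coins {ω | ∃ T σ, HaltsIn ((p.decide L k s A P Q).compile 0) w ω
      (initState N φ.length φ.encode) T σ ∧ T ≤ p.time L k s A P Q w N φ.length ∧
      (σ.reg 0 = 1 ↔ φ.Satisfiable)} := by
  classical
  -- Time and answer are tested together, as both are visible in the final state.
  let good (t x : ℕ) : Prop := t ≤ p.time L k s A P Q w N φ.length ∧ (x = 1 ↔ φ.Satisfiable)
  have h1 : 2 / 3 ≤ reach ((p.decide L k s A P Q).compile 0) w (fun σ => good σ.time (σ.reg 0))
      (initState N φ.length φ.encode) := by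
    refine le_trans ?_ (expect_exec_le_reach (p.decide L k s A P Q) ⟨wf_init, Cmd.wf_main⟩
      (off := 0) (fun i x h => by rwa [zero_add])
      (fun st => if good st.time (st.reg 0) then 1 else 0) (st := start φ)
      (H.wide.below (start_below H)) ⟨fun _ _ => rfl, rfl, rfl⟩ rfl fun st' σ _ hm hpc => ?_)
    · rw [decide, Cmd.exec, CoinTree.expect_bind]
      refine (H.all_init hL hφ).le_expect fun st ⟨hI, hr, ht⟩ => ?_
      have hT : ∀ x, x ≤ st.time + (Cmd.main k s A P Q).cost w (p.value N φ.length) →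
          x ≤ p.time L k s A P Q w N φ.length := fun x hx => hx.trans (Nat.add_le_add_right ht _)
      by_cases hs : φ.Satisfiable
      · obtain ⟨i, hi, hg⟩ := (satisfiable_iff_goodTriple (p.bits_add_bits_le N)).1 hs
        refine (Cmd.le_expect_main hI hi (c := 2 / 3) fun L hL hL' => ?_).trans
          ((main_time hr).expect_le fun st' h' => ?_)
        · rw [hr 15 (by norm_num), hr 12 (by norm_num), hr 13 (by norm_num)]
          exact hc i hi hg L hL hL'
        · split_ifs with h h2
          · exact le_rfl
          · exact absurd ⟨hT _ h', by simp [h, hs]⟩ h2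
          · exact zero_le
          · exact le_rfl
      · refine le_trans (ENNReal.div_le_of_le_mul (by norm_num) : (2 / 3 : ℝ≥0∞) ≤ 1)
          (((main_time hr).and (Cmd.all_main hI)).le_expect fun st' ⟨h', h2⟩ => ?_)
        rw [if_pos ⟨hT _ h', by simp only [hs, iff_false]; exact fun h => hs (h2 (by omega))⟩]
    · split_ifs with h
      · refine one_le_reach ?_ ?_
        · show _ ≤ _
          rw [Cmd.length_compile, hpc, zero_add]
        · rwa [hm.2.2, hm.1 0 (by norm_num [tmp])]
      · exact zero_le
  refine h1.trans ((reach_le_coins _ _ _ _).trans (measure_mono ?_))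
  rintro ω ⟨T, σ, hh, ht, hs⟩
  refine ⟨T, σ, hh, ?_, hs⟩
  have := hh.2.2
  simp only [initState, zero_add] at this
  rwa [← this]

end Parameters

/-! ### Uniform bounds for word size and running time. -/

/-- At most exponential growth. -/
def ExpBounded {ι : Type*} (N f : ι → ℕ) : Prop := ∃ c, ∀ i, f i ≤ 2 ^ (c * (N i + 1))

namespace ExpBounded

variable {ι : Type*} {N f f' : ι → ℕ}

theorem mono (h : ExpBounded N f') (hf : ∀ i, f i ≤ f' i) : ExpBounded N f :=
  let ⟨c, hc⟩ := h
  ⟨c, fun i => (hf i).trans (hc i)⟩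

theorem mul (h : ExpBounded N f) (h' : ExpBounded N f') : ExpBounded N fun i => f i * f' i := by
  obtain ⟨c, hc⟩ := h
  obtain ⟨c', hc'⟩ := h'
  exact ⟨c + c', fun i => by rw [add_mul, pow_add]; exact Nat.mul_le_mul (hc i) (hc' i)⟩

theorem add (h : ExpBounded N f) (h' : ExpBounded N f') : ExpBounded N fun i => f i + f' i := by
  obtain ⟨c, hc⟩ := h
  obtain ⟨c', hc'⟩ := h'
  refine ⟨c + c' + 1, fun i => ?_⟩
  have h1 : 2 ^ (c * (N i + 1)) ≤ 2 ^ ((c + c') * (N i + 1)) :=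
    Nat.pow_le_pow_right (by norm_num) (Nat.mul_le_mul_right _ (by omega))
  have h2 : 2 ^ (c' * (N i + 1)) ≤ 2 ^ ((c + c') * (N i + 1)) :=
    Nat.pow_le_pow_right (by norm_num) (Nat.mul_le_mul_right _ (by omega))
  have h3 : 2 ^ 1 ≤ 2 ^ (1 * (N i + 1)) := Nat.pow_le_pow_right (by norm_num) (by omega)
  rw [add_mul, pow_add]
  calc f i + f' i ≤ 2 ^ ((c + c') * (N i + 1)) * 2 ^ 1 := by
        have := hc i
        have := hc' i
        omega
    _ ≤ _ := Nat.mul_le_mul_left _ h3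

theorem pow (h : ExpBounded N f) (T : ℕ) : ExpBounded N fun i => f i ^ T := by
  obtain ⟨c, hc⟩ := h
  refine ⟨T * c, fun i => ?_⟩
  rw [mul_assoc, mul_comm T, pow_mul]
  exact Nat.pow_le_pow_left (hc i) _

theorem of_poly (h : PolyTimes N (fun _ => 1) f) : ExpBounded N f := by
  obtain ⟨c, hc⟩ := PolyTimes.exists_lt_two_pow (x := 0) (h.mono fun i => by simp)
  exact ⟨c, fun i => (hc i).le⟩

theorem const (c : ℕ) : ExpBounded N fun _ => c := of_poly (.const c fun _ => le_rfl)

theorem two_pow (hf : ∀ i, f i ≤ N i) : ExpBounded N fun i => 2 ^ f i :=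
  ⟨1, fun i => Nat.pow_le_pow_right (by norm_num) (by have := hf i; omega)⟩

end ExpBounded

theorem WordRAM.Instr.Fits.mono {k k' X X' : ℕ} {i : Instr} (h : i.Fits k X) (hk : k ≤ k')
    (hX : X ≤ X') : i.Fits k' X' := by
  cases i <;> simp only [Instr.Fits] at h ⊢ <;> omega

theorem exists_fits (l : List Program) : ∃ k, ∀ P ∈ l, (∀ i ∈ P, i.Fits k k) ∧ P.length < k := by
  have h1 (i : Instr) : ∃ k, i.Fits k k := by
    cases i with
    | const r x => exact ⟨r + x + 1, by simp only [Instr.Fits]; omega⟩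
    | bin o r a b => exact ⟨r + a + b + 1, by simp only [Instr.Fits]; omega⟩
    | load r a => exact ⟨r + a + 1, by simp only [Instr.Fits]; omega⟩
    | store a r => exact ⟨r + a + 1, by simp only [Instr.Fits]; omega⟩
    | jz r l => exact ⟨r + l + 1, by simp only [Instr.Fits]; omega⟩
    | coin r => exact ⟨r + 1, by simp only [Instr.Fits]; omega⟩
  have h2 (P : Program) : ∃ k, (∀ i ∈ P, i.Fits k k) ∧ P.length < k := by
    induction P with
    | nil => exact ⟨1, by simp⟩
    | cons i P ih =>
      obtain ⟨k, hk⟩ := ih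
      obtain ⟨k', hk'⟩ := h1 i
      refine ⟨k + k' + 1, fun j hj => ?_, by simp only [List.length_cons]; omega⟩
      rcases List.mem_cons.1 hj with rfl | hj
      · exact hk'.mono (by omega) (by omega)
      · exact (hk.1 j hj).mono (by omega) (by omega)
  induction l with
  | nil => exact ⟨0, by simp⟩
  | cons P l ih =>
    obtain ⟨k, hk⟩ := ih
    obtain ⟨k', hk'⟩ := h2 P
    refine ⟨k + k', fun R hR => ?_⟩
    rcases List.mem_cons.1 hR with rfl | hR
    · exact ⟨fun i hi => (hk'.1 i hi).mono (by omega) (by omega), by omega⟩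
    · exact ⟨fun i hi => ((hk R hR).1 i hi).mono (by omega) (by omega), by have := (hk R hR).2; omega⟩

namespace Parameters

variable (p : Parameters)

/-- The possible numbers of variables and clauses. -/
def Input : Type := {x : ℕ × ℕ // x.2 ≤ (2 * x.1 + 1) ^ p.width}

variable {p}

def Input.N (i : p.Input) : ℕ := i.1.1
def Input.m (i : p.Input) : ℕ := i.1.2

theorem poly_m : PolyTimes Input.N (fun _ => 1) (Input.m (p := p)) := by
  have h := ((PolyTimes.const (N := Input.N (p := p)) (g := fun _ => 1) 2 fun _ => le_rfl).mul_poly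
    .self).add (.const 1 fun _ => le_rfl)
  refine (PolyTimes.of_le (g := fun i => (2 * i.N + 1) ^ p.width) fun i => i.2).trans ?_
  exact (h.pow p.width).mono fun i => by simp

theorem poly_succ_m : PolyTimes Input.N (fun _ => 1) (fun i : p.Input => i.m + 1) :=
  poly_m.add (.const 1 fun _ => le_rfl)

theorem poly_length : PolyTimes Input.N (fun _ => 1) (fun i : p.Input => p.length i.m) :=
  (PolyTimes.const p.scale fun _ => le_rfl).mul_poly poly_succ_m

theorem poly_height : PolyTimes Input.N (fun _ => 1) (fun i : p.Input => p.height i.m) :=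
  (((PolyTimes.const 4 fun _ => le_rfl).add poly_succ_m).mul_poly
    (poly_length.add (.const 1 fun _ => le_rfl))).add (.const 2 fun _ => le_rfl)

theorem size_le (N m : ℕ) : p.size N m ≤ 2 ^ p.bits N * p.height m := by
  have h : 1 ≤ 2 ^ p.bits N := Nat.one_le_two_pow
  have h1 : 2 * (2 ^ p.bits N + 1) + (m + 1) ≤ 2 ^ p.bits N * (4 + (m + 1)) := by nlinarith
  rw [height, mul_add, ← mul_assoc]
  exact Nat.add_le_add (Nat.mul_le_mul_right _ h1) (by omega)

theorem poly_size : PolyTimes Input.N (fun i : p.Input => 2 ^ p.bits i.N) (fun i : p.Input => p.size i.N i.m) :=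
  have h : PolyTimes Input.N (fun i : p.Input => 2 ^ p.bits i.N) fun i => 2 ^ p.bits i.N :=
    .of_le fun _ => le_rfl
  (PolyTimes.of_le (g := fun i => 2 ^ p.bits i.N * p.height i.m) fun i => size_le i.N i.m).trans
    (h.mul_poly poly_height)

theorem bits_le (N : ℕ) : p.bits N ≤ N := by
  have := p.bits_add_bits_le N
  omega

theorem pred_mul_unit_le (N : ℕ) : (2 * p.denom - 1) * p.unit N ≤ N := by
  refine le_trans ?_ (p.bits_add_bits_le N)
  rw [bits, ← two_mul, ← mul_assoc]
  exact Nat.mul_le_mul_right _ (Nat.sub_le _ _)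

theorem unit_le (N : ℕ) : p.unit N ≤ N := Nat.div_le_self _ _

theorem expBounded_size : ExpBounded Input.N (fun i : p.Input => p.size i.N i.m) :=
  have h : ExpBounded Input.N (fun i : p.Input => 2 ^ p.bits i.N) := .two_pow fun i => bits_le i.N
  (h.mul (.of_poly poly_height)).mono fun i => size_le i.N i.m

theorem threshold_le (conv : Convention) (a : ℕ) : threshold conv a ≤ 2 * a + 4 := by
  cases conv <;> simp only [threshold] <;> omega

theorem expBounded_value (r : ℕ) : ExpBounded Input.N (fun i : p.Input => p.value i.N i.m r) := by
  have hN : ExpBounded Input.N (Input.N (p := p)) := .of_poly .self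
  have hm := ExpBounded.of_poly (poly_m (p := p))
  have hm' := ExpBounded.of_poly (poly_succ_m (p := p))
  have ha := ExpBounded.of_poly (poly_length (p := p))
  have hh := ExpBounded.of_poly (poly_height (p := p))
  have hn := expBounded_size (p := p)
  have hq : ExpBounded Input.N (fun i : p.Input => 2 ^ p.bits i.N) := .two_pow fun i => bits_le i.N
  have hl : ExpBounded Input.N (fun i : p.Input => 2 ^ (Nat.log 2 (p.size i.N i.m) + 1)) := by
    refine (hn.mul (.const 2)).mono fun i => ?_
    rw [pow_succ]
    exact Nat.mul_le_mul_right _ (Nat.pow_log_le_self 2 (by simp [size, gridSize]))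
  have hu : ExpBounded Input.N (fun i : p.Input => 2 ^ ((2 * p.denom - 1) * p.unit i.N)) :=
    .two_pow fun i => pred_mul_unit_le i.N
  rcases lt_or_ge r 27 with hr | hr
  · interval_cases r
    · exact hN
    · exact hm
    · exact hN.mono fun i => bits_le i.N
    · exact hq
    · exact hq.add (.const 1)
    · exact hm'
    · exact ha
    · exact ha.add (.const 1)
    · exact ((ExpBounded.const 2).mul (hq.add (.const 1))).add hm'
    · exact hn
    · exact hm'.mul (.const _)
    · exact hl.pow _
    · exact (ExpBounded.const _).mul (hn.pow _)
    · exact (ExpBounded.const _).mul (hm'.mul ((hh.mul hh).mul hu))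
    · exact .two_pow fun i => Nat.sub_le _ _
    · exact (((ExpBounded.const 2).mul ha).add (.const 4)).mono fun i => threshold_le _ _
    · exact hN.mono fun i => p.bits_add_bits_le i.N
    · exact hq.mul hq
    · exact hN
    · exact (ExpBounded.const 2).mul (hq.add (.const 1))
    · exact hl
    · exact hN.mono fun i => unit_le i.N
    · exact hh
    · exact hu
    · exact hn.pow _
    · exact hN.mono fun i => Nat.sub_le _ _
    · exact hN.mono fun i => pred_mul_unit_le i.N
  · obtain ⟨r, rfl⟩ := Nat.exists_eq_add_of_le' hr
    exact .const 0

/-- All numbers that occur are `2^O(N)`, uniformly in the formula, so one constant `L` serves for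
all inputs. The bound for the registers is taken for the sum of their finitely many nonzero values.
-/
theorem exists_admissible (hp : 1 ≤ p.scale) (l : List Program) : ∃ k L c, ∀ i : p.Input,
    p.Admissible i.N i.m (c * (i.N + 1)) (2 ^ (L * (i.N + 1))) k l := by
  obtain ⟨k, hk⟩ := exists_fits l
  have hsum (j : ℕ) : ExpBounded Input.N (fun i : p.Input => ∑ r ∈ Finset.range j, p.value i.N i.m r) := by
    induction j with
    | zero => exact .const 0
    | succ j ih => simpa only [Finset.sum_range_succ] using ih.add (expBounded_value j)
  obtain ⟨c₁, h₁⟩ := hsum 27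
  obtain ⟨c₂, h₂⟩ := (((ExpBounded.const 2).mul (expBounded_size.mul expBounded_size)).add
    (.const 1) : ExpBounded Input.N (fun i : p.Input => 2 * (p.size i.N i.m * p.size i.N i.m) + 1))
  -- A common bound for the fixed constants of the reduction.
  let B := p.width + p.word + p.prep + p.upd + p.scale + 2 * p.denom + p.modulus
  let L := c₁ + c₂ + B + k + 4
  -- The summand `24 L` makes room for `X^24`, the other one for the words of the dynamic algorithm,
  -- because `log n + 1 ≤ L (N + 1)`. Registers `0` and `1` of the simulated machine need cells of
  -- their own, hence `k + 2`.
  refine ⟨k + 2, L, 24 * L + p.word * L, fun i => ?_⟩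
  have hlt {c x : ℕ} (hc : c < L) (hx : x ≤ 2 ^ (c * (i.N + 1))) : x < 2 ^ (L * (i.N + 1)) :=
    hx.trans_lt (Nat.pow_lt_pow_right (by norm_num) (Nat.mul_lt_mul_of_pos_right hc (by omega)))
  have hc {x : ℕ} (hx : x < L + 1) : x < 2 ^ (L * (i.N + 1)) :=
    (lt_of_lt_of_le hx Nat.lt_two_pow_self).trans_le
      (Nat.pow_le_pow_right (by norm_num) (Nat.le_mul_of_pos_right _ (by omega)))
  have hL2 : 2 * (i.N + 1) ≤ L * (i.N + 1) := Nat.mul_le_mul_right _ (by omega)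
  have hsize := hlt (c := c₂) (by omega) (h₂ i)
  have hsize' : p.size i.N i.m < 2 ^ (L * (i.N + 1)) := by nlinarith [Nat.zero_le (p.size i.N i.m)]
  refine ⟨⟨(hc (by omega)).le, ?_⟩, ⟨hc (by omega), hc (by omega), hc (by omega), hc (by omega),
    hc (by omega), hc (by omega)⟩, fun r => ?_, hsize, ?_, ?_, ?_, by omega,
    hc (by omega), fun P hP => ⟨fun j hj => ((hk P hP).1 j hj).mono (by omega) (hc (by omega)).le, ?_⟩, hp⟩
  · rw [← pow_mul]
    exact Nat.pow_le_pow_right (by norm_num) (by nlinarith [Nat.zero_le (p.word * L * (i.N + 1))])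
  · rcases lt_or_ge r 27 with hr | hr
    · exact hlt (c := c₁) (by omega) ((Finset.single_le_sum (f := fun r => p.value i.N i.m r)
        (fun _ _ => Nat.zero_le _) (Finset.mem_range.2 hr)).trans (h₁ i))
    · obtain ⟨r, rfl⟩ := Nat.exists_eq_add_of_le' hr
      exact hc (by simp [value])
  · exact Nat.pow_le_pow_right (by norm_num) (by omega)
  · have : 2 * i.N + 2 < 2 ^ (2 * i.N + 2) := Nat.lt_two_pow_self
    exact this.trans_le (Nat.pow_le_pow_right (by norm_num) (by omega))
  · have : Nat.log 2 (p.size i.N i.m) + 1 ≤ L * (i.N + 1) :=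
      Nat.log_lt_of_lt_pow (by simp [size, gridSize]) hsize'
    calc _ ≤ p.word * (L * (i.N + 1)) := Nat.mul_le_mul_left _ this
      _ ≤ _ := by nlinarith [Nat.zero_le (24 * L * (i.N + 1))]
  · exact (hk P hP).2.trans (hc (by omega))

end Parameters

theorem PolyTimes.poly_mul {ι : Type*} {N g f f' : ι → ℕ} (h : PolyTimes N (fun _ => 1) f)
    (h' : PolyTimes N g f') : PolyTimes N g fun i => f i * f' i :=
  (h.mul h').mono fun i => by rw [one_mul]

namespace Cmd

variable {ι : Type*} {N w : ι → ℕ} {σ : ι → ℕ → ℕ}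

theorem takes_sets (l : List (ℕ × Expr)) : Takes N w σ (fun _ => 1) (sets l) := by
  induction l with
  | nil => exact takes_skip
  | cons x l ih => exact .seq (takes_set _ _) ih

end Cmd

namespace Parameters

variable {p : Parameters}

theorem takes_init (w : p.Input → ℕ) (L : ℕ) :
    Cmd.Takes Input.N w (fun i _ => i.N) (fun _ => 1) (p.init L) := by
  refine .seq (Cmd.takes_sets _) (.seq (.seq (Cmd.takes_set _ _) ?_) (Cmd.takes_sets _))
  have h1 (c : ℕ) : PolyTimes (Input.N (p := p)) (fun _ => 1) fun _ => c := .const c fun _ => le_rfl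
  have h2 : PolyTimes (Input.N (p := p)) (fun _ => 1) fun i =>
      (Expr.lit L * (.reg 0 + .lit 1)).eval (w i) ⟨fun _ => i.N, fun _ => 0, 0⟩ := by
    refine (PolyTimes.of_le (g := fun i => L * (i.N + 1)) fun i => ?_).trans
      ((h1 L).mul_poly (PolyTimes.self.add (h1 1)))
    refine (Nat.mod_le _ _).trans (Nat.mul_le_mul (Nat.mod_le _ _) ?_)
    exact (Nat.mod_le _ _).trans (Nat.add_le_add_left (Nat.mod_le _ _) _)
  exact (h1 _).add (h2.mul_poly ((h1 _).add (h1 _)))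

/-- The modulus is chosen so that `(T + 2) b + ν ≤ N` for `T = expo` and `ν = unit`. This leaves a
saving of `ν` both for building the graph and for the preprocessing. -/
theorem three_mul_unit_le (N : ℕ) :
    p.bits N + p.bits N + p.unit N ≤ N ∧ p.expo * p.bits N + p.unit N ≤ N := by
  have h : p.modulus * p.unit N ≤ N := Nat.mul_div_le N p.modulus
  have h2 : p.modulus * p.unit N = p.expo * p.bits N + (p.bits N + p.bits N) + p.unit N := by
    simp only [modulus, bits]; ring
  omega

/-- With `ν = unit` and `E = denom`, the three dominating terms are `2^(2b)`, `2^(Tb)` and `2^(N-2b)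
2^((2E-1)ν)`. The last one equals `2^(N-ν)`, because `2b = 2Eν`. -/
theorem poly_time (hp : 1 ≤ p.denom) (w : p.Input → ℕ) (L k : ℕ) (s : Bool) (A P Q : Program) :
    PolyTimes Input.N (fun i => 2 ^ (i.N - p.unit i.N)) fun i : p.Input =>
      p.time L k s A P Q (w i) i.N i.m := by
  refine PolyTimes.add ((takes_init w L).mono fun i => Nat.one_le_two_pow) ?_
  have hself (f : p.Input → ℕ) : PolyTimes Input.N f f := .of_le fun _ => le_rfl
  -- The first inequality says `b ≤ (2E - 1)ν`, so that trying all vectors in a stage is no more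
  -- expensive than an operation.
  have hE (i : p.Input) : p.bits i.N + p.unit i.N ≤ (2 * p.denom - 1) * p.unit i.N + p.unit i.N ∧
      (2 * p.denom - 1) * p.unit i.N + p.unit i.N ≤ p.bits i.N + p.bits i.N := by
    have h1 : (2 * p.denom - 1) * p.unit i.N + p.unit i.N = p.bits i.N + p.bits i.N := by
      rw [← Nat.succ_mul, bits, ← add_mul]
      congr 1
      omega
    have h2 : p.unit i.N ≤ p.bits i.N := Nat.le_mul_of_pos_left _ hp
    omega
  have h12 : PolyTimes Input.N (fun i => 2 ^ (p.expo * p.bits i.N))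
      fun i : p.Input => p.prep * p.size i.N i.m ^ p.expo := by
    refine (PolyTimes.const p.prep fun _ => le_rfl).poly_mul ((poly_size.pow p.expo).mono fun i => ?_)
    rw [← pow_mul, mul_comm]
  have h13 : PolyTimes Input.N (fun i => 2 ^ ((2 * p.denom - 1) * p.unit i.N)) fun i : p.Input =>
      p.upd * ((i.m + 1) * (p.height i.m * p.height i.m * 2 ^ ((2 * p.denom - 1) * p.unit i.N))) := by
    have h1 : PolyTimes Input.N (fun _ => 1) fun i : p.Input => p.height i.m * p.height i.m :=
      poly_height.poly_mul poly_height
    have h2 : PolyTimes Input.N (fun _ => 1) fun _ : p.Input => p.upd := .const _ fun _ => le_rfl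
    exact h2.poly_mul (poly_succ_m.poly_mul (h1.poly_mul (hself _)))
  have h10 : PolyTimes Input.N (fun _ => 1) fun i : p.Input => (i.m + 1) * (p.width + 1) :=
    poly_succ_m.mul_poly (.const _ fun _ => le_rfl)
  have h3 : PolyTimes Input.N (fun i => 2 ^ ((2 * p.denom - 1) * p.unit i.N)) fun i : p.Input =>
      2 ^ p.bits i.N :=
    .of_le fun i => Nat.pow_le_pow_right (by norm_num) (by have := hE i; omega)
  have hv (r : ℕ) {g f : p.Input → ℕ} (h : PolyTimes Input.N g f)
      (hf : ∀ i : p.Input, p.value i.N i.m r = f i) :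
      PolyTimes Input.N g fun i : p.Input => p.value i.N i.m r :=
    (PolyTimes.of_le fun i => (hf i).le).trans h
  refine Cmd.takes_main (σ := fun i : p.Input => p.value i.N i.m) (g₉ := fun i => 2 ^ p.bits i.N)
    (g₁₂ := fun i => 2 ^ (p.expo * p.bits i.N))
    (g₁₃ := fun i => 2 ^ ((2 * p.denom - 1) * p.unit i.N))
    (g₁₄ := fun i => 2 ^ (i.N - (p.bits i.N + p.bits i.N))) (hv 1 poly_m fun _ => rfl)
    (hv 10 h10 fun _ => rfl) (fun i => Nat.one_le_two_pow)
    (fun i => Nat.one_le_two_pow) (fun i => Nat.one_le_two_pow) (fun i => Nat.one_le_two_pow) (hv 3 h3 fun _ => rfl) (hv 9 poly_size fun _ => rfl)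
    (hv 12 h12 fun _ => rfl) (hv 13 h13 fun _ => rfl) (hv 14 (hself _) fun _ => rfl) (fun i => ?_)
    (fun i => ?_) (fun i => ?_)
  · rw [← pow_add]
    exact Nat.pow_le_pow_right (by norm_num) (by have := p.three_mul_unit_le i.N; omega)
  · exact Nat.pow_le_pow_right (by norm_num) (by have := p.three_mul_unit_le i.N; omega)
  · rw [← pow_add]
    have := hE i
    have := p.three_mul_unit_le i.N
    exact Nat.pow_le_pow_right (by norm_num) (by omega)

end Parameters

/-! ### Runs of the dynamic algorithm as sequences of actions. -/

namespace DynAlg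

variable {A : DynAlg} {n : ℕ}

/-- The program for insertions or deletions. -/
def upd (A : DynAlg) (s : Bool) : Program := bif s then A.ins else A.del

theorem answer_eq (σ : State) (v : Fin n) : answer σ v = estimate (σ.mem (σ.reg 0 + v)) := by
  unfold answer
  generalize σ.mem (σ.reg 0 + v) = x
  cases x <;> rfl

/-- Every operation is granted the same number `B` of steps, and those after halting have no effect.
-/
theorem Run.runActs_eq {ω : ℕ → Bool} {p d a : ℕ} (ha : 1 ≤ a) {s : Bool} {v : ℕ → Bool} {B : ℕ}
    {j : ℕ} {hj : j ≤ d} {σ σ' : State} {ts : List ℕ}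
    (h : A.Run ω σ (stageOps p ha s v j hj ++ [DynOp.query]) ts σ') (hB : ∀ t ∈ ts, t ≤ B) :
    runActs ω (updateActs (A.upd s) (A.wordSize (gridSize p d a)) B (fun c => (2 * p + c) * (a + 1))
      (fun c => (2 * p + c) * (a + 1) + a) v s j ++
      (callAct 0 0 :: List.replicate B (stepAct A.qry (A.wordSize (gridSize p d a))))) σ = σ' := by
  induction j generalizing σ ts with
  | zero =>
    obtain _ | ⟨h₁, _ | _⟩ := h
    exact HaltsIn.runActs_eq h₁ (hB _ (by simp))
  | succ j ih =>
    cases hs : (v j == s) <;> simp only [stageOps, updateActs, hs, cond_true, cond_false,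
      List.nil_append, List.cons_append, List.append_assoc] at h ⊢
    · exact ih h hB
    · obtain _ | ⟨h₁, h₂⟩ := h
      rename_i T ts
      rw [runActs, runActs_append, HaltsIn.runActs_eq (s' := _) ?_ (hB T (by simp))]
      · exact ih h₂ fun t ht => hB t (by simp [ht])
      · cases s <;> exact h₁

end DynAlg

section

variable {N b a i : ℕ} {φ : CNF N} {s : Bool}

theorem stageVector_eq :
    (fun c => if c < φ.length ∧ wVec φ b i c = s then s else initialStage s φ.length c) =
      wVec φ b i := by
  funext c
  by_cases h : c < φ.length
  · cases hw : wVec φ b i c <;> cases s <;> simp [h, initialStage]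
  · simp [h, initialStage, wVec]

theorem reveals_of_isApprox {ε : ℝ} (hε : 0 < ε) (ha : 3 ≤ ε * a) (ha' : 1 ≤ a) (conv : Convention)
    {σ : State}
    (h : ∀ v : Fin (gridSize (2 ^ b + 1) (φ.length + 1) a), IsApprox (2 - ε) conv
      (ecc (EdgeSet.toDigraph (gridEdges (2 ^ b + 1) (φ.length + 1) a (uVec φ b) (vVec φ b)
        (wVec φ b i))) v)
      (DynAlg.answer σ v)) (hg : ∃ u < 2 ^ b, ∃ v < 2 ^ b, GoodTriple φ b u v i) :
    Reveals φ b a (threshold conv a) i σ := by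
  have key (u : ℕ) (hu : u < 2 ^ b) :
      threshold conv a < σ.word a u ↔ ∃ v < 2 ^ b, GoodTriple φ b u v i := by
    rw [← exists_orthogonalTriple_iff hu]
    have h1 := h (GadgetVertex.number ha' (.uNode ⟨u, by omega⟩ (Fin.last a)))
    rw [ecc_gridEdges, DynAlg.answer_eq, GadgetVertex.number_val] at h1
    by_cases ho : ∃ v : Fin (2 ^ b + 1), OrthogonalTriple (fun c : Fin (φ.length + 1) => uVec φ b u c)
      (fun c => vVec φ b v c) fun c => wVec φ b i c
    · rw [ecc_gadget_of_orthogonal ha' nonDegenerate_uVec nonDegenerate_vVec _ ho] at h1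
      exact iff_of_true (threshold_lt hε ha conv (by exact_mod_cast h1)) ho
    · rw [ecc_gadget_of_not_orthogonal ha' nonDegenerate_uVec nonDegenerate_vVec _ ho] at h1
      exact iff_of_false (not_threshold_lt hε ha conv (by exact_mod_cast h1)) ho
  obtain ⟨u, hu, hv⟩ := hg
  exact ⟨⟨u, hu, (key u hu).2 hv⟩, fun u hu h => (key u hu).1 h⟩

end

namespace DynAlg

variable {A : DynAlg} {conv : Convention} {α : ℝ} {k : ℕ} {p u q : ℕ → ℝ} {S : Setting}

/-- Summing the individual bounds reduces everything to the amortized mode. -/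
theorem Solves.amortized (h : A.Solves S .worstCase conv α k p u q) :
    A.Solves S .amortized conv α k p u q := by
  intro n L ops hL hops hS
  refine (h n L ops hL hops hS).trans (measure_mono ?_)
  rintro ω ⟨T₀, s₀, ts, σ, h1, h2, h3, h4, h5⟩
  refine ⟨T₀, s₀, ts, σ, h1, h2, h3, ?_, h5⟩
  generalize ops ++ [DynOp.query] = ops' at h4
  simp only [TimeMode.Within] at h4 ⊢
  clear h3
  induction h4 with
  | nil => simp
  | cons h _ ih => simpa using add_le_add h ih

/-- The setting with insertions or deletions only. -/
def monotone (s : Bool) : Setting := bif s then .incremental else .decremental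

/-- Since the rollback of the memory replaces opposite updates, a fully dynamic algorithm is needed
for one kind of updates only. -/
theorem Solves.monotone {mode : TimeMode} (h : A.Solves .fullyDynamic mode conv α k p u q) (s : Bool) :
    A.Solves (monotone s) mode conv α k p u q :=
  fun n L ops hL hops _ => h n L ops hL hops fun o _ => by cases o <;> trivial

end DynAlg

section

variable {N b a i k : ℕ} {φ : CNF N} {s : Bool}

theorem fresh_stageActs {P Q : Program} {w' T m : ℕ} {v : ℕ → Bool} {f : Act}
    (hf : f ∈ stageActs P Q w' T b a v s m) : f.Fresh := by
  have hrep {R : Program} {f : Act} (hf : f ∈ List.replicate T (stepAct R w')) : f.Fresh :=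
    (List.mem_replicate.1 hf).2 ▸ fresh_stepAct R w'
  have hcall {x y : ℕ} {R : Program} {f : Act}
      (hf : f ∈ callAct x y :: List.replicate T (stepAct R w')) : f.Fresh := by
    rcases List.mem_cons.1 hf with rfl | hf
    · exact fresh_callAct _ _
    · exact hrep hf
  rcases List.mem_append.1 hf with hf | hf
  · induction m with
    | zero => simp [updateActs] at hf
    | succ m ih =>
      rcases List.mem_append.1 hf with hf' | hf'
      · cases h : (v m == s) <;> simp only [h, cond_true, cond_false] at hf'
        · simp at hf'
        · exact hcall hf'
      · exact ih (List.mem_append_left _ hf') hf'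
  · exact hcall hf

theorem DynOp.sum_cost_le {n : ℕ} {u q : ℝ} {Z : ℕ} (hu : u ≤ Z) (hq : q ≤ Z) (ops : List (DynOp n)) :
    (ops.map (DynOp.cost u q)).sum ≤ (ops.length * Z : ℕ) := by
  refine (List.sum_le_card_nsmul _ (Z : ℝ) fun x hx => ?_).trans (by simp)
  obtain ⟨o, -, rfl⟩ := List.mem_map.1 hx
  cases o <;> assumption

/-- The preprocessing followed by the operations of one stage is a legal sequence ending with a
query, so the guarantee applies to it. Amortized bounds say nothing about single operations, but
each one takes at most the total `(m + 1) Z`; granting this to every operation costs only a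
polynomial factor. -/
theorem DynAlg.Solves.le_prob_reveals {A : DynAlg} {conv : Convention} {ε : ℝ} {P u q : ℕ → ℝ}
    (hS : A.Solves (DynAlg.monotone s) .amortized conv (2 - ε) k P u q) (hk : 1 ≤ k) (hε : 0 < ε)
    (ha : 3 ≤ ε * a) (ha2 : 2 ≤ a) (hd : φ.length + 1 ≤ a) {B₀ B₁ Z : ℕ}
    (hP : P (gridSize (2 ^ b + 1) (φ.length + 1) a) ≤ B₀)
    (hu : u (gridSize (2 ^ b + 1) (φ.length + 1) a) ≤ Z)
    (hq : q (gridSize (2 ^ b + 1) (φ.length + 1) a) ≤ Z) (hZ : (φ.length + 1) * Z ≤ B₁)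
    (hg : ∃ u < 2 ^ b, ∃ v < 2 ^ b, GoodTriple φ b u v i)
    {L : List (Fin (gridSize (2 ^ b + 1) (φ.length + 1) a) ×
      Fin (gridSize (2 ^ b + 1) (φ.length + 1) a))} (hL : L.Nodup)
    (hL' : L.toFinset = gridEdges (2 ^ b + 1) (φ.length + 1) a (uVec φ b) (vVec φ b)
      (initialStage s φ.length)) :
    2 / 3 ≤ prob (Reveals φ b a (threshold conv a) i)
      (List.replicate B₀ (stepAct A.prep (A.wordSize (gridSize (2 ^ b + 1) (φ.length + 1) a))) ++
        stageActs (A.upd s) A.qry (A.wordSize (gridSize (2 ^ b + 1) (φ.length + 1) a)) B₁ b a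
          (wVec φ b i) s φ.length) (DynAlg.start L) := by
  obtain ⟨hlegal, hfinal⟩ := legal_stageOps (p := 2 ^ b + 1) (by omega) hd ha2 hk s
    (wVec φ b i) (U := uVec φ b) (V := vVec φ b) φ.length (Nat.le_succ _)
    (initialStage s φ.length) (fun c hc => by simp [initialStage, hc])
  rw [stageVector_eq] at hfinal
  have hmono : ∀ o ∈ stageOps (2 ^ b + 1) (Nat.le_of_succ_le ha2) s (wVec φ b i) φ.length
      (Nat.le_succ _), (DynAlg.monotone s).Allows o := by
    intro o ho
    obtain ⟨c, rfl⟩ := exists_of_mem_stageOps ho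
    cases s <;> trivial
  have hlen := length_stageOps (p := 2 ^ b + 1) (Nat.le_of_succ_le ha2) s
    (wVec φ b i) φ.length (Nat.le_succ _)
  have hsolve := hS _ L _ hL (by rw [hL']; exact hlegal) hmono
  rw [← coins_runActs]
  swap
  · intro f hf
    rcases List.mem_append.1 hf with hf | hf
    · exact (List.mem_replicate.1 hf).2 ▸ fresh_stepAct _ _
    · exact fresh_stageActs hf
  refine hsolve.trans (measure_mono ?_)
  rintro ω ⟨T₀, s₀, ts, σ, h1, h2, h3, h4, h5⟩
  rw [hL', hfinal] at h5
  have hT₀ : T₀ ≤ B₀ := by exact_mod_cast h2.trans hP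
  have hts : ts.sum ≤ B₁ := by
    have h := (show (ts.sum : ℝ) ≤ _ from h4).trans (DynOp.sum_cost_le hu hq _)
    refine (Nat.cast_le.1 h).trans (le_trans (Nat.mul_le_mul_right _ ?_) hZ)
    simpa using hlen
  rw [Set.mem_ofPred_eq, runActs_append, h1.runActs_eq hT₀, stageActs,
    h3.runActs_eq _ fun t ht => (List.le_sum_of_mem ht).trans hts]
  exact reveals_of_isApprox hε ha (by omega) conv h5 hg

end

/-! ## The reduction -/

/-- The values at small `n` are absorbed by the constant, which requires powers that are at least
one, hence a nonnegative exponent. -/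
theorem exists_le_mul_rpow {f : ℕ → ℝ} {r r' : ℝ} (hf : f =O[atTop] fun n : ℕ => (n : ℝ) ^ r)
    (hr : r ≤ r') (hr' : 0 ≤ r') : ∃ C : ℕ, ∀ n : ℕ, 1 ≤ n → f n ≤ C * (n : ℝ) ^ r' := by
  obtain ⟨c, hc⟩ := hf.bound
  obtain ⟨n₀, hn₀⟩ := eventually_atTop.1 hc
  have hsum : 0 ≤ ∑ n ∈ Finset.range n₀, |f n| := Finset.sum_nonneg fun _ _ => abs_nonneg _
  refine ⟨⌈|c| + ∑ n ∈ Finset.range n₀, |f n|⌉₊, fun n hn => ?_⟩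
  have hn' : (1 : ℝ) ≤ n := by exact_mod_cast hn
  have h1 : 1 ≤ (n : ℝ) ^ r' := Real.one_le_rpow hn' hr'
  refine le_trans ?_ (mul_le_mul_of_nonneg_right (Nat.le_ceil _) (by linarith))
  rcases lt_or_ge n n₀ with h | h
  · have h2 : |f n| ≤ ∑ n ∈ Finset.range n₀, |f n| :=
      Finset.single_le_sum (f := fun n => |f n|) (fun _ _ => abs_nonneg _) (Finset.mem_range.2 h)
    have h3 := le_abs_self (f n)
    have h4 := abs_nonneg c
    nlinarith
  · have h2 := hn₀ n h
    have h3 : (n : ℝ) ^ r ≤ (n : ℝ) ^ r' := Real.rpow_le_rpow_of_exponent_le hn' hr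
    have h4 : 0 ≤ (n : ℝ) ^ r := by positivity
    rw [Real.norm_eq_abs, Real.norm_eq_abs, abs_of_nonneg h4] at h2
    have h5 := le_abs_self (f n)
    have h6 := le_abs_self c
    nlinarith [abs_nonneg c]

namespace Parameters

variable {p : Parameters}

/-- For `b = Eν` the exponent `b (2 - 1/E)` is the integer `(2E - 1)ν`. The polynomial factor of the
number of vertices contributes at most its square. -/
theorem rpow_size_le (hp : 1 ≤ p.denom) (N m : ℕ) : (p.size N m : ℝ) ^ (2 - 1 / (p.denom : ℝ)) ≤
    ((p.height m * p.height m * 2 ^ ((2 * p.denom - 1) * p.unit N) : ℕ) : ℝ) := by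
  have hE : (1 : ℝ) ≤ p.denom := by exact_mod_cast hp
  have h0 : 0 ≤ 2 - 1 / (p.denom : ℝ) := by
    have : 1 / (p.denom : ℝ) ≤ 1 := by rw [div_le_one (by linarith)]; exact hE
    linarith
  have h1 : (1 : ℝ) ≤ p.height m := by
    exact_mod_cast (show 1 ≤ p.height m by simp only [height]; omega)
  calc (p.size N m : ℝ) ^ (2 - 1 / (p.denom : ℝ))
      ≤ (2 ^ p.bits N * p.height m : ℝ) ^ (2 - 1 / (p.denom : ℝ)) :=
        Real.rpow_le_rpow (by positivity) (by exact_mod_cast size_le N m) h0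
    _ = (2 ^ p.bits N : ℝ) ^ (2 - 1 / (p.denom : ℝ)) * (p.height m : ℝ) ^ (2 - 1 / (p.denom : ℝ)) :=
        Real.mul_rpow (by positivity) (by positivity)
    _ ≤ 2 ^ ((2 * p.denom - 1) * p.unit N) * (p.height m * p.height m) := by
        gcongr ?_ * ?_
        · rw [← Real.rpow_natCast, ← Real.rpow_natCast, ← Real.rpow_mul (by norm_num)]
          refine le_of_eq ?_
          congr 1
          rw [bits, Nat.cast_mul, Nat.cast_mul, Nat.cast_sub (by omega)]
          push_cast
          field_simp
        · rw [← sq, ← Real.rpow_two]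
          refine Real.rpow_le_rpow_of_exponent_le h1 ?_
          have : 0 ≤ 1 / (p.denom : ℝ) := by positivity
          linarith
    _ = _ := by push_cast; ring

/-- The factor 2 compensates for rounding `N / modulus` down. -/
theorem two_pow_sub_unit_le (N : ℕ) : ((2 ^ (N - p.unit N) : ℕ) : ℝ) ≤
    2 * (2 : ℝ) ^ ((1 - 1 / (p.modulus : ℝ)) * (N : ℝ)) := by
  have hD : (0 : ℝ) < p.modulus := by exact_mod_cast (show 0 < p.modulus by simp [modulus])
  have h1 : (N : ℝ) ≤ p.modulus * (p.unit N + 1) := by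
    exact_mod_cast (Nat.lt_mul_div_succ N (by simp [modulus] : 0 < p.modulus)).le
  have h2 : (N : ℝ) / p.modulus ≤ p.unit N + 1 := by
    rw [div_le_iff₀ hD]; linarith
  have h3 : 2 * (2 : ℝ) ^ ((1 - 1 / (p.modulus : ℝ)) * (N : ℝ)) =
      (2 : ℝ) ^ (1 + (1 - 1 / (p.modulus : ℝ)) * (N : ℝ)) := by
    rw [Real.rpow_add (by norm_num), Real.rpow_one]
  rw [h3, Nat.cast_pow, ← Real.rpow_natCast, Nat.cast_sub (unit_le N)]
  refine Real.rpow_le_rpow_of_exponent_le (by norm_num) ?_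
  have h4 : (1 - 1 / (p.modulus : ℝ)) * N = N - N / p.modulus := by ring
  rw [h4]
  linarith

end Parameters

/-- The exponent `2 - ε'` is first enlarged to `2 - 1/E` with an integer `E > 1/ε'`, and `t` to its
ceiling. This makes the exponents of the time bounds integers and also covers `ε' > 2`. -/
theorem SETH.not_solves (hSETH : SETH) {A : DynAlg} {t ε ε' : ℝ} {P u q : ℕ → ℝ} {k : ℕ}
    (hε : 0 < ε) (hε' : 0 < ε') (hk : 1 ≤ k) (conv : Convention) (s : Bool)
    (hP : P =O[atTop] fun n : ℕ => (n : ℝ) ^ t) (hu : u =O[atTop] fun n : ℕ => (n : ℝ) ^ (2 - ε'))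
    (hq : q =O[atTop] fun n : ℕ => (n : ℝ) ^ (2 - ε')) :
    ¬ A.Solves (DynAlg.monotone s) .amortized conv (2 - ε) k P u q := by
  intro hS
  obtain ⟨E, hE⟩ := exists_nat_gt (1 / ε')
  have hE0 : (0 : ℝ) < E := lt_trans (by positivity) hE
  have hE1 : 1 ≤ E := by exact_mod_cast hE0
  have hr : 2 - ε' ≤ 2 - 1 / (E : ℝ) := by
    have : 1 / (E : ℝ) ≤ ε' := by
      rw [div_le_iff₀ hE0]
      rw [div_lt_iff₀ hε'] at hE
      linarith
    linarith
  have hr' : 0 ≤ 2 - 1 / (E : ℝ) := by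
    have : 1 / (E : ℝ) ≤ 1 := by rw [div_le_one hE0]; exact_mod_cast hE1
    linarith
  obtain ⟨a, ha⟩ := exists_nat_gt (3 / ε)
  obtain ⟨cP, hcP⟩ := exists_le_mul_rpow hP (Nat.le_ceil t) (by positivity)
  obtain ⟨cu, hcu⟩ := exists_le_mul_rpow hu hr hr'
  obtain ⟨cq, hcq⟩ := exists_le_mul_rpow hq hr hr'
  -- The scale `a + 2` makes the paths longer than `3/ε` and ensures length at least 2.
  let p₀ (K : ℕ) : Parameters := ⟨K, A.c, ⌈t⌉₊, cP, cu + cq, a + 2, E, conv⟩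
  -- The modulus does not depend on the clause width, so the saving can be fixed before SETH
  -- provides `K`.
  obtain ⟨K, hK⟩ := hSETH (1 / ((p₀ 0).modulus : ℝ)) (by
    have : 0 < (p₀ 0).modulus := by simp [Parameters.modulus]
    positivity)
  apply hK
  set p := p₀ K with hp
  obtain ⟨k', L, c, hadm⟩ := p.exists_admissible (by simp [hp, p₀]) [A.prep, A.upd s, A.qry]
  obtain ⟨C, hC⟩ := p.poly_time hE1 (fun i => c * (i.N + 1)) L k' s A.prep (A.upd s) A.qry
  -- The constant `2 * C` absorbs the factor 2 from rounding.
  refine ⟨(p.decide L k' s A.prep (A.upd s) A.qry).compile 0, c, 2 * C, fun N φ hφ => ?_⟩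
  have hbound (N m : ℕ) {f : ℕ → ℝ} {x : ℕ} (hx : x ≤ cu + cq)
      (hf : ∀ n : ℕ, 1 ≤ n → f n ≤ x * (n : ℝ) ^ (2 - 1 / (E : ℝ))) : f (p.size N m) ≤
      (p.upd * (p.height m * p.height m * 2 ^ ((2 * p.denom - 1) * p.unit N)) : ℕ) := by
    rw [Nat.cast_mul]
    refine (hf _ (by simp [Parameters.size, gridSize])).trans
      (mul_le_mul (by exact_mod_cast hx) (Parameters.rpow_size_le hE1 N m) (by positivity)
        (by positivity))
  have ha3 (m : ℕ) : 3 ≤ ε * (p.length m : ℕ) := by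
    have h1 : ((a + 2 : ℕ) : ℝ) ≤ (p.length m : ℕ) := by
      exact_mod_cast Nat.le_mul_of_pos_right _ (Nat.succ_pos m)
    rw [div_lt_iff₀ hε] at ha
    push_cast at h1
    nlinarith
  have hlen (m : ℕ) : 2 ≤ p.length m ∧ m + 1 ≤ p.length m :=
    ⟨le_trans (by omega) (Nat.mul_le_mul (Nat.le_add_left 2 a) (Nat.le_add_left 1 m)),
      Nat.le_mul_of_pos_left _ (by simp [hp, p₀])⟩
  have hmain := (hadm ⟨(N, φ.length), hφ.length_le⟩).decides (s := s) rfl hφ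
    fun i hi hg l hl hl' => hS.le_prob_reveals hk hε (ha3 _) (hlen _).1 (hlen _).2
      ?_ (hbound _ _ (by omega) hcu) (hbound _ _ (by omega) hcq) ?_ hg hl hl'
  · refine hmain.trans (measure_mono ?_)
    rintro ω ⟨T, σ, h1, h2, h3⟩
    refine ⟨T, σ, h1, ?_, h3⟩
    have h4 := h2.trans (hC ⟨(N, φ.length), hφ.length_le⟩)
    have h5 : (T : ℝ) ≤ C * ((N : ℝ) + 1) ^ C * ((2 ^ (N - p.unit N) : ℕ) : ℝ) := by
      exact_mod_cast h4
    have h6 := Parameters.two_pow_sub_unit_le (p := p) N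
    have h7 : ((N : ℝ) + 1) ^ C ≤ ((N : ℝ) + 1) ^ (2 * C) :=
      pow_le_pow_right₀ (by linarith [Nat.cast_nonneg (α := ℝ) N]) (by omega)
    calc (T : ℝ) ≤ C * ((N : ℝ) + 1) ^ C * ((2 ^ (N - p.unit N) : ℕ) : ℝ) := h5
      _ ≤ C * ((N : ℝ) + 1) ^ (2 * C) *
          (2 * (2 : ℝ) ^ ((1 - 1 / (p.modulus : ℝ)) * (N : ℝ))) := by gcongr
      _ = _ := by push_cast; ring_nf; rfl
  · refine (hcP _ (by simp [gridSize])).trans (le_of_eq ?_)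
    rw [Real.rpow_natCast]
    push_cast
    rfl
  · exact le_of_eq (by simp only [Parameters.value]; ring)

theorem mainTheorem5 :
    (SETH → ∀ t ε ε' : ℝ, 0 < t → 0 < ε → 0 < ε' → ∀ (k : ℕ), 1 ≤ k → ∀ conv : Convention,
      ¬ DynAlg.ExistsWithBounds .fullyDynamic .amortized conv (2 - ε) k t (2 - ε') ∧
      ¬ DynAlg.ExistsWithBounds .incremental .worstCase conv (2 - ε) k t (2 - ε') ∧
      ¬ DynAlg.ExistsWithBounds .decremental .worstCase conv (2 - ε) k t (2 - ε')) ∧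
    (∀ (p q d a : ℕ) (U : Fin p → Fin d → Bool) (V : Fin q → Fin d → Bool) (w : Fin d → Bool),
      1 ≤ a → NonDegenerate U → NonDegenerate V → ∀ u : Fin p,
        ((∃ v, OrthogonalTriple (U u) (V v) w) →
          ecc (gadget a U V w) (.uNode u (Fin.last a)) = 2 * a + 3) ∧
        ((¬ ∃ v, OrthogonalTriple (U u) (V v) w) →
          ecc (gadget a U V w) (.uNode u (Fin.last a)) = a + 3)) := by
  refine ⟨fun hSETH t ε ε' _ hε hε' k hk conv => ⟨?_, ?_, ?_⟩, fun p q d a U V w ha hU hV u =>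
    ⟨ecc_gadget_of_orthogonal ha hU hV u, ecc_gadget_of_not_orthogonal ha hU hV u⟩⟩
  · rintro ⟨A, P, u, q, hP, hu, hq, h⟩
    -- A fully dynamic algorithm is refuted by using it with insertions only.
    exact hSETH.not_solves hε hε' hk conv true hP hu hq (h.monotone true)
  · rintro ⟨A, P, u, q, hP, hu, hq, h⟩
    exact hSETH.not_solves hε hε' hk conv true hP hu hq h.amortized
  · rintro ⟨A, P, u, q, hP, hu, hq, h⟩
    exact hSETH.not_solves hε hε' hk conv false hP hu hq h.amortized
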